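/- **Model.** A floating-point word RAM with word parameter $w$ is a random access machine with $2^w$ memory cells (addresses $0,\dots,2^w-1$) and a fixed number of registers, each holding a floating-point number with a $w$-bit mantissa and an exponent of absolute value about $2^w$ or less. Programs are built by sequencing, branching and loops from the following instructions: loading an integer constant, copying, reading and writing memory at a computed address, addition, subtraction, multiplication, division, powering $(x,y)\mapsto x^y$, floor (results are rounded to the nearest representable number, tiny results to $0$), and drawing an independent uniformly random element of $\{k/2^w : 0\le k<2^w\}$. Each instruction, and each comparison $x<y$ of two registers made by a branch or a loop, costs one step; there must be no overflow and no undefined operation. **Problem.** For $p>0$ and integer strings $X,Y$ of length $m$ let $\ell_p(X,Y)=\bigl(\sum_{j=1}^m|x_j-y_j|^p\bigr)^{1/p}$. For a text $T=t_1\cdots t_n$ and a pattern $P=p_1\cdots p_m$ over $\{0,\dots,U-1\}$, $1\le m\le n$, the text-to-pattern distances are $S[i]=\ell_p(t_{i+1}\cdots t_{i+m},P)$, $0\le i\le n-m$. An array $S_\varepsilon$ is a $(1+\varepsilon)$-approximation if $(1-\varepsilon)S[i]\le S_\varepsilon[i]\le(1+\varepsilon)S[i]$ for every $0\le i\le n-m$.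 **Theorem.** For every constant $c>0$ there are a randomized program and constants $K,C$, depending only on $c$, such that for all $0<p<1$, $0<\varepsilon\le1$, all $U$, all $1\le m\le n$, all texts $T$ of length $n$ and patterns $P$ of length $m$ over $\{0,\dots,U-1\}$, and every $w\ge K\bigl(1+\log_2\frac{nU}{p\varepsilon}\bigr)$, the program, run with word parameter $w$ on the input $(n,m,U,p,\varepsilon,T,P)$ rounded to machine words, halts for every outcome of its random choices after at most $$C\,p^{-1}\varepsilon^{-1}\,n\,\log_2(m+1)\,\log_2^2(U+1)\,\log_2(n+1)$$ steps, and with probability at least $1-n^{-c}$ its output is a $(1+\varepsilon)$-approximation of the $\ell_p$ text-to-pattern distances. In other words, the running time is $\mathcal O(p^{-1}\varepsilon^{-1}n\log m\log^2U\log n)$ and the output is correct with high probability. -/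

import Mathlib

namespace FloatRAM

/-- Rounding of a real number to a binary floating point number with a mantissa of `w` bits
and an exponent of about `w` bits: round to nearest at `w` significant bits; numbers of absolute
value below `2 ^ (-2 ^ w)` are flushed to `0`. -/
noncomputable def fround (w : ℕ) (x : ℝ) : ℝ :=
  if |x| < ((2 : ℝ) ^ (2 ^ w : ℕ))⁻¹ then 0
  else
    let ulp : ℝ := (2 : ℝ) ^ (Int.log 2 |x| - (w : ℤ) + 1)
    (round (x / ulp) : ℝ) * ulp

/-- `x` does not overflow the exponent range of a machine word. -/
def InRange (w : ℕ) (x : ℝ) : Prop := |x| < (2 : ℝ) ^ (2 ^ w : ℕ)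

/-- The binary arithmetic operations of the machine. -/
inductive BinOp
  | add | sub | mul | div | pow

/-- The exact value of an operation, before rounding. -/
noncomputable def BinOp.eval : BinOp → ℝ → ℝ → ℝ
  | .add, x, y => x + y
  | .sub, x, y => x - y
  | .mul, x, y => x * y
  | .div, x, y => x / y
  | .pow, x, y => x ^ y

/-- When an operation is defined. -/
def BinOp.Defined : BinOp → ℝ → ℝ → Prop
  | .div, _, y => y ≠ 0
  | .pow, x, y => 0 < x ∨ (x = 0 ∧ 0 < y)
  | _, _, _ => True

/-- Programs. Register names are fixed in the program; memory is addressed indirectly. -/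
inductive Cmd
  /-- no operation -/
  | skip
  /-- `reg d := z` -/
  | const (d : ℕ) (z : ℤ)
  /-- `reg d := reg a` -/
  | copy (d a : ℕ)
  /-- `reg d := reg a ∘ reg b`, rounded -/
  | op (o : BinOp) (d a b : ℕ)
  /-- `reg d := ⌊reg a⌋`, rounded -/
  | floor (d a : ℕ)
  /-- `reg d := mem[reg a]` -/
  | load (d a : ℕ)
  /-- `mem[reg a] := reg b` -/
  | store (a b : ℕ)
  /-- `reg d :=` a fresh uniformly random `w`-bit fraction in `[0, 1)` -/
  | rand (d : ℕ)
  /-- sequential composition -/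
  | seq (c₁ c₂ : Cmd)
  /-- if `reg a < reg b` then `c₁` else `c₂` -/
  | ite (a b : ℕ) (c₁ c₂ : Cmd)
  /-- while `reg a < reg b` do `c` -/
  | while (a b : ℕ) (c : Cmd)

/-- A state: registers, memory, and the number of random words drawn so far. -/
structure State where
  reg : ℕ → ℝ
  mem : ℕ → ℝ
  pos : ℕ

/-- Write `x` into register `d`. -/
def State.setReg (s : State) (d : ℕ) (x : ℝ) : State :=
  { s with reg := Function.update s.reg d x }

/-- Write `x` into memory cell `k`. -/
def State.setMem (s : State) (k : ℕ) (x : ℝ) : State :=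
  { s with mem := Function.update s.mem k x }

/-- `Exec w ω c s t s'`: on a machine with words of `w` bits and random words `ω`, the program `c`
started in state `s` halts in state `s'` after `t` steps. Every elementary instruction and every
evaluation of a test costs one step. Overflow, an undefined operation, or an address that is not an
integer in `[0, 2 ^ w)` is a fault: there is then no execution. -/
inductive Exec (w : ℕ) (ω : ℕ → Fin (2 ^ w)) : Cmd → State → ℕ → State → Prop
  | skip (s : State) : Exec w ω .skip s 1 s
  | const (s : State) (d : ℕ) (z : ℤ) (h : InRange w (z : ℝ)) :
      Exec w ω (.const d z) s 1 (s.setReg d (fround w (z : ℝ)))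
  | copy (s : State) (d a : ℕ) : Exec w ω (.copy d a) s 1 (s.setReg d (s.reg a))
  | op (s : State) (o : BinOp) (d a b : ℕ) (hd : o.Defined (s.reg a) (s.reg b))
      (hr : InRange w (o.eval (s.reg a) (s.reg b))) :
      Exec w ω (.op o d a b) s 1 (s.setReg d (fround w (o.eval (s.reg a) (s.reg b))))
  | floor (s : State) (d a : ℕ) (hr : InRange w (⌊s.reg a⌋ : ℝ)) :
      Exec w ω (.floor d a) s 1 (s.setReg d (fround w (⌊s.reg a⌋ : ℝ)))
  | load (s : State) (d a k : ℕ) (hk : k < 2 ^ w) (ha : s.reg a = (k : ℝ)) :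
      Exec w ω (.load d a) s 1 (s.setReg d (s.mem k))
  | store (s : State) (a b k : ℕ) (hk : k < 2 ^ w) (ha : s.reg a = (k : ℝ)) :
      Exec w ω (.store a b) s 1 (s.setMem k (s.reg b))
  | rand (s : State) (d : ℕ) :
      Exec w ω (.rand d) s 1
        { s.setReg d (((ω s.pos : ℕ) : ℝ) / 2 ^ w) with pos := s.pos + 1 }
  | seq {c₁ c₂ : Cmd} {s s' s'' : State} {t₁ t₂ : ℕ}
      (h₁ : Exec w ω c₁ s t₁ s') (h₂ : Exec w ω c₂ s' t₂ s'') :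
      Exec w ω (.seq c₁ c₂) s (t₁ + t₂) s''
  | ite_true {a b : ℕ} {c₁ c₂ : Cmd} {s s' : State} {t : ℕ} (hab : s.reg a < s.reg b)
      (h : Exec w ω c₁ s t s') : Exec w ω (.ite a b c₁ c₂) s (t + 1) s'
  | ite_false {a b : ℕ} {c₁ c₂ : Cmd} {s s' : State} {t : ℕ} (hab : ¬ s.reg a < s.reg b)
      (h : Exec w ω c₂ s t s') : Exec w ω (.ite a b c₁ c₂) s (t + 1) s'
  | while_false {a b : ℕ} {c : Cmd} {s : State} (hab : ¬ s.reg a < s.reg b) :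
      Exec w ω (.while a b c) s 1 s
  | while_true {a b : ℕ} {c : Cmd} {s s' s'' : State} {t₁ t₂ : ℕ} (hab : s.reg a < s.reg b)
      (h₁ : Exec w ω c s t₁ s') (h₂ : Exec w ω (.while a b c) s' t₂ s'') :
      Exec w ω (.while a b c) s (t₁ + t₂ + 1) s''

/-- The law of an infinite sequence of independent uniformly random `w`-bit words. -/
noncomputable def coinMeasure (w : ℕ) : MeasureTheory.Measure (ℕ → Fin (2 ^ w)) :=
  MeasureTheory.Measure.infinitePi
    (fun _ : ℕ => (PMF.uniformOfFintype (Fin (2 ^ w))).toMeasure)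

end FloatRAM

/-- The `ℓ_p` distance `(∑ᵢ |xᵢ - yᵢ| ^ p) ^ (1 / p)` of two strings over the natural numbers. -/
noncomputable def lpDist (p : ℝ) {m : ℕ} (X Y : Fin m → ℕ) : ℝ :=
  (∑ j, |(X j : ℝ) - (Y j : ℝ)| ^ p) ^ (1 / p)

/-- The `m`-substring of the text starting at position `i`. -/
def window {n m : ℕ} (hmn : m ≤ n) (T : Fin n → ℕ) (i : Fin (n - m + 1)) : Fin m → ℕ :=
  fun j => T ⟨i + j, by have := i.isLt; have := j.isLt; omega⟩

/-- `S` is a `(1 + ε)`-approximation of the array of `ℓ_p` text-to-pattern distances. -/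
def IsApproxDistances (p ε : ℝ) {n m : ℕ} (hmn : m ≤ n) (T : Fin n → ℕ) (P : Fin m → ℕ)
    (S : Fin (n - m + 1) → ℝ) : Prop :=
  ∀ i, (1 - ε) * lpDist p (window hmn T i) P ≤ S i ∧
    S i ≤ (1 + ε) * lpDist p (window hmn T i) P

/-- The initial state: `n, m, U, p, ε` (as floating point numbers) in registers `0, …, 4`, the text
in memory cells `0, …, n - 1`, the pattern in cells `n, …, n + m - 1`, and `0` elsewhere. -/
noncomputable def inputState (w : ℕ) {n m : ℕ} (U : ℕ) (p ε : ℝ) (T : Fin n → ℕ)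
    (P : Fin m → ℕ) : FloatRAM.State where
  reg := fun k => FloatRAM.fround w
    (match k with
      | 0 => (n : ℝ)
      | 1 => (m : ℝ)
      | 2 => (U : ℝ)
      | 3 => p
      | 4 => ε
      | _ => 0)
  mem := fun k => FloatRAM.fround w
    (if h : k < n then (T ⟨k, h⟩ : ℝ)
      else if h' : k - n < m then (P ⟨k - n, h'⟩ : ℝ)
      else 0)
  pos := 0

/-- The output array: the memory cells `0, …, n - m`. -/
def outputArray (n m : ℕ) (s : FloatRAM.State) : Fin (n - m + 1) → ℝ := fun i => s.mem i

set_option linter.constructorNameAsVariable false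

namespace FloatRAM

/-! ### Rounding -/

/-! The power |x - y|^p is split over dyadic scales. `blockDist a D` is the least distance
compatible with 2^a-blocks at distance D, and `weight p a` is what its p-th power loses between the
scales a and a + 1. Weights are nonnegative and telescope (`weight_sum`): summed from scale s on,
they give the p-th power of the block distance at scale s, because at scale A = clog U all symbols
lie in block 0. If s is the first scale at which the blocks of x and y are less than N apart, this
block distance is |x - y| up to a factor 1 - 8/N. So only the weights of near pairs of blocks have
to be collected.

Near pairs are detected by a random map of the symbols to M = 4N cells: multiplication by b / (4NΛ)
on the circle, with b uniform in [Λ, 2Λ). Distinct symbols at distance below 2N never share a cell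
(`cell_ne_of_near`), and symbols farther apart share one with probability at most 4/N
(`card_collision_le`). A text symbol u puts the weights of the 2N - 1 symbols around it into their
cells, and a pattern symbol reads its own cell. For a near pair this returns exactly its weight
(`estLevel_near`). A far pair collects nonnegative noise only. Since the weights around u sum to at
most 4 (2^a N)^p (`sum_weight_le`) and a far pair has |x - y| ≥ 2^a N / 2, the expected noise is at
most 32/N · |x - y|^p per scale.

Hence the estimated sum of a window is never below 1 - 8/N times the truth (`le_est`), and by
Markov's inequality it is at most 1 + 64A/N times the truth for at least half of the multipliers
(`card_bad_le`). As the error is bounded below with certainty, the minimum over independent trials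
amplifies the success probability: C (clog n + 1) trials and a union bound over the positions leave
a failure probability of at most n^(-c) (`le_coinMeasure`, `div_two_pow_le`). With N of order A /
(pε) the sum is known up to a relative error pε/12, and the 1/p-th root turns this into ε
(`outVal_accuracy`).

For a fixed scale and cell, the sum over the pattern is a correlation of one column of the weight
table with a 0/1 vector (`Good.levelSum_eq`). It is computed by transforms of a length between 2m
and 4m on about n/m chunks of the text. With O(log U / (pε)) cells, O(log U) scales and O(log n)
trials this gives the running time (`time_le`).

On the machine, operations on short integers and dyadic fractions are exact. All other errors have
the form Θ^j / 2^w, where Θ bounds the parameters and Θ^30 ≤ 2^w. The algorithm is written in a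
small structured language that compiles to the machine with the same step count (`HX.exec`) and is
verified by weakest preconditions that carry a bound on the cost (`WP`). -/

theorem fround_zero (w : ℕ) : fround w 0 = 0 := by
  unfold fround
  rw [if_pos]
  rw [abs_zero]; positivity

/-- Rounding to nearest moves a number by at most half an ulp, which is 2^(e - w) when 2^e ≤ |x|.
The hypothesis excludes flushing to zero, so the error is relative. -/
theorem abs_fround_sub_le_of_le {w : ℕ} {x : ℝ} (hx : ((2 : ℝ) ^ (2 ^ w : ℕ))⁻¹ ≤ |x|) :
    |fround w x - x| ≤ |x| / 2 ^ w := by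
  unfold fround
  rw [if_neg (not_lt.mpr hx)]
  have hpos : 0 < |x| := lt_of_lt_of_le (by positivity) hx
  set e := Int.log 2 |x|
  have hlog : (2 : ℝ) ^ e ≤ |x| := Int.zpow_log_le_self (b := 2) (by norm_num) hpos
  set ulp : ℝ := (2 : ℝ) ^ (e - (w : ℤ) + 1) with hulp
  have hu : 0 < ulp := by positivity
  have h1 : ulp = 2 ^ e / 2 ^ w * 2 := by
    rw [hulp, zpow_add₀ (by norm_num), zpow_sub₀ (by norm_num)]; simp
  have h2 : (round (x / ulp) : ℝ) * ulp - x = -((x / ulp - round (x / ulp)) * ulp) := by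
    field_simp; ring
  change |(round (x / ulp) : ℝ) * ulp - x| ≤ _
  rw [h2, abs_neg, abs_mul, abs_of_pos hu]
  calc _ ≤ 1 / 2 * ulp := by gcongr; exact abs_sub_round _
    _ = 2 ^ e / 2 ^ w := by rw [h1]; ring
    _ ≤ _ := by gcongr

theorem pow_lt_pow_pow (w : ℕ) : (2 : ℝ) ^ w < 2 ^ (2 ^ w : ℕ) :=
  pow_lt_pow_right₀ (by norm_num) Nat.lt_two_pow_self

/-- The rounding error of a machine operation. -/
theorem abs_fround_sub_le (w : ℕ) (x : ℝ) : |fround w x - x| ≤ (|x| + 1) / 2 ^ w := by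
  by_cases hx : |x| < ((2 : ℝ) ^ (2 ^ w : ℕ))⁻¹
  · have h0 : fround w x = 0 := by unfold fround; rw [if_pos hx]
    rw [h0, zero_sub, abs_neg]
    have h1 : ((2 : ℝ) ^ (2 ^ w : ℕ))⁻¹ ≤ ((2 : ℝ) ^ w)⁻¹ :=
      inv_anti₀ (by positivity) (pow_lt_pow_pow w).le
    have h2 : (|x| + 1) / 2 ^ w = |x| / 2 ^ w + ((2 : ℝ) ^ w)⁻¹ := by
      rw [add_div, one_div]
    have h3 : 0 ≤ |x| / 2 ^ w := by positivity
    linarith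
  · refine (abs_fround_sub_le_of_le (not_lt.mp hx)).trans ?_
    gcongr; linarith

/-- Numbers `z / 2 ^ j` with a short numerator are machine numbers. -/
theorem fround_dyadic {w : ℕ} (hw : 0 < w) (z : ℤ) (j : ℕ) (hz : |(z : ℝ)| ≤ 2 ^ w) (hj : j ≤ 2 ^ w) :
    fround w (z / 2 ^ j) = z / 2 ^ j := by
  rcases eq_or_ne z 0 with rfl | hz0
  · simp [fround_zero]
  have hz1 : (1 : ℝ) ≤ |(z : ℝ)| := by
    rw [← Int.cast_abs]; exact_mod_cast Int.one_le_abs hz0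
  set x : ℝ := z / 2 ^ j with hx
  have hxabs : |x| = |(z : ℝ)| / 2 ^ j := by rw [hx, abs_div, abs_of_pos (by positivity : (0 : ℝ) < 2 ^ j)]
  have hlow : ((2 : ℝ) ^ (2 ^ w : ℕ))⁻¹ ≤ |x| := by
    rw [hxabs, ← one_div]
    exact div_le_div₀ (by positivity) hz1 (by positivity) (pow_le_pow_right₀ (by norm_num) hj)
  have hpos : 0 < |x| := lt_of_lt_of_le (by positivity) hlow
  unfold fround
  rw [if_neg (not_lt.mpr hlow)]
  set e := Int.log 2 |x|
  set ulp : ℝ := (2 : ℝ) ^ (e - (w : ℤ) + 1) with hulp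
  have hu : 0 < ulp := by positivity
  change (round (x / ulp) : ℝ) * ulp = x
  -- For |z| < 2^w the ulp is 2^(-j) divided by a power of two, so the number is a multiple of it.
  -- For |z| = 2^w the ulp is 2 / 2^j, and z has to be even, which needs w > 0.
  rcases lt_or_ge |(z : ℝ)| (2 ^ w) with hlt | hge
  · have he : e < (w : ℤ) - j := by
      rw [← Int.lt_zpow_iff_log_lt (by norm_num) hpos]
      rw [hxabs, Nat.cast_ofNat, zpow_sub₀ (by norm_num)]
      simp only [zpow_natCast]
      gcongr
    obtain ⟨k, hk⟩ : ∃ k : ℕ, (k : ℤ) = (w : ℤ) - j - e - 1 := ⟨((w : ℤ) - j - e - 1).toNat, by omega⟩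
    have hdiv : x / ulp = ((z * 2 ^ k : ℤ) : ℝ) := by
      rw [div_eq_iff hu.ne', hx, hulp]
      have : e - (w : ℤ) + 1 = -(j : ℤ) - k := by omega
      rw [this, zpow_sub₀ (by norm_num), zpow_neg]
      push_cast
      simp only [zpow_natCast]
      field_simp
    rw [hdiv, round_intCast, ← hdiv, div_mul_cancel₀ _ hu.ne']
  · have habs : |(z : ℝ)| = 2 ^ w := le_antisymm hz hge
    have he : e = (w : ℤ) - j := by
      have : |x| = (2 : ℝ) ^ ((w : ℤ) - j) := by
        rw [hxabs, habs, zpow_sub₀ (by norm_num)]; simp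
      change Int.log 2 |x| = _
      rw [this]
      exact_mod_cast Int.log_zpow (R := ℝ) (b := 2) (by norm_num) ((w : ℤ) - j)
    have hulp' : ulp = 2 / 2 ^ j := by
      rw [hulp, he]
      have : (w : ℤ) - j - w + 1 = 1 - j := by ring
      rw [this, zpow_sub₀ (by norm_num)]; simp
    have hz2 : z = 2 ^ w ∨ z = -2 ^ w := by
      have : |z| = 2 ^ w := by
        have : ((|z| : ℤ) : ℝ) = ((2 ^ w : ℤ) : ℝ) := by push_cast; exact habs
        exact_mod_cast this
      rcases abs_eq (by positivity) |>.mp this with h | h <;> simp [h]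
    rcases w with _ | w
    · exact absurd hw (lt_irrefl _)
    · have hdiv : x / ulp = (((z / 2 : ℤ)) : ℝ) := by
        rw [hulp', hx]
        have : (2 : ℤ) ∣ z := by
          rcases hz2 with h | h <;> rw [h, pow_succ]
          · exact Dvd.intro_left _ rfl
          · exact (dvd_neg).mpr (Dvd.intro_left _ rfl)
        rw [Int.cast_div this (by norm_num)]
        push_cast
        field_simp
      rw [hdiv, round_intCast, ← hdiv, div_mul_cancel₀ _ hu.ne']


theorem fround_int {w : ℕ} (hw : 0 < w) (z : ℤ) (hz : |(z : ℝ)| ≤ 2 ^ w) : fround w z = z := by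
  simpa using fround_dyadic hw z 0 hz (Nat.zero_le _)

theorem fround_nat {w : ℕ} (hw : 0 < w) (z : ℕ) (hz : z ≤ 2 ^ w) : fround w z = z := by
  have := fround_int hw z (by rw [Int.cast_natCast, abs_of_nonneg (by positivity)]; exact_mod_cast hz)
  simpa using this

theorem inRange_of_le {w : ℕ} {x : ℝ} (hx : |x| ≤ 2 ^ w) : InRange w x :=
  lt_of_le_of_lt hx (pow_lt_pow_pow w)

/-! ### A structured language with expressions and arrays -/

/-- Program variables. The first two are kept in the registers in which the input arrives. -/
inductive Var
  | U | eps | n | m | p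
  | A | PU | N | X | TH | L | K | P2 | R | M | LAM | NM | NMm | SZ | LM | Wd | ip | KM
  | h | C | S | b | st | x | o | par | lo | pr | pi | s | t | a | c | i | j | r | rho | beta | G
  | vh | z | ce | d | dd | e1 | e2 | t1
deriving DecidableEq

/-- Arrays. -/
inductive Arr
  | io | txt | pat | acc | best | W | PT | rr | ri | xr | xi | yr | yi | br | bi
deriving DecidableEq

/-- The register of a variable. -/
def Var.reg (v : Var) : ℕ := 2 * v.ctorIdx + 2

/-- The number of an array. -/
def Arr.code (k : Arr) : ℕ := k.ctorIdx

theorem Var.reg_injective {v v' : Var} (h : v.reg = v'.reg) : v = v' := by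
  have h1 : v.ctorIdx = v'.ctorIdx := by unfold Var.reg at h; omega
  rw [← Var.ofNat_ctorIdx v, h1, Var.ofNat_ctorIdx]

theorem Arr.code_injective {v v' : Arr} (h : v.code = v'.code) : v = v' := by
  rw [← Arr.ofNat_ctorIdx v, ← Arr.ofNat_ctorIdx v']
  exact congrArg _ h

theorem Arr.code_lt (k : Arr) : k.code < 16 := by cases k <;> decide

/-- Expressions. -/
inductive Ex
  | var (x : Var)
  | lit (z : ℤ)
  | bin (o : BinOp) (a b : Ex)
  | flr (a : Ex)
  | get (k : Arr) (a : Ex)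

instance : Coe Var Ex := ⟨Ex.var⟩
instance : Add Ex := ⟨Ex.bin .add⟩
instance : Sub Ex := ⟨Ex.bin .sub⟩
instance : Mul Ex := ⟨Ex.bin .mul⟩
instance : Div Ex := ⟨Ex.bin .div⟩

/-- Number of machine steps of an expression. -/
def Ex.cost : Ex → ℕ
  | .var _ => 1
  | .lit _ => 1
  | .bin _ a b => a.cost + b.cost + 1
  | .flr a => a.cost + 1
  | .get _ a => a.cost + 4

/-- Evaluate an expression into the temporary register `2 * d + 1`. -/
def Ex.comp : Ex → ℕ → Cmd
  | .var x, d => .copy (2 * d + 1) x.reg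
  | .lit z, d => .const (2 * d + 1) z
  | .bin o a b, d =>
    .seq (.seq (a.comp d) (b.comp (d + 1))) (.op o (2 * d + 1) (2 * d + 1) (2 * (d + 1) + 1))
  | .flr a, d => .seq (a.comp d) (.floor (2 * d + 1) (2 * d + 1))
  | .get k a, d =>
    .seq (a.comp d) (.seq (.const (2 * (d + 1) + 1) k.code)
      (.seq (.op .mul (2 * (d + 1) + 1) (2 * (d + 1) + 1) 0)
        (.seq (.op .add (2 * d + 1) (2 * d + 1) (2 * (d + 1) + 1))
          (.load (2 * d + 1) (2 * d + 1)))))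

/-- Programs. -/
inductive Pg
  | skip
  | asg (x : Var) (e : Ex)
  | put (k : Arr) (i e : Ex)
  | rnd (x : Var)
  | seq (c₁ c₂ : Pg)
  | ite (a b : Ex) (c₁ c₂ : Pg)
  | wh (x y : Var) (c : Pg)

infixr:60 " ;; " => Pg.seq

/-- Compilation to machine code. -/
def Pg.comp : Pg → Cmd
  | .skip => .skip
  | .asg x e => .seq (e.comp 0) (.copy x.reg 1)
  | .put k i e =>
    .seq (i.comp 0) (.seq (.const 3 k.code) (.seq (.op .mul 3 3 0) (.seq (.op .add 1 1 3)
      (.seq (e.comp 1) (.store 1 3)))))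
  | .rnd x => .rand x.reg
  | .seq c₁ c₂ => .seq c₁.comp c₂.comp
  | .ite a b c₁ c₂ => .seq (a.comp 0) (.seq (b.comp 1) (.ite 1 3 c₁.comp c₂.comp))
  | .wh x y c => .while x.reg y.reg c.comp

/-- The abstract store. -/
structure Sto where
  var : Var → ℝ
  arr : Arr → ℕ → ℝ
  pos : ℕ

/-- Write a variable. -/
def Sto.setVar (σ : Sto) (x : Var) (v : ℝ) : Sto := { σ with var := Function.update σ.var x v }

/-- Write an array cell. -/
def Sto.setArr (σ : Sto) (k : Arr) (i : ℕ) (v : ℝ) : Sto :=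
  { σ with arr := Function.update σ.arr k (Function.update (σ.arr k) i v) }

@[simp] theorem Sto.setVar_arr (σ : Sto) (x v) : (σ.setVar x v).arr = σ.arr := rfl
@[simp] theorem Sto.setVar_pos (σ : Sto) (x v) : (σ.setVar x v).pos = σ.pos := rfl
@[simp] theorem Sto.setVar_self (σ : Sto) (x v) : (σ.setVar x v).var x = v := by simp [Sto.setVar]
theorem Sto.setVar_ne (σ : Sto) {x y : Var} (v) (h : y ≠ x) : (σ.setVar x v).var y = σ.var y := by
  simp [Sto.setVar, h]
theorem Sto.setVar_var (σ : Sto) (x y : Var) (v) :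
    (σ.setVar x v).var y = if y = x then v else σ.var y := by
  simp [Sto.setVar, Function.update_apply]
theorem Sto.setArr_arr (σ : Sto) (k i v k' i') :
    (σ.setArr k i v).arr k' i' = if k' = k ∧ i' = i then v else σ.arr k' i' := by
  by_cases hk : k' = k
  · subst hk; simp [Sto.setArr, Function.update_apply]
  · simp [Sto.setArr, hk]
theorem Sto.setArr_ne (σ : Sto) {k k' : Arr} (i v) (h : k' ≠ k) :
    (σ.setArr k i v).arr k' = σ.arr k' := by
  simp [Sto.setArr, h]

/-- `Ev w Z σ e v`: the expression `e` evaluates without a fault to `v`; arrays have size `Z`. -/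
def Ev (w Z : ℕ) (σ : Sto) : Ex → ℝ → Prop
  | .var x, v => v = σ.var x
  | .lit z, v => InRange w z ∧ v = fround w z
  | .bin o a b, v => ∃ x y, Ev w Z σ a x ∧ Ev w Z σ b y ∧ o.Defined x y ∧ InRange w (o.eval x y) ∧
      v = fround w (o.eval x y)
  | .flr a, v => ∃ x, Ev w Z σ a x ∧ InRange w ⌊x⌋ ∧ v = fround w ⌊x⌋
  | .get k a, v => ∃ i : ℕ, Ev w Z σ a i ∧ i < Z ∧ v = σ.arr k i

/-- Big-step semantics on the abstract store. -/
inductive HX (w : ℕ) (ω : ℕ → Fin (2 ^ w)) (Z : ℕ) : Pg → Sto → ℕ → Sto → Prop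
  | skip {σ} : HX w ω Z .skip σ 1 σ
  | asg {σ x e v} (h : Ev w Z σ e v) : HX w ω Z (.asg x e) σ (e.cost + 1) (σ.setVar x v)
  | put {σ k e₁ e₂ v} {i : ℕ} (h₁ : Ev w Z σ e₁ i) (hi : i < Z) (h₂ : Ev w Z σ e₂ v) :
      HX w ω Z (.put k e₁ e₂) σ (e₁.cost + e₂.cost + 4) (σ.setArr k i v)
  | rnd {σ x} : HX w ω Z (.rnd x) σ 1
      { σ.setVar x (((ω σ.pos : ℕ) : ℝ) / 2 ^ w) with pos := σ.pos + 1 }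
  | seq {c₁ c₂ σ σ' σ'' t₁ t₂} (h₁ : HX w ω Z c₁ σ t₁ σ') (h₂ : HX w ω Z c₂ σ' t₂ σ'') :
      HX w ω Z (.seq c₁ c₂) σ (t₁ + t₂) σ''
  | ite_true {a b c₁ c₂ σ σ' t x y} (ha : Ev w Z σ a x) (hb : Ev w Z σ b y) (hab : x < y)
      (h : HX w ω Z c₁ σ t σ') : HX w ω Z (.ite a b c₁ c₂) σ (a.cost + b.cost + t + 1) σ'
  | ite_false {a b c₁ c₂ σ σ' t x y} (ha : Ev w Z σ a x) (hb : Ev w Z σ b y) (hab : ¬ x < y)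
      (h : HX w ω Z c₂ σ t σ') : HX w ω Z (.ite a b c₁ c₂) σ (a.cost + b.cost + t + 1) σ'
  | wh_false {x y c σ} (hxy : ¬ σ.var x < σ.var y) : HX w ω Z (.wh x y c) σ 1 σ
  | wh_true {x y c σ σ' σ'' t₁ t₂} (hxy : σ.var x < σ.var y) (h₁ : HX w ω Z c σ t₁ σ')
      (h₂ : HX w ω Z (.wh x y c) σ' t₂ σ'') : HX w ω Z (.wh x y c) σ (t₁ + t₂ + 1) σ''

/-- A machine state represents an abstract store; the cells `a ≥ 16 Z` hold `g a`. -/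
structure Rep (Z : ℕ) (g : ℕ → ℝ) (s : State) (σ : Sto) : Prop where
  zreg : s.reg 0 = Z
  var : ∀ x : Var, s.reg x.reg = σ.var x
  arr : ∀ (k : Arr) (i : ℕ), i < Z → s.mem (k.code * Z + i) = σ.arr k i
  rest : ∀ a, 16 * Z ≤ a → s.mem a = g a
  pos : s.pos = σ.pos

theorem Arr.addr_lt (k : Arr) {Z i : ℕ} (hi : i < Z) : k.code * Z + i < 16 * Z := by
  have := k.code_lt
  nlinarith

theorem Arr.addr_inj {k k' : Arr} {Z i i' : ℕ} (hi : i < Z) (hi' : i' < Z)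
    (h : k.code * Z + i = k'.code * Z + i') : k = k' ∧ i = i' := by
  have h1 : k.code = k'.code := by
    have e1 : (k.code * Z + i) / Z = k.code := by
      rw [mul_comm, Nat.mul_add_div (by omega), Nat.div_eq_of_lt hi, add_zero]
    have e2 : (k'.code * Z + i') / Z = k'.code := by
      rw [mul_comm, Nat.mul_add_div (by omega), Nat.div_eq_of_lt hi', add_zero]
    rw [← e1, h, e2]
  exact ⟨Arr.code_injective h1, by rw [h1] at h; omega⟩

/-! ### Simulation of structured programs by machine code. -/

section Simulation

variable {w : ℕ} {ω : ℕ → Fin (2 ^ w)} {Z : ℕ} {g : ℕ → ℝ}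


/-- Variables live in even registers from 2 on and register 0 holds the array size, so all odd
registers are free for temporaries. -/
theorem Rep.setTemp {s : State} {σ : Sto} (h : Rep Z g s σ) (d : ℕ) (v : ℝ) :
    Rep Z g (s.setReg (2 * d + 1) v) σ := by
  refine ⟨?_, fun x => ?_, h.arr, h.rest, h.pos⟩
  · rw [← h.zreg]; simp [State.setReg]
  · rw [← h.var x]
    simp only [State.setReg]
    rw [Function.update_of_ne]
    unfold Var.reg; omega

theorem Rep.setVar {s : State} {σ : Sto} (h : Rep Z g s σ) (x : Var) (v : ℝ) :
    Rep Z g (s.setReg x.reg v) (σ.setVar x v) := by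
  refine ⟨?_, fun y => ?_, h.arr, h.rest, h.pos⟩
  · rw [← h.zreg]
    simp only [State.setReg]
    rw [Function.update_of_ne]
    unfold Var.reg; omega
  · simp only [State.setReg, Sto.setVar_var, Function.update_apply]
    by_cases hxy : y = x
    · simp [hxy]
    · rw [if_neg hxy, if_neg (fun hh => hxy (Var.reg_injective hh)), h.var]

theorem Rep.setArr {s : State} {σ : Sto} (h : Rep Z g s σ) (k : Arr) {i : ℕ} (hi : i < Z) (v : ℝ) :
    Rep Z g (s.setMem (k.code * Z + i) v) (σ.setArr k i v) := by
  refine ⟨h.zreg, h.var, fun k' i' hi' => ?_, fun a ha => ?_, h.pos⟩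
  · simp only [State.setMem, Sto.setArr_arr, Function.update_apply]
    by_cases hk : k' = k ∧ i' = i
    · rw [if_pos hk, hk.1, hk.2, if_pos rfl]
    · rw [if_neg hk, if_neg (fun hh => hk (Arr.addr_inj hi' hi hh)), h.arr k' i' hi']
  · have := k.addr_lt hi
    simp only [State.setMem]
    rw [Function.update_of_ne (by omega), h.rest a ha]

/-- The address computation for cell `i` of array `k`. -/
theorem Exec.addr (hZ : 16 * Z ≤ 2 ^ w) (k : Arr) {i : ℕ} (hi : i < Z) {s : State} {σ : Sto}
    (d d' : ℕ) (hs : Rep Z g s σ) (hd : s.reg (2 * d + 1) = i) (hdd : d ≠ d') :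
    ∃ s', (∀ c t s'', Exec w ω c s' t s'' →
        Exec w ω (.seq (.const (2 * d' + 1) k.code) (.seq (.op .mul (2 * d' + 1) (2 * d' + 1) 0)
          (.seq (.op .add (2 * d + 1) (2 * d + 1) (2 * d' + 1)) c))) s (1 + (1 + (1 + t))) s'') ∧
      s'.reg (2 * d + 1) = ((k.code * Z + i : ℕ) : ℝ) ∧ Rep Z g s' σ ∧
      (∀ e, e ≠ d → e ≠ d' → s'.reg (2 * e + 1) = s.reg (2 * e + 1)) := by
  have hk := k.code_lt
  have hlt := k.addr_lt hi
  have hw : 0 < w := by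
    by_contra h
    have : w = 0 := by omega
    subst this; simp at hZ; omega
  have hc : (k.code : ℝ) * Z = ((k.code * Z : ℕ) : ℝ) := by push_cast; ring
  have ha : ((i : ℕ) : ℝ) + ((k.code * Z : ℕ) : ℝ) = ((k.code * Z + i : ℕ) : ℝ) := by push_cast; ring
  have rng : ∀ {a : ℕ}, a ≤ 2 ^ w → InRange w (a : ℝ) := fun {a} h =>
    inRange_of_le (by rw [abs_of_nonneg (by positivity)]; exact_mod_cast h)
  have f1 : fround w (((k.code : ℕ) : ℤ) : ℝ) = (k.code : ℝ) := by
    rw [Int.cast_natCast]; exact fround_nat hw _ (by omega)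
  have n1 : (2 * d' + 1) ≠ 0 := by omega
  have n2 : (2 * d + 1) ≠ 2 * d' + 1 := by omega
  set s1 := s.setReg (2 * d' + 1) (k.code : ℝ) with hs1
  set s2 := s1.setReg (2 * d' + 1) ((k.code * Z : ℕ) : ℝ) with hs2
  set s3 := s2.setReg (2 * d + 1) ((k.code * Z + i : ℕ) : ℝ) with hs3
  refine ⟨s3, fun c t s'' h => ?_, by simp [hs3, State.setReg], ?_, ?_⟩
  · have e1 : Exec w ω (.const (2 * d' + 1) k.code) s 1 s1 := by
      have := Exec.const (w := w) (ω := ω) s (2 * d' + 1) (k.code : ℤ)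
        (by rw [Int.cast_natCast]; exact rng (by omega))
      rwa [f1] at this
    have r1 : s1.reg (2 * d' + 1) = k.code := by simp [hs1, State.setReg]
    have r0 : s1.reg 0 = Z := by rw [← hs.zreg]; simp [hs1, State.setReg]
    have e2 : Exec w ω (.op .mul (2 * d' + 1) (2 * d' + 1) 0) s1 1 s2 := by
      have hv : BinOp.mul.eval (s1.reg (2 * d' + 1)) (s1.reg 0) = ((k.code * Z : ℕ) : ℝ) := by
        rw [r1, r0, ← hc]; rfl
      have := Exec.op (w := w) (ω := ω) s1 .mul (2 * d' + 1) (2 * d' + 1) 0 trivial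
        (by rw [hv]; exact rng (by omega))
      rwa [hv, fround_nat hw _ (by omega)] at this
    have q1 : s2.reg (2 * d' + 1) = ((k.code * Z : ℕ) : ℝ) := by simp [hs2, State.setReg]
    have q0 : s2.reg (2 * d + 1) = i := by
      rw [← hd]; simp [hs2, hs1, State.setReg, Function.update_of_ne n2]
    have e3 : Exec w ω (.op .add (2 * d + 1) (2 * d + 1) (2 * d' + 1)) s2 1 s3 := by
      have hv : BinOp.add.eval (s2.reg (2 * d + 1)) (s2.reg (2 * d' + 1))
          = ((k.code * Z + i : ℕ) : ℝ) := by
        rw [q1, q0, ← ha]; rfl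
      have := Exec.op (w := w) (ω := ω) s2 .add (2 * d + 1) (2 * d + 1) (2 * d' + 1) trivial
        (by rw [hv]; exact rng (by omega))
      rwa [hv, fround_nat hw _ (by omega)] at this
    exact .seq e1 (.seq e2 (.seq e3 h))
  · exact ((hs.setTemp _ _).setTemp _ _).setTemp _ _
  · intro e h1 h2
    simp [hs3, hs2, hs1, State.setReg, h1, h2]

/-- Evaluation at depth d only writes temporaries of depth at least d. The last conjunct records
this; it keeps the left operand intact while the right operand is evaluated one level deeper. -/
theorem Ev.exec (hZ : 16 * Z ≤ 2 ^ w) {σ : Sto} {e : Ex} : ∀ {v : ℝ} {s : State} (d : ℕ),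
    Ev w Z σ e v → Rep Z g s σ →
    ∃ s', Exec w ω (e.comp d) s e.cost s' ∧ Rep Z g s' σ ∧ s'.reg (2 * d + 1) = v ∧
      ∀ d' < d, s'.reg (2 * d' + 1) = s.reg (2 * d' + 1) := by
  have keep : ∀ (s : State) (d d' : ℕ) (v : ℝ), d' < d →
      (s.setReg (2 * d + 1) v).reg (2 * d' + 1) = s.reg (2 * d' + 1) := fun s d d' v h => by
    simp only [State.setReg]
    rw [Function.update_of_ne]; omega
  have self : ∀ (s : State) (d : ℕ) (v : ℝ), (s.setReg d v).reg d = v := fun s d v => by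
    simp [State.setReg]
  induction e with
  | var x =>
    intro v s d h hs
    refine ⟨_, .copy _ _ _, hs.setTemp _ _, ?_, fun d' hd' => keep _ _ _ _ hd'⟩
    rw [self, hs.var]; exact h.symm
  | lit z =>
    intro v s d h hs
    exact ⟨_, .const _ _ _ h.1, hs.setTemp _ _, by rw [self, h.2], fun d' hd' => keep _ _ _ _ hd'⟩
  | bin o a b iha ihb =>
    rintro v s d ⟨x, y, ha, hb, hdef, hr, rfl⟩ hs
    obtain ⟨s1, x1, r1, v1, k1⟩ := iha d ha hs
    obtain ⟨s2, x2, r2, v2, k2⟩ := ihb (d + 1) hb r1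
    have v1' : s2.reg (2 * d + 1) = x := by rw [k2 d (by omega), v1]
    have e3 := Exec.op (w := w) (ω := ω) s2 o (2 * d + 1) (2 * d + 1) (2 * (d + 1) + 1)
      (by rw [v1', v2]; exact hdef) (by rw [v1', v2]; exact hr)
    refine ⟨_, .seq (.seq x1 x2) e3, r2.setTemp _ _, ?_, fun d' hd' => ?_⟩
    · rw [self, v1', v2]
    · rw [keep _ _ _ _ hd', k2 _ (by omega), k1 _ hd']
  | flr a iha =>
    rintro v s d ⟨x, ha, hr, rfl⟩ hs
    obtain ⟨s1, x1, r1, v1, k1⟩ := iha d ha hs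
    have e3 := Exec.floor (w := w) (ω := ω) s1 (2 * d + 1) (2 * d + 1) (by rw [v1]; exact hr)
    refine ⟨_, .seq x1 e3, r1.setTemp _ _, ?_, fun d' hd' => ?_⟩
    · rw [self, v1]
    · rw [keep _ _ _ _ hd', k1 _ hd']
  | get k a iha =>
    rintro v s d ⟨i, ha, hi, rfl⟩ hs
    obtain ⟨s1, x1, r1, v1, k1⟩ := iha d ha hs
    obtain ⟨s2, x2, v2, r2, k2⟩ := Exec.addr (ω := ω) hZ k hi d (d + 1) r1 v1 (by omega)
    have hlt := k.addr_lt hi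
    have e3 := Exec.load (w := w) (ω := ω) s2 (2 * d + 1) (2 * d + 1) _ (by omega) v2
    refine ⟨_, .seq x1 (x2 _ _ _ e3), r2.setTemp _ _, ?_, fun d' hd' => ?_⟩
    · rw [self, r2.arr k i hi]
    · rw [keep _ _ _ _ hd', k2 _ (by omega) (by omega), k1 _ hd']

/-- The compiled program simulates the abstract one, step for step. -/
theorem HX.exec (hZ : 16 * Z ≤ 2 ^ w) {c : Pg} {σ σ' : Sto} {t : ℕ} (h : HX w ω Z c σ t σ') :
    ∀ {s : State}, Rep Z g s σ → ∃ s', Exec w ω c.comp s t s' ∧ Rep Z g s' σ' := by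
  induction h with
  | skip => exact fun hs => ⟨_, .skip _, hs⟩
  | @asg σ x e v h =>
    intro s hs
    obtain ⟨s1, x1, r1, v1, -⟩ := Ev.exec (ω := ω) hZ 0 h hs
    refine ⟨_, .seq x1 (.copy _ _ _), ?_⟩
    have v1' : s1.reg 1 = v := v1
    rw [v1']; exact r1.setVar _ _
  | @put σ k e₁ e₂ v i h₁ hi h₂ =>
    intro s hs
    obtain ⟨s1, x1, r1, v1, -⟩ := Ev.exec (ω := ω) hZ 0 h₁ hs
    obtain ⟨s2, x2, v2, r2, -⟩ := Exec.addr (ω := ω) hZ k hi 0 1 r1 v1 (by omega)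
    obtain ⟨s3, x3, r3, v3, k3⟩ := Ev.exec (ω := ω) hZ 1 h₂ r2
    have hlt := k.addr_lt hi
    have v3' : s3.reg 3 = v := v3
    have e3 := Exec.store (w := w) (ω := ω) s3 1 3 (k.code * Z + i) (by omega)
      (by rw [← v2]; exact k3 0 (by omega))
    rw [v3'] at e3
    refine ⟨_, ?_, r3.setArr k hi v⟩
    rw [show e₁.cost + e₂.cost + 4 = e₁.cost + (1 + (1 + (1 + (e₂.cost + 1)))) by ring]
    exact Exec.seq x1 (x2 _ _ _ (.seq x3 e3))
  | @rnd σ x =>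
    intro s hs
    refine ⟨_, .rand _ _, ?_⟩
    have := hs.setVar x (((ω σ.pos : ℕ) : ℝ) / 2 ^ w)
    rw [hs.pos]
    exact ⟨this.zreg, this.var, this.arr, this.rest, rfl⟩
  | seq _ _ ih1 ih2 =>
    intro s hs
    obtain ⟨s1, x1, r1⟩ := ih1 hs
    obtain ⟨s2, x2, r2⟩ := ih2 r1
    exact ⟨s2, .seq x1 x2, r2⟩
  | @ite_true a b c₁ c₂ σ σ' t x y ha hb hab _ ih =>
    intro s hs
    obtain ⟨s1, x1, r1, v1, -⟩ := Ev.exec (ω := ω) hZ 0 ha hs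
    obtain ⟨s2, x2, r2, v2, k2⟩ := Ev.exec (ω := ω) hZ 1 hb r1
    obtain ⟨s3, x3, r3⟩ := ih r2
    refine ⟨s3, ?_, r3⟩
    have h1 : s2.reg 1 = x := by rw [← v1]; exact k2 0 (by omega)
    have h2 : s2.reg 3 = y := v2
    rw [show a.cost + b.cost + t + 1 = a.cost + (b.cost + (t + 1)) by ring]
    exact Exec.seq x1 (.seq x2 (.ite_true (by rw [h1, h2]; exact hab) x3))
  | @ite_false a b c₁ c₂ σ σ' t x y ha hb hab _ ih =>
    intro s hs
    obtain ⟨s1, x1, r1, v1, -⟩ := Ev.exec (ω := ω) hZ 0 ha hs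
    obtain ⟨s2, x2, r2, v2, k2⟩ := Ev.exec (ω := ω) hZ 1 hb r1
    obtain ⟨s3, x3, r3⟩ := ih r2
    refine ⟨s3, ?_, r3⟩
    have h1 : s2.reg 1 = x := by rw [← v1]; exact k2 0 (by omega)
    have h2 : s2.reg 3 = y := v2
    rw [show a.cost + b.cost + t + 1 = a.cost + (b.cost + (t + 1)) by ring]
    exact Exec.seq x1 (.seq x2 (.ite_false (by rw [h1, h2]; exact hab) x3))
  | wh_false h =>
    intro s hs
    exact ⟨s, .while_false (by rw [hs.var, hs.var]; exact h), hs⟩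
  | wh_true h _ _ ih1 ih2 =>
    intro s hs
    obtain ⟨s1, x1, r1⟩ := ih1 hs
    obtain ⟨s2, x2, r2⟩ := ih2 r1
    exact ⟨s2, .while_true (by rw [hs.var, hs.var]; exact h) x1 x2, r2⟩

end Simulation

/-! ### Frames and weakest preconditions -/

/-- The variables a program may modify. -/
def Pg.mv : Pg → List Var
  | .skip => []
  | .asg x _ => [x]
  | .put _ _ _ => []
  | .rnd x => [x]
  | .seq c₁ c₂ => c₁.mv ++ c₂.mv
  | .ite _ _ c₁ c₂ => c₁.mv ++ c₂.mv
  | .wh _ _ c => c.mv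

/-- The arrays a program may modify. -/
def Pg.ma : Pg → List Arr
  | .skip => []
  | .asg _ _ => []
  | .put k _ _ => [k]
  | .rnd _ => []
  | .seq c₁ c₂ => c₁.ma ++ c₂.ma
  | .ite _ _ c₁ c₂ => c₁.ma ++ c₂.ma
  | .wh _ _ c => c.ma

/-- Does the program draw random words? -/
def Pg.random : Pg → Bool
  | .skip => false
  | .asg _ _ => false
  | .put _ _ _ => false
  | .rnd _ => true
  | .seq c₁ c₂ => c₁.random || c₂.random
  | .ite _ _ c₁ c₂ => c₁.random || c₂.random
  | .wh _ _ c => c.random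

/-- `σ'` differs from `σ` at most where the program `c` may write. -/
structure Frame (c : Pg) (σ σ' : Sto) : Prop where
  var : ∀ x, x ∉ c.mv → σ'.var x = σ.var x
  arr : ∀ k, k ∉ c.ma → σ'.arr k = σ.arr k
  pos : c.random = false → σ'.pos = σ.pos

theorem Frame.refl (c : Pg) (σ : Sto) : Frame c σ σ := ⟨fun _ _ => rfl, fun _ _ => rfl, fun _ => rfl⟩

theorem Frame.trans {c : Pg} {σ σ' σ'' : Sto} (h : Frame c σ σ') (h' : Frame c σ' σ'') :
    Frame c σ σ'' :=
  ⟨fun x hx => (h'.var x hx).trans (h.var x hx), fun k hk => (h'.arr k hk).trans (h.arr k hk),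
    fun hr => (h'.pos hr).trans (h.pos hr)⟩

theorem Frame.mono {c c' : Pg} {σ σ' : Sto} (h : Frame c σ σ') (hv : c.mv ⊆ c'.mv)
    (ha : c.ma ⊆ c'.ma) (hr : c'.random = false → c.random = false) : Frame c' σ σ' :=
  ⟨fun x hx => h.var x (fun hh => hx (hv hh)), fun k hk => h.arr k (fun hh => hk (ha hh)),
    fun hh => h.pos (hr hh)⟩

/-- The written variables and arrays are syntactic lists, so that a specification only has to say
what changes; the preservation of everything else is a decidable membership question. -/
theorem HX.frame {w : ℕ} {ω : ℕ → Fin (2 ^ w)} {Z : ℕ} {c : Pg} {σ σ' : Sto} {t : ℕ}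
    (h : HX w ω Z c σ t σ') : Frame c σ σ' := by
  induction h with
  | skip => exact Frame.refl _ _
  | asg h =>
    exact ⟨fun y hy => Sto.setVar_ne _ _ (by simpa [Pg.mv] using hy), fun _ _ => rfl, fun _ => rfl⟩
  | put h₁ hi h₂ =>
    exact ⟨fun y hy => rfl, fun k hk => Sto.setArr_ne _ _ _ (by simpa [Pg.ma] using hk), fun _ => rfl⟩
  | rnd =>
    exact ⟨fun y hy => Sto.setVar_ne _ _ (by simpa [Pg.mv] using hy), fun _ _ => rfl,
      fun h => by simp [Pg.random] at h⟩
  | seq _ _ ih1 ih2 =>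
    refine (ih1.mono ?_ ?_ ?_).trans (ih2.mono ?_ ?_ ?_) <;> simp +contextual [Pg.mv, Pg.ma, Pg.random]
  | ite_true _ _ _ _ ih => refine ih.mono ?_ ?_ ?_ <;> simp +contextual [Pg.mv, Pg.ma, Pg.random]
  | ite_false _ _ _ _ ih => refine ih.mono ?_ ?_ ?_ <;> simp +contextual [Pg.mv, Pg.ma, Pg.random]
  | wh_false _ => exact Frame.refl _ _
  | wh_true _ _ _ ih1 ih2 => exact Frame.trans ⟨ih1.var, ih1.arr, ih1.pos⟩ ih2

/-- Total correctness from a given store, with a bound on the number of steps. -/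
def WP (w : ℕ) (ω : ℕ → Fin (2 ^ w)) (Z : ℕ) (c : Pg) (T : ℕ) (σ : Sto) (Q : Sto → Prop) : Prop :=
  ∃ t ≤ T, ∃ σ', HX w ω Z c σ t σ' ∧ Q σ'

/-- `for x < y do c` -/
def forL (x y : Var) (c : Pg) : Pg :=
  .asg x (.lit 0) ;; .wh x y (c ;; .asg x (x + .lit 1))

section Rules

variable {w : ℕ} {ω : ℕ → Fin (2 ^ w)} {Z : ℕ} {σ : Sto} {Q Q' : Sto → Prop}

/-- The frame is handed to the weakened postcondition, so that facts about untouched variables and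
arrays pass through any command without being part of its specification. -/
theorem WP.mono {c : Pg} {T T' : ℕ} (h : WP w ω Z c T σ Q) (hT : T ≤ T')
    (hQ : ∀ σ', Frame c σ σ' → Q σ' → Q' σ') : WP w ω Z c T' σ Q' := by
  obtain ⟨t, ht, σ', hx, hq⟩ := h
  exact ⟨t, ht.trans hT, σ', hx, hQ σ' hx.frame hq⟩

theorem WP.skip (h : Q σ) : WP w ω Z .skip 1 σ Q := ⟨1, le_rfl, σ, .skip, h⟩

theorem WP.asg {x : Var} {e : Ex} {v : ℝ} (he : Ev w Z σ e v) (h : Q (σ.setVar x v)) :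
    WP w ω Z (.asg x e) (e.cost + 1) σ Q := ⟨_, le_rfl, _, .asg he, h⟩

theorem WP.put {k : Arr} {e₁ e₂ : Ex} {i : ℕ} {v : ℝ} (h₁ : Ev w Z σ e₁ i) (hi : i < Z)
    (h₂ : Ev w Z σ e₂ v) (h : Q (σ.setArr k i v)) :
    WP w ω Z (.put k e₁ e₂) (e₁.cost + e₂.cost + 4) σ Q := ⟨_, le_rfl, _, .put h₁ hi h₂, h⟩

theorem WP.seq {c₁ c₂ : Pg} {T₁ T₂ : ℕ}
    (h : WP w ω Z c₁ T₁ σ (fun σ' => WP w ω Z c₂ T₂ σ' Q)) :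
    WP w ω Z (c₁ ;; c₂) (T₁ + T₂) σ Q := by
  obtain ⟨t, ht, σ', hx, t', ht', σ'', hx', hq⟩ := h
  exact ⟨t + t', by omega, σ'', .seq hx hx', hq⟩

theorem WP.ite {a b : Ex} {c₁ c₂ : Pg} {T : ℕ} {x y : ℝ} (ha : Ev w Z σ a x) (hb : Ev w Z σ b y)
    (h₁ : x < y → WP w ω Z c₁ T σ Q) (h₂ : ¬ x < y → WP w ω Z c₂ T σ Q) :
    WP w ω Z (.ite a b c₁ c₂) (a.cost + b.cost + T + 1) σ Q := by
  by_cases hxy : x < y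
  · obtain ⟨t, ht, σ', hx, hq⟩ := h₁ hxy
    exact ⟨_, by omega, σ', .ite_true ha hb hxy hx, hq⟩
  · obtain ⟨t, ht, σ', hx, hq⟩ := h₂ hxy
    exact ⟨_, by omega, σ', .ite_false ha hb hxy hx, hq⟩

/-- Loops that end after at most `B` rounds. -/
theorem WP.wh {x y : Var} {c : Pg} (B Tb : ℕ) (J : ℕ → Sto → Prop) (h0 : J 0 σ)
    (hstep : ∀ k < B, ∀ σ', Frame c σ σ' → J k σ' → σ'.var x < σ'.var y →
      WP w ω Z c Tb σ' (J (k + 1)))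
    (hB : ∀ σ', Frame c σ σ' → J B σ' → ¬ σ'.var x < σ'.var y)
    (hend : ∀ k ≤ B, ∀ σ', Frame c σ σ' → J k σ' → ¬ σ'.var x < σ'.var y → Q σ') :
    WP w ω Z (.wh x y c) (B * (Tb + 1) + 1) σ Q := by
  -- Induction on the number j of rounds that are still allowed; the index of the invariant is then
  -- B - j.
  have key : ∀ j ≤ B, ∀ σ', Frame c σ σ' → J (B - j) σ' →
      WP w ω Z (.wh x y c) (j * (Tb + 1) + 1) σ' Q := by
    intro j
    induction j with
    | zero =>
      intro _ σ' hf hJ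
      exact ⟨1, by omega, σ', .wh_false (hB σ' hf hJ), hend B le_rfl σ' hf hJ (hB σ' hf hJ)⟩
    | succ j ih =>
      intro hj σ' hf hJ
      by_cases hxy : σ'.var x < σ'.var y
      · obtain ⟨t, ht, σ'', hx, hq⟩ := hstep _ (by omega) σ' hf hJ hxy
        have e : B - (j + 1) + 1 = B - j := by omega
        rw [e] at hq
        obtain ⟨t', ht', σ3, hx', hq'⟩ := ih (by omega) σ'' (hf.trans hx.frame) hq
        refine ⟨t + t' + 1, ?_, σ3, .wh_true hxy hx hx', hq'⟩
        have : (j + 1) * (Tb + 1) = j * (Tb + 1) + (Tb + 1) := by ring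
        omega
      · exact ⟨1, by omega, σ', .wh_false hxy, hend _ (by omega) σ' hf hJ hxy⟩
  exact key B le_rfl σ (Frame.refl _ _) (by simpa using h0)

theorem Ev.var (σ : Sto) (x : Var) : Ev w Z σ (.var x) (σ.var x) := rfl

theorem Ev.litN (hw : 0 < w) (z : ℕ) (hz : z ≤ 2 ^ w) : Ev w Z σ (.lit (z : ℤ)) (z : ℝ) := by
  have hh := fround_nat hw z hz
  refine ⟨inRange_of_le ?_, ?_⟩
  · rw [Int.cast_natCast, abs_of_nonneg (by positivity)]; exact_mod_cast hz
  · rw [Int.cast_natCast, hh]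

theorem Ev.bin_ok {o : BinOp} {a b : Ex} {x y : ℝ} (ha : Ev w Z σ a x) (hb : Ev w Z σ b y)
    (hd : o.Defined x y) (hr : |o.eval x y| ≤ 2 ^ w) :
    Ev w Z σ (.bin o a b) (fround w (o.eval x y)) := ⟨x, y, ha, hb, hd, inRange_of_le hr, rfl⟩

/-- Natural numbers up to 2^w are machine numbers, so arithmetic on counters and addresses is not
rounded at all. -/
theorem Ev.addN (hw : 0 < w) {a b : Ex} {i j : ℕ} (ha : Ev w Z σ a i) (hb : Ev w Z σ b j)
    (h : i + j ≤ 2 ^ w) : Ev w Z σ (a + b) ((i + j : ℕ) : ℝ) := by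
  have e : BinOp.add.eval (i : ℝ) j = ((i + j : ℕ) : ℝ) := by push_cast; rfl
  have hr : |BinOp.add.eval (i : ℝ) j| ≤ 2 ^ w := by
    rw [e, abs_of_nonneg (by positivity)]; exact_mod_cast h
  have := Ev.bin_ok ha hb (o := .add) trivial hr
  rwa [e, fround_nat hw _ h] at this

theorem Ev.mulN (hw : 0 < w) {a b : Ex} {i j : ℕ} (ha : Ev w Z σ a i) (hb : Ev w Z σ b j)
    (h : i * j ≤ 2 ^ w) : Ev w Z σ (a * b) ((i * j : ℕ) : ℝ) := by
  have e : BinOp.mul.eval (i : ℝ) j = ((i * j : ℕ) : ℝ) := by push_cast; rfl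
  have hr : |BinOp.mul.eval (i : ℝ) j| ≤ 2 ^ w := by
    rw [e, abs_of_nonneg (by positivity)]; exact_mod_cast h
  have := Ev.bin_ok ha hb (o := .mul) trivial hr
  rwa [e, fround_nat hw _ h] at this

theorem Ev.subN (hw : 0 < w) {a b : Ex} {i j : ℕ} (ha : Ev w Z σ a i) (hb : Ev w Z σ b j)
    (hji : j ≤ i) (h : i ≤ 2 ^ w) : Ev w Z σ (a - b) ((i - j : ℕ) : ℝ) := by
  have e : BinOp.sub.eval (i : ℝ) j = ((i - j : ℕ) : ℝ) := by rw [Nat.cast_sub hji]; rfl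
  have hr : |BinOp.sub.eval (i : ℝ) j| ≤ 2 ^ w := by
    rw [e, abs_of_nonneg (by positivity)]; exact_mod_cast (Nat.sub_le i j).trans h
  have := Ev.bin_ok ha hb (o := .sub) trivial hr
  rwa [e, fround_nat hw _ (by omega)] at this

theorem Ev.flr_int (hw : 0 < w) {a : Ex} {x : ℝ} {z : ℤ} (ha : Ev w Z σ a x) (hx : ⌊x⌋ = z)
    (hz : |(z : ℝ)| ≤ 2 ^ w) : Ev w Z σ (.flr a) z :=
  ⟨x, ha, by rw [hx]; exact inRange_of_le hz, by rw [hx, fround_int hw z hz]⟩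

theorem Ev.flrN (hw : 0 < w) {a : Ex} {x : ℝ} {z : ℕ} (ha : Ev w Z σ a x) (hx : ⌊x⌋ = (z : ℤ))
    (hz : z ≤ 2 ^ w) : Ev w Z σ (.flr a) z := by
  have := Ev.flr_int hw ha hx (by
    rw [Int.cast_natCast, abs_of_nonneg (by positivity)]; exact_mod_cast hz)
  simpa using this

theorem Ev.getN {k : Arr} {a : Ex} {i : ℕ} (ha : Ev w Z σ a i) (hi : i < Z) :
    Ev w Z σ (.get k a) (σ.arr k i) := ⟨i, ha, hi, rfl⟩

/-- Operations with a dyadic result are exact. -/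
theorem Ev.binD (hw : 0 < w) {o : BinOp} {a b : Ex} {x y : ℝ} (z : ℤ) (j : ℕ) (ha : Ev w Z σ a x)
    (hb : Ev w Z σ b y) (hd : o.Defined x y) (he : o.eval x y = z / 2 ^ j)
    (hz : |(z : ℝ)| ≤ 2 ^ w) (hj : j ≤ 2 ^ w) : Ev w Z σ (.bin o a b) (z / 2 ^ j) := by
  have hr : |o.eval x y| ≤ 2 ^ w := by
    rw [he, abs_div, abs_of_pos (by positivity : (0 : ℝ) < 2 ^ j)]
    exact (div_le_self (abs_nonneg _) (one_le_pow₀ (by norm_num))).trans hz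
  have := Ev.bin_ok ha hb hd hr
  rwa [he, fround_dyadic hw z j hz hj] at this

/-- The body is required to establish the next invariant in the store in which the counter has
already been advanced, because the increment follows the body. A round costs the body, 4 steps for
the increment and 1 for the test; the final 3 are the initialization and the last test. -/
theorem WP.for {x y : Var} {c : Pg} {N : ℕ} (Tb : ℕ) (I : ℕ → Sto → Prop) (hw : 0 < w)
    (hN : σ.var y = N) (hNw : N ≤ 2 ^ w) (h0 : I 0 (σ.setVar x 0))
    (hstep : ∀ k < N, ∀ σ', Frame (forL x y c) σ σ' → σ'.var x = k → I k σ' →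
      WP w ω Z c Tb σ' (fun σ'' => I (k + 1) (σ''.setVar x ((k + 1 : ℕ) : ℝ))))
    (hend : ∀ σ', Frame (forL x y c) σ σ' → I N σ' → Q σ')
    (hyx : y ≠ x := by decide) (hy : y ∉ c.mv := by decide) (hx : x ∉ c.mv := by decide) :
    WP w ω Z (forL x y c) (N * (Tb + 5) + 3) σ Q := by
  have hyf : y ∉ (forL x y c).mv := by simp [forL, Pg.mv, hyx, hy]
  have hw1 : (1 : ℕ) ≤ 2 ^ w := Nat.one_le_two_pow
  have T0 : N * (Tb + 5) + 3 = 2 + (N * (Tb + 4 + 1) + 1) := by ring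
  rw [T0]
  refine WP.seq (T₁ := 2) (WP.mono (WP.asg (Q := fun σ' => σ' = σ.setVar x 0) (v := 0) (by
    simpa using Ev.litN (σ := σ) (Z := Z) hw 0 (Nat.zero_le _)) rfl) le_rfl ?_)
  rintro σ0 hf0 rfl
  have hF : ∀ σ', Frame (c ;; .asg x (x + .lit 1)) (σ.setVar x 0) σ' → Frame (forL x y c) σ σ' := by
    intro σ' hf
    refine (Frame.mono hf0 ?_ ?_ ?_).trans (Frame.mono hf ?_ ?_ ?_) <;>
      simp +contextual [forL, Pg.mv, Pg.ma, Pg.random]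
  refine WP.wh N (Tb + 4) (fun k σ' => σ'.var x = k ∧ I k σ') ⟨by simp, h0⟩ ?_ ?_ ?_
  · rintro k hk σ' hf ⟨hxk, hI⟩ -
    refine WP.seq (T₁ := Tb) (T₂ := 4) ((hstep k hk σ' (hF σ' hf) hxk hI).mono le_rfl ?_)
    intro σ'' hf' hI'
    have hxk' : σ''.var x = k := by rw [hf'.var x hx, hxk]
    have hev : Ev w Z σ'' (x + .lit 1) ((k + 1 : ℕ) : ℝ) := by
      refine Ev.addN hw (i := k) (j := 1) ?_ (Ev.litN hw 1 hw1) (by omega)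
      rw [← hxk']; exact Ev.var _ _
    exact WP.asg hev ⟨by simp, hI'⟩
  · rintro σ' hf ⟨h1, -⟩
    rw [h1, (hF σ' hf).var y hyf, hN]; exact lt_irrefl _
  · rintro k hk σ' hf ⟨h1, hI⟩ hn
    rw [h1, (hF σ' hf).var y hyf, hN, Nat.cast_lt] at hn
    have : k = N := by omega
    subst this
    exact hend σ' (hF σ' hf) hI

end Rules

/-! ### The estimator -/

/-- The least possible distance of two integers whose `2 ^ a`-blocks have distance `D`. -/
def blockDist (a D : ℕ) : ℕ := if D = 0 then 0 else 2 ^ a * (D - 1) + 1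

theorem blockDist_mono (a : ℕ) {D D' : ℕ} (h : D ≤ D') : blockDist a D ≤ blockDist a D' := by
  unfold blockDist
  split_ifs with h1 h2
  · exact le_rfl
  · exact Nat.zero_le _
  · omega
  · gcongr

theorem blockDist_le (a D : ℕ) : blockDist a D ≤ 2 ^ a * D := by
  unfold blockDist
  split_ifs with h
  · exact Nat.zero_le _
  · obtain ⟨k, rfl⟩ := Nat.exists_eq_succ_of_ne_zero h
    have := Nat.one_le_two_pow (n := a)
    simp only [Nat.succ_eq_add_one, Nat.add_sub_cancel, mul_add]
    omega

/-- Integers compatible with the fine blocks are compatible with the coarse ones, so the least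
distance cannot grow under coarsening. This makes the weights nonnegative. -/
theorem blockDist_succ_le (a : ℕ) {D D' : ℕ} (h : 2 * D' ≤ D + 1) :
    blockDist (a + 1) D' ≤ blockDist a D := by
  unfold blockDist
  split_ifs with h1 h2
  · exact le_rfl
  · exact Nat.zero_le _
  · omega
  · rw [pow_succ, mul_assoc]
    have : 2 * (D' - 1) ≤ D - 1 := by omega
    gcongr

/-- Coarsening loses at most two fine blocks. This is what bounds a weight by a difference of p-th
powers with step two. -/
theorem le_blockDist_succ (a : ℕ) {D D' : ℕ} (h : D ≤ 2 * D' + 1) :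
    blockDist a (D - 2) ≤ blockDist (a + 1) D' := by
  unfold blockDist
  split_ifs with h1 h2
  · exact le_rfl
  · exact Nat.zero_le _
  · omega
  · rw [pow_succ, mul_assoc]
    have : D - 2 - 1 ≤ 2 * (D' - 1) := by omega
    gcongr

/-- The part of `|x - y| ^ p` that is lost between the block sizes `2 ^ a` and `2 ^ (a + 1)`, in terms
of the `2 ^ a`-blocks `u`, `v` of `x`, `y`. -/
noncomputable def weight (p : ℝ) (a : ℕ) (u v : ℤ) : ℝ :=
  (blockDist a (u - v).natAbs : ℝ) ^ p - (blockDist (a + 1) (u / 2 - v / 2).natAbs : ℝ) ^ p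

theorem half_dist (u v : ℤ) : 2 * (u / 2 - v / 2).natAbs ≤ (u - v).natAbs + 1 ∧
    (u - v).natAbs ≤ 2 * (u / 2 - v / 2).natAbs + 1 := by omega

theorem weight_nonneg {p : ℝ} (hp : 0 < p) (a : ℕ) (u v : ℤ) : 0 ≤ weight p a u v := by
  unfold weight
  rw [sub_nonneg]
  exact Real.rpow_le_rpow (by positivity)
    (by exact_mod_cast blockDist_succ_le a (half_dist u v).1) hp.le

theorem weight_le {p : ℝ} (hp : 0 < p) (a : ℕ) (u v : ℤ) : weight p a u v ≤
    (blockDist a (u - v).natAbs : ℝ) ^ p - (blockDist a ((u - v).natAbs - 2) : ℝ) ^ p := by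
  unfold weight
  gcongr
  exact le_blockDist_succ a (half_dist u v).2

/-- Even and odd indices telescope separately and leave the two last values. -/
theorem sum_step_two (g : ℕ → ℝ) (h0 : g 0 = 0) (n : ℕ) :
    ∑ D ∈ Finset.range (n + 1), (g D - g (D - 2)) = g n + g (n - 1) := by
  induction n with
  | zero => simp [h0]
  | succ n ih =>
    rw [Finset.sum_range_succ, ih]
    rcases n with _ | n
    · simp [h0]
    · have : n + 1 + 1 - 2 = n := by omega
      rw [this]; simp only [Nat.add_sub_cancel]; ring

/-- Folding a window. -/
theorem sum_window_le (f : ℕ → ℝ) (hf : ∀ D, 0 ≤ f D) (n : ℕ) :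
    ∑ k ∈ Finset.range (2 * (n + 1) - 1), f ((k : ℤ) - n).natAbs
      ≤ 2 * ∑ D ∈ Finset.range (n + 1), f D := by
  have e : 2 * (n + 1) - 1 = n + (n + 1) := by omega
  rw [e, Finset.sum_range_add, two_mul]
  refine add_le_add ?_ (le_of_eq ?_)
  · rw [← Finset.sum_range_reflect]
    calc _ = ∑ k ∈ Finset.range n, f (k + 1) := by
          refine Finset.sum_congr rfl fun k hk => ?_
          rw [Finset.mem_range] at hk
          congr 1; omega
      _ ≤ _ := by
          rw [Finset.sum_range_succ']
          linarith [hf 0]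
  · refine Finset.sum_congr rfl fun k _ => ?_
    congr 1; omega

/-- A weight depends on the distance D through at most g(D) - g(D - 2), where g is the p-th power of
the block distance. Each D occurs at most twice in the window, and the sum with step two leaves two
values of g, each at most (2^a N)^p. -/
theorem sum_weight_le {p : ℝ} (hp : 0 < p) (a N : ℕ) (hN : 1 ≤ N) (u : ℤ) :
    ∑ k ∈ Finset.range (2 * N - 1), weight p a u (u + ((k : ℤ) - (N - 1)))
      ≤ 4 * ((2 : ℝ) ^ a * N) ^ p := by
  obtain ⟨n, rfl⟩ := Nat.exists_eq_add_of_le' hN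
  set g : ℕ → ℝ := fun D => (blockDist a D : ℝ) ^ p with hg
  have g0 : g 0 = 0 := by simp [hg, blockDist, Real.zero_rpow hp.ne']
  have gle : ∀ D ≤ n + 1, g D ≤ ((2 : ℝ) ^ a * (n + 1 : ℕ)) ^ p := fun D hD => by
    refine Real.rpow_le_rpow (by positivity) ?_ hp.le
    have := (blockDist_le a D).trans (Nat.mul_le_mul_left (2 ^ a) hD)
    exact_mod_cast this
  calc _ ≤ ∑ k ∈ Finset.range (2 * (n + 1) - 1), (fun D => g D - g (D - 2)) ((k : ℤ) - n).natAbs := by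
        refine Finset.sum_le_sum fun k _ => ?_
        refine (weight_le hp a _ _).trans (le_of_eq ?_)
        have : (u - (u + ((k : ℤ) - (((n + 1 : ℕ) : ℤ) - 1)))).natAbs = ((k : ℤ) - n).natAbs := by omega
        rw [this]
    _ ≤ 2 * ∑ D ∈ Finset.range (n + 1), (g D - g (D - 2)) := by
        refine sum_window_le (fun D => g D - g (D - 2)) (fun D => ?_) n
        refine sub_nonneg.mpr (Real.rpow_le_rpow (by positivity) ?_ hp.le)
        exact_mod_cast blockDist_mono a (Nat.sub_le D 2)
    _ = 2 * (g n + g (n - 1)) := by rw [sum_step_two g g0]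
    _ ≤ _ := by linarith [gle n (by omega), gle (n - 1) (by omega)]

/-! ### The hash function -/

/-- Multiplication by `b / (4 N Λ)` on the circle, which is cut into `4 N` cells. -/
def cell (N Lam b : ℕ) (v : ℤ) : ℤ := (b * v) % (4 * N * Lam : ℕ) / (Lam : ℤ)

theorem cell_nonneg (N Lam b : ℕ) (hL : 0 < N * Lam) (v : ℤ) : 0 ≤ cell N Lam b v := by
  have : ((4 * N * Lam : ℕ) : ℤ) ≠ 0 := by
    have : 4 * N * Lam ≠ 0 := by rw [mul_assoc]; omega
    exact_mod_cast this
  exact Int.ediv_nonneg (Int.emod_nonneg _ this) (by positivity)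

theorem cell_lt (N Lam b : ℕ) (hN : 0 < N) (hL : 0 < Lam) (v : ℤ) : cell N Lam b v < 4 * N := by
  unfold cell
  refine Int.ediv_lt_of_lt_mul (by exact_mod_cast hL) ?_
  have := Int.emod_lt_of_pos (b * v) (b := ((4 * N * Lam : ℕ) : ℤ)) (by positivity)
  push_cast at this ⊢
  exact this

/-- Two points in one cell have residues modulo 4NΛ that differ by less than the cell length Λ. -/
theorem exists_of_cell_eq {N Lam b : ℕ} (hL : 0 < Lam) {v v' : ℤ}
    (h : cell N Lam b v = cell N Lam b v') :
    ∃ z : ℤ, |b * (v - v') - 4 * N * Lam * z| < Lam := by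
  unfold cell at h
  set Q : ℤ := ((4 * N * Lam : ℕ) : ℤ) with hQ
  have hL' : (0 : ℤ) < Lam := by exact_mod_cast hL
  have e1 := Int.emod_add_mul_ediv (b * v) Q
  have e2 := Int.emod_add_mul_ediv (b * v') Q
  have f1 := Int.emod_add_mul_ediv ((b * v) % Q) Lam
  have f2 := Int.emod_add_mul_ediv ((b * v') % Q) Lam
  have g1 := Int.emod_nonneg ((b * v) % Q) hL'.ne'
  have g2 := Int.emod_nonneg ((b * v') % Q) hL'.ne'
  have g3 := Int.emod_lt_of_pos ((b * v) % Q) hL'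
  have g4 := Int.emod_lt_of_pos ((b * v') % Q) hL'
  refine ⟨(b * v) / Q - (b * v') / Q, ?_⟩
  have hQ' : (4 * N * Lam : ℤ) = Q := by rw [hQ]; push_cast; rfl
  have : (b : ℤ) * (v - v') - 4 * N * Lam * ((b * v) / Q - (b * v') / Q)
      = (b * v) % Q % Lam - (b * v') % Q % Lam := by
    rw [hQ']
    rw [h] at f1
    linear_combination (-1 : ℤ) * e1 + e2 - f1 + f2
  rw [this, abs_lt]
  omega

/-- The multiplier is at least one cell length, so distinct symbols are moved apart by at least one
cell; it is below two cell lengths, so symbols at distance below 2N are not carried around the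
circle of 4N cells back into the same cell. This holds for every multiplier, not only with high
probability. -/
theorem cell_ne_of_near {N Lam b : ℕ} (hL : 0 < Lam) (hb : Lam ≤ b) (hb' : b < 2 * Lam) {v v' : ℤ}
    (hne : v ≠ v') (h : |v - v'| < 2 * N) : cell N Lam b v ≠ cell N Lam b v' := by
  intro he
  obtain ⟨z, hz⟩ := exists_of_cell_eq hL he
  have hL' : (1 : ℤ) ≤ Lam := by exact_mod_cast hL
  have hb1 : (Lam : ℤ) ≤ b := by exact_mod_cast hb
  have hb2 : (b : ℤ) + 1 ≤ 2 * Lam := by exact_mod_cast hb'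
  set D := v - v' with hD
  have hD0 : D ≠ 0 := sub_ne_zero.mpr hne
  rw [abs_lt] at hz h
  have hD1 : 1 ≤ |D| := Int.one_le_abs hD0
  -- The extreme product (2Λ - 1)(2N - 1) stays below 4NΛ by more than Λ, which excludes every
  -- nonzero z.
  have hup : (b : ℤ) * |D| ≤ (2 * Lam - 1) * (2 * N - 1) := by
    have hDN : |D| ≤ 2 * N - 1 := by have := abs_lt.mpr h; omega
    nlinarith [abs_nonneg D]
  have hlo : (Lam : ℤ) ≤ b * |D| := by nlinarith
  have hN1 : (1 : ℤ) ≤ N := by omega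
  have hz' : |(b : ℤ) * D - 4 * N * Lam * z| < Lam := abs_lt.mpr hz
  have hbD : |(b : ℤ) * D| = b * |D| := by rw [abs_mul, abs_of_nonneg (by omega : (0 : ℤ) ≤ b)]
  rcases eq_or_ne z 0 with rfl | hz0
  · rw [mul_zero, sub_zero, hbD] at hz'; omega
  · have hz1 : 1 ≤ |z| := Int.one_le_abs hz0
    have h1 : |4 * (N : ℤ) * Lam * z| ≤ |(b : ℤ) * D| + |(b : ℤ) * D - 4 * N * Lam * z| := by
      rw [abs_sub_comm]
      have := abs_add_le ((b : ℤ) * D) (4 * N * Lam * z - b * D)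
      rwa [add_sub_cancel] at this
    rw [hbD, abs_mul, abs_of_nonneg (by positivity : (0 : ℤ) ≤ 4 * N * Lam)] at h1
    have h2 : 4 * (N : ℤ) * Lam ≤ 4 * N * Lam * |z| := by nlinarith [mul_nonneg (by omega : (0:ℤ) ≤ N) (by omega : (0:ℤ) ≤ Lam)]
    nlinarith

/-- An interval of length `2 L / D` contains at most `2 L / D + 1` integers. -/
theorem card_close_le (D : ℤ) (hD : 0 < D) (L : ℕ) (y : ℤ) (s : Finset ℕ)
    (hs : ∀ k ∈ s, |(k : ℤ) * D - y| < L) : (s.card : ℤ) * D ≤ 2 * L + D := by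
  rcases s.eq_empty_or_nonempty with rfl | hne
  · simp only [Finset.card_empty, Nat.cast_zero, zero_mul]; positivity
  · set a := s.min' hne
    set b := s.max' hne
    have ha := abs_lt.mp (hs a (s.min'_mem hne))
    have hb := abs_lt.mp (hs b (s.max'_mem hne))
    have hsub : s ⊆ Finset.Icc a b := fun k hk =>
      Finset.mem_Icc.mpr ⟨s.min'_le k hk, s.le_max' k hk⟩
    have hab : a ≤ b := s.min'_le_max' hne
    have hc : (s.card : ℤ) ≤ b - a + 1 := by
      have := Finset.card_le_card hsub
      rw [Nat.card_Icc] at this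
      omega
    nlinarith

/-- Far symbols rarely collide. -/
theorem card_collision_le {N Lam : ℕ} (hN : 1 ≤ N) (D : ℤ) (hD : 2 * (N : ℤ) ≤ |D|)
    (hDL : 4 * |D| ≤ Lam) (s : Finset ℕ) (hs : ∀ k ∈ s, k < Lam ∧
      ∃ z : ℤ, |((Lam + k : ℕ) : ℤ) * D - 4 * N * Lam * z| < Lam) :
    N * s.card ≤ 4 * Lam := by
  wlog hpos : 0 < D generalizing D
  · have hD0 : 0 < |D| := by omega
    refine this (-D) (by rwa [abs_neg]) (by rwa [abs_neg]) (fun k hk => ?_) ?_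
    · obtain ⟨h1, z, hz⟩ := hs k hk
      refine ⟨h1, -z, ?_⟩
      rw [← abs_neg]
      convert hz using 2
      ring
    · rcases abs_pos.mp hD0 |>.lt_or_gt with h | h
      · omega
      · exact absurd h hpos
  rw [abs_of_pos hpos] at hD hDL
  have hL : (0 : ℤ) < Lam := by omega
  have hN' : (1 : ℤ) ≤ N := by exact_mod_cast hN
  choose! hk z hz using hs
  -- the values of `z`
  set q := D / (4 * N) with hq
  have hq1 : 4 * N * q ≤ D := by
    rw [hq]; exact Int.mul_ediv_self_le (by omega)
  have hq2 : D < 4 * N * (q + 1) := by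
    rw [hq]; have := Int.lt_ediv_add_one_mul_self D (by omega : (0 : ℤ) < 4 * N); linarith
  -- The multiplier lies between Λ and 2Λ, so the product divided by 4NΛ lies between D/(4N) and
  -- 2D/(4N). Only q + 3 multiples of the circumference can be met.
  have hzr : ∀ k ∈ s, z k ∈ Finset.Icc q (2 * q + 2) := by
    intro k hks
    have h1 := abs_lt.mp (hz k hks)
    have h2 : (k : ℤ) < Lam := by exact_mod_cast hk k hks
    push_cast at h1
    rw [Finset.mem_Icc]
    have hNL : 0 < 4 * (N : ℤ) * Lam := by positivity
    constructor
    · by_contra hc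
      have hc' : z k ≤ q - 1 := by omega
      have : 4 * (N : ℤ) * Lam * z k ≤ 4 * N * Lam * (q - 1) := by gcongr
      have h3 : (Lam : ℤ) * D ≤ (Lam + k) * D := by nlinarith
      have h4 : (Lam : ℤ) * (4 * N * q) ≤ Lam * D := by gcongr
      nlinarith
    · by_contra hc
      have hc' : 2 * q + 3 ≤ z k := by omega
      have : 4 * (N : ℤ) * Lam * (2 * q + 3) ≤ 4 * N * Lam * z k := by gcongr
      have h3 : ((Lam : ℤ) + k) * D ≤ 2 * Lam * D := by nlinarith
      have h4 : (Lam : ℤ) * D ≤ Lam * (4 * N * (q + 1)) := by gcongr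
      nlinarith
  -- The multipliers are sorted by the multiple they come close to; for each multiple
  -- `card_close_le` allows at most (2Λ + D)/D of them.
  have hcard : (s.card : ℤ) * D ≤ (q + 3) * (2 * Lam + D) := by
    rw [Finset.card_eq_sum_card_fiberwise hzr]
    push_cast
    rw [Finset.sum_mul]
    calc _ ≤ ∑ b ∈ Finset.Icc q (2 * q + 2), (2 * (Lam : ℤ) + D) := by
          refine Finset.sum_le_sum fun b _ => ?_
          refine card_close_le D hpos Lam (4 * N * Lam * b - Lam * D) _ fun k hk' => ?_
          rw [Finset.mem_filter] at hk'
          have := hz k hk'.1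
          rw [hk'.2] at this
          convert this using 2
          push_cast; ring
      _ = _ := by
          rw [Finset.sum_const, Int.card_Icc, nsmul_eq_mul]
          congr 1
          have : 0 ≤ q := Int.ediv_nonneg hpos.le (by omega)
          rw [Int.toNat_of_nonneg (by omega)]; ring
  -- The lower bound 2N ≤ D absorbs the summand 3. The upper bound 4D ≤ Λ is used at the end, where
  -- 7 (2Λ + D) becomes at most 16Λ.
  have h7 : 4 * N * (q + 3) ≤ 7 * D := by nlinarith
  have h8 : 4 * N * (s.card * D) ≤ 7 * D * (2 * Lam + D) := by
    calc 4 * (N : ℤ) * (s.card * D) ≤ 4 * N * ((q + 3) * (2 * Lam + D)) := by gcongr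
      _ = (4 * N * (q + 3)) * (2 * Lam + D) := by ring
      _ ≤ _ := by gcongr
  have h9 : (4 * N * s.card : ℤ) ≤ 7 * (2 * Lam + D) := by
    have : (4 * N * s.card : ℤ) * D ≤ 7 * (2 * Lam + D) * D := by linarith
    exact le_of_mul_le_mul_right this hpos
  rw [mul_assoc] at h9
  have : (N * s.card : ℤ) ≤ 4 * Lam := by omega
  exact_mod_cast this

/-! ### Estimating one pair of symbols -/

/-- The contribution of level `a`. -/
noncomputable def estLevel (p : ℝ) (N Lam b a : ℕ) (u v : ℤ) : ℝ :=
  ∑ k ∈ Finset.range (2 * N - 1),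
    if cell N Lam b (u + ((k : ℤ) - (N - 1))) = cell N Lam b v
    then weight p a u (u + ((k : ℤ) - (N - 1))) else 0

/-- The estimate of `|x - y| ^ p`. -/
noncomputable def est (p : ℝ) (N Lam b A x y : ℕ) : ℝ :=
  ∑ a ∈ Finset.range A, estLevel p N Lam b a ((x / 2 ^ a : ℕ) : ℤ) ((y / 2 ^ a : ℕ) : ℤ)

theorem estLevel_nonneg {p : ℝ} (hp : 0 < p) (N Lam b a : ℕ) (u v : ℤ) :
    0 ≤ estLevel p N Lam b a u v := by
  unfold estLevel
  refine Finset.sum_nonneg fun k _ => ?_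
  split_ifs
  · exact weight_nonneg hp _ _ _
  · exact le_rfl

/-- All symbols in the window around u are at distance below 2N from v if v is in the window itself.
None of them except v shares the cell of v, so exactly one summand survives. -/
theorem estLevel_near {p : ℝ} {N Lam b a : ℕ} (hL : 0 < Lam) (hb : Lam ≤ b) (hb' : b < 2 * Lam)
    {u v : ℤ} (h : (u - v).natAbs < N) : estLevel p N Lam b a u v = weight p a u v := by
  unfold estLevel
  have hN : 1 ≤ N := by omega
  -- This is the index at which the window contains v; it is nonnegative and in range because v is
  -- less than N away from u.
  rw [Finset.sum_eq_single (v - u + (N - 1)).toNat]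
  · have : u + (((v - u + (N - 1)).toNat : ℤ) - (N - 1)) = v := by
      rw [Int.toNat_of_nonneg (by omega)]; ring
    rw [this, if_pos rfl]
  · intro k hk hne
    rw [Finset.mem_range] at hk
    rw [if_neg]
    refine cell_ne_of_near hL hb hb' (by omega) ?_
    rw [abs_lt]; omega
  · intro hnot
    exfalso; apply hnot
    rw [Finset.mem_range]; omega

/-- The sum telescopes, and the term at scale A vanishes because both symbols lie in block 0 there.
-/
theorem weight_sum (p : ℝ) (hp : 0 < p) (x y : ℕ) (s A : ℕ) (hs : s ≤ A) (hx : x < 2 ^ A)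
    (hy : y < 2 ^ A) :
    ∑ a ∈ Finset.Ico s A, weight p a ((x / 2 ^ a : ℕ) : ℤ) ((y / 2 ^ a : ℕ) : ℤ)
      = (blockDist s (((x / 2 ^ s : ℕ) : ℤ) - ((y / 2 ^ s : ℕ) : ℤ)).natAbs : ℝ) ^ p := by
  set f : ℕ → ℝ := fun a =>
    -(blockDist a (((x / 2 ^ a : ℕ) : ℤ) - ((y / 2 ^ a : ℕ) : ℤ)).natAbs : ℝ) ^ p with hf
  have h1 : ∀ a, weight p a ((x / 2 ^ a : ℕ) : ℤ) ((y / 2 ^ a : ℕ) : ℤ) = f (a + 1) - f a := by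
    intro a
    have e : ∀ t : ℕ, ((t / 2 ^ a : ℕ) : ℤ) / 2 = ((t / 2 ^ (a + 1) : ℕ) : ℤ) := fun t => by
      rw [pow_succ, ← Nat.div_div_eq_div_mul]; push_cast; rfl
    simp only [hf, weight, e]; ring
  rw [Finset.sum_congr rfl fun a _ => h1 a, Finset.sum_Ico_sub _ hs]
  simp only [hf, Nat.div_eq_of_lt hx, Nat.div_eq_of_lt hy]
  simp [blockDist, Real.zero_rpow hp.ne']

theorem abs_sub_eq_natAbs (x y : ℕ) : |(x : ℝ) - y| = ((((x : ℤ) - y).natAbs : ℕ) : ℝ) := by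
  rw [Nat.cast_natAbs]; push_cast; rfl

/-- The positions of x and y inside their blocks are unknown, which costs less than one block length
on either side. -/
theorem dist_bounds (x y a : ℕ) :
    ((x : ℤ) - y).natAbs ≤ blockDist a (((x / 2 ^ a : ℕ) : ℤ) - ((y / 2 ^ a : ℕ) : ℤ)).natAbs
      + 2 * 2 ^ a ∧
    blockDist a (((x / 2 ^ a : ℕ) : ℤ) - ((y / 2 ^ a : ℕ) : ℤ)).natAbs ≤ ((x : ℤ) - y).natAbs := by
  have h1 := Nat.div_add_mod x (2 ^ a)
  have h2 := Nat.div_add_mod y (2 ^ a)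
  have h3 := Nat.mod_lt x (Nat.two_pow_pos a)
  have h4 := Nat.mod_lt y (Nat.two_pow_pos a)
  generalize x / 2 ^ a = u at *
  generalize y / 2 ^ a = v at *
  generalize x % 2 ^ a = r at *
  generalize y % 2 ^ a = r' at *
  wlog huv : v ≤ u generalizing x y u v r r'
  · have := this y x v u r' h4 h2 r h3 h1 (by omega)
    rw [← Int.natAbs_neg, neg_sub, ← Int.natAbs_neg ((u : ℤ) - v), neg_sub]
    exact this
  set P := 2 ^ a
  obtain ⟨D, rfl⟩ := Nat.exists_eq_add_of_le huv
  have e : (((v + D : ℕ) : ℤ) - (v : ℤ)).natAbs = D := by omega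
  rw [e]
  unfold blockDist
  rw [mul_add] at h1
  split_ifs with hD
  · subst hD; rw [mul_zero] at h1; omega
  · obtain ⟨E, rfl⟩ := Nat.exists_eq_succ_of_ne_zero hD
    have : P * (E + 1) = P * E + P := by ring
    simp only [Nat.succ_eq_add_one, Nat.add_sub_cancel] at *
    change _ ≤ P * E + 1 + 2 * P ∧ P * E + 1 ≤ _
    omega

/-- A far pair at level `a` is at distance at least `2 ^ a * N / 2`. -/
theorem far_dist {N : ℕ} (hN : 2 ≤ N) {x y a : ℕ}
    (h : N ≤ (((x / 2 ^ a : ℕ) : ℤ) - ((y / 2 ^ a : ℕ) : ℤ)).natAbs) :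
    2 ^ a * N ≤ 2 * ((x : ℤ) - y).natAbs := by
  have h1 := (blockDist_mono a h).trans (dist_bounds x y a).2
  unfold blockDist at h1
  rw [if_neg (by omega)] at h1
  obtain ⟨n, rfl⟩ := Nat.exists_eq_add_of_le hN
  have e : 2 + n - 1 = 1 + n := by omega
  rw [e] at h1
  have := Nat.zero_le (2 ^ a * n)
  nlinarith

/-- The scales at which the pair is near contribute exactly, and together they give the block
distance at the first such scale. All other scales contribute something nonnegative, so the bound
holds for every multiplier. -/
theorem le_est {p : ℝ} (hp : 0 < p) (hp1 : p ≤ 1) {N Lam b A x y : ℕ} (hN : 2 ≤ N) (hL : 0 < Lam)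
    (hb : Lam ≤ b) (hb' : b < 2 * Lam) (hx : x < 2 ^ A) (hy : y < 2 ^ A) :
    (1 - 8 / N) * |(x : ℝ) - y| ^ p ≤ est p N Lam b A x y := by
  set D : ℕ → ℕ := fun a => (((x / 2 ^ a : ℕ) : ℤ) - ((y / 2 ^ a : ℕ) : ℤ)).natAbs with hD
  have hDA : D A = 0 := by simp only [hD, Nat.div_eq_of_lt hx, Nat.div_eq_of_lt hy]; simp
  have hex : ∃ a, D a < N := ⟨A, by omega⟩
  classical
  -- The first scale at which the pair is near; it is at most A, where both blocks are 0.
  set s := Nat.find hex with hs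
  have hsN : D s < N := Nat.find_spec hex
  have hsA : s ≤ A := Nat.find_min' hex (by omega)
  -- Near pairs stay near under coarsening, because halving maps a distance D to at most (D + 1)/2.
  have hanti : ∀ a, s ≤ a → D a < N := by
    intro a ha
    induction a, ha using Nat.le_induction with
    | base => exact hsN
    | succ a _ ih =>
      have e : ∀ t : ℕ, ((t / 2 ^ (a + 1) : ℕ) : ℤ) = ((t / 2 ^ a : ℕ) : ℤ) / 2 := fun t => by
        rw [pow_succ, ← Nat.div_div_eq_div_mul]; push_cast; rfl
      have := half_dist ((x / 2 ^ a : ℕ) : ℤ) ((y / 2 ^ a : ℕ) : ℤ)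
      simp only [hD, e] at ih ⊢
      omega
  have h1 : (blockDist s (D s) : ℝ) ^ p ≤ est p N Lam b A x y := by
    rw [← weight_sum p hp x y s A hsA hx hy]
    unfold est
    rw [Finset.range_eq_Ico, ← Finset.sum_Ico_consecutive _ (Nat.zero_le s) hsA]
    have h2 : 0 ≤ ∑ a ∈ Finset.Ico 0 s,
        estLevel p N Lam b a ((x / 2 ^ a : ℕ) : ℤ) ((y / 2 ^ a : ℕ) : ℤ) :=
      Finset.sum_nonneg fun a _ => estLevel_nonneg hp _ _ _ _ _ _
    have h3 : ∑ a ∈ Finset.Ico s A, estLevel p N Lam b a ((x / 2 ^ a : ℕ) : ℤ) ((y / 2 ^ a : ℕ) : ℤ)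
        = ∑ a ∈ Finset.Ico s A, weight p a ((x / 2 ^ a : ℕ) : ℤ) ((y / 2 ^ a : ℕ) : ℤ) :=
      Finset.sum_congr rfl fun a ha =>
        estLevel_near hL hb hb' (hanti a (Finset.mem_Ico.mp ha).1)
    linarith
  refine le_trans ?_ h1
  rw [abs_sub_eq_natAbs]
  set d := ((x : ℤ) - y).natAbs with hd
  have hN0 : (0 : ℝ) < N := by positivity
  rcases Nat.eq_zero_or_pos s with h0 | h0
  -- At scale 0 the block distance is the distance itself, so nothing is lost.
  · have e : blockDist s (D s) = d := by
      rw [h0]; simp only [hD, pow_zero, Nat.div_one, blockDist, one_mul]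
      split_ifs with hh
      · exact hh.symm
      · omega
    rw [e]
    have : 0 ≤ (d : ℝ) ^ p := by positivity
    have h8 : (0 : ℝ) ≤ 8 / N := by positivity
    nlinarith
  · have hprev : ¬ D (s - 1) < N := Nat.find_min hex (by omega)
    have hfar := far_dist hN (not_lt.mp hprev)
    have hpow : (2 : ℕ) ^ s = 2 * 2 ^ (s - 1) := by
      rw [← pow_succ']; congr 1; omega
    have hdb := (dist_bounds x y s).1
    have hdpos : 0 < d := by
      have : 0 < 2 ^ (s - 1) * N := by positivity
      omega
    rcases le_or_gt (1 - 8 / (N : ℝ)) 0 with hneg | hposi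
    · have : 0 ≤ (d : ℝ) ^ p := by positivity
      have h2 : 0 ≤ (blockDist s (D s) : ℝ) ^ p := by positivity
      nlinarith
    -- Scale s - 1 is far, so 2^(s-1) N ≤ 2d. The possible loss 2 · 2^s of the block distance is
    -- therefore at most 8d/N.
    · have hle : (1 - 8 / (N : ℝ)) * d ≤ blockDist s (D s) := by
        have f1 : (2 * 2 ^ s : ℝ) * N ≤ 8 * d := by
          have : 2 * 2 ^ s * N ≤ 8 * d := by rw [hpow]; nlinarith
          exact_mod_cast this
        have f2 : (d : ℝ) ≤ blockDist s (D s) + 2 * 2 ^ s := by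
          calc (d : ℝ) ≤ ((blockDist s (D s) + 2 * 2 ^ s : ℕ) : ℝ) := Nat.cast_le.mpr hdb
            _ = _ := by push_cast; ring
        have f3 : (2 * 2 ^ s : ℝ) ≤ 8 / N * d := by
          rw [div_mul_eq_mul_div, le_div_iff₀ hN0]; exact f1
        linarith
      -- Here p ≤ 1 enters: t ≤ t^p for t in [0, 1].
      calc (1 - 8 / (N : ℝ)) * (d : ℝ) ^ p ≤ (1 - 8 / (N : ℝ)) ^ p * (d : ℝ) ^ p := by
            gcongr
            refine Real.self_le_rpow_of_le_one hposi.le ?_ hp1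
            have : (0 : ℝ) ≤ 8 / N := by positivity
            linarith
        _ = ((1 - 8 / (N : ℝ)) * d) ^ p := (Real.mul_rpow hposi.le (by positivity)).symm
        _ ≤ _ := Real.rpow_le_rpow (by positivity) hle hp.le

/-- The part of the estimate that comes from levels at which the pair is far. -/
noncomputable def farPart (p : ℝ) (N Lam b A x y : ℕ) : ℝ :=
  ∑ a ∈ Finset.range A,
    if (((x / 2 ^ a : ℕ) : ℤ) - ((y / 2 ^ a : ℕ) : ℤ)).natAbs < N then 0
    else estLevel p N Lam b a ((x / 2 ^ a : ℕ) : ℤ) ((y / 2 ^ a : ℕ) : ℤ)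

theorem farPart_nonneg {p : ℝ} (hp : 0 < p) (N Lam b A x y : ℕ) : 0 ≤ farPart p N Lam b A x y := by
  refine Finset.sum_nonneg fun a _ => ?_
  split_ifs
  · exact le_rfl
  · exact estLevel_nonneg hp _ _ _ _ _ _

/-- At near scales the estimate is the weight, and the weights over all scales sum to |x - y|^p. The
excess therefore comes only from far scales. -/
theorem est_le {p : ℝ} (hp : 0 < p) {N Lam b A x y : ℕ} (hL : 0 < Lam)
    (hb : Lam ≤ b) (hb' : b < 2 * Lam) (hx : x < 2 ^ A) (hy : y < 2 ^ A) :
    est p N Lam b A x y ≤ |(x : ℝ) - y| ^ p + farPart p N Lam b A x y := by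
  have h0 := weight_sum p hp x y 0 A (Nat.zero_le _) hx hy
  have e : blockDist 0 (((x / 2 ^ 0 : ℕ) : ℤ) - ((y / 2 ^ 0 : ℕ) : ℤ)).natAbs
      = ((x : ℤ) - y).natAbs := by
    simp only [pow_zero, Nat.div_one, blockDist, one_mul]
    split_ifs with hh
    · exact hh.symm
    · omega
  rw [e, ← abs_sub_eq_natAbs, ← Finset.range_eq_Ico] at h0
  rw [← h0]
  unfold est farPart
  rw [← Finset.sum_add_distrib]
  refine Finset.sum_le_sum fun a _ => ?_
  split_ifs with h
  · rw [estLevel_near hL hb hb' h, add_zero]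
  · linarith [weight_nonneg hp a ((x / 2 ^ a : ℕ) : ℤ) ((y / 2 ^ a : ℕ) : ℤ)]

/-- Summed over all Λ multipliers, a symbol v' of the window around u contributes its weight times
the number of multipliers for which it collides with v. That number is at most 4Λ/N, the weights sum
to at most 4 (2^a N)^p, and 2^a N ≤ 2 |x - y| because the pair is far. -/
theorem sum_estLevel_far_le {p : ℝ} (hp : 0 < p) (hp1 : p ≤ 1) {N Lam A a x y : ℕ} (hN : 2 ≤ N)
    (hLam : 8 * 2 ^ A * N ≤ Lam) (hx : x < 2 ^ A) (hy : y < 2 ^ A)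
    (hfar : N ≤ (((x / 2 ^ a : ℕ) : ℤ) - ((y / 2 ^ a : ℕ) : ℤ)).natAbs) :
    ∑ k ∈ Finset.range Lam,
      estLevel p N Lam (Lam + k) a ((x / 2 ^ a : ℕ) : ℤ) ((y / 2 ^ a : ℕ) : ℤ)
      ≤ 32 / N * |(x : ℝ) - y| ^ p * Lam := by
  have hux : x / 2 ^ a ≤ x := Nat.div_le_self _ _
  have hvy : y / 2 ^ a ≤ y := Nat.div_le_self _ _
  have hfd := far_dist hN hfar
  set u : ℤ := ((x / 2 ^ a : ℕ) : ℤ) with hu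
  set v : ℤ := ((y / 2 ^ a : ℕ) : ℤ) with hv
  have hu0 : 0 ≤ u ∧ u < ((2 ^ A : ℕ) : ℤ) :=
    ⟨Int.natCast_nonneg _, by rw [hu]; exact_mod_cast hux.trans_lt hx⟩
  have hv0 : 0 ≤ v ∧ v < ((2 ^ A : ℕ) : ℤ) :=
    ⟨Int.natCast_nonneg _, by rw [hv]; exact_mod_cast hvy.trans_lt hy⟩
  clear_value u v
  have hN0 : (0 : ℝ) < N := by positivity
  have hLam0 : 0 < Lam := lt_of_lt_of_le (by positivity) hLam
  have hAN : 2 ^ A + N ≤ 2 * (2 ^ A * N) := by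
    have := Nat.one_le_two_pow (n := A)
    nlinarith
  unfold estLevel
  rw [Finset.sum_comm]
  calc _ ≤ ∑ k ∈ Finset.range (2 * N - 1),
        weight p a u (u + ((k : ℤ) - (N - 1))) * (4 * Lam / N) := by
        refine Finset.sum_le_sum fun k hk => ?_
        rw [Finset.mem_range] at hk
        rw [← Finset.sum_filter, Finset.sum_const, nsmul_eq_mul, mul_comm]
        refine mul_le_mul_of_nonneg_left ?_ (weight_nonneg hp _ _ _)
        rw [le_div_iff₀ hN0, mul_comm]
        set v' := u + ((k : ℤ) - (N - 1)) with hv'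
        -- A symbol of the window may be close to v although u is far from v. It still differs from
        -- v, since v lies outside the window, so it never collides; only for distances of at least
        -- 2N is the collision bound needed.
        by_cases hnear : |v' - v| < 2 * N
        · rw [Finset.filter_false_of_mem]
          · simp
          · intro c hc
            rw [Finset.mem_range] at hc
            exact cell_ne_of_near hLam0 (by omega) (by omega) (by omega) hnear
        · have := card_collision_le (N := N) (Lam := Lam) (by omega) (v' - v) (not_lt.mp hnear)
            (by
              have h1 : |v' - v| ≤ 2 ^ A + N := by
                have : ((2 ^ A : ℕ) : ℤ) = 2 ^ A := by push_cast; rfl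
                rw [abs_le]; omega
              have h2 : (2 ^ A + N : ℤ) ≤ 2 * (2 ^ A * N) := by exact_mod_cast hAN
              have h3 : (8 * 2 ^ A * N : ℤ) ≤ Lam := by exact_mod_cast hLam
              nlinarith)
            (Finset.filter (fun c => cell N Lam (Lam + c) v' = cell N Lam (Lam + c) v)
              (Finset.range Lam))
            (fun c hc => by
              rw [Finset.mem_filter, Finset.mem_range] at hc
              exact ⟨hc.1, exists_of_cell_eq hLam0 hc.2⟩)
          exact_mod_cast this
    _ = (∑ k ∈ Finset.range (2 * N - 1), weight p a u (u + ((k : ℤ) - (N - 1)))) * (4 * Lam / N) := by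
        rw [Finset.sum_mul]
    _ ≤ 4 * ((2 : ℝ) ^ a * N) ^ p * (4 * Lam / N) := by
        gcongr
        exact sum_weight_le hp a N (by omega) u
    _ ≤ 4 * (2 * |(x : ℝ) - y| ^ p) * (4 * Lam / N) := by
        gcongr
        rw [abs_sub_eq_natAbs]
        -- Since p ≤ 1, the factor 2 leaves the power as 2^p ≤ 2.
        calc ((2 : ℝ) ^ a * N) ^ p ≤ (2 * (((x : ℤ) - y).natAbs : ℝ)) ^ p := by
              refine Real.rpow_le_rpow (by positivity) ?_ hp.le
              exact_mod_cast hfd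
          _ = 2 ^ p * (((x : ℤ) - y).natAbs : ℝ) ^ p := Real.mul_rpow (by norm_num) (by positivity)
          _ ≤ 2 * (((x : ℤ) - y).natAbs : ℝ) ^ p := by
              gcongr
              calc (2 : ℝ) ^ p ≤ 2 ^ (1 : ℝ) := Real.rpow_le_rpow_of_exponent_le (by norm_num) hp1
                _ = 2 := Real.rpow_one 2
    _ = _ := by ring

theorem sum_farPart_le {p : ℝ} (hp : 0 < p) (hp1 : p ≤ 1) {N Lam A x y : ℕ} (hN : 2 ≤ N)
    (hLam : 8 * 2 ^ A * N ≤ Lam) (hx : x < 2 ^ A) (hy : y < 2 ^ A) :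
    ∑ k ∈ Finset.range Lam, farPart p N Lam (Lam + k) A x y
      ≤ 32 * A / N * |(x : ℝ) - y| ^ p * Lam := by
  unfold farPart
  rw [Finset.sum_comm]
  calc _ ≤ ∑ a ∈ Finset.range A, 32 / N * |(x : ℝ) - y| ^ p * Lam := by
        refine Finset.sum_le_sum fun a _ => ?_
        split_ifs with h
        · simp only [Finset.sum_const_zero]; positivity
        · exact sum_estLevel_far_le hp hp1 hN hLam hx hy (not_lt.mp h)
    _ = _ := by rw [Finset.sum_const, Finset.card_range, nsmul_eq_mul]; ring

/-- Markov's inequality for a whole window: at most half of the hash functions are bad. -/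
theorem card_bad_le {p : ℝ} (hp : 0 < p) (hp1 : p ≤ 1) {N Lam A m : ℕ} (hN : 2 ≤ N)
    (hLam : 8 * 2 ^ A * N ≤ Lam) (X Y : Fin m → ℕ) (hX : ∀ j, X j < 2 ^ A) (hY : ∀ j, Y j < 2 ^ A) :
    2 * ((Finset.range Lam).filter fun k => (1 + 64 * A / N) * ∑ j, |(X j : ℝ) - Y j| ^ p <
      ∑ j, est p N Lam (Lam + k) A (X j) (Y j)).card ≤ Lam := by
  set S := ∑ j, |(X j : ℝ) - Y j| ^ p with hS
  set bad := (Finset.range Lam).filter fun k => (1 + 64 * A / N) * S <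
      ∑ j, est p N Lam (Lam + k) A (X j) (Y j) with hbad
  have hLam0 : 0 < Lam := lt_of_lt_of_le (by positivity) hLam
  have hN0 : (0 : ℝ) < N := by positivity
  have hS0 : 0 ≤ S := Finset.sum_nonneg fun j _ => by positivity
  set F : ℕ → ℝ := fun k => ∑ j, farPart p N Lam (Lam + k) A (X j) (Y j) with hF
  have hF0 : ∀ k, 0 ≤ F k := fun k => Finset.sum_nonneg fun j _ => farPart_nonneg hp _ _ _ _ _ _
  have hbadF : ∀ k ∈ bad, 64 * A / N * S < F k := by
    intro k hk
    rw [hbad, Finset.mem_filter, Finset.mem_range] at hk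
    have : ∑ j, est p N Lam (Lam + k) A (X j) (Y j) ≤ S + F k := by
      rw [hS, hF, ← Finset.sum_add_distrib]
      exact Finset.sum_le_sum fun j _ => est_le hp hLam0 (by omega) (by omega) (hX j) (hY j)
    linarith [hk.2]
  have htot : ∑ k ∈ Finset.range Lam, F k ≤ 32 * A / N * S * Lam := by
    rw [hF, Finset.sum_comm, hS, Finset.mul_sum, Finset.sum_mul]
    exact Finset.sum_le_sum fun j _ => sum_farPart_le hp hp1 hN hLam (hX j) (hY j)
  have hsub : ∑ k ∈ bad, F k ≤ ∑ k ∈ Finset.range Lam, F k :=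
    Finset.sum_le_sum_of_subset_of_nonneg (Finset.filter_subset _ _) fun k _ _ => hF0 k
  rcases (bad.eq_empty_or_nonempty) with h0 | hne
  · rw [h0]; simp
  have hlow : (bad.card : ℝ) * (64 * A / N * S) < ∑ k ∈ bad, F k := by
    rw [← nsmul_eq_mul]
    calc _ = ∑ k ∈ bad, (64 * A / N * S) := by rw [Finset.sum_const]
      _ < _ := Finset.sum_lt_sum_of_nonempty hne hbadF
  have hc0 : 0 ≤ 32 * A / N * S := by positivity
  -- The inequality is strict because some multiplier is bad, so the common factor can be cancelled
  -- although it might only be known to be nonnegative.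
  have hkey : (2 * (bad.card : ℝ)) * (32 * A / N * S) < Lam * (32 * A / N * S) := by
    calc _ = (bad.card : ℝ) * (64 * A / N * S) := by ring
      _ < 32 * A / N * S * Lam := by linarith
      _ = _ := by ring
  have := lt_of_mul_lt_mul_right hkey hc0
  exact_mod_cast this.le

/-! ### The fast Fourier transform -/

/-- Bit reversed fractions: `phase n` is `n % 2` plus half of `phase (n / 2)`. -/
noncomputable def phase (n : ℕ) : ℝ :=
  if n = 0 then 0 else phase (n / 2) / 2 + (n % 2 : ℕ)
termination_by n
decreasing_by omega

theorem phase_eq (n : ℕ) : phase n = phase (n / 2) / 2 + (n % 2 : ℕ) := by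
  rcases eq_or_ne n 0 with rfl | h
  · simp [phase]
  · conv_lhs => rw [phase]
    rw [if_neg h]

theorem phase_zero : phase 0 = 0 := by simp [phase]

/-- Setting bit k adds 2^(-k), since `phase` reads the binary digits in reversed order behind the
point. -/
theorem phase_add_pow (k : ℕ) : ∀ b < 2 ^ k, phase (b + 2 ^ k) = phase b + 1 / 2 ^ k := by
  induction k with
  | zero =>
    intro b hb
    have : b = 0 := by simpa using hb
    subst this
    rw [phase_eq]; simp [phase_zero]
  | succ k ih =>
    intro b hb
    have h1 : (b + 2 ^ (k + 1)) / 2 = b / 2 + 2 ^ k := by rw [pow_succ]; omega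
    have h2 : (b + 2 ^ (k + 1)) % 2 = b % 2 := by rw [pow_succ]; omega
    rw [phase_eq, h1, h2, ih _ (by rw [pow_succ] at hb; omega), phase_eq b, pow_succ]
    ring

/-- Roots of unity in bit reversed order. -/
noncomputable def root (n : ℕ) : ℂ := Complex.exp ((Real.pi * phase n : ℝ) * Complex.I)

theorem norm_root (n : ℕ) : ‖root n‖ = 1 := Complex.norm_exp_ofReal_mul_I _

theorem root_zero : root 0 = 1 := by simp [root, phase_zero]

/-- Doubling the phase shifts its digits by one place; the lowest bit of n then contributes a full
turn and disappears. -/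
theorem root_sq (n : ℕ) : root n ^ 2 = root (n / 2) := by
  unfold root
  rw [← Complex.exp_nat_mul, phase_eq n]
  rcases Nat.mod_two_eq_zero_or_one n with h | h <;> rw [h]
  · congr 1; push_cast; ring
  · rw [← Complex.exp_periodic.sub_eq]
    congr 1; push_cast; ring

/-- Adjacent indices are the two square roots of the same number. This is what lets the transform
run in place of any bit reversal of the data. -/
theorem root_odd (n : ℕ) : root (2 * n + 1) = -root (2 * n) := by
  unfold root
  rw [phase_eq (2 * n + 1), phase_eq (2 * n)]
  have h1 : (2 * n + 1) / 2 = n := by omega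
  have h2 : (2 * n + 1) % 2 = 1 := by omega
  have h3 : (2 * n) / 2 = n := by omega
  have h4 : (2 * n) % 2 = 0 := by omega
  rw [h1, h2, h3, h4]
  have : ((Real.pi * (phase n / 2 + (1 : ℕ)) : ℝ) : ℂ) * Complex.I
      = (Real.pi * (phase n / 2 + (0 : ℕ)) : ℝ) * Complex.I + Real.pi * Complex.I := by
    push_cast; ring
  rw [this, Complex.exp_add, Complex.exp_pi_mul_I]; ring

theorem root_add_pow (k b : ℕ) (hb : b < 2 ^ k) :
    root (b + 2 ^ k) = root b * Complex.exp ((Real.pi / 2 ^ k : ℝ) * Complex.I) := by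
  unfold root
  rw [phase_add_pow k b hb, ← Complex.exp_add]
  congr 1; push_cast; ring

theorem root_pow (k n : ℕ) : root n ^ 2 ^ k = root (n / 2 ^ k) := by
  induction k generalizing n with
  | zero => simp
  | succ k ih =>
    rw [pow_succ', pow_mul, root_sq, ih, Nat.div_div_eq_div_mul]

/-- The array after some stages of the transform: the blocks have length `h`, and there are `B`. -/
noncomputable def fftCur (a : ℕ → ℂ) (h B x : ℕ) : ℂ :=
  ∑ q ∈ Finset.range B, a (x % h + q * h) * root (x / h) ^ q

theorem fftCur_first (a : ℕ → ℂ) (L x : ℕ) (hx : x < L) : fftCur a L 1 x = a x := by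
  simp [fftCur, Nat.mod_eq_of_lt hx]

theorem fftCur_last (a : ℕ → ℂ) (L x : ℕ) :
    fftCur a 1 L x = ∑ q ∈ Finset.range L, a q * root x ^ q := by
  simp [fftCur, Nat.mod_one]

theorem sum_range_two_mul (f : ℕ → ℂ) (B : ℕ) : ∑ q ∈ Finset.range (2 * B), f q
    = ∑ q ∈ Finset.range B, f (2 * q) + ∑ q ∈ Finset.range B, f (2 * q + 1) := by
  induction B with
  | zero => simp
  | succ B ih =>
    rw [mul_add, mul_one, Finset.sum_range_succ, Finset.sum_range_succ, ih, Finset.sum_range_succ,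
      Finset.sum_range_succ]
    ring

/-- The first index of the butterfly that produces entry `x`. -/
def lowIdx (h x : ℕ) : ℕ := x - x / h % 2 * h

/-- Block o of length h is one half of block o / 2 of length 2h. The low index has the same offset
in the first half of that parent block, and its partner is h further on. -/
theorem lowIdx_facts {h : ℕ} (hh : 0 < h) (x : ℕ) :
    x / h % 2 * h ≤ x ∧
    lowIdx h x / (2 * h) = x / h / 2 ∧ lowIdx h x % (2 * h) = x % h ∧
    (lowIdx h x + h) / (2 * h) = x / h / 2 ∧ (lowIdx h x + h) % (2 * h) = x % h + h := by
  have h1 := Nat.div_add_mod x h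
  have h2 := Nat.mod_lt x hh
  set o := x / h
  set r := x % h
  have h3 := Nat.div_add_mod o 2
  have hle : o % 2 * h ≤ x := by
    have : o % 2 * h ≤ h * o := by rw [mul_comm]; exact Nat.mul_le_mul_left _ (Nat.mod_le _ _)
    omega
  have e1 : lowIdx h x = 2 * h * (o / 2) + r := by
    change x - o % 2 * h = _
    have : h * o = 2 * h * (o / 2) + o % 2 * h := by
      conv_lhs => rw [← h3]
      ring
    omega
  refine ⟨hle, ?_, ?_, ?_, ?_⟩
  · rw [e1, Nat.mul_add_div (by omega), Nat.div_eq_of_lt (show r < 2 * h by omega), add_zero]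
  · rw [e1, Nat.mul_add_mod, Nat.mod_eq_of_lt (show r < 2 * h by omega)]
  · rw [e1, add_assoc, Nat.mul_add_div (by omega), Nat.div_eq_of_lt (show r + h < 2 * h by omega),
      add_zero]
  · rw [e1, add_assoc, Nat.mul_add_mod, Nat.mod_eq_of_lt (show r + h < 2 * h by omega)]

theorem lowIdx_lt {h B x : ℕ} (hh : 0 < h) (hx : x < 2 * h * B) : lowIdx h x + h < 2 * h * B := by
  obtain ⟨-, -, -, h4, -⟩ := lowIdx_facts hh x
  have h5 : x / h / 2 < B := by
    rw [Nat.div_div_eq_div_mul, mul_comm h 2]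
    exact Nat.div_lt_of_lt_mul hx
  rw [← h4] at h5
  exact Nat.lt_mul_of_div_lt h5 (by omega) |>.trans_eq (by ring)

/-- Block o of length h holds the coefficients of the remainder of the polynomial modulo X^h -
root(o). Since root(o)^2 = root(o / 2), the modulus X^(2h) - root(o / 2) of the parent splits into
X^h - root(o) and X^h + root(o), and reducing a remainder further replaces X^h by root(o). -/
theorem fftCur_stage (a : ℕ → ℂ) {h : ℕ} (hh : 0 < h) (B x : ℕ) :
    fftCur a h (2 * B) x
      = fftCur a (2 * h) B (lowIdx h x) + root (x / h) * fftCur a (2 * h) B (lowIdx h x + h) := by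
  obtain ⟨-, h1, h2, h3, h4⟩ := lowIdx_facts hh x
  unfold fftCur
  rw [h1, h2, h3, h4, sum_range_two_mul, Finset.mul_sum]
  congr 1
  · refine Finset.sum_congr rfl fun q _ => ?_
    rw [pow_mul, root_sq]; congr 2; ring
  · refine Finset.sum_congr rfl fun q _ => ?_
    rw [pow_succ, pow_mul, root_sq]
    have : x % h + (2 * q + 1) * h = x % h + h + q * (2 * h) := by ring
    rw [this]; ring

-- The two children of a block hold u + r v and u - r v. Their sum is 2u and their difference is 2 r
-- v, and r has modulus one, so it is removed by its conjugate. Both cases are put into one formula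
-- through the parity of the block: an even block uses the multiplier root(0) = 1 and the sign +1,
-- an odd block its own root and the sign -1.
open ComplexConjugate in
theorem fftCur_unstage (a : ℕ → ℂ) {h : ℕ} (hh : 0 < h) (B x : ℕ) :
    2 * fftCur a (2 * h) B x = conj (root (x / h % 2 * (x / h))) *
      (fftCur a h (2 * B) (lowIdx h x + h)
        + (1 - 2 * (x / h % 2 : ℕ)) * fftCur a h (2 * B) (lowIdx h x)) := by
  have hc : ∀ n, conj (root n) * root n = 1 := fun n => by
    rw [Complex.conj_mul', norm_root]; simp
  set y := lowIdx h x with hy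
  obtain ⟨hle, h1, h2, h3, h4⟩ := lowIdx_facts hh x
  rw [← hy] at h1 h2 h3 h4
  -- the two children of the block
  have ey : y / h = 2 * (x / h / 2) := by
    have := Nat.div_add_mod y (2 * h)
    rw [h1, h2] at this
    rw [← this, mul_comm 2 h, mul_assoc, Nat.mul_add_div hh,
      Nat.div_eq_of_lt (Nat.mod_lt _ hh), add_zero]
  have eyh : (y + h) / h = 2 * (x / h / 2) + 1 := by
    rw [Nat.add_div_right _ hh, ey]
  have l1 : lowIdx h y = y := by
    unfold lowIdx; rw [ey]; simp
  have l2 : lowIdx h (y + h) = y := by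
    unfold lowIdx; rw [eyh]
    have : (2 * (x / h / 2) + 1) % 2 = 1 := by omega
    rw [this]; omega
  have s1 := fftCur_stage a hh B y
  have s2 := fftCur_stage a hh B (y + h)
  rw [l1, ey] at s1
  rw [l2, eyh, root_odd] at s2
  rcases Nat.mod_two_eq_zero_or_one (x / h) with hb | hb
  · have ex : x = y := by rw [hy]; unfold lowIdx; rw [hb]; simp
    rw [hb, zero_mul, root_zero, s1, s2, ← ex]
    simp; ring
  · have ex : x = y + h := by
      rw [hb] at hle
      rw [hy]; unfold lowIdx; rw [hb]; omega
    have hodd : x / h = 2 * (x / h / 2) + 1 := by omega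
    rw [hb, one_mul, s1, s2]
    have hr : root (2 * (x / h / 2)) = -root (x / h) := by
      conv_rhs => rw [hodd, root_odd]
      ring
    rw [hr, ← ex]
    push_cast
    linear_combination (-2 * fftCur a (2 * h) B x) * hc (x / h)

theorem norm_fftCur_le {a : ℕ → ℂ} {V : ℝ} (ha : ∀ i, ‖a i‖ ≤ V) (h B x : ℕ) :
    ‖fftCur a h B x‖ ≤ B * V := by
  unfold fftCur
  refine (norm_sum_le _ _).trans ?_
  calc _ ≤ ∑ q ∈ Finset.range B, V := by
        refine Finset.sum_le_sum fun q _ => ?_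
        rw [norm_mul, norm_pow, norm_root, one_pow, mul_one]
        exact ha _
    _ = _ := by simp

/-- Cyclic shifts do not change sums over a period. -/
theorem sum_range_shift (g : ℕ → ℂ) (L : ℕ) (hg : ∀ q, g (q + L) = g q) (j : ℕ) :
    ∑ q ∈ Finset.range L, g (q + j) = ∑ q ∈ Finset.range L, g q := by
  induction j with
  | zero => rfl
  | succ j ih =>
    rw [← ih]
    have h1 := Finset.sum_range_succ (fun q => g (q + j)) L
    have h2 := Finset.sum_range_succ' (fun q => g (q + j)) L
    have h3 : g (L + j) = g (0 + j) := by rw [add_comm, hg, zero_add]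
    rw [h1] at h2
    rw [h3] at h2
    have h4 := add_right_cancel h2
    rw [h4]
    exact Finset.sum_congr rfl fun q _ => by congr 1; ring

/-- Cyclic correlation. -/
noncomputable def corr (a b : ℕ → ℝ) (L x : ℕ) : ℝ :=
  ∑ j ∈ Finset.range L, a ((x + j) % L) * b j

open ComplexConjugate in
/-- The transform of a correlation. -/
theorem fft_corr (a b : ℕ → ℝ) (k x : ℕ) (hx : x < 2 ^ k) :
    fftCur (fun i => (a i : ℂ)) 1 (2 ^ k) x * conj (fftCur (fun i => (b i : ℂ)) 1 (2 ^ k) x)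
      = fftCur (fun i => (corr a b (2 ^ k) i : ℂ)) 1 (2 ^ k) x := by
  rw [fftCur_last, fftCur_last, fftCur_last]
  set L := 2 ^ k with hL
  set z := root x with hz
  have hzL : z ^ L = 1 := by rw [hz, hL, root_pow, Nat.div_eq_of_lt hx, root_zero]
  have hzc : z * conj z = 1 := by rw [Complex.mul_conj', hz, norm_root]; simp
  have hmod : ∀ q, z ^ (q % L) = z ^ q := fun q => by
    conv_rhs => rw [← Nat.div_add_mod q L, pow_add, pow_mul, hzL, one_pow, one_mul]
  rw [map_sum, Finset.mul_sum]
  have e1 : ∀ q, (corr a b L q : ℂ) * z ^ q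
      = ∑ j ∈ Finset.range L, (b j : ℂ) * ((a ((q + j) % L) : ℂ) * z ^ q) := fun q => by
    unfold corr
    push_cast
    rw [Finset.sum_mul]
    exact Finset.sum_congr rfl fun j _ => by ring
  rw [Finset.sum_congr rfl fun q _ => e1 q, Finset.sum_comm]
  refine Finset.sum_congr rfl fun j _ => ?_
  rw [← Finset.mul_sum, map_mul, map_pow, Complex.conj_ofReal]
  -- Shifting the summation index by j costs a factor z^j, which the conjugate factor of the second
  -- transform cancels because |z| = 1.
  have e2 : ∑ q ∈ Finset.range L, (a q : ℂ) * z ^ q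
      = (∑ q ∈ Finset.range L, (a ((q + j) % L) : ℂ) * z ^ q) * z ^ j := by
    rw [Finset.sum_mul]
    have := sum_range_shift (fun q => (a (q % L) : ℂ) * z ^ (q % L)) L
      (fun q => by simp) j
    calc _ = ∑ q ∈ Finset.range L, (a (q % L) : ℂ) * z ^ (q % L) :=
          Finset.sum_congr rfl fun q hq => by
            rw [Nat.mod_eq_of_lt (Finset.mem_range.mp hq)]
      _ = _ := this.symm
      _ = _ := Finset.sum_congr rfl fun q _ => by simp only [hmod]; rw [pow_add]; ring
  rw [e2]
  have e3 : z ^ j * conj z ^ j = 1 := by rw [← mul_pow, hzc, one_pow]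
  linear_combination ((b j : ℂ) * ∑ q ∈ Finset.range L, (a ((q + j) % L) : ℂ) * z ^ q) * e3

/-- If the second sequence is supported on m entries and x + m ≤ L, no index wraps around. A
transform of length at least 2m thus serves m positions at once. -/
theorem corr_eq (a b : ℕ → ℝ) {L m x : ℕ} (hb : ∀ j, m ≤ j → b j = 0) (hx : x + m ≤ L) :
    corr a b L x = ∑ j ∈ Finset.range m, a (x + j) * b j := by
  unfold corr
  obtain ⟨r, rfl⟩ := Nat.exists_eq_add_of_le (show m ≤ L by omega)
  rw [Finset.sum_range_add]
  have h2 : ∑ j ∈ Finset.range r, a ((x + (m + j)) % (m + r)) * b (m + j) = 0 :=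
    Finset.sum_eq_zero fun j _ => by rw [hb _ (by omega), mul_zero]
  rw [h2, add_zero]
  refine Finset.sum_congr rfl fun j hj => ?_
  rw [Finset.mem_range] at hj
  rw [Nat.mod_eq_of_lt (by omega)]

/-! ### Error propagation -/

/-- The complex number stored in two arrays. -/
def cplx (r i : ℕ → ℝ) (x : ℕ) : ℂ := ⟨r x, i x⟩

theorem norm_le_of_re_im {z : ℂ} {f : ℝ} (h1 : |z.re| ≤ f) (h2 : |z.im| ≤ f) : ‖z‖ ≤ 2 * f :=
  (Complex.norm_le_abs_re_add_abs_im z).trans (by linarith)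

theorem mul_error {x x' y y' : ℂ} {dx dy X Y : ℝ} (hx : ‖x' - x‖ ≤ dx) (hy : ‖y' - y‖ ≤ dy)
    (hX : ‖x‖ ≤ X) (hY : ‖y‖ ≤ Y) : ‖x' * y' - x * y‖ ≤ dx * Y + X * dy + dx * dy := by
  have h : x' * y' - x * y = (x' - x) * y + x * (y' - y) + (x' - x) * (y' - y) := by ring
  rw [h]
  have dx0 : 0 ≤ dx := (norm_nonneg _).trans hx
  have X0 : 0 ≤ X := (norm_nonneg _).trans hX
  refine (norm_add₃_le).trans ?_
  rw [norm_mul, norm_mul, norm_mul]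
  gcongr

/-- Errors that grow by `4 e + 4 η V` per stage, while the magnitude `V` doubles. -/
theorem stage_error {e0 η V : ℝ} (he0 : 0 ≤ e0) (hη : 0 ≤ η) (hV : 0 ≤ V) (j : ℕ) :
    4 * (8 ^ j * (e0 + η * V)) + 4 * η * (2 ^ j * V) ≤ 8 ^ (j + 1) * (e0 + η * V) := by
  have h1 : (2 : ℝ) ^ j ≤ 8 ^ j := pow_le_pow_left₀ (by norm_num) (by norm_num) j
  have h2 : η * (2 ^ j * V) ≤ 8 ^ j * (e0 + η * V) := by
    calc η * (2 ^ j * V) = 2 ^ j * (η * V) := by ring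
      _ ≤ 8 ^ j * (e0 + η * V) := by gcongr; linarith
  rw [pow_succ]
  linarith

/-! ### Evaluation of expressions up to rounding errors. -/

section Approx

variable {w : ℕ} {ω : ℕ → Fin (2 ^ w)} {Z : ℕ} {σ : Sto} {Q Q' : Sto → Prop}

theorem WP.cost {c : Pg} {T T' : ℕ} (h : WP w ω Z c T σ Q) (hT : T ≤ T') : WP w ω Z c T' σ Q :=
  h.mono hT fun _ _ h => h

theorem Ev.v {x : Var} {v : ℝ} (h : σ.var x = v) : Ev w Z σ (.var x) v := h.symm

theorem Ev.vN {x : Var} {v : ℕ} (h : σ.var x = v) : Ev w Z σ (.var x) (v : ℝ) := h.symm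

theorem Ev.cast {e : Ex} {v v' : ℝ} (h : Ev w Z σ e v) (hv : v = v') : Ev w Z σ e v' := hv ▸ h

theorem Ev.two (hw : 0 < w) : Ev w Z σ (.lit 2) ((2 : ℕ) : ℝ) :=
  Ev.litN hw 2 (by calc 2 = 2 ^ 1 := rfl
    _ ≤ 2 ^ w := Nat.pow_le_pow_right (by norm_num) hw)

theorem Ev.one (hw : 0 < w) : Ev w Z σ (.lit 1) ((1 : ℕ) : ℝ) :=
  Ev.litN hw 1 Nat.one_le_two_pow

theorem Ev.zero (hw : 0 < w) : Ev w Z σ (.lit 0) (0 : ℝ) := by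
  have := Ev.litN (Z := Z) (σ := σ) hw 0 (Nat.zero_le _)
  simpa using this

theorem floor_nat_div (x y : ℕ) : ⌊(x : ℝ) / y⌋ = ((x / y : ℕ) : ℤ) := by
  rw [← Int.natCast_floor_eq_floor (by positivity), Nat.floor_div_eq_div]

/-- Division of a natural number by a power of two, rounded down. -/
theorem Ev.divFlr (hw : 0 < w) {a b : Ex} {x e : ℕ} (ha : Ev w Z σ a x)
    (hb : Ev w Z σ b ((2 ^ e : ℕ) : ℝ)) (hx : x ≤ 2 ^ w) (he : e ≤ w) :
    Ev w Z σ (.flr (a / b)) ((x / 2 ^ e : ℕ) : ℝ) := by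
  have h1 : Ev w Z σ (a / b) (((x : ℤ) : ℝ) / 2 ^ e) :=
    Ev.binD hw (o := .div) x e ha hb (by change ((2 ^ e : ℕ) : ℝ) ≠ 0; positivity)
      (by simp [BinOp.eval])
      (by rw [Int.cast_natCast, abs_of_nonneg (by positivity)]; exact_mod_cast hx)
      (he.trans Nat.lt_two_pow_self.le)
  refine Ev.flrN hw h1 ?_ ((Nat.div_le_self _ _).trans hx)
  have := floor_nat_div x (2 ^ e)
  push_cast at this ⊢
  exact this

/-- The expression `e` evaluates to `x` up to an error `d`. -/
def Ap (w Z : ℕ) (σ : Sto) (e : Ex) (x d : ℝ) : Prop := ∃ v, Ev w Z σ e v ∧ |v - x| ≤ d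

theorem Ev.ap {e : Ex} {x : ℝ} (h : Ev w Z σ e x) : Ap w Z σ e x 0 := ⟨x, h, by simp⟩

theorem Ap.mono {e : Ex} {x d d' : ℝ} (h : Ap w Z σ e x d) (hd : d ≤ d') : Ap w Z σ e x d' := by
  obtain ⟨v, h1, h2⟩ := h
  exact ⟨v, h1, h2.trans hd⟩

/-- Any operation, in terms of the error of its exact value. -/
theorem Ev.bin_ap {o : BinOp} {a b : Ex} {x y t B : ℝ} (ha : Ev w Z σ a x) (hb : Ev w Z σ b y)
    (hd : o.Defined x y) {d : ℝ} (ht : |o.eval x y - t| ≤ d) (hB : |t| + d ≤ B) (hBw : B ≤ 2 ^ w) :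
    Ap w Z σ (.bin o a b) t (d + (B + 1) / 2 ^ w) := by
  have h1 : |o.eval x y| ≤ B := by
    have := abs_add_le (o.eval x y - t) t
    rw [sub_add_cancel] at this
    linarith
  refine ⟨_, Ev.bin_ok ha hb hd (h1.trans hBw), ?_⟩
  have h2 := abs_fround_sub_le w (o.eval x y)
  have h3 := abs_add_le (fround w (o.eval x y) - o.eval x y) (o.eval x y - t)
  rw [sub_add_sub_cancel] at h3
  have h4 : (|o.eval x y| + 1) / 2 ^ w ≤ (B + 1) / 2 ^ w := by gcongr
  linarith

theorem Ap.add {a b : Ex} {x y dx dy B : ℝ} (ha : Ap w Z σ a x dx) (hb : Ap w Z σ b y dy)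
    (hB : |x| + |y| + dx + dy ≤ B) (hBw : B ≤ 2 ^ w) :
    Ap w Z σ (a + b) (x + y) (dx + dy + (B + 1) / 2 ^ w) := by
  obtain ⟨x', h1, h2⟩ := ha
  obtain ⟨y', h3, h4⟩ := hb
  refine Ev.bin_ap (o := .add) h1 h3 trivial ?_ ?_ hBw
  · change |x' + y' - (x + y)| ≤ _
    rw [add_sub_add_comm]
    exact (abs_add_le _ _).trans (add_le_add h2 h4)
  · have := abs_add_le x y
    linarith

theorem Ap.sub {a b : Ex} {x y dx dy B : ℝ} (ha : Ap w Z σ a x dx) (hb : Ap w Z σ b y dy)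
    (hB : |x| + |y| + dx + dy ≤ B) (hBw : B ≤ 2 ^ w) :
    Ap w Z σ (a - b) (x - y) (dx + dy + (B + 1) / 2 ^ w) := by
  obtain ⟨x', h1, h2⟩ := ha
  obtain ⟨y', h3, h4⟩ := hb
  refine Ev.bin_ap (o := .sub) h1 h3 trivial ?_ ?_ hBw
  · change |x' - y' - (x - y)| ≤ _
    rw [sub_sub_sub_comm]
    exact (abs_sub _ _).trans (add_le_add h2 h4)
  · have := abs_sub x y
    linarith

theorem Ev.mul_ap {a b : Ex} {x y B : ℝ} (ha : Ev w Z σ a x) (hb : Ev w Z σ b y)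
    (hB : |x * y| ≤ B) (hBw : B ≤ 2 ^ w) : Ap w Z σ (a * b) (x * y) ((B + 1) / 2 ^ w) := by
  have := Ev.bin_ap (o := .mul) (t := x * y) (d := 0) (B := B) ha hb trivial
    (by change |x * y - x * y| ≤ 0; simp) (by simpa using hB) hBw
  rwa [zero_add] at this

theorem abs_mul_le {x y X Y : ℝ} (hx : |x| ≤ X) (hy : |y| ≤ Y) : |x * y| ≤ X * Y := by
  rw [abs_mul]; exact mul_le_mul hx hy (abs_nonneg _) ((abs_nonneg _).trans hx)

/-- `a * b + c * d` -/
theorem Ev.dot_add {a b c d : Ex} {x y x' y' P : ℝ} (ha : Ev w Z σ a x) (hb : Ev w Z σ b y)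
    (hc : Ev w Z σ c x') (hd : Ev w Z σ d y') (h1 : |x * y| ≤ P) (h2 : |x' * y'| ≤ P)
    (hP : 4 * P + 2 ≤ 2 ^ w) : Ap w Z σ (a * b + c * d) (x * y + x' * y') (8 * (P + 1) / 2 ^ w) := by
  have hP0 : 0 ≤ P := (abs_nonneg _).trans h1
  have hw1 : (1 : ℝ) ≤ 2 ^ w := one_le_pow₀ (by norm_num)
  have hu : (P + 1) / 2 ^ w ≤ P + 1 := div_le_self (by linarith) hw1
  refine (Ap.add (Ev.mul_ap ha hb h1 (by linarith)) (Ev.mul_ap hc hd h2 (by linarith))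
    (B := 4 * P + 2) (by linarith) hP).mono ?_
  rw [← add_div, ← add_div]
  gcongr
  linarith

/-- `a * b - c * d` -/
theorem Ev.dot_sub {a b c d : Ex} {x y x' y' P : ℝ} (ha : Ev w Z σ a x) (hb : Ev w Z σ b y)
    (hc : Ev w Z σ c x') (hd : Ev w Z σ d y') (h1 : |x * y| ≤ P) (h2 : |x' * y'| ≤ P)
    (hP : 4 * P + 2 ≤ 2 ^ w) : Ap w Z σ (a * b - c * d) (x * y - x' * y') (8 * (P + 1) / 2 ^ w) := by
  have hP0 : 0 ≤ P := (abs_nonneg _).trans h1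
  have hw1 : (1 : ℝ) ≤ 2 ^ w := one_le_pow₀ (by norm_num)
  have hu : (P + 1) / 2 ^ w ≤ P + 1 := div_le_self (by linarith) hw1
  refine (Ap.sub (Ev.mul_ap ha hb h1 (by linarith)) (Ev.mul_ap hc hd h2 (by linarith))
    (B := 4 * P + 2) (by linarith) hP).mono ?_
  rw [← add_div, ← add_div]
  gcongr
  linarith

end Approx

/-! ### The program of the transform -/

/-- Compute the block `o` of index `x`, its parity, and the low index of its butterfly. -/
def idxPg : Pg :=
  .asg .o (.flr (.var .x / .var .h)) ;;
  .asg .par (.var .o - .lit 2 * .flr (.var .o / .lit 2)) ;;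
  .asg .lo (.var .x - .var .par * .var .h)

/-- Copy the output of a stage back. -/
def copyBack : Pg :=
  forL .x .L (.put .xr (.var .x) (.get .yr (.var .x)) ;; .put .xi (.var .x) (.get .yi (.var .x)))

/-- Results go to a second pair of arrays, because each old entry is needed for two new ones;
`copyBack` moves them when the stage is complete. -/
def fwdBody : Pg :=
  idxPg ;;
  .put .yr (.var .x) (.get .xr (.var .lo) + (.get .rr (.var .o) * .get .xr (.var .lo + .var .h)
    - .get .ri (.var .o) * .get .xi (.var .lo + .var .h))) ;;
  .put .yi (.var .x) (.get .xi (.var .lo) + (.get .rr (.var .o) * .get .xi (.var .lo + .var .h)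
    + .get .ri (.var .o) * .get .xr (.var .lo + .var .h)))

/-- The variables `o` and `par` are reused: `o` becomes parity times block number, so that an even
block uses the root 1, and `par` becomes the sign 1 - 2 · parity. This realizes `fftCur_unstage`
without a branch and without the factor 1/2. -/
def invBody : Pg :=
  idxPg ;;
  .asg .o (.var .par * .var .o) ;;
  .asg .par (.lit 1 - .lit 2 * .var .par) ;;
  .asg .pr (.get .xr (.var .lo + .var .h) + .var .par * .get .xr (.var .lo)) ;;
  .asg .pi (.get .xi (.var .lo + .var .h) + .var .par * .get .xi (.var .lo)) ;;
  .put .yr (.var .x) (.get .rr (.var .o) * .var .pr + .get .ri (.var .o) * .var .pi) ;;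
  .put .yi (.var .x) (.get .rr (.var .o) * .var .pi - .get .ri (.var .o) * .var .pr)

/-- The forward transform of the array `xr + i xi`. -/
def fwdPg : Pg :=
  .asg .h (.var .L) ;;
  forL .st .K (.asg .h (.var .h / .lit 2) ;; forL .x .L fwdBody ;; copyBack)

/-- The inverse transform of the array `xr + i xi`, up to a factor `L`. -/
def invPg : Pg :=
  .asg .h (.lit 1) ;;
  forL .st .K ((forL .x .L invBody ;; copyBack) ;; .asg .h (.var .h * .lit 2))

/-- Multiply the array `xr + i xi` by the conjugate of `br + i bi`. -/
def mulPg : Pg :=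
  forL .x .L (
    .put .yr (.var .x) (.get .xr (.var .x) * .get .br (.var .x)
      + .get .xi (.var .x) * .get .bi (.var .x)) ;;
    .put .yi (.var .x) (.get .xi (.var .x) * .get .br (.var .x)
      - .get .xr (.var .x) * .get .bi (.var .x))) ;;
  copyBack

/-- Sizes of words and arrays. -/
structure Ctx (w Z k : ℕ) : Prop where
  hw : 0 < w
  hZ : 16 * Z ≤ 2 ^ w
  hL : 2 ^ k ≤ Z

theorem Ctx.le {w Z k : ℕ} (h : Ctx w Z k) : 2 ^ k ≤ 2 ^ w := by
  have := h.hZ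
  have := h.hL
  omega

theorem Ctx.kw {w Z k : ℕ} (h : Ctx w Z k) : k ≤ w :=
  (Nat.pow_le_pow_iff_right (by norm_num)).mp h.le

section Transform

variable {w : ℕ} {ω : ℕ → Fin (2 ^ w)} {Z k : ℕ} {σ : Sto}

/-- The complex array `r + i i` is `e`-close to `f` on `[0, L)`. -/
def Close (σ : Sto) (r i : Arr) (f : ℕ → ℂ) (L : ℕ) (e : ℝ) : Prop :=
  ∀ x < L, ‖cplx (σ.arr r) (σ.arr i) x - f x‖ ≤ e

theorem Close.congr {σ' : Sto} {r i : Arr} {f : ℕ → ℂ} {L : ℕ} {e : ℝ} (h : Close σ r i f L e)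
    (hr : σ'.arr r = σ.arr r) (hi : σ'.arr i = σ.arr i) : Close σ' r i f L e := by
  intro x hx
  rw [hr, hi]; exact h x hx

theorem idx_wp (C : Ctx w Z k) {x e : ℕ} (hx : σ.var .x = x) (hh : σ.var .h = ((2 ^ e : ℕ) : ℝ))
    (hxL : x < 2 ^ k) (he : e ≤ k) (Q : Sto → Prop)
    (hQ : ∀ σ', Frame idxPg σ σ' → σ'.arr = σ.arr → σ'.var .o = ((x / 2 ^ e : ℕ) : ℝ) →
      σ'.var .par = ((x / 2 ^ e % 2 : ℕ) : ℝ) → σ'.var .lo = ((lowIdx (2 ^ e) x : ℕ) : ℝ) → Q σ') :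
    WP w ω Z idxPg 40 σ Q := by
  have hw := C.hw
  have hkw := C.le
  have hkw' := C.kw
  have ho : x / 2 ^ e ≤ x := Nat.div_le_self _ _
  have hf := lowIdx_facts (Nat.two_pow_pos e) x
  have hpar : x / 2 ^ e - 2 * (x / 2 ^ e / 2 ^ 1) = x / 2 ^ e % 2 := by omega
  have e1 : Ev w Z σ (.flr (.var .x / .var .h)) ((x / 2 ^ e : ℕ) : ℝ) :=
    Ev.divFlr hw (Ev.v hx) (Ev.v hh) (by omega) (by omega)
  have e2 : ∀ σ' : Sto, σ'.var .o = ((x / 2 ^ e : ℕ) : ℝ) →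
      Ev w Z σ' (.var .o - .lit 2 * .flr (.var .o / .lit 2)) ((x / 2 ^ e % 2 : ℕ) : ℝ) := by
    intro σ' h
    rw [← hpar]
    refine Ev.subN hw (Ev.v h) (Ev.mulN hw (Ev.two hw) (Ev.divFlr hw (Ev.v h) (Ev.two hw)
      (by omega) (by omega)) ?_) ?_ ?_ <;> omega
  have e3 : ∀ σ' : Sto, σ'.var .x = x → σ'.var .par = ((x / 2 ^ e % 2 : ℕ) : ℝ) →
      σ'.var .h = ((2 ^ e : ℕ) : ℝ) →
      Ev w Z σ' (.var .x - .var .par * .var .h) ((lowIdx (2 ^ e) x : ℕ) : ℝ) := by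
    intro σ' h h' h''
    have := hf.1
    exact Ev.subN hw (Ev.v h) (Ev.mulN hw (Ev.v h') (Ev.v h'') (by omega)) this (by omega)
  have key : WP w ω Z idxPg 40 σ (fun σ' => σ'.arr = σ.arr ∧ σ'.var .o = ((x / 2 ^ e : ℕ) : ℝ) ∧
      σ'.var .par = ((x / 2 ^ e % 2 : ℕ) : ℝ) ∧ σ'.var .lo = ((lowIdx (2 ^ e) x : ℕ) : ℝ)) := by
    refine WP.cost (WP.seq (WP.asg e1 (WP.seq (WP.asg (e2 _ rfl) (WP.asg (e3 _ hx rfl hh) ?_)))))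
      (by decide)
    exact ⟨rfl, rfl, rfl, rfl⟩
  exact key.mono le_rfl fun σ' hf h => hQ σ' hf h.1 h.2.1 h.2.2.1 h.2.2.2

/-- A loop that computes all entries of `yr + i yi`, followed by the copy to `xr + i xi`. -/
theorem map_wp (C : Ctx w Z k) {body : Pg} {Tb : ℕ} {g : ℕ → ℂ} {e : ℝ}
    (hL : σ.var .L = ((2 ^ k : ℕ) : ℝ)) (hLv : Var.L ∉ body.mv) (hxv : Var.x ∉ body.mv)
    (hbody : ∀ i : ℕ, i < 2 ^ k → ∀ σ', Frame (forL .x .L body) σ σ' → σ'.var .x = i →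
      WP w ω Z body Tb σ' (fun σ'' => ∃ v₁ v₂, σ''.arr .yr = Function.update (σ'.arr .yr) i v₁ ∧
        σ''.arr .yi = Function.update (σ'.arr .yi) i v₂ ∧ ‖(⟨v₁, v₂⟩ : ℂ) - g i‖ ≤ e)) :
    WP w ω Z (forL .x .L body ;; copyBack) (2 ^ k * (Tb + 30) + 6) σ
      (fun σ' => Close σ' .xr .xi g (2 ^ k) e) := by
  have hw := C.hw
  have hkw := C.le
  have hZ := C.hL
  have hLf : Var.L ∉ (forL .x .L body).mv := by
    simp only [forL, Pg.mv, List.mem_append, List.mem_singleton]; simp [hLv]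
  refine WP.cost (T := (2 ^ k * (Tb + 5) + 3) + (2 ^ k * (20 + 5) + 3)) ?_ (le_of_eq (by ring))
  refine WP.seq (WP.for Tb (fun j σ' => ∀ i < j, ‖cplx (σ'.arr .yr) (σ'.arr .yi) i - g i‖ ≤ e) hw hL
    hkw (by simp) ?_ ?_ (by decide) hLv hxv)
  · intro j hj σ' hf hx hI
    refine (hbody j hj σ' hf hx).mono le_rfl ?_
    rintro σ'' hf' ⟨v₁, v₂, h1, h2, h3⟩ i hi
    simp only [Sto.setVar_arr, h1, h2]
    rcases Nat.lt_succ_iff_lt_or_eq.mp hi with hlt | rfl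
    · have := hI i hlt
      simpa [cplx, Function.update_of_ne hlt.ne] using this
    · simpa [cplx] using h3
  · intro σ' hf hI
    have hL' : σ'.var .L = ((2 ^ k : ℕ) : ℝ) := by rw [hf.var _ hLf, hL]
    refine WP.for 20 (fun j σ'' => (∀ i < j, σ''.arr .xr i = σ'.arr .yr i ∧
      σ''.arr .xi i = σ'.arr .yi i)) hw hL' hkw (by simp) ?_ ?_
    · intro j hj σ'' hf' hx hI'
      have hyr : σ''.arr .yr = σ'.arr .yr := hf'.arr _ (by decide)
      have hyi : σ''.arr .yi = σ'.arr .yi := hf'.arr _ (by decide)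
      have hjZ : j < Z := by omega
      refine WP.cost (WP.seq (WP.put (Ev.vN hx) hjZ (Ev.getN (Ev.vN hx) hjZ)
        (WP.put (Ev.vN hx) hjZ (Ev.getN (Ev.vN hx) hjZ) ?_))) (by decide)
      intro i hi
      simp only [Sto.setVar_arr, Sto.setArr_arr, hyr, hyi]
      rcases Nat.lt_succ_iff_lt_or_eq.mp hi with hlt | rfl
      · simpa [hlt.ne] using hI' i hlt
      · simp
    · intro σ'' hf' hI' i hi
      obtain ⟨h1, h2⟩ := hI' i hi
      have := hI i hi
      simpa [cplx, h1, h2] using this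

theorem abs_arr_le {r i : ℕ → ℝ} {x : ℕ} {f : ℂ} {e V : ℝ} (h : ‖cplx r i x - f‖ ≤ e)
    (hf : ‖f‖ ≤ V) : |r x| ≤ V + e ∧ |i x| ≤ V + e := by
  have h1 : ‖cplx r i x‖ ≤ V + e := by
    have := norm_add_le (cplx r i x - f) f
    rw [sub_add_cancel] at this
    linarith
  exact ⟨(Complex.abs_re_le_norm (cplx r i x)).trans h1, (Complex.abs_im_le_norm (cplx r i x)).trans h1⟩

/-- One butterfly of the forward transform. -/
theorem fwdBody_wp (C : Ctx w Z k) {X : ℕ → ℂ} {V e η : ℝ} {s i : ℕ} (hV : 1 ≤ V) (he : e ≤ 1)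
    (hη : 200 / 2 ^ w ≤ η) (hη1 : η ≤ 1) (hbig : 100 * V ≤ 2 ^ w) (hs : s < k)
    (hh : σ.var .h = ((2 ^ s : ℕ) : ℝ)) (hx : σ.var .x = i) (hi : i < 2 ^ k)
    (hX : Close σ .xr .xi X (2 ^ k) e) (hXV : ∀ x, ‖X x‖ ≤ V)
    (hR : Close σ .rr .ri root (2 ^ k) η) :
    WP w ω Z fwdBody 200 σ (fun σ'' => ∃ v₁ v₂, σ''.arr .yr = Function.update (σ.arr .yr) i v₁ ∧
      σ''.arr .yi = Function.update (σ.arr .yi) i v₂ ∧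
      ‖(⟨v₁, v₂⟩ : ℂ) - (X (lowIdx (2 ^ s) i) + root (i / 2 ^ s) * X (lowIdx (2 ^ s) i + 2 ^ s))‖
        ≤ 4 * e + 4 * η * V) := by
  have hw := C.hw
  have hkw := C.le
  have hZ := C.hL
  have he0 : 0 ≤ e := (norm_nonneg _).trans (hX i hi)
  have hη0 : 0 ≤ η := le_trans (by positivity) hη
  have hlow : lowIdx (2 ^ s) i + 2 ^ s < 2 ^ k := by
    obtain ⟨t, rfl⟩ := Nat.exists_eq_add_of_lt hs
    have e1 : 2 ^ (s + t + 1) = 2 * 2 ^ s * 2 ^ t := by ring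
    rw [e1] at hi ⊢
    exact lowIdx_lt (Nat.two_pow_pos s) hi
  have ho : i / 2 ^ s < 2 ^ k := (Nat.div_le_self _ _).trans_lt hi
  have hs0 := Nat.two_pow_pos s
  set l := lowIdx (2 ^ s) i with hl
  set o := i / 2 ^ s
  refine WP.cost (WP.seq (idx_wp C hx hh hi hs.le _ ?_)) (T := 40 + 160) (by norm_num)
  intro σ1 hf harr hvo hvp hvl
  have hx1 : σ1.var .x = i := by rw [hf.var _ (by decide), hx]
  have hh1 : σ1.var .h = ((2 ^ s : ℕ) : ℝ) := by rw [hf.var _ (by decide), hh]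
  obtain ⟨a1, a2⟩ := abs_arr_le (hX l (by omega)) (hXV _)
  obtain ⟨a3, a4⟩ := abs_arr_le (hX (l + 2 ^ s) hlow) (hXV _)
  obtain ⟨a5, a6⟩ := abs_arr_le (hR o ho) (norm_root o).le
  have b : ∀ {x y : ℝ}, |x| ≤ 1 + η → |y| ≤ V + e → |x * y| ≤ 4 * V := fun hx hy =>
    (abs_mul_le hx hy).trans (by nlinarith)
  -- one of the two components
  have comp : ∀ {x : ℝ} {y : ℝ} {e₁ e₂ : Ex}, Ev w Z σ1 e₁ x → |x| ≤ V + e →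
      Ap w Z σ1 e₂ y (8 * (4 * V + 1) / 2 ^ w) → |y| ≤ 8 * V →
      Ap w Z σ1 (e₁ + e₂) (x + y) (η * V / 2) := by
    intro x y e₁ e₂ h1 h2 h3 h4
    have hw100 : (100 : ℝ) ≤ 2 ^ w := by linarith
    have hd : 8 * (4 * V + 1) / 2 ^ w ≤ V := by
      rw [div_le_iff₀ (by positivity)]; nlinarith
    refine (Ap.add h1.ap h3 (B := 12 * V) (by linarith) (by linarith)).mono ?_
    have h5 : η * V / 2 ≥ 100 * V / 2 ^ w := by
      have : 200 / 2 ^ w * V ≤ η * V := by gcongr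
      calc 100 * V / 2 ^ w = 200 / 2 ^ w * V / 2 := by ring
        _ ≤ _ := by linarith
    refine le_trans ?_ h5
    rw [zero_add, ← add_div]
    gcongr; linarith
  have g1 : Ev w Z σ1 (.get .xr (.var .lo)) (σ.arr .xr l) := by
    have := Ev.getN (w := w) (k := .xr) (Ev.vN hvl) (show l < Z by omega); rwa [harr] at this
  have g2 : Ev w Z σ1 (.get .xi (.var .lo)) (σ.arr .xi l) := by
    have := Ev.getN (w := w) (k := .xi) (Ev.vN hvl) (show l < Z by omega); rwa [harr] at this
  have gi : Ev w Z σ1 (.var .lo + .var .h) ((l + 2 ^ s : ℕ) : ℝ) :=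
    Ev.addN hw (Ev.vN hvl) (Ev.vN hh1) (by omega)
  have g3 : Ev w Z σ1 (.get .xr (.var .lo + .var .h)) (σ.arr .xr (l + 2 ^ s)) := by
    have := Ev.getN (w := w) (k := .xr) gi (by omega); rwa [harr] at this
  have g4 : Ev w Z σ1 (.get .xi (.var .lo + .var .h)) (σ.arr .xi (l + 2 ^ s)) := by
    have := Ev.getN (w := w) (k := .xi) gi (by omega); rwa [harr] at this
  have g5 : Ev w Z σ1 (.get .rr (.var .o)) (σ.arr .rr o) := by
    have := Ev.getN (w := w) (k := .rr) (Ev.vN hvo) (show o < Z by omega); rwa [harr] at this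
  have g6 : Ev w Z σ1 (.get .ri (.var .o)) (σ.arr .ri o) := by
    have := Ev.getN (w := w) (k := .ri) (Ev.vN hvo) (show o < Z by omega); rwa [harr] at this
  obtain ⟨v₁, p1, q1⟩ := comp g1 a1 (Ev.dot_sub g5 g3 g6 g4 (b a5 a3) (b a6 a4) (by linarith))
    ((abs_sub _ _).trans (by linarith [b a5 a3, b a6 a4]))
  obtain ⟨v₂, p2, q2⟩ := comp g2 a2 (Ev.dot_add g5 g4 g6 g3 (b a5 a4) (b a6 a3) (by linarith))
    ((abs_add_le _ _).trans (by linarith [b a5 a4, b a6 a3]))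
  have hiZ : i < Z := by omega
  refine WP.cost (WP.seq (WP.put (Ev.vN hx1) hiZ p1 (WP.put (Ev.vN (σ := σ1.setArr .yr i v₁) hx1) hiZ p2
    ⟨v₁, v₂, ?_, ?_, ?_⟩))) (by decide)
  · rw [← harr]; simp [Sto.setArr]
  · rw [← harr]; simp [Sto.setArr]
  · set x := cplx (σ.arr .xr) (σ.arr .xi) l with hxdef
    set y := cplx (σ.arr .xr) (σ.arr .xi) (l + 2 ^ s) with hydef
    set r := cplx (σ.arr .rr) (σ.arr .ri) o with hrdef
    have n1 : ‖(⟨v₁, v₂⟩ : ℂ) - (x + r * y)‖ ≤ 2 * (η * V / 2) := by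
      refine norm_le_of_re_im ?_ ?_
      · simpa [hxdef, hydef, hrdef, cplx] using q1
      · simpa [hxdef, hydef, hrdef, cplx] using q2
    have n2 : ‖r * y - root o * X (l + 2 ^ s)‖ ≤ η * V + 1 * e + η * e :=
      mul_error (hR o ho) (hX _ hlow) (norm_root o).le (hXV _)
    have n3 : ‖x - X l‖ ≤ e := hX l (by omega)
    -- The three parts are the rounding of this butterfly, the inherited error of the first entry,
    -- and the error of the product of the second entry with the table value.
    have e1 : (⟨v₁, v₂⟩ : ℂ) - (X l + root o * X (l + 2 ^ s)) = ((⟨v₁, v₂⟩ : ℂ) - (x + r * y))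
        + (x - X l) + (r * y - root o * X (l + 2 ^ s)) := by ring
    rw [e1]
    refine norm_add₃_le.trans ?_
    nlinarith

end Transform

section Transform

variable {w : ℕ} {ω : ℕ → Fin (2 ^ w)} {Z k : ℕ} {σ : Sto}

open ComplexConjugate in
/-- One butterfly of the inverse transform. -/
theorem invBody_wp (C : Ctx w Z k) {X : ℕ → ℂ} {V e η : ℝ} {s i : ℕ} (hV : 1 ≤ V) (he : e ≤ 1)
    (hη : 200 / 2 ^ w ≤ η) (hη1 : η ≤ 1) (hbig : 100 * V ≤ 2 ^ w) (hs : s < k)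
    (hh : σ.var .h = ((2 ^ s : ℕ) : ℝ)) (hx : σ.var .x = i) (hi : i < 2 ^ k)
    (hX : Close σ .xr .xi X (2 ^ k) e) (hXV : ∀ x, ‖X x‖ ≤ V)
    (hR : Close σ .rr .ri root (2 ^ k) η) :
    WP w ω Z invBody 200 σ (fun σ'' => ∃ v₁ v₂, σ''.arr .yr = Function.update (σ.arr .yr) i v₁ ∧
      σ''.arr .yi = Function.update (σ.arr .yi) i v₂ ∧
      ‖(⟨v₁, v₂⟩ : ℂ) - conj (root (i / 2 ^ s % 2 * (i / 2 ^ s))) *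
        (X (lowIdx (2 ^ s) i + 2 ^ s) + (1 - 2 * (i / 2 ^ s % 2 : ℕ)) * X (lowIdx (2 ^ s) i))‖
        ≤ 4 * e + 4 * η * V) := by
  have hw := C.hw
  have hkw := C.le
  have hZ := C.hL
  have he0 : 0 ≤ e := (norm_nonneg _).trans (hX i hi)
  have hη0 : 0 ≤ η := le_trans (by positivity) hη
  have hlow : lowIdx (2 ^ s) i + 2 ^ s < 2 ^ k := by
    obtain ⟨t, rfl⟩ := Nat.exists_eq_add_of_lt hs
    have e1 : 2 ^ (s + t + 1) = 2 * 2 ^ s * 2 ^ t := by ring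
    rw [e1] at hi ⊢
    exact lowIdx_lt (Nat.two_pow_pos s) hi
  have hs0 := Nat.two_pow_pos s
  have ho : i / 2 ^ s < 2 ^ k := (Nat.div_le_self _ _).trans_lt hi
  set l := lowIdx (2 ^ s) i with hl
  set b := i / 2 ^ s % 2 with hb
  have hb2 : b = 0 ∨ b = 1 := Nat.mod_two_eq_zero_or_one _
  set o := b * (i / 2 ^ s) with hodef
  have ho' : o < 2 ^ k := by
    rcases hb2 with h | h <;> rw [hodef, h] <;> omega
  set κ : ℝ := 1 - 2 * (b : ℝ) with hκ
  have hκ1 : |κ| = 1 := by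
    rcases hb2 with h | h <;> rw [hκ, h] <;> norm_num
  refine WP.cost (WP.seq (idx_wp C hx hh hi hs.le _ ?_)) (T := 40 + 160) (by norm_num)
  intro σ1 hf harr hvo hvp hvl
  have hx1 : σ1.var .x = i := by rw [hf.var _ (by decide), hx]
  have hh1 : σ1.var .h = ((2 ^ s : ℕ) : ℝ) := by rw [hf.var _ (by decide), hh]
  have ev1 : Ev w Z σ1 (.var .par * .var .o) (o : ℝ) :=
    Ev.mulN hw (Ev.vN hvp) (Ev.vN hvo) (by omega)
  set σ2 := σ1.setVar .o o with hσ2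
  have ev2 : Ev w Z σ2 (.lit 1 - .lit 2 * .var .par) κ := by
    have h1 : Ev w Z σ2 (.lit 2 * .var .par) ((2 * b : ℕ) : ℝ) := by
      refine Ev.mulN hw (Ev.two hw) (Ev.vN hvp) ?_
      have : 2 ^ 1 ≤ 2 ^ w := Nat.pow_le_pow_right (by norm_num) hw
      omega
    exact (Ev.binD hw (o := .sub) (1 - 2 * (b : ℤ)) 0 (Ev.one (σ := σ2) (Z := Z) hw) h1 trivial
      (by simp [BinOp.eval])
      (by
        push_cast; rw [← hκ, hκ1]; exact one_le_pow₀ (by norm_num))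
      (Nat.zero_le _)).cast (by simp [hκ])
  set σ3 := σ2.setVar .par κ with hσ3
  obtain ⟨a1, a2⟩ := abs_arr_le (hX l (by omega)) (hXV _)
  obtain ⟨a3, a4⟩ := abs_arr_le (hX (l + 2 ^ s) hlow) (hXV _)
  obtain ⟨a5, a6⟩ := abs_arr_le (hR o ho') (norm_root o).le
  have hw100 : (100 : ℝ) ≤ 2 ^ w := by linarith
  -- one of the two sums
  have sum1 : ∀ {τ : Sto} {x y : ℝ} {e₁ e₂ e₃ : Ex}, Ev w Z τ e₁ x → Ev w Z τ e₂ κ → Ev w Z τ e₃ y →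
      |x| ≤ V + e → |y| ≤ V + e → Ap w Z τ (e₁ + e₂ * e₃) (x + κ * y) (11 * V / 2 ^ w) := by
    intro τ x y e₁ e₂ e₃ h1 h2 h3 h4 h5
    have hky : |κ * y| ≤ V + 1 := by rw [abs_mul, hκ1]; linarith
    have hd : (V + 1 + 1) / 2 ^ w ≤ V := by
      rw [div_le_iff₀ (by positivity)]; nlinarith
    refine (Ap.add h1.ap (Ev.mul_ap h2 h3 hky (by linarith)) (B := 5 * V + 2) (by linarith)
      (by linarith)).mono ?_
    rw [zero_add, ← add_div]
    gcongr
    linarith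
  have hd11 : 11 * V / 2 ^ w ≤ V := by
    rw [div_le_iff₀ (by positivity)]; nlinarith
  have gi : ∀ τ : Sto, τ.var .lo = l → τ.var .h = ((2 ^ s : ℕ) : ℝ) →
      Ev w Z τ (.var .lo + .var .h) ((l + 2 ^ s : ℕ) : ℝ) := fun τ h1 h2 =>
    Ev.addN hw (Ev.vN h1) (Ev.vN h2) (by omega)
  have G : ∀ (τ : Sto) (A : Arr) (e : Ex) (j : ℕ), τ.arr = σ.arr → Ev w Z τ e j → j < Z →
      Ev w Z τ (.get A e) (σ.arr A j) := fun τ A e j h1 h2 h3 => by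
    have := Ev.getN (k := A) h2 h3; rwa [h1] at this
  obtain ⟨pr, p1, q1⟩ := sum1 (τ := σ3) (G σ3 .xr _ _ harr (gi σ3 hvl hh1) (by omega))
    (Ev.v (x := .par) rfl) (G σ3 .xr _ _ harr (Ev.vN (σ := σ3) (x := .lo) hvl) (by omega)) a3 a1
  set σ4 := σ3.setVar .pr pr with hσ4
  obtain ⟨pi, p2, q2⟩ := sum1 (τ := σ4) (G σ4 .xi _ _ harr (gi σ4 hvl hh1) (by omega))
    (Ev.v (x := .par) rfl) (G σ4 .xi _ _ harr (Ev.vN (σ := σ4) (x := .lo) hvl) (by omega)) a4 a2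
  set σ5 := σ4.setVar .pi pi with hσ5
  have hpr : |pr| ≤ 3 * V + 2 := by
    have h1 := abs_add_le (pr - (σ.arr .xr (l + 2 ^ s) + κ * σ.arr .xr l))
      (σ.arr .xr (l + 2 ^ s) + κ * σ.arr .xr l)
    rw [sub_add_cancel] at h1
    have h2 := abs_add_le (σ.arr .xr (l + 2 ^ s)) (κ * σ.arr .xr l)
    rw [abs_mul, hκ1] at h2
    linarith
  have hpi : |pi| ≤ 3 * V + 2 := by
    have h1 := abs_add_le (pi - (σ.arr .xi (l + 2 ^ s) + κ * σ.arr .xi l))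
      (σ.arr .xi (l + 2 ^ s) + κ * σ.arr .xi l)
    rw [sub_add_cancel] at h1
    have h2 := abs_add_le (σ.arr .xi (l + 2 ^ s)) (κ * σ.arr .xi l)
    rw [abs_mul, hκ1] at h2
    linarith
  have bd : ∀ {x y : ℝ}, |x| ≤ 1 + η → |y| ≤ 3 * V + 2 → |x * y| ≤ 10 * V := fun hx hy =>
    (abs_mul_le hx hy).trans (by nlinarith)
  have g5 : ∀ τ : Sto, τ.arr .rr = σ.arr .rr → τ.var .o = o → Ev w Z τ (.get .rr (.var .o)) (σ.arr .rr o) :=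
    fun τ h1 h2 => by
      have := Ev.getN (w := w) (k := .rr) (Ev.vN h2) (show o < Z by omega); rwa [h1] at this
  have g6 : ∀ τ : Sto, τ.arr .ri = σ.arr .ri → τ.var .o = o → Ev w Z τ (.get .ri (.var .o)) (σ.arr .ri o) :=
    fun τ h1 h2 => by
      have := Ev.getN (w := w) (k := .ri) (Ev.vN h2) (show o < Z by omega); rwa [h1] at this
  obtain ⟨v₁, r1, s1⟩ := Ev.dot_add (g5 σ5 (congrFun harr _) rfl) (Ev.v (σ := σ5) (x := .pr) rfl)
    (g6 σ5 (congrFun harr _) rfl) (Ev.v (σ := σ5) (x := .pi) rfl) (bd a5 hpr) (bd a6 hpi) (by linarith)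
  change |v₁ - (σ.arr .rr o * pr + σ.arr .ri o * pi)| ≤ _ at s1
  set σ6 := σ5.setArr .yr i v₁ with hσ6
  obtain ⟨v₂, r2, s2⟩ := Ev.dot_sub (g5 σ6 (congrFun harr _) rfl) (Ev.v (σ := σ6) (x := .pi) rfl)
    (g6 σ6 (congrFun harr _) rfl) (Ev.v (σ := σ6) (x := .pr) rfl) (bd a5 hpi) (bd a6 hpr) (by linarith)
  change |v₂ - (σ.arr .rr o * pi - σ.arr .ri o * pr)| ≤ _ at s2
  have hiZ : i < Z := by omega
  refine WP.cost (WP.seq (WP.asg ev1 (WP.seq (WP.asg ev2 (WP.seq (WP.asg p1 (WP.seq (WP.asg p2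
    (WP.seq (WP.put (Ev.vN (σ := σ5) hx1) hiZ r1 (WP.put (Ev.vN (σ := σ6) hx1) hiZ r2
    ⟨v₁, v₂, ?_, ?_, ?_⟩))))))))))) (by decide)
  · rw [← harr]; simp [Sto.setArr]
  · rw [← harr]; simp [Sto.setArr]
  · set x := cplx (σ.arr .xr) (σ.arr .xi) l with hxdef
    set y := cplx (σ.arr .xr) (σ.arr .xi) (l + 2 ^ s) with hydef
    set r := cplx (σ.arr .rr) (σ.arr .ri) o with hrdef
    set P : ℂ := ⟨pr, pi⟩ with hP
    set f := 11 * V / 2 ^ w with hfdef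
    -- The rounding errors of the butterfly will add up to 20 f, which the 2ηV left over in the
    -- bound covers.
    have hfη : 18 * f ≤ η * V := by
      have : 200 / 2 ^ w * V ≤ η * V := by gcongr
      have e : 200 / 2 ^ w * V = 200 / 11 * f := by rw [hfdef]; ring
      have : 0 ≤ f := by positivity
      linarith
    have n1 : ‖(⟨v₁, v₂⟩ : ℂ) - conj r * P‖ ≤ 2 * (8 * f) := by
      have hle : 8 * (10 * V + 1) / 2 ^ w ≤ 8 * f := by
        rw [hfdef, ← mul_div_assoc]; gcongr; linarith
      refine norm_le_of_re_im ?_ ?_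
      · refine le_trans ?_ (s1.trans hle)
        simp only [hP, hrdef, cplx, Complex.mul_re, Complex.sub_re, Complex.conj_re, Complex.conj_im]
        apply le_of_eq; congr 1; ring
      · refine le_trans ?_ (s2.trans hle)
        simp only [hP, hrdef, cplx, Complex.mul_im, Complex.sub_im, Complex.conj_re, Complex.conj_im]
        apply le_of_eq; congr 1; ring
    have n2 : ‖P - (y + (κ : ℂ) * x)‖ ≤ 2 * f := by
      refine norm_le_of_re_im ?_ ?_
      · simpa [hP, hxdef, hydef, cplx] using q1
      · simpa [hP, hxdef, hydef, cplx] using q2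
    have hκn : ‖(κ : ℂ)‖ = 1 := by rw [Complex.norm_real]; exact hκ1
    have n3 : ‖(y + (κ : ℂ) * x) - (X (l + 2 ^ s) + (κ : ℂ) * X l)‖ ≤ 2 * e := by
      have e1 : (y + (κ : ℂ) * x) - (X (l + 2 ^ s) + (κ : ℂ) * X l)
        = (y - X (l + 2 ^ s)) + (κ : ℂ) * (x - X l) := by ring
      rw [e1]
      refine (norm_add_le _ _).trans ?_
      rw [norm_mul, hκn]
      have := hX (l + 2 ^ s) hlow
      have := hX l (by omega)
      linarith
    have n4 : ‖P - (X (l + 2 ^ s) + (κ : ℂ) * X l)‖ ≤ 2 * f + 2 * e := by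
      have := norm_add_le (P - (y + (κ : ℂ) * x)) ((y + (κ : ℂ) * x) - (X (l + 2 ^ s) + (κ : ℂ) * X l))
      rw [sub_add_sub_cancel] at this
      linarith
    have n5 : ‖X (l + 2 ^ s) + (κ : ℂ) * X l‖ ≤ 2 * V := by
      refine (norm_add_le _ _).trans ?_
      rw [norm_mul, hκn]
      linarith [hXV (l + 2 ^ s), hXV l]
    have n6 : ‖conj r - conj (root o)‖ ≤ η := by
      rw [← map_sub, RCLike.norm_conj]; exact hR o ho'
    have n7 : ‖conj (root o)‖ ≤ 1 := by rw [RCLike.norm_conj, norm_root]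
    have n8 := mul_error n6 n4 n7 n5
    have ek : ((1 : ℂ) - 2 * (b : ℕ)) = (κ : ℂ) := by rw [hκ]; push_cast; ring
    rw [ek]
    have := norm_add_le ((⟨v₁, v₂⟩ : ℂ) - conj r * P)
      (conj r * P - conj (root o) * (X (l + 2 ^ s) + (κ : ℂ) * X l))
    rw [sub_add_sub_cancel] at this
    have hf0 : 0 ≤ f := by positivity
    have hq : η * (2 * f + 2 * e) ≤ 2 * f + 2 * e := mul_le_of_le_one_left (by positivity) hη1
    linarith

end Transform

section Transform

variable {w : ℕ} {ω : ℕ → Fin (2 ^ w)} {Z k : ℕ} {σ : Sto}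

set_option maxHeartbeats 1000000 in
/-- The forward transform. -/
theorem fwd_wp (C : Ctx w Z k) {a : ℕ → ℂ} {V e η : ℝ} (hV : 1 ≤ V) (he : 0 ≤ e)
    (hη : 200 / 2 ^ w ≤ η) (hη1 : η ≤ 1) (hbig : 100 * (2 ^ k * V) ≤ 2 ^ w)
    (hsmall : 8 ^ k * (e + η * V) ≤ 1)
    (hL : σ.var .L = ((2 ^ k : ℕ) : ℝ)) (hK : σ.var .K = k) (ha : ∀ i, ‖a i‖ ≤ V)
    (hX : Close σ .xr .xi a (2 ^ k) e) (hR : Close σ .rr .ri root (2 ^ k) η) :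
    WP w ω Z fwdPg (k * (2 ^ k * 250) + 10) σ
      (fun σ' => Close σ' .xr .xi (fftCur a 1 (2 ^ k)) (2 ^ k) (8 ^ k * (e + η * V))) := by
  have hw := C.hw
  have hη0 : 0 ≤ η := le_trans (by positivity) hη
  have hkw : k ≤ 2 ^ w := C.kw.trans Nat.lt_two_pow_self.le
  have h1k := Nat.one_le_two_pow (n := k)
  refine WP.cost (T := 2 + (k * ((4 + (2 ^ k * (200 + 30) + 6)) + 5) + 3)) ?_ (by nlinarith)
  refine WP.seq (WP.asg (Ev.v hL) ?_)
  -- After j stages the blocks have length 2^(k - j), the entries are bounded by 2^j V, and the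
  -- error has grown by at most the factor 8^j; the summand ηV leaves room for the table and
  -- rounding errors.
  refine WP.for (4 + (2 ^ k * (200 + 30) + 6)) (fun j σ' => σ'.var .h = ((2 ^ (k - j) : ℕ) : ℝ) ∧
    Close σ' .xr .xi (fftCur a (2 ^ (k - j)) (2 ^ j)) (2 ^ k) (8 ^ j * (e + η * V))) hw hK hkw ?_ ?_ ?_
  · refine ⟨rfl, ?_⟩
    intro x hx
    rw [Nat.sub_zero, pow_zero, pow_zero, one_mul, fftCur_first _ _ _ hx]
    exact (hX x hx).trans (by nlinarith)
  · rintro j hj σ' hf - ⟨hh, hcl⟩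
    set s := k - j - 1 with hs
    have ekj : k - j = s + 1 := by omega
    have hsj : k = s + j + 1 := by omega
    rw [ekj] at hh hcl
    have hL' : σ'.var .L = ((2 ^ k : ℕ) : ℝ) := by rw [hf.var _ (by decide)]; exact hL
    have hev : Ev w Z σ' (.var .h / .lit 2) ((2 ^ s : ℕ) : ℝ) := by
      refine (Ev.binD hw (o := .div) ((2 ^ s : ℕ) : ℤ) 0 (Ev.v (Z := Z) hh) (Ev.two hw)
        (by change ((2 : ℕ) : ℝ) ≠ 0; norm_num)
        (by simp only [BinOp.eval]; push_cast; rw [pow_succ]; simp)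
        (by
          rw [Int.cast_natCast, abs_of_nonneg (by positivity)]
          have : 2 ^ s ≤ 2 ^ w := Nat.pow_le_pow_right (by norm_num) (by have := C.kw; omega)
          exact_mod_cast this)
        (Nat.zero_le _)).cast (by simp)
    refine WP.seq (T₁ := 4) (T₂ := 2 ^ k * (200 + 30) + 6) (WP.asg hev ?_)
    have hsm : 8 ^ j * (e + η * V) ≤ 1 := by
      refine le_trans ?_ hsmall
      gcongr
      · norm_num
    have hVj : (2 : ℝ) ^ j * V ≤ 2 ^ k * V := by
      gcongr
      norm_num
    have hVj1 : 1 ≤ (2 : ℝ) ^ j * V := by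
      have : (1 : ℝ) ≤ 2 ^ j := one_le_pow₀ (by norm_num)
      nlinarith
    refine WP.mono (map_wp C (g := fftCur a (2 ^ s) (2 ^ (j + 1)))
      (e := 8 ^ (j + 1) * (e + η * V)) hL' (by decide) (by decide) ?_) le_rfl ?_
    · intro i hi σ'' hf' hx
      have hh'' : σ''.var .h = ((2 ^ s : ℕ) : ℝ) := by rw [hf'.var _ (by decide)]; rfl
      refine (fwdBody_wp C (X := fftCur a (2 ^ (s + 1)) (2 ^ j)) (V := 2 ^ j * V)
        (e := 8 ^ j * (e + η * V)) (η := η) (s := s) hVj1 hsm hη hη1 (by linarith) (by omega) hh'' hx hi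
        (hcl.congr (hf'.arr _ (by decide)) (hf'.arr _ (by decide)))
        (fun x => (norm_fftCur_le ha _ _ _).trans (by push_cast; exact le_rfl))
        (hR.congr ?_ ?_)).mono le_rfl ?_
      · rw [hf'.arr _ (by decide)]; exact hf.arr _ (by decide)
      · rw [hf'.arr _ (by decide)]; exact hf.arr _ (by decide)
      · rintro σ3 - ⟨v₁, v₂, h1, h2, h3⟩
        refine ⟨v₁, v₂, h1, h2, ?_⟩
        rw [pow_succ' 2 j, fftCur_stage a (Nat.two_pow_pos s), ← pow_succ']
        exact h3.trans (stage_error he hη0 (by linarith) j)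
    · intro σ'' hf' hcl'
      have e2 : k - (j + 1) = s := by omega
      refine ⟨?_, ?_⟩
      · rw [e2]
        change σ''.var .h = _
        rw [hf'.var _ (by decide)]; rfl
      · rw [e2]; exact hcl'
  · rintro σ' - ⟨-, h⟩
    simpa using h

/-- The inverse transform. -/
theorem inv_wp (C : Ctx w Z k) {c : ℕ → ℂ} {V e η : ℝ} (hV : 1 ≤ V) (he : 0 ≤ e)
    (hη : 200 / 2 ^ w ≤ η) (hη1 : η ≤ 1) (hbig : 100 * (2 ^ k * V) ≤ 2 ^ w)
    (hsmall : 8 ^ k * (e + η * (2 ^ k * V)) ≤ 1)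
    (hL : σ.var .L = ((2 ^ k : ℕ) : ℝ)) (hK : σ.var .K = k) (hc : ∀ i, ‖c i‖ ≤ V)
    (hX : Close σ .xr .xi (fftCur c 1 (2 ^ k)) (2 ^ k) e) (hR : Close σ .rr .ri root (2 ^ k) η) :
    WP w ω Z invPg (k * (2 ^ k * 250) + 10) σ
      (fun σ' => Close σ' .xr .xi (fun x => 2 ^ k * c x) (2 ^ k) (8 ^ k * (e + η * (2 ^ k * V)))) := by
  have hw := C.hw
  have hη0 : 0 ≤ η := le_trans (by positivity) hη
  have hkw : k ≤ 2 ^ w := C.kw.trans Nat.lt_two_pow_self.le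
  have h1k := Nat.one_le_two_pow (n := k)
  have hVk : 1 ≤ (2 : ℝ) ^ k * V := by
    have : (1 : ℝ) ≤ 2 ^ k := one_le_pow₀ (by norm_num)
    nlinarith
  obtain ⟨T, hT⟩ : ∃ T, T = 2 ^ k * (200 + 30) + 6 := ⟨_, rfl⟩
  refine WP.cost (T := 2 + (k * ((T + 4) + 5) + 3)) ?_ (by nlinarith)
  refine WP.seq (T₁ := 2) (T₂ := k * ((T + 4) + 5) + 3) (WP.asg (Ev.one hw) ?_)
  -- Each inverse stage doubles the result, and the division by L is deferred to the end. The factor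
  -- 2^j together with the 2^(k - j) summands keeps the entries below 2^k V at every stage.
  refine WP.for (T + 4) (fun j σ' => σ'.var .h = ((2 ^ j : ℕ) : ℝ) ∧
    Close σ' .xr .xi (fun x => 2 ^ j * fftCur c (2 ^ j) (2 ^ (k - j)) x) (2 ^ k)
      (8 ^ j * (e + η * (2 ^ k * V)))) hw hK hkw ?_ ?_ ?_
  · refine ⟨by simp [Sto.setVar_var], ?_⟩
    intro x hx
    simp only [Nat.sub_zero, pow_zero, one_mul]
    exact (hX x hx).trans (by nlinarith)
  · rintro j hj σ' hf - ⟨hh, hcl⟩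
    have hL' : σ'.var .L = ((2 ^ k : ℕ) : ℝ) := by rw [hf.var _ (by decide)]; exact hL
    have hsm : 8 ^ j * (e + η * (2 ^ k * V)) ≤ 1 := by
      refine le_trans ?_ hsmall
      gcongr
      · norm_num
    refine WP.seq (T₁ := T) (T₂ := 4) (WP.mono (map_wp C
      (g := fun x => 2 ^ (j + 1) * fftCur c (2 ^ (j + 1)) (2 ^ (k - (j + 1))) x)
      (e := 8 ^ (j + 1) * (e + η * (2 ^ k * V))) hL' (by decide) (by decide) ?_) hT.ge ?_)
    · intro i hi σ'' hf' hx
      have hh'' : σ''.var .h = ((2 ^ j : ℕ) : ℝ) := by rw [hf'.var _ (by decide)]; exact hh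
      refine (invBody_wp C (X := fun x => 2 ^ j * fftCur c (2 ^ j) (2 ^ (k - j)) x) (V := 2 ^ k * V)
        (e := 8 ^ j * (e + η * (2 ^ k * V))) (η := η) (s := j) hVk hsm hη hη1 hbig hj hh'' hx hi
        (hcl.congr (hf'.arr _ (by decide)) (hf'.arr _ (by decide)))
        (fun x => ?_) (hR.congr ?_ ?_)).mono le_rfl ?_
      · have := norm_fftCur_le hc (2 ^ j) (2 ^ (k - j)) x
        rw [norm_mul, norm_pow, Complex.norm_ofNat]
        have e1 : (2 : ℝ) ^ k = 2 ^ j * 2 ^ (k - j) := by rw [← pow_add]; congr 1; omega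
        rw [e1, mul_assoc]
        push_cast at this
        gcongr
      · rw [hf'.arr _ (by decide)]; exact hf.arr _ (by decide)
      · rw [hf'.arr _ (by decide)]; exact hf.arr _ (by decide)
      · rintro σ3 - ⟨v₁, v₂, h1, h2, h3⟩
        refine ⟨v₁, v₂, h1, h2, ?_⟩
        have e1 : (2 : ℂ) ^ (j + 1) * fftCur c (2 ^ (j + 1)) (2 ^ (k - (j + 1))) i
            = 2 ^ j * (2 * fftCur c (2 * 2 ^ j) (2 ^ (k - (j + 1))) i) := by
          rw [pow_succ' 2 j, pow_succ']; ring
        have e2 : 2 * 2 ^ (k - (j + 1)) = 2 ^ (k - j) := by rw [← pow_succ']; congr 1; omega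
        rw [e1, fftCur_unstage c (Nat.two_pow_pos j), e2]
        have h4 := stage_error he hη0 (show 0 ≤ 2 ^ k * V by linarith) j
        have h5 : (1 : ℝ) ≤ 2 ^ j := one_le_pow₀ (by norm_num)
        -- The magnitude does not double here; it is bounded by 2^k V throughout, and this is
        -- weakened to fit `stage_error`.
        have h6 : 4 * η * (2 ^ k * V) ≤ 4 * η * (2 ^ j * (2 ^ k * V)) := by
          refine mul_le_mul_of_nonneg_left ?_ (by linarith)
          exact le_mul_of_one_le_left (by linarith) h5
        refine le_trans (le_of_eq ?_) (h3.trans (by linarith))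
        congr 1
        ring
    · intro σ'' hf' hcl'
      have hh'' : σ''.var .h = ((2 ^ j : ℕ) : ℝ) := by rw [hf'.var _ (by decide)]; exact hh
      refine WP.asg (Ev.mulN hw (Ev.vN hh'') (Ev.two hw) ?_) ⟨?_, hcl'⟩
      · rw [← pow_succ]
        exact Nat.pow_le_pow_right (by norm_num) (by have := C.kw; omega)
      · change ((2 ^ j * 2 : ℕ) : ℝ) = _
        rw [pow_succ]
  · rintro σ' - ⟨-, h⟩
    intro x hx
    have := h x hx
    have e1 : k - k = 0 := by omega
    simp only [e1, pow_zero, fftCur_first _ _ _ hx] at this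
    exact this

open ComplexConjugate in
/-- The pointwise product. -/
theorem mul_wp (C : Ctx w Z k) {F G : ℕ → ℂ} {VF VG e e' : ℝ} (hVF : 1 ≤ VF) (hVG : 1 ≤ VG)
    (he : e ≤ 1) (he' : e' ≤ 1) (hbig : 100 * (VF * VG) ≤ 2 ^ w)
    (hL : σ.var .L = ((2 ^ k : ℕ) : ℝ)) (hF : ∀ i, ‖F i‖ ≤ VF) (hG : ∀ i, ‖G i‖ ≤ VG)
    (hX : Close σ .xr .xi F (2 ^ k) e) (hB : Close σ .br .bi G (2 ^ k) e') :
    WP w ω Z mulPg (2 ^ k * 100 + 6) σ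
      (fun σ' => Close σ' .xr .xi (fun x => F x * conj (G x)) (2 ^ k)
        (e * VG + VF * e' + e * e' + 100 * (VF * VG) / 2 ^ w)) := by
  have hw := C.hw
  have hZ := C.hL
  refine WP.cost (T := 2 ^ k * (70 + 30) + 6) ?_ (le_of_eq (by ring))
  refine map_wp C hL (by decide) (by decide) ?_
  intro i hi σ' hf hx
  have hiZ : i < Z := by omega
  obtain ⟨a1, a2⟩ := abs_arr_le (hX i hi) (hF _)
  obtain ⟨a3, a4⟩ := abs_arr_le (hB i hi) (hG _)
  have hVV : 1 ≤ VF * VG := by nlinarith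
  have bd : ∀ {x y : ℝ}, |x| ≤ VF + e → |y| ≤ VG + e' → |x * y| ≤ 4 * (VF * VG) := fun hx hy =>
    (abs_mul_le (hx.trans (show VF + e ≤ 2 * VF by linarith))
      (hy.trans (show VG + e' ≤ 2 * VG by linarith))).trans (le_of_eq (by ring))
  have G' : ∀ (τ : Sto) (A : Arr), τ.arr A = σ.arr A → τ.var .x = i →
      Ev w Z τ (.get A (.var .x)) (σ.arr A i) := fun τ A h1 h2 => by
    have := Ev.getN (w := w) (k := A) (Ev.vN h2) hiZ; rwa [h1] at this
  have f : ∀ A, A ∈ [Arr.xr, .xi, .br, .bi] → σ'.arr A = σ.arr A := by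
    intro A hA
    exact hf.arr _ (by revert hA; cases A <;> decide)
  obtain ⟨v₁, p1, q1⟩ := Ev.dot_add (G' σ' .xr (f _ (by decide)) hx) (G' σ' .br (f _ (by decide)) hx)
    (G' σ' .xi (f _ (by decide)) hx) (G' σ' .bi (f _ (by decide)) hx) (bd a1 a3) (bd a2 a4) (by linarith)
  set σ1 := σ'.setArr .yr i v₁ with hσ1
  obtain ⟨v₂, p2, q2⟩ := Ev.dot_sub (G' σ1 .xi (f .xi (by decide)) hx) (G' σ1 .br (f .br (by decide)) hx)
    (G' σ1 .xr (f .xr (by decide)) hx) (G' σ1 .bi (f .bi (by decide)) hx) (bd a2 a3) (bd a1 a4) (by linarith)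
  refine WP.cost (WP.seq (WP.put (Ev.vN hx) hiZ p1 (WP.put (Ev.vN (σ := σ1) hx) hiZ p2
    ⟨v₁, v₂, ?_, ?_, ?_⟩))) (by decide)
  · simp [Sto.setArr]
  · simp [Sto.setArr]
  · set x := cplx (σ.arr .xr) (σ.arr .xi) i with hxdef
    set y := cplx (σ.arr .br) (σ.arr .bi) i with hydef
    have hle : 8 * (4 * (VF * VG) + 1) / 2 ^ w ≤ 50 * (VF * VG) / 2 ^ w := by
      refine div_le_div_of_nonneg_right ?_ (by positivity)
      linarith
    have n1 : ‖(⟨v₁, v₂⟩ : ℂ) - x * conj y‖ ≤ 2 * (50 * (VF * VG) / 2 ^ w) := by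
      refine norm_le_of_re_im ?_ ?_
      · refine le_trans (le_of_eq ?_) (q1.trans hle)
        simp [hxdef, hydef, cplx, Complex.mul_re]
      · refine le_trans (le_of_eq ?_) (q2.trans hle)
        simp [hxdef, hydef, cplx, Complex.mul_im]
        congr 1; ring
    have n2 : ‖conj y - conj (G i)‖ ≤ e' := by
      rw [← map_sub, RCLike.norm_conj]; exact hB i hi
    have n3 : ‖conj (G i)‖ ≤ VG := by rw [RCLike.norm_conj]; exact hG i
    have n4 := mul_error (hX i hi) n2 (hF i) n3
    have := norm_add_le ((⟨v₁, v₂⟩ : ℂ) - x * conj y) (x * conj y - F i * conj (G i))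
    rw [sub_add_sub_cancel] at this
    have e1 : 2 * (50 * (VF * VG) / 2 ^ w) = 100 * (VF * VG) / 2 ^ w := by ring
    linarith

end Transform

/-! ### The table of roots of unity -/

/-- `C := cos (θ / 2)` and `S := sin (θ / 2)`, from `C = cos θ` and `S = sin θ`. -/
def halfPg : Pg :=
  .asg .C (.bin .pow ((.lit 1 + .var .C) / .lit 2) (.lit 1 / .lit 2)) ;;
  .asg .S (.var .S / (.lit 2 * .var .C))

/-- Append to the table its multiples by `C + i S`. -/
def extendPg : Pg :=
  forL .b .h (
    .put .rr (.var .b + .var .h) (.get .rr (.var .b) * .var .C - .get .ri (.var .b) * .var .S) ;;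
    .put .ri (.var .b + .var .h) (.get .rr (.var .b) * .var .S + .get .ri (.var .b) * .var .C))

def rootsPg : Pg :=
  .put .rr (.lit 0) (.lit 1) ;; .put .ri (.lit 0) (.lit 0) ;;
  .put .rr (.lit 1) (.lit 0 - .lit 1) ;; .put .ri (.lit 1) (.lit 0) ;;
  .asg .h (.lit 2) ;; .asg .C (.lit 0) ;; .asg .S (.lit 1) ;;
  forL .j .KM (extendPg ;; halfPg ;; .asg .h (.var .h * .lit 2))

section Roots

variable {w : ℕ} {ω : ℕ → Fin (2 ^ w)} {Z k : ℕ} {σ : Sto}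

theorem Ev.half (hw : 0 < w) : Ev w Z σ (.lit 1 / .lit 2) (1 / 2 : ℝ) := by
  have h2w : (2 : ℝ) ≤ 2 ^ w := by
    calc (2 : ℝ) = 2 ^ 1 := (pow_one _).symm
      _ ≤ 2 ^ w := pow_le_pow_right₀ (by norm_num) hw
  refine (Ev.binD hw (o := .div) 1 1 (Ev.one (Z := Z) hw) (Ev.two hw)
    (by change ((2 : ℕ) : ℝ) ≠ 0; norm_num) (by simp [BinOp.eval]) (by simp; linarith)
    Nat.one_le_two_pow).cast (by simp)

/-- The half-angle formulas do not accumulate errors in this range. Since cos θ ≥ 0, the new cosine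
is at least 7/10, the square root does not enlarge errors, and the division by 2 cos(θ/2) shrinks
them; the bounds 32/2^w and 300/2^w reproduce themselves. -/
theorem half_wp (hw : 10 ≤ w) {θ : ℝ} (h0 : 0 < θ) (h1 : θ ≤ Real.pi / 2)
    (hC : |σ.var .C - Real.cos θ| ≤ 32 / 2 ^ w) (hS : |σ.var .S - Real.sin θ| ≤ 300 / 2 ^ w)
    (Q : Sto → Prop) (hQ : ∀ σ', Frame halfPg σ σ' →
      |σ'.var .C - Real.cos (θ / 2)| ≤ 32 / 2 ^ w → |σ'.var .S - Real.sin (θ / 2)| ≤ 300 / 2 ^ w → Q σ') :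
    WP w ω Z halfPg 20 σ Q := by
  have hw0 : 0 < w := by omega
  have hbig : (1024 : ℝ) ≤ 2 ^ w := by
    calc (1024 : ℝ) = 2 ^ 10 := by norm_num
      _ ≤ 2 ^ w := pow_le_pow_right₀ (by norm_num) hw
  obtain ⟨u, hu⟩ : ∃ u : ℝ, u = 1 / 2 ^ w := ⟨_, rfl⟩
  have hdiv : ∀ x : ℝ, x / 2 ^ w = x * u := fun x => by rw [hu]; ring
  have hu0 : 0 < u := by rw [hu]; positivity
  have hu1 : u ≤ 1 / 1024 := by rw [hu]; exact one_div_le_one_div_of_le (by norm_num) hbig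
  simp only [hdiv] at hC hS hQ
  have hpi := Real.pi_pos
  have hcos0 : 0 ≤ Real.cos θ := Real.cos_nonneg_of_mem_Icc ⟨by linarith, h1⟩
  have hcos1 := Real.cos_le_one θ
  have hsin0 : 0 ≤ Real.sin θ := Real.sin_nonneg_of_nonneg_of_le_pi h0.le (by linarith)
  have hsin1 := Real.sin_le_one θ
  set c := Real.cos θ with hc
  set s := Real.sin θ with hs
  set c' := Real.cos (θ / 2) with hc'
  have ec' : c' = √((1 + c) / 2) := Real.cos_half (by linarith) (by linarith)
  have hc'0 : 7 / 10 ≤ c' := by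
    rw [ec']; exact Real.le_sqrt_of_sq_le (by linarith)
  have hc'1 : c' ≤ 1 := Real.cos_le_one _
  have es : s = 2 * Real.sin (θ / 2) * c' := by
    rw [hs, hc', ← Real.sin_two_mul]; congr 1; ring
  -- the new cosine
  have a1 : Ap w Z σ (.lit 1 + .var .C) (1 + c) (36 * u) := by
    obtain ⟨v, e1, e2⟩ := Ap.add (w := w) (Z := Z) (σ := σ) (Ev.ap (Ev.one hw0))
      ⟨σ.var .C, Ev.var _ _, hC⟩ (B := 3) (by
        rw [Nat.cast_one, abs_one, abs_of_nonneg hcos0]; linarith) (by linarith)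
    rw [Nat.cast_one, hdiv] at e2
    exact ⟨v, e1, by linarith⟩
  obtain ⟨v1, ev1, hv1⟩ := a1
  have a2 : Ap w Z σ ((.lit 1 + .var .C) / .lit 2) ((1 + c) / 2) (21 * u) := by
    obtain ⟨v, e1, e2⟩ := Ev.bin_ap (o := .div) (t := (1 + c) / 2) (d := 18 * u) (B := 2) ev1
      (Ev.two hw0) (by change ((2 : ℕ) : ℝ) ≠ 0; norm_num)
      (by
        change |v1 / ((2 : ℕ) : ℝ) - (1 + c) / 2| ≤ _
        rw [abs_le] at hv1 ⊢
        push_cast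
        constructor <;> linarith) (by rw [abs_of_nonneg (by linarith)]; linarith) (by linarith)
    rw [hdiv] at e2
    exact ⟨v, e1, by linarith⟩
  obtain ⟨v2, ev2, hv2⟩ := a2
  have hv2' := abs_le.mp hv2
  have hv2pos : 0 < v2 := by linarith
  -- The difference of the roots times their sum is the difference of the radicands, and the sum is
  -- at least 1.
  have hsq : |√v2 - c'| ≤ 21 * u := by
    have hs0 : 1 ≤ √v2 + c' := by
      have : 3 / 10 ≤ √v2 := Real.le_sqrt_of_sq_le (by linarith)
      linarith
    have e : (√v2 - c') * (√v2 + c') = v2 - (1 + c) / 2 := by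
      have e1 := Real.mul_self_sqrt hv2pos.le
      have e2 : c' * c' = (1 + c) / 2 := by rw [ec']; exact Real.mul_self_sqrt (by linarith)
      linear_combination e1 - e2
    have h : |√v2 - c'| * (√v2 + c') ≤ 21 * u := by
      rw [← abs_of_nonneg (by linarith : 0 ≤ √v2 + c'), ← abs_mul, e]; exact hv2
    nlinarith [abs_nonneg (√v2 - c')]
  have a3 : Ap w Z σ (.bin .pow ((.lit 1 + .var .C) / .lit 2) (.lit 1 / .lit 2)) c' (32 * u) := by
    obtain ⟨v, e1, e2⟩ := Ev.bin_ap (o := .pow) (t := c') (d := 21 * u) (B := 2) ev2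
      (Ev.half hw0) (Or.inl hv2pos)
      (by
        change |v2 ^ (1 / 2 : ℝ) - c'| ≤ _
        rw [← Real.sqrt_eq_rpow]; exact hsq) (by rw [abs_of_nonneg (by linarith)]; linarith)
      (by linarith)
    rw [hdiv] at e2
    exact ⟨v, e1, by linarith⟩
  obtain ⟨C', ev3, hC'⟩ := a3
  -- the new sine
  set σ1 := σ.setVar .C C' with hσ1
  have hC2 := abs_le.mp hC'
  have a4 : Ap w Z σ1 (.lit 2 * .var .C) (2 * c') (68 * u) := by
    obtain ⟨v, e1, e2⟩ := Ev.bin_ap (w := w) (Z := Z) (σ := σ1) (o := .mul) (t := 2 * c')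
      (d := 64 * u) (B := 3) (Ev.two hw0) (Ev.v (x := .C) rfl) trivial
      (by
        change |((2 : ℕ) : ℝ) * C' - 2 * c'| ≤ _
        rw [abs_le]
        push_cast
        constructor <;> linarith) (by rw [abs_of_nonneg (by linarith)]; linarith) (by linarith)
    rw [hdiv] at e2
    exact ⟨v, e1, by linarith⟩
  obtain ⟨D, ev4, hD⟩ := a4
  have hD' := abs_le.mp hD
  have hD13 : 13 / 10 ≤ D := by linarith
  -- The numerator error 300 and the denominator error 68 add up to 368, and the denominator is at
  -- least 13/10.
  have hSd : |σ.var .S / D - Real.sin (θ / 2)| ≤ 290 * u := by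
    set s' := Real.sin (θ / 2) with hs'
    have hs'1 : |s'| ≤ 1 := Real.abs_sin_le_one _
    have e : (σ.var .S / D - s') * D = (σ.var .S - s) - s' * (D - 2 * c') := by
      rw [sub_mul, div_mul_cancel₀ _ (by linarith), es]; ring
    have h : |σ.var .S / D - s'| * D ≤ 368 * u := by
      rw [← abs_of_nonneg (by linarith : 0 ≤ D), ← abs_mul, abs_of_nonneg (by linarith : 0 ≤ D), e]
      have g1 := abs_sub (σ.var .S - s) (s' * (D - 2 * c'))
      have g2 := abs_mul_le hs'1 hD
      linarith
    nlinarith [abs_nonneg (σ.var .S / D - s')]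
  have a5 : Ap w Z σ1 (.var .S / (.lit 2 * .var .C)) (Real.sin (θ / 2)) (300 * u) := by
    obtain ⟨v, e1, e2⟩ := Ev.bin_ap (w := w) (Z := Z) (σ := σ1) (o := .div)
      (t := Real.sin (θ / 2)) (d := 290 * u) (B := 2)
      (Ev.v (x := .S) (v := σ.var .S) rfl) ev4 (by change D ≠ 0; linarith) hSd
      (by have := Real.abs_sin_le_one (θ / 2); linarith) (by linarith)
    rw [hdiv] at e2
    exact ⟨v, e1, by linarith⟩
  obtain ⟨S', ev5, hS'⟩ := a5
  have key : WP w ω Z halfPg 20 σ (fun σ' => |σ'.var .C - c'| ≤ 32 * u ∧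
      |σ'.var .S - Real.sin (θ / 2)| ≤ 300 * u) := by
    refine WP.cost (WP.seq (WP.asg ev3 (WP.asg ev5 ⟨?_, ?_⟩))) (by decide)
    · exact hC'
    · exact hS'
  exact key.mono le_rfl fun σ' hf h => hQ σ' hf h.1 h.2

/-- In bit reversed order the entries from 2^j to 2^(j+1) are the first 2^j entries times
e^(iπ/2^j). A doubling therefore adds only a constant multiple of 2^(-w) to the error of the table.
-/
theorem extend_wp (C : Ctx w Z k) {j : ℕ} (hj : j < k) {θ e : ℝ} (hw : 10 ≤ w)
    (hh : σ.var .h = ((2 ^ j : ℕ) : ℝ)) (hθ : θ = Real.pi / 2 ^ j)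
    (hC : |σ.var .C - Real.cos θ| ≤ 32 / 2 ^ w) (hS : |σ.var .S - Real.sin θ| ≤ 300 / 2 ^ w)
    (he : e ≤ 1) (hR : Close σ .rr .ri root (2 ^ j) e) :
    WP w ω Z extendPg (2 ^ j * 60 + 3) σ
      (fun σ' => Close σ' .rr .ri root (2 ^ (j + 1)) (e + 1000 / 2 ^ w)) := by
  have hbig : (1024 : ℝ) ≤ 2 ^ w := by
    calc (1024 : ℝ) = 2 ^ 10 := by norm_num
      _ ≤ 2 ^ w := pow_le_pow_right₀ (by norm_num) hw
  have hw0 := C.hw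
  have hjk : 2 ^ (j + 1) ≤ 2 ^ k := Nat.pow_le_pow_right (by norm_num) hj
  have hj2 : 2 ^ (j + 1) = 2 ^ j + 2 ^ j := by ring
  have hL := C.hL
  have hkw := C.le
  have hj0 := Nat.two_pow_pos j
  have he0 : 0 ≤ e := (norm_nonneg _).trans (hR 0 hj0)
  set ξ : ℂ := ⟨σ.var .C, σ.var .S⟩ with hξ
  have hξe : ‖ξ - Complex.exp ((θ : ℝ) * Complex.I)‖ ≤ 332 / 2 ^ w := by
    have e1 : Complex.exp ((θ : ℝ) * Complex.I) = ⟨Real.cos θ, Real.sin θ⟩ := by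
      rw [Complex.exp_mul_I, ← Complex.ofReal_cos, ← Complex.ofReal_sin]
      apply Complex.ext <;> simp only [Complex.add_re, Complex.add_im, Complex.mul_re, Complex.mul_im,
        Complex.ofReal_re, Complex.ofReal_im, Complex.I_re, Complex.I_im] <;> ring
    rw [e1]
    refine (Complex.norm_le_abs_re_add_abs_im _).trans ?_
    have : (332 : ℝ) / 2 ^ w = 32 / 2 ^ w + 300 / 2 ^ w := by ring
    rw [this]
    exact add_le_add (by simpa [hξ] using hC) (by simpa [hξ] using hS)
  refine WP.cost (T := 2 ^ j * (55 + 5) + 3) ?_ (le_of_eq (by ring))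
  refine WP.for 55 (fun b σ' => Close σ' .rr .ri root (2 ^ j) e ∧
    ∀ i < b, ‖cplx (σ'.arr .rr) (σ'.arr .ri) (i + 2 ^ j) - root (i + 2 ^ j)‖ ≤ e + 1000 / 2 ^ w)
    hw0 hh (by omega) ⟨hR, by simp⟩ ?_ ?_
  · rintro b hb σ' hf hvb ⟨hR', hI⟩
    have hvh : σ'.var .h = ((2 ^ j : ℕ) : ℝ) := by rw [hf.var _ (by decide)]; exact hh
    have hvC : σ'.var .C = σ.var .C := hf.var _ (by decide)
    have hvS : σ'.var .S = σ.var .S := hf.var _ (by decide)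
    have hlt : b + 2 ^ j < Z := by omega
    have hbZ : b < Z := by omega
    obtain ⟨a1, a2⟩ := abs_arr_le (hR' b hb) (norm_root b).le
    have hC1 : |σ.var .C| ≤ 2 := by
      have h1 := abs_add_le (σ.var .C - Real.cos θ) (Real.cos θ)
      rw [sub_add_cancel] at h1
      have h2 := Real.abs_cos_le_one θ
      have h3 : (32 : ℝ) / 2 ^ w ≤ 1 := by rw [div_le_one (by positivity)]; linarith
      linarith
    have hS1 : |σ.var .S| ≤ 2 := by
      have h1 := abs_add_le (σ.var .S - Real.sin θ) (Real.sin θ)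
      rw [sub_add_cancel] at h1
      have h2 := Real.abs_sin_le_one θ
      have h3 : (300 : ℝ) / 2 ^ w ≤ 1 := by rw [div_le_one (by positivity)]; linarith
      linarith
    have bd : ∀ {x y : ℝ}, |x| ≤ 1 + e → |y| ≤ 2 → |x * y| ≤ 4 := fun hx hy =>
      (abs_mul_le hx hy).trans (by linarith)
    set x := σ'.arr .rr b with hx
    set y := σ'.arr .ri b with hy
    obtain ⟨v₁, p1, q1⟩ := Ev.dot_sub (w := w) (Z := Z) (σ := σ') (Ev.getN (k := .rr) (Ev.vN hvb) hbZ) (Ev.v hvC)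
      (Ev.getN (k := .ri) (Ev.vN hvb) hbZ) (Ev.v hvS) (bd a1 hC1) (bd a2 hS1) (by linarith)
    set σ1 := σ'.setArr .rr (b + 2 ^ j) v₁ with hσ1
    have g1 : σ1.arr .rr b = x := by
      rw [hσ1, Sto.setArr_arr, if_neg (by omega)]
    have g2 : Ev w Z σ1 (.get .rr (.var .b)) x := by
      rw [← g1]; exact Ev.getN (Ev.vN (by exact hvb)) hbZ
    have g3 : Ev w Z σ1 (.get .ri (.var .b)) y := Ev.getN (k := .ri) (Ev.vN (by exact hvb)) hbZ
    obtain ⟨v₂, p2, q2⟩ := Ev.dot_add g2 (Ev.v (σ := σ1) (x := .S) hvS) g3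
      (Ev.v (σ := σ1) (x := .C) hvC) (bd a1 hS1) (bd a2 hC1) (by linarith)
    have hn : ‖(⟨v₁, v₂⟩ : ℂ) - root (b + 2 ^ j)‖ ≤ e + 1000 / 2 ^ w := by
      have n1 : ‖(⟨v₁, v₂⟩ : ℂ) - cplx (σ'.arr .rr) (σ'.arr .ri) b * ξ‖ ≤ 2 * (8 * (4 + 1) / 2 ^ w) := by
        refine norm_le_of_re_im ?_ ?_
        · refine le_trans (le_of_eq ?_) q1
          simp [hξ, cplx, Complex.mul_re]
        · refine le_trans (le_of_eq ?_) q2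
          simp [hξ, cplx, Complex.mul_im, hx, hy]
      have n2 := mul_error (hR' b hb) hξe (norm_root b).le
        (Y := 1) (Complex.norm_exp_ofReal_mul_I θ).le
      rw [hθ, ← root_add_pow j b hb] at n2
      have := norm_add_le ((⟨v₁, v₂⟩ : ℂ) - cplx (σ'.arr .rr) (σ'.arr .ri) b * ξ)
        (cplx (σ'.arr .rr) (σ'.arr .ri) b * ξ - root (b + 2 ^ j))
      rw [sub_add_sub_cancel] at this
      have h5 : e * (332 / 2 ^ w) ≤ 332 / 2 ^ w := mul_le_of_le_one_left (by positivity) he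
      have h6 : (1000 : ℝ) / 2 ^ w = 2 * (8 * (4 + 1) / 2 ^ w) + 332 / 2 ^ w + 332 / 2 ^ w + 256 / 2 ^ w := by
        ring
      have h7 : (0 : ℝ) ≤ 256 / 2 ^ w := by positivity
      linarith
    refine WP.cost (WP.seq (WP.put (i := b + 2 ^ j) (Ev.addN hw0 (Ev.vN hvb) (Ev.vN hvh) (by omega)) hlt p1
      (WP.put (i := b + 2 ^ j) (Ev.addN hw0 (Ev.vN (σ := σ1) hvb) (Ev.vN (σ := σ1) hvh) (by omega)) hlt p2
      ⟨?_, ?_⟩))) (by decide)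
    · intro i hi
      have : i ≠ b + 2 ^ j := by omega
      simpa [cplx, Sto.setArr_arr, hσ1, this] using hR' i hi
    · intro i hi
      rcases Nat.lt_succ_iff_lt_or_eq.mp hi with hlt | rfl
      · simpa [cplx, Sto.setArr_arr, hσ1, hlt.ne] using hI i hlt
      · simpa [cplx, Sto.setArr_arr, hσ1] using hn
  · rintro σ' - ⟨h1, h2⟩ i hi
    rcases lt_or_ge i (2 ^ j) with hlt | hge
    · refine (h1 i hlt).trans ?_
      have : (0 : ℝ) ≤ 1000 / 2 ^ w := by positivity
      linarith
    · obtain ⟨t, rfl⟩ := Nat.exists_eq_add_of_le' hge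
      exact h2 t (by omega)

/-- The table starts with the exact entries 1 and -1 and the angle π/2; k - 1 doublings complete it.
The error grows linearly in k because each doubling adds 1000/2^w. -/
theorem roots_wp (C : Ctx w Z k) (hk : 1 ≤ k) (hw : 10 ≤ w) (hsm : 1000 * (k : ℝ) ≤ 2 ^ w)
    (hKM : σ.var .KM = ((k - 1 : ℕ) : ℝ)) :
    WP w ω Z rootsPg (k * (2 ^ k * 100) + 100) σ
      (fun σ' => Close σ' .rr .ri root (2 ^ k) (1000 * k / 2 ^ w)) := by
  have hw0 := C.hw
  have hL := C.hL
  have hkw := C.le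
  have hk2 : 2 ≤ 2 ^ k := by
    calc 2 = 2 ^ 1 := rfl
      _ ≤ 2 ^ k := Nat.pow_le_pow_right (by norm_num) hk
  have root_one : root 1 = -1 := by
    have := root_add_pow 0 0 (by norm_num)
    rw [root_zero] at this
    simpa using this
  obtain ⟨B, hB⟩ : ∃ B, B = 2 ^ (k - 1) * 60 + 3 + (20 + 4) := ⟨_, rfl⟩
  have hpow : 2 ^ k = 2 * 2 ^ (k - 1) := by rw [← pow_succ']; congr 1; omega
  have hZ1 : 1 < Z := by omega
  have hZ0 : 0 < Z := by omega
  have ev0 : ∀ τ : Sto, Ev w Z τ (.lit 0) ((0 : ℕ) : ℝ) := fun τ => Ev.litN hw0 0 (Nat.zero_le _)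
  have ev1 : ∀ τ : Sto, Ev w Z τ (.lit 1) ((1 : ℕ) : ℝ) := fun τ => Ev.one hw0
  have evm : ∀ τ : Sto, Ev w Z τ (.lit 0 - .lit 1) (-1 : ℝ) := fun τ => by
    have := Ev.binD hw0 (o := .sub) (-1) 0 (ev0 τ) (ev1 τ) trivial (by simp [BinOp.eval])
      (by simp; exact one_le_pow₀ (by norm_num)) (Nat.zero_le _)
    exact this.cast (by norm_num)
  refine WP.cost (T := 6 + (6 + (8 + (6 + (2 + (2 + (2 + ((k - 1) * (B + 5) + 3)))))))) ?_ ?_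
  swap
  · have h1 : (k - 1) * (B + 5) ≤ k * (2 ^ k * 100) := by
      refine Nat.mul_le_mul (Nat.sub_le _ _) ?_
      omega
    omega
  refine WP.seq (T₁ := 6) (WP.put (i := 0) (ev0 _) hZ0 (ev1 _) ?_)
  refine WP.seq (T₁ := 6) (WP.put (i := 0) (ev0 _) hZ0 (ev0 _) ?_)
  refine WP.seq (T₁ := 8) (WP.put (i := 1) (ev1 _) hZ1 (evm _) ?_)
  refine WP.seq (T₁ := 6) (WP.put (i := 1) (ev1 _) hZ1 (ev0 _) ?_)
  refine WP.seq (WP.asg (Ev.two hw0) (WP.seq (WP.asg (ev0 _) (WP.seq (WP.asg (ev1 _) ?_)))))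
  refine WP.for B (fun j σ' => σ'.var .h = ((2 ^ (j + 1) : ℕ) : ℝ) ∧
    |σ'.var .C - Real.cos (Real.pi / 2 ^ (j + 1))| ≤ 32 / 2 ^ w ∧
    |σ'.var .S - Real.sin (Real.pi / 2 ^ (j + 1))| ≤ 300 / 2 ^ w ∧
    Close σ' .rr .ri root (2 ^ (j + 1)) (1000 * ((j + 1 : ℕ) : ℝ) / 2 ^ w)) hw0 hKM ?_ ?_ ?_ ?_
  · have := Nat.lt_two_pow_self (n := k); omega
  · refine ⟨by simp [Sto.setVar_var], ?_, ?_, ?_⟩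
    · simp [Sto.setVar_var]; positivity
    · simp [Sto.setVar_var]; positivity
    · intro i hi
      have : i = 0 ∨ i = 1 := by omega
      have h0 : (0 : ℝ) ≤ 1000 * ((0 + 1 : ℕ) : ℝ) / 2 ^ w := by positivity
      rcases this with rfl | rfl
      · rw [root_zero]
        refine le_trans (le_of_eq ?_) h0
        rw [norm_eq_zero, sub_eq_zero]
        apply Complex.ext <;> simp [cplx, Sto.setArr_arr]
      · rw [root_one]
        refine le_trans (le_of_eq ?_) h0
        rw [norm_eq_zero, sub_eq_zero]
        apply Complex.ext <;> simp [cplx, Sto.setArr_arr]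
  · rintro j hj σ' hf - ⟨i1, i2, i3, i4⟩
    have hpow2 : 2 ^ (j + 1) ≤ 2 ^ (k - 1) := Nat.pow_le_pow_right (by norm_num) (by omega)
    have hej : 1000 * ((j + 1 : ℕ) : ℝ) / 2 ^ w ≤ 1 := by
      rw [div_le_one (by positivity)]
      have : ((j + 1 : ℕ) : ℝ) ≤ k := by exact_mod_cast (by omega : j + 1 ≤ k)
      linarith
    refine WP.cost (WP.seq (WP.mono (extend_wp C (by omega) hw i1 rfl i2 i3 hej i4) le_rfl
      fun σ1 hf1 h1 => WP.seq (half_wp hw (θ := Real.pi / 2 ^ (j + 1)) (by positivity)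
        (div_le_div_of_nonneg_left Real.pi_pos.le (by norm_num) ?_) ?_ ?_ _ fun σ2 hf2 h2 h3 =>
        WP.asg (Ev.mulN hw0 (i := 2 ^ (j + 1)) (Ev.vN ?_) (Ev.two hw0) ?_) ⟨?_, ?_, ?_, ?_⟩)))
      (T := (2 ^ (j + 1) * 60 + 3) + (20 + 4)) (by omega)
    · calc (2 : ℝ) = 2 ^ 1 := (pow_one _).symm
        _ ≤ 2 ^ (j + 1) := pow_le_pow_right₀ (by norm_num) (by omega)
    · rw [hf1.var _ (by decide)]; exact i2
    · rw [hf1.var _ (by decide)]; exact i3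
    · rw [hf2.var _ (by decide), hf1.var _ (by decide)]; exact i1
    · omega
    · simp [Sto.setVar_var, pow_succ]
    · have e : Real.pi / 2 ^ (j + 1 + 1) = Real.pi / 2 ^ (j + 1) / 2 := by rw [pow_succ 2 (j + 1)]; field_simp
      rw [e]; exact h2
    · have e : Real.pi / 2 ^ (j + 1 + 1) = Real.pi / 2 ^ (j + 1) / 2 := by rw [pow_succ 2 (j + 1)]; field_simp
      rw [e]; exact h3
    · have e : 1000 * ((j + 1 + 1 : ℕ) : ℝ) / 2 ^ w = 1000 * ((j + 1 : ℕ) : ℝ) / 2 ^ w + 1000 / 2 ^ w := by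
        push_cast; ring
      rw [e]
      exact h1.congr (hf2.arr _ (by decide)) (hf2.arr _ (by decide))
  · rintro σ' - ⟨-, -, -, h⟩
    have : k - 1 + 1 = k := by omega
    rwa [this] at h

end Roots

/-! ### Parameters -/

/-- The parameters of a run: lengths, the number `A` of levels, the window `2 ^ ν`, the denominator
`2 ^ lam` of the random word, the size `2 ^ k` of the transforms, the number of trials, the exponent. -/
structure Par where
  n : ℕ
  m : ℕ
  U : ℕ
  A : ℕ
  ν : ℕ
  lam : ℕ
  k : ℕ
  R : ℕ
  p : ℝ

namespace Par

def N (P : Par) : ℕ := 2 ^ P.ν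
def M (P : Par) : ℕ := 4 * P.N
def Lam (P : Par) : ℕ := 2 ^ P.lam
def L (P : Par) : ℕ := 2 ^ P.k

/-- The values of the program variables that stay constant after the setup. -/
def val (P : Par) : Var → ℝ
  | .n => P.n
  | .m => P.m
  | .U => P.U
  | .p => P.p
  | .A => P.A
  | .N => P.N
  | .M => P.M
  | .LAM => P.Lam
  | .K => P.k
  | .KM => ((P.k - 1 : ℕ) : ℝ)
  | .L => P.L
  | .R => P.R
  | .NM => ((P.n - P.m + 1 : ℕ) : ℝ)
  | .NMm => ((P.n - P.m + 1 + P.m : ℕ) : ℝ)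
  | .SZ => (((P.n + P.L) * P.M : ℕ) : ℝ)
  | .LM => ((P.L * P.M : ℕ) : ℝ)
  | .Wd => ((2 * P.N - 1 : ℕ) : ℝ)
  | _ => 0

end Par

def constVars : List Var :=
  [.n, .m, .U, .p, .A, .N, .M, .LAM, .K, .KM, .L, .R, .NM, .NMm, .SZ, .LM, .Wd]

/-- The constant variables have their values. -/
def Vals (P : Par) (σ : Sto) : Prop := ∀ x ∈ constVars, σ.var x = P.val x

theorem Vals.frame {P : Par} {σ σ' : Sto} (h : Vals P σ) {c : Pg} (hf : Frame c σ σ')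
    (hc : ∀ x ∈ constVars, x ∉ c.mv := by decide) : Vals P σ' := fun x hx => by
  rw [hf.var x (hc x hx)]; exact h x hx

theorem Vals.congr {P : Par} {σ σ' : Sto} (h : Vals P σ) (hv : σ'.var = σ.var) : Vals P σ' :=
  fun x hx => by rw [hv]; exact h x hx

theorem Vals.set {P : Par} {σ : Sto} (h : Vals P σ) {y : Var} (v : ℝ)
    (hc : ∀ x ∈ constVars, x ≠ y := by decide) : Vals P (σ.setVar y v) := fun x hx => by
  rw [Sto.setVar_ne _ _ (hc x hx)]; exact h x hx

/-- The parameters fit into the memory, and into words: all of them are at most `Θ`, and `Θ ^ 30`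
is at most `2 ^ w`. -/
structure Good (w Z : ℕ) (P : Par) (Θ : ℝ) : Prop where
  hw : 0 < w
  hZ : 16 * Z ≤ 2 ^ w
  hSZ : (P.n + P.L) * P.M ≤ Z
  hm : 1 ≤ P.m
  hmn : P.m ≤ P.n
  h2m : 2 * P.m ≤ P.L
  p0 : 0 < P.p
  p1 : P.p ≤ 1
  Θ0 : 1000 ≤ Θ
  Θw : Θ ^ 30 ≤ 2 ^ w
  Θn : (P.n : ℝ) ≤ Θ
  ΘA : (2 : ℝ) ^ P.A ≤ Θ
  ΘM : (P.M : ℝ) ≤ Θ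
  ΘLam : (P.Lam : ℝ) ≤ Θ
  ΘL : (P.L : ℝ) ≤ Θ

section Level

variable {w : ℕ} {ω : ℕ → Fin (2 ^ w)} {Z : ℕ} {σ : Sto} {P : Par} {Θ : ℝ}

namespace Good

theorem ctx (h : Good w Z P Θ) : Ctx w Z P.k := by
  refine ⟨h.hw, h.hZ, ?_⟩
  have h1 := h.hSZ
  have h2 : 1 ≤ P.M := by unfold Par.M Par.N; have := Nat.two_pow_pos P.ν; omega
  have h3 : P.L = 2 ^ P.k := rfl
  nlinarith

theorem pow_le (h : Good w Z P Θ) {j : ℕ} (hj : j ≤ 30) : Θ ^ j ≤ 2 ^ w :=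
  (pow_le_pow_right₀ (by linarith [h.Θ0]) hj).trans h.Θw

theorem nat_le (h : Good w Z P Θ) {j x : ℕ} (hj : j ≤ 30) (hx : (x : ℝ) ≤ Θ ^ j) : x ≤ 2 ^ w := by
  have := hx.trans (h.pow_le hj)
  exact_mod_cast this

theorem N_pos (_ : Good w Z P Θ) : 0 < P.N := Nat.two_pow_pos _
theorem M_pos (_ : Good w Z P Θ) : 0 < P.M := by unfold Par.M Par.N; have := Nat.two_pow_pos P.ν; omega
theorem Lam_pos (_ : Good w Z P Θ) : 0 < P.Lam := Nat.two_pow_pos _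
theorem L_pos (_ : Good w Z P Θ) : 0 < P.L := Nat.two_pow_pos _

theorem ΘN (h : Good w Z P Θ) : (4 * P.N : ℝ) ≤ Θ := by
  have := h.ΘM
  unfold Par.M at this
  push_cast at this
  exact this

theorem Zw (h : Good w Z P Θ) : Z ≤ 2 ^ w := by have := h.hZ; omega

end Good

/-- An exact operation on integers. -/
theorem Ev.binZ (hw : 0 < w) {o : BinOp} {a b : Ex} {x y : ℝ} (z : ℤ) (ha : Ev w Z σ a x)
    (hb : Ev w Z σ b y) (hd : o.Defined x y) (he : o.eval x y = z)
    (hz : |(z : ℝ)| ≤ 2 ^ w) : Ev w Z σ (.bin o a b) (z : ℝ) :=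
  (Ev.binD hw z 0 ha hb hd (by simp [he]) hz (Nat.zero_le _)).cast (by simp)

theorem floor_int_div (x : ℤ) (y : ℕ) : ⌊(x : ℝ) / (y : ℝ)⌋ = x / (y : ℤ) := by
  rw [Int.floor_div_natCast, Int.floor_intCast]

/-! ### Hashing a symbol -/

def cellPg : Pg :=
  .asg .z (.var .beta * .var .vh) ;;
  .asg .ce (.flr ((.var .z - .flr (.var .z)) * .var .M))

/-- The multiplier is a dyadic fraction and the symbol an integer, so the product, its fractional
part and the scaled fractional part all have short numerators. The machine computes the cell
exactly, which the combinatorial analysis of collisions relies on. -/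
theorem cell_wp (H : Good w Z P Θ) (hV : Vals P σ) {b : ℕ} {v : ℤ} (hb : b ≤ 2 * P.Lam)
    (hbeta : σ.var .beta = (b : ℝ) / 2 ^ (P.ν + P.lam + 2)) (hvh : σ.var .vh = v)
    (hv : |(v : ℝ)| ≤ 2 * Θ) (Q : Sto → Prop)
    (hQ : ∀ σ', Frame cellPg σ σ' → σ'.arr = σ.arr → σ'.var .ce = ((cell P.N P.Lam b v).toNat : ℝ) →
      (cell P.N P.Lam b v).toNat < P.M → Q σ') :
    WP w ω Z cellPg 12 σ Q := by
  have hw := H.hw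
  have hN := H.N_pos
  have hL := H.Lam_pos
  have Θ0 := H.Θ0
  have hQ4 : 4 * P.N * P.Lam = 2 ^ (P.ν + P.lam + 2) := by unfold Par.N Par.Lam; ring
  set J := P.ν + P.lam + 2 with hJ
  have hΘ2 : ((4 * P.N * P.Lam : ℕ) : ℝ) ≤ Θ ^ 2 := by
    push_cast
    rw [sq]; exact mul_le_mul H.ΘN H.ΘLam (by positivity) (by linarith)
  have hJw : J ≤ 2 ^ w := by
    have h1 := H.nat_le (by norm_num) hΘ2
    rw [hQ4] at h1
    have := Nat.lt_two_pow_self (n := J)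
    omega
  have hbv : |((b * v : ℤ) : ℝ)| ≤ Θ ^ 3 := by
    push_cast
    rw [abs_mul, Nat.abs_cast]
    have h1 : (b : ℝ) ≤ 2 * Θ := by
      have : (b : ℝ) ≤ 2 * P.Lam := by exact_mod_cast hb
      linarith [H.ΘLam]
    calc (b : ℝ) * |(v : ℝ)| ≤ (2 * Θ) * (2 * Θ) := by gcongr
      _ = 4 * Θ ^ 2 := by ring
      _ ≤ Θ * Θ ^ 2 := by gcongr; linarith
      _ = Θ ^ 3 := by ring
  have hbw : |((b * v : ℤ) : ℝ)| ≤ 2 ^ w := hbv.trans (H.pow_le (by norm_num))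
  have e1 : Ev w Z σ (.var .beta * .var .vh) (((b * v : ℤ) : ℝ) / 2 ^ J) :=
    Ev.binD hw (o := .mul) (b * v) J (Ev.v hbeta) (Ev.v hvh) trivial
      (by simp only [BinOp.eval]; push_cast; ring) hbw hJw
  set σ1 := σ.setVar .z (((b * v : ℤ) : ℝ) / 2 ^ J)
  set Q' : ℤ := ((4 * P.N * P.Lam : ℕ) : ℤ) with hQ'
  have hQ'0 : 0 < Q' := by rw [hQ', hQ4]; positivity
  have hQr : (2 : ℝ) ^ J = ((2 ^ J : ℕ) : ℝ) := by push_cast; rfl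
  have ez : ⌊((b * v : ℤ) : ℝ) / 2 ^ J⌋ = (b * v) / Q' := by
    rw [hQr, floor_int_div, hQ', hQ4]
  have e2 : Ev w Z σ1 (.flr (.var .z)) (((b * v) / Q' : ℤ) : ℝ) := by
    refine Ev.flr_int hw (Ev.v rfl) ez (le_trans ?_ hbw)
    rw [← Int.cast_abs, ← Int.cast_abs]
    exact_mod_cast Int.abs_ediv_le_abs _ _
  have hmod := Int.emod_add_mul_ediv (b * v) Q'
  have hmod0 := Int.emod_nonneg (b * v) hQ'0.ne'
  have hmod1 := Int.emod_lt_of_pos (b * v) hQ'0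
  have hmodR : ((b * v : ℤ) : ℝ) = ((b * v % Q' : ℤ) : ℝ) + 2 ^ J * (((b * v) / Q' : ℤ) : ℝ) := by
    have : (Q' : ℝ) = 2 ^ J := by rw [hQ', hQ4]; push_cast; rfl
    rw [← this]
    exact_mod_cast hmod.symm
  have hmw : |((b * v % Q' : ℤ) : ℝ)| ≤ 2 ^ w := by
    rw [abs_of_nonneg (by exact_mod_cast hmod0)]
    have : ((b * v % Q' : ℤ) : ℝ) ≤ (Q' : ℝ) := by exact_mod_cast hmod1.le
    refine this.trans (le_trans ?_ (H.pow_le (j := 2) (by norm_num)))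
    rw [hQ']; exact_mod_cast hΘ2
  have e3 : Ev w Z σ1 (.var .z - .flr (.var .z)) (((b * v % Q' : ℤ) : ℝ) / 2 ^ J) :=
    Ev.binD hw (o := .sub) (b * v % Q') J (Ev.v rfl) e2 trivial
      (by
        change ((b * v : ℤ) : ℝ) / 2 ^ J - _ = _
        rw [hmodR]; field_simp; ring) hmw hJw
  -- The denominator 2^J is 4NΛ and M is 4N, so multiplying by M turns the residue over 4NΛ into the
  -- residue over Λ, whose floor is the cell.
  have e4 : Ev w Z σ1 ((.var .z - .flr (.var .z)) * .var .M) (((b * v % Q' : ℤ) : ℝ) / 2 ^ P.lam) :=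
    Ev.binD hw (o := .mul) (b * v % Q') P.lam e3 (Ev.v (hV .M (by decide))) trivial
      (by
        have : (2 : ℝ) ^ J = 2 ^ P.ν * 2 ^ P.lam * 4 := by rw [hJ]; ring
        have h2 : P.val .M = 4 * 2 ^ P.ν := by
          change ((P.M : ℕ) : ℝ) = _
          unfold Par.M Par.N; push_cast; rfl
        simp only [BinOp.eval]
        rw [h2, this]; field_simp) hmw (by omega)
  have c0 := cell_nonneg P.N P.Lam b (Nat.mul_pos hN hL) v
  have c1 := cell_lt P.N P.Lam b hN hL v
  have hce : (cell P.N P.Lam b v).toNat < P.M := by unfold Par.M; omega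
  have e5 : Ev w Z σ1 (.flr ((.var .z - .flr (.var .z)) * .var .M)) ((cell P.N P.Lam b v).toNat : ℝ) := by
    refine Ev.flrN hw e4 ?_ ?_
    · have : (2 : ℝ) ^ P.lam = ((P.Lam : ℕ) : ℝ) := by unfold Par.Lam; push_cast; rfl
      rw [this, floor_int_div, Int.toNat_of_nonneg c0]; rfl
    · refine H.nat_le (j := 1) (by norm_num) ?_
      rw [pow_one]
      refine le_trans ?_ H.ΘM
      exact_mod_cast hce.le
  have key : WP w ω Z cellPg 12 σ (fun σ' => σ'.arr = σ.arr ∧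
      σ'.var .ce = ((cell P.N P.Lam b v).toNat : ℝ)) :=
    WP.cost (WP.seq (WP.asg e1 (WP.asg e5 ⟨rfl, rfl⟩))) (by decide)
  exact key.mono le_rfl fun σ' hf h => hQ σ' hf h.1 h.2 hce

/-! ### Weights -/

def absPg (x : Var) : Pg := .ite (.var x) (.lit 0) (.asg x (.lit 0 - .var x)) .skip

theorem abs_wp (hw : 0 < w) {x : Var} {v : ℤ} (hx : σ.var x = v) (hv : |(v : ℝ)| ≤ 2 ^ w) (Q : Sto → Prop)
    (hQ : ∀ σ', Frame (absPg x) σ σ' → σ'.arr = σ.arr → σ'.var x = (v.natAbs : ℝ) → Q σ') :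
    WP w ω Z (absPg x) 10 σ Q := by
  have key : WP w ω Z (absPg x) 10 σ (fun σ' => σ'.arr = σ.arr ∧ σ'.var x = (v.natAbs : ℝ)) := by
    refine WP.cost (WP.ite (T := 4) (Ev.v hx) (Ev.zero hw) (fun h => ?_) (fun h => ?_)) (by simp only [Ex.cost]; omega)
    · have h0 : v < 0 := by exact_mod_cast h
      refine WP.cost (WP.asg (v := ((v.natAbs : ℤ) : ℝ)) (Ev.binZ hw (o := .sub) v.natAbs (Ev.zero hw)
        (Ev.v hx) trivial ?_ ?_) ⟨rfl, ?_⟩) (le_of_eq rfl)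
      · have : ((v.natAbs : ℕ) : ℤ) = -v := by omega
        rw [this]; simp [BinOp.eval]
      · rw [Int.cast_natCast, Nat.cast_natAbs, abs_of_nonneg (by positivity)]
        push_cast; exact hv
      · simp
    · have h0 : 0 ≤ v := by exact_mod_cast not_lt.mp h
      refine WP.cost (WP.skip ⟨rfl, ?_⟩) (by norm_num)
      rw [hx]
      have : ((v.natAbs : ℕ) : ℤ) = v := by omega
      have h1 : (((v.natAbs : ℕ) : ℤ) : ℝ) = (v : ℝ) := by rw [this]
      rw [← h1, Int.cast_natCast]
  exact key.mono le_rfl fun σ' hf h => hQ σ' hf h.1 h.2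

/-- The least distance in blocks of size `g`. -/
def distPg (e d : Var) (g : Ex) : Pg :=
  .ite (.var d) (.lit 1) (.asg e (.lit 0)) (.asg e ((.var d - .lit 1) * g + .lit 1))

theorem dist_wp (hw : 0 < w) {e d : Var} {g : Ex} {a D : ℕ} (hd : σ.var d = D)
    (hg : Ev w Z σ g ((2 ^ a : ℕ) : ℝ)) (hb : 2 ^ a * D ≤ 2 ^ w) (hD : D ≤ 2 ^ w) (Q : Sto → Prop)
    (hQ : ∀ σ', Frame (distPg e d g) σ σ' → σ'.arr = σ.arr → σ'.var e = (blockDist a D : ℝ) → Q σ') :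
    WP w ω Z (distPg e d g) (10 + g.cost) σ Q := by
  have key : WP w ω Z (distPg e d g) (10 + g.cost) σ
      (fun σ' => σ'.arr = σ.arr ∧ σ'.var e = (blockDist a D : ℝ)) := by
    have hcost : ∀ x : ℕ, (Ex.var d).cost + (Ex.lit 1).cost + x + 1 = x + 3 := fun x => by
      simp only [Ex.cost]; omega
    have hcost2 : ((Ex.var d - Ex.lit 1) * g + Ex.lit 1).cost = g.cost + 6 := by
      change 1 + 1 + 1 + g.cost + 1 + 1 + 1 = _
      omega
    refine WP.cost (WP.ite (T := 7 + g.cost) (Ev.vN hd) (Ev.one hw) (fun h => ?_) (fun h => ?_))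
      (by rw [hcost]; omega)
    · have h0 : D = 0 := by
        have : D < 1 := by exact_mod_cast h
        omega
      refine WP.cost (WP.asg (Ev.zero hw) ⟨rfl, ?_⟩) (by simp only [Ex.cost]; omega)
      simp [h0, blockDist]
    · have h0 : 1 ≤ D := by
        have : ¬ D < 1 := by exact_mod_cast h
        omega
      obtain ⟨D', rfl⟩ := Nat.exists_eq_add_of_le' h0
      have h2 := Nat.two_pow_pos a
      have h3 : D' * 2 ^ a + 1 ≤ 2 ^ w := by
        rw [mul_add] at hb
        have := mul_comm D' (2 ^ a)
        omega
      refine WP.cost (WP.asg (Ev.addN hw (Ev.mulN hw (Ev.subN hw (Ev.vN hd) (Ev.one hw) h0 hD) hg ?_)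
        (Ev.one hw) ?_) ⟨rfl, ?_⟩) (by rw [hcost2]; omega)
      · rw [Nat.add_sub_cancel]; omega
      · rw [Nat.add_sub_cancel]; exact h3
      · simp [blockDist, mul_comm]
  exact key.mono le_rfl fun σ' hf h => hQ σ' hf h.1 h.2

end Level

/-! ### The weights of the symbols near a text symbol -/

def weightPg : Pg :=
  .asg .d (.get .txt (.var .i) - .var .vh) ;; absPg .d ;;
  .asg .dd (.flr (.get .txt (.var .i) / .lit 2) - .flr (.var .vh / .lit 2)) ;; absPg .dd ;;
  distPg .e1 .d (.var .G) ;; distPg .e2 .dd (.lit 2 * .var .G) ;;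
  .asg .t1 (.bin .pow (.var .e1) (.var .p) - .bin .pow (.var .e2) (.var .p))

def scatterBody : Pg :=
  .asg .vh (.get .txt (.var .i) + (.var .j - (.var .N - .lit 1))) ;;
  cellPg ;; weightPg ;;
  .put .W (.var .i * .var .M + .var .ce) (.get .W (.var .i * .var .M + .var .ce) + .var .t1)

def zeroPg (k : Arr) (y : Var) : Pg := forL .x y (.put k (.var .x) (.lit 0))

def scatterPg : Pg := zeroPg .W .SZ ;; forL .i .n (forL .j .Wd scatterBody)

section Scatter

variable {w : ℕ} {ω : ℕ → Fin (2 ^ w)} {Z : ℕ} {σ : Sto} {P : Par} {Θ : ℝ}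

/-- All numerical constants are absorbed in this way: a factor up to 1000 costs one power of Θ. -/
theorem Good.bump (H : Good w Z P Θ) {c : ℝ} (hc : c ≤ 1000) (j : ℕ) : c * Θ ^ j ≤ Θ ^ (j + 1) := by
  have := H.Θ0
  rw [pow_succ', ]
  gcongr; linarith

theorem Good.pow_mono (H : Good w Z P Θ) {i j : ℕ} (h : i ≤ j) : Θ ^ i ≤ Θ ^ j :=
  pow_le_pow_right₀ (by linarith [H.Θ0]) h

theorem Good.Θpos (H : Good w Z P Θ) : 0 < Θ := by linarith [H.Θ0]

theorem rpow_le_max {x p B : ℝ} (hx : 0 ≤ x) (hp0 : 0 < p) (hp1 : p ≤ 1) (hB : 1 ≤ B) (hxB : x ≤ B) :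
    x ^ p ≤ B :=
  calc x ^ p ≤ B ^ p := Real.rpow_le_rpow hx hxB hp0.le
    _ ≤ B ^ (1 : ℝ) := Real.rpow_le_rpow_of_exponent_le hB hp1
    _ = B := Real.rpow_one B

theorem Ev.pow_ap {a b : Ex} {x p B : ℝ} (ha : Ev w Z σ a x) (hb : Ev w Z σ b p) (hx : 0 ≤ x)
    (hp0 : 0 < p) (hp1 : p ≤ 1) (hB : 1 ≤ B) (hxB : x ≤ B) (hBw : B ≤ 2 ^ w) :
    Ap w Z σ (.bin .pow a b) (x ^ p) ((B + 1) / 2 ^ w) := by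
  have h1 := rpow_le_max hx hp0 hp1 hB hxB
  have h0 : 0 ≤ x ^ p := Real.rpow_nonneg hx p
  have hd : BinOp.pow.Defined x p := by
    rcases hx.eq_or_lt with h | h
    · exact Or.inr ⟨h.symm, hp0⟩
    · exact Or.inl h
  have := Ev.bin_ap (o := .pow) (t := x ^ p) (d := 0) (B := B) ha hb hd
    (by change |x ^ p - x ^ p| ≤ 0; simp) (by rw [abs_of_nonneg h0]; linarith) hBw
  rwa [zero_add] at this

/-- The neighbour v of a text symbol may be negative; the halvings are floors of exact dyadic
quotients and agree with integer division there too. Only the powers and their difference are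
rounded. -/
theorem weight_wp (H : Good w Z P Θ) (hV : Vals P σ) {i a x : ℕ} {v : ℤ} (hi : i < P.n)
    (hvi : σ.var .i = i) (hvh : σ.var .vh = v) (hG : σ.var .G = ((2 ^ a : ℕ) : ℝ)) (ha : a < P.A)
    (htxt : σ.arr .txt i = x) (hx : x < 2 ^ P.A) (hv : ((x : ℤ) - v).natAbs < P.N) (Q : Sto → Prop)
    (hQ : ∀ σ', Frame weightPg σ σ' → σ'.arr = σ.arr →
      |σ'.var .t1 - weight P.p a x v| ≤ Θ ^ 3 / 2 ^ w → |weight P.p a x v| ≤ Θ ^ 2 → Q σ') :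
    WP w ω Z weightPg 90 σ Q := by
  have hw := H.hw
  have Θ0 := H.Θ0
  have hiZ : i < Z := by
    have h1 := H.hSZ
    have h2 := H.M_pos
    have h3 : i < P.n + P.L := by omega
    nlinarith
  have hNr := H.ΘN
  set D := ((x : ℤ) - v).natAbs with hD
  set DD := ((x : ℤ) / 2 - v / 2).natAbs with hDD
  have hhalf := half_dist (x : ℤ) v
  rw [← hD, ← hDD] at hhalf
  have h2A : (2 : ℝ) ^ (a + 1) ≤ Θ := (pow_le_pow_right₀ (by norm_num) ha).trans H.ΘA
  have hDr : ((D + 1 : ℕ) : ℝ) ≤ P.N := by exact_mod_cast hv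
  have hb2 : ((2 ^ (a + 1) * (D + 1) : ℕ) : ℝ) ≤ Θ ^ 2 := by
    push_cast
    rw [sq]
    push_cast at hDr
    gcongr
    linarith
  have hb1 : ((2 ^ a * D : ℕ) : ℝ) ≤ Θ ^ 2 := by
    refine le_trans ?_ hb2
    have : 2 ^ a * D ≤ 2 ^ (a + 1) * (D + 1) := by gcongr <;> omega
    exact_mod_cast this
  have hb3 : ((2 ^ (a + 1) * DD : ℕ) : ℝ) ≤ Θ ^ 2 := by
    refine le_trans ?_ hb2
    have : 2 ^ (a + 1) * DD ≤ 2 ^ (a + 1) * (D + 1) := by gcongr; omega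
    exact_mod_cast this
  have hD1 : ((D + 1 : ℕ) : ℝ) ≤ Θ := by linarith
  have hDw : D + 1 ≤ 2 ^ w := H.nat_le (j := 1) (by norm_num) (by rwa [pow_one])
  have hxr : (x : ℝ) ≤ Θ := by
    refine le_trans ?_ H.ΘA
    exact_mod_cast hx.le
  have hxw : (x : ℝ) ≤ 2 ^ w := by
    have := H.pow_le (j := 1) (by norm_num)
    rw [pow_one] at this
    linarith
  have hvr : |(v : ℝ)| ≤ 2 ^ w := by
    have h1 : |v| ≤ ((x + D : ℕ) : ℤ) := by rw [Int.abs_eq_natAbs]; omega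
    have h2 : |(v : ℝ)| ≤ ((x + D : ℕ) : ℝ) := by
      have : ((|v| : ℤ) : ℝ) ≤ (((x + D : ℕ) : ℤ) : ℝ) := by exact_mod_cast h1
      simpa using this
    push_cast at h2 hD1
    have h3 := H.pow_le (j := 2) (by norm_num)
    nlinarith
  have habsZ : ∀ z : ℤ, |(z : ℝ)| = (z.natAbs : ℝ) := fun z => by rw [Nat.cast_natAbs, Int.cast_abs]
  -- the distance
  have e1 : Ev w Z σ (.get .txt (.var .i)) (x : ℝ) := by
    rw [← htxt]; exact Ev.getN (Ev.vN hvi) hiZ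
  have e2 : Ev w Z σ (.get .txt (.var .i) - .var .vh) (((x : ℤ) - v : ℤ) : ℝ) :=
    Ev.binZ hw (o := .sub) ((x : ℤ) - v) e1 (Ev.v hvh) trivial (by simp [BinOp.eval])
      (by
        rw [habsZ]
        have : D ≤ 2 ^ w := by omega
        exact_mod_cast this)
  have h0 := weight_nonneg H.p0 a x v
  suffices key : WP w ω Z weightPg 90 σ
      (fun σ' => σ'.arr = σ.arr ∧ |σ'.var .t1 - weight P.p a x v| ≤ Θ ^ 3 / 2 ^ w) by
    refine key.mono le_rfl fun σ' hf h => hQ σ' hf h.1 h.2 ?_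
    rw [abs_of_nonneg h0]
    have hx1 : ((blockDist a D : ℕ) : ℝ) ≤ Θ ^ 2 :=
      le_trans (by exact_mod_cast blockDist_le a D) hb1
    have b1 := rpow_le_max (Nat.cast_nonneg (blockDist a D)) H.p0 H.p1 (one_le_pow₀ (by linarith)) hx1
    have b20 : (0 : ℝ) ≤ (blockDist (a + 1) DD : ℝ) ^ P.p := by positivity
    have hwt : weight P.p a x v = (blockDist a D : ℝ) ^ P.p - (blockDist (a + 1) DD : ℝ) ^ P.p := rfl
    linarith
  refine WP.cost (WP.seq (T₁ := 9) (WP.cost (WP.asg e2 ?_) (by decide))) (T := 9 + (10 + (20 + (10 + (11 + (14 + 8)))))) (by norm_num)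
  set σ1 := σ.setVar .d (((x : ℤ) - v : ℤ) : ℝ) with hσ1
  refine WP.seq (abs_wp hw (v := (x : ℤ) - v) rfl (by
    rw [habsZ]
    have : D ≤ 2 ^ w := by omega
    exact_mod_cast this) _ ?_)
  intro σ2 hf2 ha2 hd2
  have hvi2 : σ2.var .i = i := by rw [hf2.var _ (by decide)]; exact hvi
  have hvh2 : σ2.var .vh = v := by rw [hf2.var _ (by decide)]; exact hvh
  have e3 : Ev w Z σ2 (.get .txt (.var .i)) (x : ℝ) := by
    rw [← htxt]
    have := Ev.getN (w := w) (k := .txt) (Ev.vN hvi2) hiZ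
    rwa [ha2] at this
  have h2w : (2 : ℝ) ≤ 2 ^ w := by
    calc (2 : ℝ) = 2 ^ 1 := (pow_one _).symm
      _ ≤ 2 ^ w := pow_le_pow_right₀ (by norm_num) hw
  have half : ∀ {e : Ex} {z : ℤ}, Ev w Z σ2 e z → |(z : ℝ)| ≤ 2 ^ w →
      Ev w Z σ2 (.flr (e / .lit 2)) ((z / 2 : ℤ) : ℝ) := by
    intro e z he hz
    have h1 : Ev w Z σ2 (e / .lit 2) ((z : ℝ) / 2 ^ 1) :=
      Ev.binD hw (o := .div) z 1 he (Ev.two hw) (by change ((2 : ℕ) : ℝ) ≠ 0; norm_num)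
        (by simp [BinOp.eval]) hz Nat.one_le_two_pow
    refine Ev.flr_int hw h1 ?_ ?_
    · have := floor_int_div z 2
      simpa using this
    · rw [← Int.cast_abs] at hz ⊢
      refine le_trans ?_ hz
      exact_mod_cast Int.abs_ediv_le_abs _ _
  have e4 : Ev w Z σ2 (.flr (.get .txt (.var .i) / .lit 2) - .flr (.var .vh / .lit 2))
      (((x : ℤ) / 2 - v / 2 : ℤ) : ℝ) :=
    Ev.binZ hw (o := .sub) _ (half (z := (x : ℤ)) e3 (by simpa using hxw)) (half (Ev.v hvh2) hvr) trivial
      (by simp [BinOp.eval])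
      (by
        rw [habsZ]
        have : DD ≤ 2 ^ w := by omega
        exact_mod_cast this)
  refine WP.seq (T₁ := 20) (WP.cost (WP.asg e4 ?_) (by decide))
  set σ3 := σ2.setVar .dd (((x : ℤ) / 2 - v / 2 : ℤ) : ℝ) with hσ3
  refine WP.seq (abs_wp hw (v := (x : ℤ) / 2 - v / 2) rfl (by
    rw [habsZ]
    have : DD ≤ 2 ^ w := by omega
    exact_mod_cast this) _ ?_)
  intro σ4 hf4 ha4 hd4
  have hd4' : σ4.var .d = (D : ℝ) := by rw [hf4.var _ (by decide)]; exact hd2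
  have hG4 : σ4.var .G = ((2 ^ a : ℕ) : ℝ) := by
    rw [hf4.var _ (by decide)]
    change σ2.var .G = _
    rw [hf2.var _ (by decide)]; exact hG
  refine WP.seq (T₁ := 11) (dist_wp hw (a := a) hd4' (Ev.vN hG4) (H.nat_le (by norm_num) hb1) (by omega) _ ?_)
  intro σ5 hf5 ha5 he5
  have hd5 : σ5.var .dd = (DD : ℝ) := by rw [hf5.var _ (by decide)]; exact hd4
  have hG5 : σ5.var .G = ((2 ^ a : ℕ) : ℝ) := by rw [hf5.var _ (by decide)]; exact hG4
  refine WP.seq (T₁ := 14) (WP.cost (dist_wp hw (a := a + 1) hd5 ?_ (H.nat_le (by norm_num) hb3) (by omega) _ ?_)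
    (by decide))
  · have := Ev.mulN hw (Ev.two (Z := Z) hw) (Ev.vN hG5) (by
      rw [← pow_succ']
      refine H.nat_le (j := 1) (by norm_num) ?_
      push_cast
      rwa [pow_one])
    rwa [← pow_succ'] at this
  intro σ6 hf6 ha6 he6
  have he6' : σ6.var .e1 = (blockDist a D : ℝ) := by rw [hf6.var _ (by decide)]; exact he5
  have hp6 : σ6.var .p = P.p := by
    rw [hf6.var _ (by decide), hf5.var _ (by decide), hf4.var _ (by decide)]
    change σ2.var .p = _
    rw [hf2.var _ (by decide)]
    exact hV .p (by decide)
  have hB1 : (1 : ℝ) ≤ Θ ^ 2 := one_le_pow₀ (by linarith)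
  have hx1 : ((blockDist a D : ℕ) : ℝ) ≤ Θ ^ 2 :=
    le_trans (by exact_mod_cast blockDist_le a D) hb1
  have hx2 : ((blockDist (a + 1) DD : ℕ) : ℝ) ≤ Θ ^ 2 :=
    le_trans (by exact_mod_cast blockDist_le (a + 1) DD) hb3
  have r1 := Ev.pow_ap (w := w) (Z := Z) (Ev.v he6') (Ev.v hp6) (by positivity) H.p0 H.p1 hB1 hx1
    (H.pow_le (by norm_num))
  have r2 := Ev.pow_ap (w := w) (Z := Z) (Ev.v he6) (Ev.v hp6) (by positivity) H.p0 H.p1 hB1 hx2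
    (H.pow_le (by norm_num))
  have b1 := rpow_le_max (Nat.cast_nonneg (blockDist a D)) H.p0 H.p1 hB1 hx1
  have b2 := rpow_le_max (Nat.cast_nonneg (blockDist (a + 1) DD)) H.p0 H.p1 hB1 hx2
  have b10 : (0 : ℝ) ≤ (blockDist a D : ℝ) ^ P.p := by positivity
  have b20 : (0 : ℝ) ≤ (blockDist (a + 1) DD : ℝ) ^ P.p := by positivity
  have bump : 20 * Θ ^ 2 ≤ Θ ^ 3 := H.bump (by norm_num) 2
  have hw3 : Θ ^ 3 ≤ 2 ^ w := H.pow_le (by norm_num)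
  have hu1 : (Θ ^ 2 + 1) / 2 ^ w ≤ 1 := by rw [div_le_one (by positivity)]; linarith
  obtain ⟨v1, ev1, hv1⟩ := Ap.sub r1 r2 (B := 5 * Θ ^ 2)
    (by rw [abs_of_nonneg b10, abs_of_nonneg b20]; linarith) (by linarith)
  have hwt : weight P.p a x v = (blockDist a D : ℝ) ^ P.p - (blockDist (a + 1) DD : ℝ) ^ P.p := rfl
  refine WP.cost (WP.asg ev1 ⟨?_, ?_⟩) (by decide)
  · exact ha6.trans (ha5.trans (ha4.trans ha2))
  · change |v1 - _| ≤ _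
    rw [hwt]
    refine hv1.trans ?_
    rw [← add_div, ← add_div]
    gcongr
    linarith

end Scatter

section Scatter

variable {w : ℕ} {ω : ℕ → Fin (2 ^ w)} {Z : ℕ} {σ : Sto} {P : Par} {Θ : ℝ}

/-- The `j`-th symbol in the window around the text symbol `u`. -/
def Par.near (P : Par) (u j : ℕ) : ℤ := u + ((j : ℤ) - (P.N - 1))

/-- The cell of the `j`-th symbol near `u`. -/
def Par.nearCell (P : Par) (b u j : ℕ) : ℕ := (cell P.N P.Lam b (P.near u j)).toNat

/-- What the first `r` symbols near the text symbol `u i` contribute to entry `q` of the weight table. -/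
noncomputable def Par.row (P : Par) (a b : ℕ) (u : ℕ → ℕ) (i r q : ℕ) : ℝ :=
  ∑ j ∈ Finset.range r, if q = i * P.M + P.nearCell b (u i) j
    then weight P.p a (u i) (P.near (u i) j) else 0

/-- What the first `i` text symbols contribute to entry `q` of the weight table. -/
noncomputable def Par.table (P : Par) (a b : ℕ) (u : ℕ → ℕ) (i q : ℕ) : ℝ :=
  ∑ i' ∈ Finset.range i, P.row a b u i' (2 * P.N - 1) q

theorem zero_wp (hw : 0 < w) {k : Arr} {y : Var} {B : ℕ} (hy : σ.var y = B) (hB : B ≤ Z)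
    (hZ : Z ≤ 2 ^ w) (hyx : y ≠ .x) (Q : Sto → Prop)
    (hQ : ∀ σ', Frame (zeroPg k y) σ σ' → (∀ q < B, σ'.arr k q = 0) → Q σ') :
    WP w ω Z (zeroPg k y) (B * 11 + 3) σ Q := by
  have key : WP w ω Z (zeroPg k y) (B * 11 + 3) σ (fun σ' => ∀ q < B, σ'.arr k q = 0) := by
    refine WP.for 6 (fun j σ' => ∀ q < j, σ'.arr k q = 0) hw hy (by omega) (by simp) ?_ ?_ hyx
      (by simp [Pg.mv]) (by simp [Pg.mv])
    · intro j hj σ' hf hx hI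
      refine WP.put (Ev.vN hx) (by omega) (Ev.zero hw) ?_
      intro q hq
      simp only [Sto.setVar_arr, Sto.setArr_arr]
      split_ifs with h
      · rfl
      · have : q ≠ j := fun hh => h ⟨trivial, hh⟩
        exact hI q (by omega)
    · intro σ' _ h
      exact h
  exact key.mono le_rfl fun σ' hf h => hQ σ' hf h

theorem Par.row_succ (P : Par) (a b : ℕ) (u : ℕ → ℕ) (i r q : ℕ) :
    P.row a b u i (r + 1) q = P.row a b u i r q + if q = i * P.M + P.nearCell b (u i) r
      then weight P.p a (u i) (P.near (u i) r) else 0 := by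
  unfold Par.row; rw [Finset.sum_range_succ]

theorem Par.table_succ (P : Par) (a b : ℕ) (u : ℕ → ℕ) (i q : ℕ) :
    P.table a b u (i + 1) q = P.table a b u i q + P.row a b u i (2 * P.N - 1) q := by
  unfold Par.table; rw [Finset.sum_range_succ]

theorem Par.near_dist (P : Par) (u : ℕ) {j : ℕ} (hj : j < 2 * P.N - 1) :
    ((u : ℤ) - P.near u j).natAbs < P.N := by
  unfold Par.near; omega

theorem Good.weight_le (H : Good w Z P Θ) {a x : ℕ} {v : ℤ} (ha : a < P.A)
    (hv : ((x : ℤ) - v).natAbs < P.N) : weight P.p a x v ≤ Θ ^ 2 := by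
  have hb1 : ((2 ^ a * ((x : ℤ) - v).natAbs : ℕ) : ℝ) ≤ Θ ^ 2 := by
    have h2A : (2 : ℝ) ^ a ≤ Θ := (pow_le_pow_right₀ (by norm_num) ha.le).trans H.ΘA
    have : (((x : ℤ) - v).natAbs : ℝ) ≤ P.N := by exact_mod_cast hv.le
    have := H.ΘN
    have := H.Θpos
    push_cast only [Nat.cast_mul, Nat.cast_pow]
    rw [sq]
    push_cast
    gcongr
    linarith
  have hx1 : ((blockDist a ((x : ℤ) - v).natAbs : ℕ) : ℝ) ≤ Θ ^ 2 :=
    le_trans (by exact_mod_cast blockDist_le a _) hb1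
  have b1 := rpow_le_max (Nat.cast_nonneg (blockDist a ((x : ℤ) - v).natAbs)) H.p0 H.p1
    (one_le_pow₀ (by linarith [H.Θ0])) hx1
  have b20 : (0 : ℝ) ≤ (blockDist (a + 1) ((x : ℤ) / 2 - v / 2).natAbs : ℝ) ^ P.p := by positivity
  unfold weight
  linarith

theorem Good.row_bounds (H : Good w Z P Θ) {a : ℕ} (b : ℕ) (u : ℕ → ℕ) (ha : a < P.A) (i q : ℕ) {r : ℕ}
    (hr : r ≤ 2 * P.N - 1) : 0 ≤ P.row a b u i r q ∧ P.row a b u i r q ≤ Θ ^ 3 := by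
  have hΘ := H.Θpos
  constructor
  · refine Finset.sum_nonneg fun j _ => ?_
    split_ifs
    · exact weight_nonneg H.p0 _ _ _
    · exact le_rfl
  · calc P.row a b u i r q ≤ ∑ j ∈ Finset.range r, Θ ^ 2 := by
          refine Finset.sum_le_sum fun j hj => ?_
          split_ifs
          · exact H.weight_le ha (P.near_dist _ ((Finset.mem_range.mp hj).trans_le hr))
          · positivity
      _ = r * Θ ^ 2 := by rw [Finset.sum_const, Finset.card_range, nsmul_eq_mul]
      _ ≤ Θ * Θ ^ 2 := by
          gcongr
          have : (r : ℝ) ≤ 2 * P.N := by exact_mod_cast (by omega : r ≤ 2 * P.N)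
          have := H.ΘN
          have : (0 : ℝ) ≤ P.N := by positivity
          linarith
      _ = Θ ^ 3 := by ring

theorem Good.table_bounds (H : Good w Z P Θ) {a : ℕ} (b : ℕ) (u : ℕ → ℕ) (ha : a < P.A) (q : ℕ) {i : ℕ}
    (hi : i ≤ P.n) : 0 ≤ P.table a b u i q ∧ P.table a b u i q ≤ Θ ^ 4 := by
  have hΘ := H.Θpos
  constructor
  · exact Finset.sum_nonneg fun j _ => (H.row_bounds b u ha j q le_rfl).1
  · calc P.table a b u i q ≤ ∑ j ∈ Finset.range i, Θ ^ 3 :=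
          Finset.sum_le_sum fun j hj => (H.row_bounds b u ha j q le_rfl).2
      _ = i * Θ ^ 3 := by rw [Finset.sum_const, Finset.card_range, nsmul_eq_mul]
      _ ≤ Θ * Θ ^ 3 := by
          gcongr
          refine le_trans ?_ H.Θn
          exact_mod_cast hi
      _ = Θ ^ 4 := by ring

/-- The weight table of a level. -/
theorem scatter_wp (H : Good w Z P Θ) (hV : Vals P σ) {a b : ℕ} {u : ℕ → ℕ} (hb : b ≤ 2 * P.Lam)
    (hbeta : σ.var .beta = (b : ℝ) / 2 ^ (P.ν + P.lam + 2)) (hG : σ.var .G = ((2 ^ a : ℕ) : ℝ))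
    (ha : a < P.A) (htxt : ∀ i < P.n, σ.arr .txt i = u i) (hu : ∀ i, u i < 2 ^ P.A) (Q : Sto → Prop)
    (hQ : ∀ σ', Frame scatterPg σ σ' →
      (∀ q < (P.n + P.L) * P.M, |σ'.arr .W q - P.table a b u P.n q| ≤ Θ ^ 8 / 2 ^ w) → Q σ') :
    WP w ω Z scatterPg ((P.n + P.L) * P.M * 11 + P.n * (2 * P.N * 200) + 100) σ Q := by
  have hw := H.hw
  have hN := H.N_pos
  have hM := H.M_pos
  have hΘ := H.Θpos
  have hSZ := H.hSZ
  have hnSZ : P.n ≤ Z := by nlinarith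
  have hZw := H.Zw
  have hWd : 2 * P.N - 1 ≤ 2 ^ w := by
    refine H.nat_le (j := 1) (by norm_num) ?_
    rw [pow_one]
    refine le_trans ?_ H.ΘM
    exact_mod_cast (by unfold Par.M; omega : 2 * P.N - 1 ≤ P.M)
  -- The error of a single update: at most Θ^3/2^w from the weight, and the rounding of a sum below
  -- 4Θ^4. There are at most Θ^2 updates in total, which leads to the exponent 8.
  set δ := 2 * Θ ^ 5 / 2 ^ w with hδ
  have hδ0 : 0 ≤ δ := by positivity
  set Wd := 2 * P.N - 1 with hWdd
  have hWdr : (Wd : ℝ) ≤ Θ := by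
    refine le_trans ?_ H.ΘM
    exact_mod_cast (by unfold Par.M; omega : 2 * P.N - 1 ≤ P.M)
  have herr : ∀ i j : ℕ, i < P.n → j ≤ Wd → ((i * Wd + j : ℕ) : ℝ) * δ ≤ Θ ^ 8 / 2 ^ w := by
    intro i j hi hj
    have h1 : i * Wd + j ≤ P.n * Wd := by
      calc i * Wd + j ≤ (i + 1) * Wd := by rw [add_mul]; omega
        _ ≤ _ := by gcongr; omega
    have h2 : ((i * Wd + j : ℕ) : ℝ) ≤ Θ * Θ :=
      calc ((i * Wd + j : ℕ) : ℝ) ≤ ((P.n * Wd : ℕ) : ℝ) := by exact_mod_cast h1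
        _ = (P.n : ℝ) * Wd := by push_cast; rfl
        _ ≤ _ := mul_le_mul H.Θn hWdr (by positivity) hΘ.le
    calc ((i * Wd + j : ℕ) : ℝ) * δ ≤ Θ * Θ * δ := by gcongr
      _ = 2 * Θ ^ 7 / 2 ^ w := by rw [hδ]; ring
      _ ≤ Θ ^ 8 / 2 ^ w := by
          have : 2 * Θ ^ 7 ≤ Θ ^ 8 := H.bump (by norm_num) 7
          gcongr
  have hsmall : Θ ^ 8 / 2 ^ w ≤ 1 := by
    rw [div_le_one (by positivity)]; exact H.pow_le (by norm_num)
  suffices key : WP w ω Z scatterPg ((P.n + P.L) * P.M * 11 + P.n * (2 * P.N * 200) + 100) σ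
      (fun σ' => ∀ q < (P.n + P.L) * P.M, |σ'.arr .W q - P.table a b u P.n q| ≤ Θ ^ 8 / 2 ^ w) from
    key.mono le_rfl fun σ' hf h => hQ σ' hf h
  obtain ⟨T, hT⟩ : ∃ T, T = Wd * (150 + 5) + 3 := ⟨_, rfl⟩
  refine WP.cost (T := ((P.n + P.L) * P.M * 11 + 3) + (P.n * (T + 5) + 3)) ?_ ?_
  swap
  · have : T + 5 ≤ 2 * P.N * 200 := by omega
    have := Nat.mul_le_mul_left P.n this
    omega
  refine WP.seq (zero_wp hw (hV .SZ (by decide)) hSZ hZw (by decide) _ ?_)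
  intro σ1 hf1 hz
  have hV1 := hV.frame hf1
  refine WP.for T (fun i σ' => ∀ q < (P.n + P.L) * P.M,
    |σ'.arr .W q - P.table a b u i q| ≤ ((i * Wd : ℕ) : ℝ) * δ) hw (hV1 .n (by decide)) (by omega)
    ?_ ?_ ?_
  · intro q hq
    simp [Par.table, hz q hq]
  · intro i hi σ2 hf2 hvi hI
    have hV2 := hV1.frame hf2
    rw [hT]
    refine WP.for 150 (fun j σ' => ∀ q < (P.n + P.L) * P.M,
      |σ'.arr .W q - (P.table a b u i q + P.row a b u i j q)| ≤ ((i * Wd + j : ℕ) : ℝ) * δ) hw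
      (hV2 .Wd (by decide)) (by exact hWd) ?_ ?_ ?_
    · intro q hq
      simpa [Par.row] using hI q hq
    · intro j hj σ3 hf3 hvj hI3
      have hV3 := hV2.frame hf3
      have hvi3 : σ3.var .i = i := by rw [hf3.var _ (by decide)]; exact hvi
      have htx3 : σ3.arr .txt = σ.arr .txt := by
        rw [hf3.arr _ (by decide), hf2.arr _ (by decide), hf1.arr _ (by decide)]
      have hbe3 : σ3.var .beta = (b : ℝ) / 2 ^ (P.ν + P.lam + 2) := by
        rw [hf3.var _ (by decide), hf2.var _ (by decide), hf1.var _ (by decide)]; exact hbeta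
      have hG3 : σ3.var .G = ((2 ^ a : ℕ) : ℝ) := by
        rw [hf3.var _ (by decide), hf2.var _ (by decide), hf1.var _ (by decide)]; exact hG
      have hNw : P.N ≤ 2 ^ w := by omega
      have hux : (u i : ℝ) ≤ Θ := by
        refine le_trans ?_ H.ΘA
        exact_mod_cast (hu i).le
      have hnr : |(P.near (u i) j : ℝ)| ≤ 2 * Θ := by
        unfold Par.near
        push_cast
        have h1 : (j : ℝ) + 1 ≤ 2 * P.N := by exact_mod_cast (by omega : j + 1 ≤ 2 * P.N)
        have h2 := H.ΘN
        have h3 : (0 : ℝ) ≤ u i := by positivity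
        have h4 : (0 : ℝ) ≤ j := by positivity
        rw [abs_le]
        constructor <;> linarith
      have h2Θ : 2 * Θ ≤ 2 ^ w := by
        have := H.pow_le (j := 2) (by norm_num)
        nlinarith [H.Θ0]
      have e1 : Ev w Z σ3 (.get .txt (.var .i) + (.var .j - (.var .N - .lit 1)))
          ((P.near (u i) j : ℤ) : ℝ) := by
        have g1 : Ev w Z σ3 (.get .txt (.var .i)) (u i : ℝ) := by
          rw [← htxt i hi, ← htx3]
          exact Ev.getN (Ev.vN hvi3) (by omega)
        have g2 : Ev w Z σ3 (.var .j - (.var .N - .lit 1)) (((j : ℤ) - (P.N - 1) : ℤ) : ℝ) := by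
          refine Ev.binZ hw (o := .sub) _ (Ev.vN hvj) (Ev.subN hw (Ev.vN (hV3 .N (by decide))) (Ev.one hw)
            (by omega) hNw) trivial ?_ ?_
          · rw [Nat.cast_sub (by omega)]
            simp [BinOp.eval]
          · rw [abs_le]
            have : ((2 ^ w : ℕ) : ℤ) = 2 ^ w := by push_cast; rfl
            have h1 : -(2 ^ w : ℤ) ≤ (j : ℤ) - (P.N - 1) := by omega
            have h2 : (j : ℤ) - (P.N - 1) ≤ (2 ^ w : ℤ) := by omega
            constructor
            · exact_mod_cast h1
            · exact_mod_cast h2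
        exact Ev.binZ hw (o := .add) _ g1 g2 trivial (by simp [BinOp.eval, Par.near]) (hnr.trans h2Θ)
      refine WP.cost (T := 15 + (12 + (90 + 20))) (WP.seq (WP.cost (WP.asg e1 ?_) (by decide))) (by norm_num)
      set σ4 := σ3.setVar .vh ((P.near (u i) j : ℤ) : ℝ) with hσ4
      have hV4 : Vals P σ4 := hV3.set _
      refine WP.seq (cell_wp H hV4 hb hbe3 rfl hnr _ ?_)
      intro σ5 hf5 ha5 hce5 hceM
      have hV5 := hV4.frame hf5
      refine WP.seq (weight_wp H hV5 (a := a) (x := u i) (v := P.near (u i) j) hi ?_ ?_ ?_ ha ?_ (hu i)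
        (P.near_dist _ (by omega)) _ ?_)
      · rw [hf5.var _ (by decide)]; exact hvi3
      · rw [hf5.var _ (by decide)]; rfl
      · rw [hf5.var _ (by decide)]; exact hG3
      · rw [ha5]
        change σ3.arr .txt i = _
        rw [htx3, htxt i hi]
      intro σ6 hf6 ha6 ht6 hwt6
      have hV6 := hV5.frame hf6
      have harr : σ6.arr .W = σ3.arr .W := by rw [ha6, ha5]; rfl
      have hvi6 : σ6.var .i = i := by rw [hf6.var _ (by decide), hf5.var _ (by decide)]; exact hvi3
      have hce6 : σ6.var .ce = (P.nearCell b (u i) j : ℝ) := by rw [hf6.var _ (by decide)]; exact hce5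
      have hqlt : i * P.M + P.nearCell b (u i) j < (P.n + P.L) * P.M := by
        have : P.nearCell b (u i) j < P.M := hceM
        calc i * P.M + P.nearCell b (u i) j < i * P.M + P.M := Nat.add_lt_add_left this _
          _ = (i + 1) * P.M := by ring
          _ ≤ _ := Nat.mul_le_mul_right _ (by omega)
      have hqw : i * P.M + P.nearCell b (u i) j ≤ 2 ^ w := by omega
      have hiM : i * P.M ≤ 2 ^ w := le_trans (Nat.le_add_right _ _) hqw
      set q0 := i * P.M + P.nearCell b (u i) j with hq0
      have eq0 : Ev w Z σ6 (.var .i * .var .M + .var .ce) ((q0 : ℕ) : ℝ) :=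
        Ev.addN hw (Ev.mulN hw (Ev.vN hvi6) (Ev.vN (hV6 .M (by decide))) hiM) (Ev.vN hce6) hqw
      have hW0 := hI3 q0 hqlt
      have hgW : Ev w Z σ6 (.get .W (.var .i * .var .M + .var .ce)) (σ3.arr .W q0) := by
        rw [← harr]; exact Ev.getN eq0 (by omega)
      have tb := H.table_bounds b u ha q0 hi.le
      have rb := H.row_bounds b u ha i q0 (r := j) (by omega)
      have he0 := herr i j hi (by omega)
      have b1 : 20 * Θ ^ 2 ≤ Θ ^ 3 := H.bump (by norm_num) 2
      have b2 : 20 * Θ ^ 3 ≤ Θ ^ 4 := H.bump (by norm_num) 3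
      have b3 : 20 * Θ ^ 4 ≤ Θ ^ 5 := H.bump (by norm_num) 4
      have b5 : Θ ^ 5 ≤ 2 ^ w := H.pow_le (by norm_num)
      have b0 : (1 : ℝ) ≤ Θ ^ 2 := one_le_pow₀ (by linarith [H.Θ0])
      have hΘ3 : Θ ^ 3 / 2 ^ w ≤ 1 := by rw [div_le_one (by positivity)]; linarith
      obtain ⟨v1, ev1, hv1⟩ := Ap.add (w := w) (Z := Z) (σ := σ6) ⟨_, hgW, hW0⟩ ⟨_, Ev.var σ6 .t1, ht6⟩
        (B := 4 * Θ ^ 4) (by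
          rw [abs_of_nonneg (add_nonneg tb.1 rb.1)]
          linarith) (by linarith)
      refine WP.cost (WP.put eq0 (by omega) ev1 ?_) (by decide)
      intro q hq
      simp only [Sto.setVar_arr, Sto.setArr_arr, P.row_succ, harr, true_and]
      have hmono : ((i * Wd + j : ℕ) : ℝ) * δ ≤ ((i * Wd + (j + 1) : ℕ) : ℝ) * δ := by
        gcongr; omega
      by_cases hqq : q = q0
      · subst hqq
        rw [if_pos rfl, if_pos rfl, ← add_assoc]
        refine hv1.trans ?_
        have : ((i * Wd + (j + 1) : ℕ) : ℝ) * δ = ((i * Wd + j : ℕ) : ℝ) * δ + δ := by push_cast; ring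
        rw [this, add_assoc]
        gcongr
        rw [hδ, ← add_div]
        gcongr
        linarith
      · rw [if_neg hqq, if_neg hqq, add_zero]
        exact (hI3 q hq).trans hmono
    · intro σ3 _ h q hq
      simp only [Sto.setVar_arr]
      rw [P.table_succ]
      refine (h q hq).trans (le_of_eq ?_)
      rw [add_mul, one_mul]
  · intro σ2 _ h q hq
    refine (h q hq).trans ?_
    have hn : 1 ≤ P.n := H.hm.trans H.hmn
    have := herr (P.n - 1) Wd (by omega) le_rfl
    have e : (P.n - 1) * Wd + Wd = P.n * Wd := by
      rw [← Nat.succ_mul]; congr 1; omega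
    rwa [e] at this

end Scatter

/-! ### Correlating one column -/

def loadPat : Pg :=
  forL .x .L (.put .xr (.var .x) (.get .PT (.var .x * .var .M + .var .c)) ;; .put .xi (.var .x) (.lit 0))

def saveB : Pg :=
  forL .x .L (.put .br (.var .x) (.get .xr (.var .x)) ;; .put .bi (.var .x) (.get .xi (.var .x)))

/-- A chunk reads L rows, which may run past the end of the text. The weight table has n + L rows,
so this remains inside the array. -/
def loadText : Pg :=
  forL .x .L (.put .xr (.var .x) (.get .W ((.var .s + .var .x) * .var .M + .var .c)) ;;
    .put .xi (.var .x) (.lit 0))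

/-- The division by L is the one that the inverse transform left out. Only the first m entries of
the cyclic correlation are free of wrap-around, so only these are used. -/
def addAcc : Pg :=
  forL .x .m (.put .acc (.var .s + .var .x)
    (.get .acc (.var .s + .var .x) + .get .xr (.var .x) / .var .L))

def chunkPg : Pg := loadText ;; fwdPg ;; mulPg ;; invPg ;; addAcc ;; .asg .s (.var .s + .var .m)

/-- The transform of the pattern column is computed once and saved for all chunks of the text. -/
def columnPg : Pg := loadPat ;; fwdPg ;; saveB ;; .asg .s (.lit 0) ;; .wh .s .NM chunkPg

section Column

variable {w : ℕ} {ω : ℕ → Fin (2 ^ w)} {Z : ℕ} {σ : Sto} {P : Par} {Θ : ℝ}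

/-- Since 8^k = L^3, the error growth of a whole transform costs three powers of Θ. -/
theorem Good.eight_le (H : Good w Z P Θ) : (8 : ℝ) ^ P.k ≤ Θ ^ 3 := by
  have h : (2 : ℝ) ^ P.k ≤ Θ := by
    have := H.ΘL
    unfold Par.L at this
    exact_mod_cast this
  calc (8 : ℝ) ^ P.k = (2 ^ P.k) ^ 3 := by rw [← pow_mul, mul_comm, pow_mul]; norm_num
    _ ≤ Θ ^ 3 := by gcongr

theorem Good.k_pos (H : Good w Z P Θ) : 1 ≤ P.k := by
  have h1 := H.h2m
  have h2 := H.hm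
  unfold Par.L at h1
  rcases Nat.eq_zero_or_pos P.k with h | h
  · rw [h] at h1; omega
  · exact h

theorem Good.div_le (H : Good w Z P Θ) {x : ℝ} {i j : ℕ} (hx : x ≤ Θ ^ i) (hij : i ≤ j) :
    x / 2 ^ w ≤ Θ ^ j / 2 ^ w := by
  have := hx.trans (H.pow_mono hij)
  gcongr

theorem Good.div_le_one (H : Good w Z P Θ) {j : ℕ} (hj : j ≤ 30) : Θ ^ j / 2 ^ w ≤ 1 := by
  rw [_root_.div_le_one (by positivity)]; exact H.pow_le hj

theorem Close.mono {r i : Arr} {f : ℕ → ℂ} {L : ℕ} {e e' : ℝ} (h : Close σ r i f L e) (he : e ≤ e') :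
    Close σ r i f L e' := fun x hx => (h x hx).trans he

/-- The forward transform of data of size `Θ ^ i` with error `Θ ^ j / 2 ^ w`. -/
theorem Good.fwd_wp (H : Good w Z P Θ) (hV : Vals P σ) {a : ℕ → ℂ} {i j : ℕ} (hi : i + 2 ≤ j) (hj : j ≤ 20)
    (ha : ∀ x, ‖a x‖ ≤ Θ ^ i) (hX : Close σ .xr .xi a P.L (Θ ^ j / 2 ^ w))
    (hR : Close σ .rr .ri root P.L (Θ ^ 2 / 2 ^ w)) :
    WP w ω Z fwdPg (P.k * (P.L * 250) + 10) σ
      (fun σ' => Close σ' .xr .xi (fftCur a 1 P.L) P.L (Θ ^ (j + 4) / 2 ^ w)) := by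
  have hΘ := H.Θpos
  have Θ0 := H.Θ0
  have h1 : (1 : ℝ) ≤ Θ := by linarith
  have herr : (8 : ℝ) ^ P.k * (Θ ^ j / 2 ^ w + Θ ^ 2 / 2 ^ w * Θ ^ i) ≤ Θ ^ (j + 4) / 2 ^ w := by
    have h2 : Θ ^ 2 / 2 ^ w * Θ ^ i ≤ Θ ^ j / 2 ^ w := by
      rw [div_mul_eq_mul_div, ← pow_add]
      exact H.div_le le_rfl (by omega)
    calc (8 : ℝ) ^ P.k * (Θ ^ j / 2 ^ w + Θ ^ 2 / 2 ^ w * Θ ^ i)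
        ≤ Θ ^ 3 * (Θ ^ j / 2 ^ w + Θ ^ j / 2 ^ w) := by
          gcongr
          exact H.eight_le
      _ = 2 * Θ ^ (j + 3) / 2 ^ w := by ring
      _ ≤ Θ ^ (j + 4) / 2 ^ w := by
          have : 2 * Θ ^ (j + 3) ≤ Θ ^ (j + 3 + 1) := H.bump (by norm_num) _
          gcongr
  have hL : (2 : ℝ) ^ P.k ≤ Θ := by
    have := H.ΘL
    unfold Par.L at this
    exact_mod_cast this
  refine WP.mono (FloatRAM.fwd_wp H.ctx (V := Θ ^ i) (η := Θ ^ 2 / 2 ^ w) (one_le_pow₀ h1) (by positivity)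
    ?_ (H.div_le_one (by norm_num)) ?_ (herr.trans (H.div_le_one (by omega))) (hV .L (by decide))
    (hV .K (by decide)) ha hX hR) le_rfl fun σ' _ h => Close.mono h herr
  · gcongr; nlinarith
  · calc 100 * ((2 : ℝ) ^ P.k * Θ ^ i) ≤ Θ * (Θ * Θ ^ i) := by gcongr; linarith
      _ = Θ ^ (i + 2) := by ring
      _ ≤ 2 ^ w := H.pow_le (by omega)

theorem abs_corr_le {a b : ℕ → ℝ} {V : ℝ} (ha : ∀ x, |a x| ≤ V) (hb : ∀ x, |b x| ≤ 1) (L x : ℕ) :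
    |corr a b L x| ≤ L * V := by
  unfold corr
  refine (Finset.abs_sum_le_sum_abs _ _).trans ?_
  calc _ ≤ ∑ j ∈ Finset.range L, V := by
        refine Finset.sum_le_sum fun j _ => ?_
        have := abs_mul_le (ha ((x + j) % L)) (hb j)
        rwa [mul_one] at this
    _ = _ := by simp

/-- The correlation of `xr` with the array whose transform is in `br + i bi`. -/
theorem correlate_wp (H : Good w Z P Θ) (hV : Vals P σ) {a b : ℕ → ℝ} (ha : ∀ x, |a x| ≤ Θ ^ 4)
    (hb : ∀ x, |b x| ≤ 1) (hX : Close σ .xr .xi (fun x => (a x : ℂ)) P.L (Θ ^ 8 / 2 ^ w))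
    (hB : Close σ .br .bi (fftCur (fun x => (b x : ℂ)) 1 P.L) P.L (Θ ^ 6 / 2 ^ w))
    (hR : Close σ .rr .ri root P.L (Θ ^ 2 / 2 ^ w)) (Q : Sto → Prop)
    (hQ : ∀ σ', Frame (fwdPg ;; mulPg ;; invPg) σ σ' →
      (∀ x < P.L, |σ'.arr .xr x - 2 ^ P.k * corr a b P.L x| ≤ Θ ^ 18 / 2 ^ w) → Q σ') :
    WP w ω Z (fwdPg ;; mulPg ;; invPg) (P.L * P.k * 700) σ Q := by
  have hΘ := H.Θpos
  have Θ0 := H.Θ0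
  have h1 : (1 : ℝ) ≤ Θ := by linarith
  have hk := H.k_pos
  have hLr : (P.L : ℝ) ≤ Θ := H.ΘL
  have hL : (2 : ℝ) ^ P.k ≤ Θ := by
    have := H.ΘL
    unfold Par.L at this
    exact_mod_cast this
  suffices key : WP w ω Z (fwdPg ;; mulPg ;; invPg) (P.L * P.k * 700) σ (fun σ' =>
      Close σ' .xr .xi (fun x => 2 ^ P.k * (corr a b P.L x : ℂ)) P.L (Θ ^ 18 / 2 ^ w)) by
    refine key.mono le_rfl fun σ' hf h => hQ σ' hf fun x hx => ?_
    refine le_trans (le_of_eq ?_) ((Complex.abs_re_le_norm _).trans (h x hx))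
    congr 1
    rw [Complex.sub_re]
    congr 1
    change _ = ((2 : ℂ) ^ P.k * (corr a b P.L x : ℂ)).re
    rw [show (2 : ℂ) ^ P.k * (corr a b P.L x : ℂ) = (((2 : ℝ) ^ P.k * corr a b P.L x : ℝ) : ℂ) by
      push_cast; rfl, Complex.ofReal_re]
  refine WP.cost (T := (P.k * (P.L * 250) + 10) + ((P.L * 100 + 6) + (P.k * (P.L * 250) + 10))) ?_ ?_
  swap
  · have h2 : 2 ≤ P.L := by have := H.h2m; have := H.hm; omega
    have h3 : P.L * 1 ≤ P.L * P.k := Nat.mul_le_mul_left _ hk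
    have h4 : P.k * (P.L * 250) = P.L * P.k * 250 := by ring
    omega
  -- The exponent of Θ in the error is 8 for the data, 12 after the transform, 14 after the
  -- pointwise product and 18 after the inverse transform.
  refine WP.seq (WP.mono (H.fwd_wp hV (i := 4) (j := 8) (by norm_num) (by norm_num)
    (fun x => by rw [Complex.norm_real]; exact ha x) hX hR) le_rfl ?_)
  intro σ1 hf1 h1F
  have hV1 := hV.frame hf1
  have hB1 := hB.congr (hf1.arr _ (by decide)) (hf1.arr _ (by decide))
  have hnF : ∀ x, ‖fftCur (fun x => (a x : ℂ)) 1 P.L x‖ ≤ Θ ^ 5 := fun x => by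
    refine (norm_fftCur_le (V := Θ ^ 4) (fun x => by rw [Complex.norm_real]; exact ha x) _ _ _).trans ?_
    calc (P.L : ℝ) * Θ ^ 4 ≤ Θ * Θ ^ 4 := by gcongr
      _ = Θ ^ 5 := by ring
  have hnG : ∀ x, ‖fftCur (fun x => (b x : ℂ)) 1 P.L x‖ ≤ Θ := fun x => by
    refine (norm_fftCur_le (V := 1) (fun x => by rw [Complex.norm_real]; exact hb x) _ _ _).trans ?_
    rwa [mul_one]
  refine WP.seq (WP.mono (mul_wp H.ctx (VF := Θ ^ 5) (VG := Θ) (one_le_pow₀ h1) h1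
    (H.div_le_one (j := 12) (by norm_num)) (H.div_le_one (j := 6) (by norm_num)) ?_ (hV1 .L (by decide)) hnF hnG h1F hB1)
    le_rfl ?_)
  · calc 100 * (Θ ^ 5 * Θ) = 100 * Θ ^ 6 := by ring
      _ ≤ Θ ^ 7 := H.bump (by norm_num) 6
      _ ≤ 2 ^ w := H.pow_le (by norm_num)
  intro σ2 hf2 h2F
  have hV2 := hV1.frame hf2
  have hcl : Close σ2 .xr .xi (fftCur (fun x => (corr a b P.L x : ℂ)) 1 (2 ^ P.k)) (2 ^ P.k)
      (Θ ^ 14 / 2 ^ w) := by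
    intro x hx
    have := h2F x hx
    rw [show P.L = 2 ^ P.k from rfl, ← fft_corr a b P.k x hx]
    refine this.trans ?_
    have e1 : Θ ^ 12 / 2 ^ w * (Θ ^ 6 / 2 ^ w) ≤ Θ ^ 12 / 2 ^ w :=
      mul_le_of_le_one_right (by positivity) (H.div_le_one (by norm_num))
    have e2 : Θ ^ 12 / 2 ^ w ≤ Θ ^ 13 / 2 ^ w := H.div_le le_rfl (by norm_num)
    have e3 : Θ ^ 11 / 2 ^ w ≤ Θ ^ 13 / 2 ^ w := H.div_le le_rfl (by norm_num)
    have e4 : 100 * (Θ ^ 5 * Θ) / 2 ^ w ≤ Θ ^ 13 / 2 ^ w := by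
      refine H.div_le (i := 7) ?_ (by norm_num)
      calc 100 * (Θ ^ 5 * Θ) = 100 * Θ ^ 6 := by ring
        _ ≤ Θ ^ 7 := H.bump (by norm_num) 6
    calc Θ ^ 12 / 2 ^ w * Θ + Θ ^ 5 * (Θ ^ 6 / 2 ^ w) + Θ ^ 12 / 2 ^ w * (Θ ^ 6 / 2 ^ w)
          + 100 * (Θ ^ 5 * Θ) / 2 ^ w
        = Θ ^ 13 / 2 ^ w + Θ ^ 11 / 2 ^ w + Θ ^ 12 / 2 ^ w * (Θ ^ 6 / 2 ^ w)
          + 100 * (Θ ^ 5 * Θ) / 2 ^ w := by ring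
      _ ≤ 4 * (Θ ^ 13 / 2 ^ w) := by linarith
      _ = 4 * Θ ^ 13 / 2 ^ w := by ring
      _ ≤ Θ ^ 14 / 2 ^ w := H.div_le (H.bump (by norm_num) 13) le_rfl
  have hR2 : Close σ2 .rr .ri root (2 ^ P.k) (Θ ^ 2 / 2 ^ w) :=
    Close.congr (Close.congr hR (hf1.arr _ (by decide)) (hf1.arr _ (by decide)))
      (hf2.arr _ (by decide)) (hf2.arr _ (by decide))
  have herr : (8 : ℝ) ^ P.k * (Θ ^ 14 / 2 ^ w + Θ ^ 2 / 2 ^ w * (2 ^ P.k * Θ ^ 5)) ≤ Θ ^ 18 / 2 ^ w := by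
    have e2 : Θ ^ 2 / 2 ^ w * (Θ * Θ ^ 5) ≤ Θ ^ 14 / 2 ^ w := by
      have : Θ ^ 2 / 2 ^ w * (Θ * Θ ^ 5) = Θ ^ 8 / 2 ^ w := by ring
      rw [this]
      exact H.div_le le_rfl (by norm_num)
    calc (8 : ℝ) ^ P.k * (Θ ^ 14 / 2 ^ w + Θ ^ 2 / 2 ^ w * (2 ^ P.k * Θ ^ 5))
        ≤ Θ ^ 3 * (Θ ^ 14 / 2 ^ w + Θ ^ 2 / 2 ^ w * (Θ * Θ ^ 5)) := by
          gcongr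
          exact H.eight_le
      _ ≤ Θ ^ 3 * (Θ ^ 14 / 2 ^ w + Θ ^ 14 / 2 ^ w) := by gcongr
      _ = 2 * Θ ^ 17 / 2 ^ w := by ring
      _ ≤ Θ ^ 18 / 2 ^ w := H.div_le (H.bump (by norm_num) 17) le_rfl
  refine WP.mono (inv_wp H.ctx (V := Θ ^ 5) (η := Θ ^ 2 / 2 ^ w) (one_le_pow₀ h1) (by positivity)
    ?_ (H.div_le_one (by norm_num)) ?_ (herr.trans (H.div_le_one (by norm_num))) (hV2 .L (by decide))
    (hV2 .K (by decide)) ?_ hcl hR2) le_rfl fun σ' _ h => Close.mono h herr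
  · gcongr; nlinarith
  · calc 100 * ((2 : ℝ) ^ P.k * Θ ^ 5) ≤ Θ * (Θ * Θ ^ 5) := by gcongr; linarith
      _ = Θ ^ 7 := by ring
      _ ≤ 2 ^ w := H.pow_le (by norm_num)
  · intro x
    rw [Complex.norm_real]
    refine (abs_corr_le ha hb _ _).trans ?_
    calc (P.L : ℝ) * Θ ^ 4 ≤ Θ * Θ ^ 4 := by gcongr
      _ = Θ ^ 5 := by ring

/-- A loop that loads real data into `xr + i xi`. -/
theorem load_wp (H : Good w Z P Θ) (hV : Vals P σ) {k : Arr} {ix : Ex} {a : ℕ → ℝ} {e : ℝ} (ind : ℕ → ℕ)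
    (hk : k ≠ .xr ∧ k ≠ .xi)
    (hix : ∀ x < P.L, ∀ σ', Frame (forL .x .L (.put .xr (.var .x) (.get k ix) ;; .put .xi (.var .x) (.lit 0))) σ σ' →
      σ'.var .x = x → Ev w Z σ' ix ((ind x : ℕ) : ℝ) ∧ ind x < Z)
    (ha : ∀ x < P.L, |σ.arr k (ind x) - a x| ≤ e) :
    WP w ω Z (forL .x .L (.put .xr (.var .x) (.get k ix) ;; .put .xi (.var .x) (.lit 0)))
      (P.L * (ix.cost + 20) + 3) σ (fun σ' => Close σ' .xr .xi (fun x => (a x : ℂ)) P.L e) := by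
  have hw := H.hw
  have hLZ : P.L ≤ Z := H.ctx.hL
  have hZw := H.Zw
  have e : P.L * (ix.cost + 20) + 3 = P.L * (ix.cost + 15 + 5) + 3 := by ring
  rw [e]
  refine WP.for (ix.cost + 15) (fun j σ' => ∀ x < j, σ'.arr .xr x = σ.arr k (ind x) ∧ σ'.arr .xi x = 0) hw
    (hV .L (by decide)) (by omega) (by simp) ?_ ?_ (by decide) (by simp [Pg.mv]) (by simp [Pg.mv])
  · intro j hj σ' hf hx hI
    obtain ⟨h1, h2⟩ := hix j hj σ' hf hx
    have hk' : σ'.arr k = σ.arr k := hf.arr _ (by simp [forL, Pg.ma, hk])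
    have hg := Ev.getN (k := k) h1 h2
    rw [hk'] at hg
    refine WP.cost (WP.seq (WP.put (Ev.vN hx) (by omega) hg (WP.put (Ev.vN hx) (by omega) (Ev.zero hw) ?_)))
      (by simp only [Ex.cost]; omega)
    intro x hx'
    simp only [Sto.setVar_arr, Sto.setArr_arr]
    rcases Nat.lt_succ_iff_lt_or_eq.mp hx' with hlt | rfl
    · simpa [hlt.ne] using hI x hlt
    · simp
  · intro σ' _ hI x hx
    obtain ⟨h1, h2⟩ := hI x hx
    have e1 : cplx (σ'.arr .xr) (σ'.arr .xi) x = ((σ.arr k (ind x) : ℝ) : ℂ) := by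
      unfold cplx; rw [h1, h2]; rfl
    rw [e1, ← Complex.ofReal_sub, Complex.norm_real]
    exact ha x hx

theorem saveB_wp (H : Good w Z P Θ) (hV : Vals P σ) (Q : Sto → Prop)
    (hQ : ∀ σ', Frame saveB σ σ' → (∀ x < P.L, σ'.arr .br x = σ.arr .xr x ∧ σ'.arr .bi x = σ.arr .xi x) → Q σ') :
    WP w ω Z saveB (P.L * 30 + 3) σ Q := by
  have hw := H.hw
  have hLZ : P.L ≤ Z := H.ctx.hL
  have hZw := H.Zw
  have key : WP w ω Z saveB (P.L * (25 + 5) + 3) σ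
      (fun σ' => ∀ x < P.L, σ'.arr .br x = σ.arr .xr x ∧ σ'.arr .bi x = σ.arr .xi x) := by
    refine WP.for 25 (fun j σ' => ∀ x < j, σ'.arr .br x = σ.arr .xr x ∧ σ'.arr .bi x = σ.arr .xi x) hw
      (hV .L (by decide)) (by omega) (by simp) ?_ (fun σ' _ h => h)
    intro j hj σ' hf hx hI
    have h1 : σ'.arr .xr = σ.arr .xr := hf.arr _ (by decide)
    have h2 : σ'.arr .xi = σ.arr .xi := hf.arr _ (by decide)
    refine WP.cost (WP.seq (WP.put (Ev.vN hx) (by omega) (Ev.getN (Ev.vN hx) (by omega))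
      (WP.put (Ev.vN hx) (by omega) (Ev.getN (Ev.vN hx) (by omega)) ?_))) (by decide)
    intro x hx'
    simp only [Sto.setVar_arr, Sto.setArr_arr, h1, h2]
    rcases Nat.lt_succ_iff_lt_or_eq.mp hx' with hlt | rfl
    · simpa [hlt.ne] using hI x hlt
    · simp
  exact key.mono le_rfl fun σ' hf h => hQ σ' hf h

end Column

section Column

variable {w : ℕ} {ω : ℕ → Fin (2 ^ w)} {Z : ℕ} {σ : Sto} {P : Par} {Θ : ℝ}

/-- The correlation of column `c` of the table `t` with `b`, at position `i`. -/
noncomputable def Par.colSum (P : Par) (t b : ℕ → ℝ) (c i : ℕ) : ℝ :=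
  ∑ j ∈ Finset.range P.m, t ((i + j) * P.M + c) * b j

/-- The positions that are covered by the chunks. -/
def Par.cov (P : Par) : ℕ := P.n / P.m * P.m

theorem Good.colSum_bounds (H : Good w Z P Θ) {t b : ℕ → ℝ} (ht : ∀ q, 0 ≤ t q ∧ t q ≤ Θ ^ 4)
    (hb : ∀ x, 0 ≤ b x ∧ b x ≤ 1) (c i : ℕ) : 0 ≤ P.colSum t b c i ∧ P.colSum t b c i ≤ Θ ^ 5 := by
  have hΘ := H.Θpos
  constructor
  · exact Finset.sum_nonneg fun j _ => mul_nonneg (ht _).1 (hb _).1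
  · calc P.colSum t b c i ≤ ∑ j ∈ Finset.range P.m, Θ ^ 4 := by
          refine Finset.sum_le_sum fun j _ => ?_
          have := mul_le_mul (ht ((i + j) * P.M + c)).2 (hb j).2 (hb j).1 (by positivity)
          rwa [mul_one] at this
      _ = P.m * Θ ^ 4 := by rw [Finset.sum_const, Finset.card_range, nsmul_eq_mul]
      _ ≤ Θ * Θ ^ 4 := by
          gcongr
          refine le_trans ?_ H.Θn
          exact_mod_cast H.hmn
      _ = Θ ^ 5 := by ring

/-- The accumulator is close to `g`, and `D` has been added to it below position `s`. -/
def Acc (P : Par) (σ : Sto) (g D : ℕ → ℝ) (e δ : ℝ) (s : ℕ) : Prop :=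
  ∀ i < P.n + 1, |σ.arr .acc i - (g i + if i < s then D i else 0)| ≤ e + if i < s then δ else 0

theorem addAcc_wp (H : Good w Z P Θ) (hV : Vals P σ) {g D d : ℕ → ℝ} {e : ℝ} {s : ℕ}
    (he : e ≤ 1) (hg : ∀ i, |g i| ≤ Θ ^ 8) (hD : ∀ i, |D i| ≤ Θ ^ 5) (hs : s + P.m ≤ P.n + 1)
    (hvs : σ.var .s = s) (hd : ∀ x < P.m, d x = D (s + x))
    (hx : ∀ x < P.L, |σ.arr .xr x - 2 ^ P.k * d x| ≤ Θ ^ 18 / 2 ^ w)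
    (hacc : Acc P σ g D e (Θ ^ 19 / 2 ^ w) s) :
    WP w ω Z addAcc (P.m * 30 + 3) σ (fun σ' => Acc P σ' g D e (Θ ^ 19 / 2 ^ w) (s + P.m)) := by
  have hw := H.hw
  have hZw := H.Zw
  have hM := H.M_pos
  have hL0 := H.L_pos
  have hSZ := H.hSZ
  have hnZ : P.n + 1 ≤ Z := by nlinarith
  have hLZ : P.L ≤ Z := H.ctx.hL
  have h2m := H.h2m
  refine WP.cost (T := P.m * (25 + 5) + 3) ?_ le_rfl
  refine WP.for 25 (fun x σ' => Acc P σ' g D e (Θ ^ 19 / 2 ^ w) (s + x)) hw (hV .m (by decide))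
    (by omega) hacc ?_ (fun σ' _ h => h)
  intro x hxm σ1 hf hvx hI
  have hvs1 : σ1.var .s = s := by rw [hf.var _ (by decide)]; exact hvs
  have hvL1 : σ1.var .L = P.L := (hV.frame hf) .L (by decide)
  have hxr1 : σ1.arr .xr = σ.arr .xr := hf.arr _ (by decide)
  have ei : Ev w Z σ1 (.var .s + .var .x) ((s + x : ℕ) : ℝ) :=
    Ev.addN hw (Ev.vN hvs1) (Ev.vN hvx) (by omega)
  have hI0 := hI (s + x) (by omega)
  rw [if_neg (lt_irrefl _), if_neg (lt_irrefl _), add_zero, add_zero] at hI0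
  have hx0 := hx x (by omega)
  rw [hd x hxm] at hx0
  have hLr : ((P.L : ℕ) : ℝ) = 2 ^ P.k := by unfold Par.L; push_cast; rfl
  have hLpos : (1 : ℝ) ≤ 2 ^ P.k := one_le_pow₀ (by norm_num)
  have hd1 : |σ.arr .xr x / P.L - D (s + x)| ≤ Θ ^ 18 / 2 ^ w := by
    rw [hLr]
    have e1 : σ.arr .xr x / 2 ^ P.k - D (s + x) = (σ.arr .xr x - 2 ^ P.k * D (s + x)) / 2 ^ P.k := by
      field_simp
    rw [e1, abs_div, abs_of_pos (by positivity : (0 : ℝ) < 2 ^ P.k)]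
    exact (div_le_self (abs_nonneg _) hLpos).trans hx0
  have u18 : Θ ^ 18 / 2 ^ w ≤ 1 := H.div_le_one (by norm_num)
  have p0 : (1 : ℝ) ≤ Θ ^ 5 := one_le_pow₀ (by linarith [H.Θ0])
  have p1 : 20 * Θ ^ 5 ≤ Θ ^ 6 := H.bump (by norm_num) 5
  have p2 : Θ ^ 6 ≤ Θ ^ 8 := H.pow_mono (by norm_num)
  have p3 : 20 * Θ ^ 8 ≤ Θ ^ 9 := H.bump (by norm_num) 8
  have p4 : Θ ^ 9 ≤ 2 ^ w := H.pow_le (by norm_num)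
  have p5 : 20 * Θ ^ 9 ≤ Θ ^ 10 := H.bump (by norm_num) 9
  have p6 : Θ ^ 10 ≤ Θ ^ 18 := H.pow_mono (by norm_num)
  have p7 : 20 * Θ ^ 18 ≤ Θ ^ 19 := H.bump (by norm_num) 18
  have hDb := hD (s + x)
  have hgb := hg (s + x)
  obtain ⟨v1, ev1, hv1⟩ := Ev.bin_ap (w := w) (Z := Z) (σ := σ1) (o := .div) (t := D (s + x))
    (d := Θ ^ 18 / 2 ^ w) (B := Θ ^ 6)
    (Ev.getN (k := .xr) (Ev.vN hvx) (by omega)) (Ev.v hvL1)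
    (by change ((P.L : ℕ) : ℝ) ≠ 0; rw [hLr]; positivity) (by rw [hxr1]; exact hd1) (by linarith)
    (by linarith)
  have q1 : (Θ ^ 6 + 1) / 2 ^ w ≤ Θ ^ 18 / 2 ^ w := by gcongr; linarith
  obtain ⟨v2, ev2, hv2⟩ := Ap.add ⟨_, Ev.getN (k := .acc) ei (by omega), hI0⟩ ⟨_, ev1, hv1⟩ (B := Θ ^ 9)
    (by linarith) p4
  refine WP.cost (WP.put ei (by omega) ev2 ?_) (by decide)
  intro i hi
  simp only [Sto.setVar_arr, Sto.setArr_arr, true_and]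
  have hδ0 : 0 ≤ Θ ^ 19 / 2 ^ w := by have := H.Θpos; positivity
  by_cases hii : i = s + x
  · subst hii
    rw [if_pos rfl, if_pos (by omega), if_pos (by omega)]
    refine hv2.trans ?_
    have q2 : (Θ ^ 9 + 1) / 2 ^ w ≤ Θ ^ 18 / 2 ^ w := by gcongr; linarith
    have q3 : 20 * (Θ ^ 18 / 2 ^ w) ≤ Θ ^ 19 / 2 ^ w := by rw [← mul_div_assoc]; gcongr
    have q4 : 0 ≤ Θ ^ 18 / 2 ^ w := by have := H.Θpos; positivity
    linarith
  · rw [if_neg hii]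
    have hiff : i < s + (x + 1) ↔ i < s + x := by omega
    simp only [hiff]
    exact hI i hi

/-- Sequences associate to the right, while the correlation was verified as one unit of three
commands. Its execution has to be taken apart before it can be continued inside a chunk. -/
theorem HX.seq_inv {c₁ c₂ : Pg} {σ' : Sto} {t : ℕ} (h : HX w ω Z (c₁ ;; c₂) σ t σ') :
    ∃ t₁ t₂ σ₁, t = t₁ + t₂ ∧ HX w ω Z c₁ σ t₁ σ₁ ∧ HX w ω Z c₂ σ₁ t₂ σ' := by
  cases h with
  | seq h₁ h₂ => exact ⟨_, _, _, rfl, h₁, h₂⟩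

/-- The program for one column. -/
theorem column_wp (H : Good w Z P Θ) (hV : Vals P σ) {g t b : ℕ → ℝ} {e : ℝ} {c : ℕ}
    (he : e ≤ 1) (hg : ∀ i, |g i| ≤ Θ ^ 8) (hc : c < P.M) (hvc : σ.var .c = c)
    (ht : ∀ q, 0 ≤ t q ∧ t q ≤ Θ ^ 4) (hb : ∀ x, 0 ≤ b x ∧ b x ≤ 1) (hbm : ∀ x, P.m ≤ x → b x = 0)
    (hW : ∀ q < (P.n + P.L) * P.M, |σ.arr .W q - t q| ≤ Θ ^ 8 / 2 ^ w)
    (hPT : ∀ x < P.L, σ.arr .PT (x * P.M + c) = b x)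
    (hR : Close σ .rr .ri root P.L (Θ ^ 2 / 2 ^ w))
    (hacc : ∀ i < P.n + 1, |σ.arr .acc i - g i| ≤ e) :
    WP w ω Z columnPg ((P.n / P.m + 1) * (P.L * P.k * 800)) σ (fun σ' => ∀ i < P.n + 1,
      |σ'.arr .acc i - (g i + if i < P.cov then P.colSum t b c i else 0)| ≤ e + Θ ^ 19 / 2 ^ w) := by
  have hw := H.hw
  have hZw := H.Zw
  have hM := H.M_pos
  have hL0 := H.L_pos
  have hSZ := H.hSZ
  have hnZ : P.n + 1 ≤ Z := by nlinarith
  have hLZ : P.L ≤ Z := H.ctx.hL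
  have h2m := H.h2m
  have hm := H.hm
  have hmn := H.hmn
  have hk := H.k_pos
  have hΘ := H.Θpos
  obtain ⟨LK, hLK⟩ : ∃ LK, LK = P.L * P.k := ⟨_, rfl⟩
  have hLK1 : P.L ≤ LK := by rw [hLK]; exact Nat.le_mul_of_pos_right _ hk
  set Tb := (P.L * (7 + 20) + 3) + (P.L * P.k * 700 + ((P.m * 30 + 3) + 4)) with hTb
  have hcell : ∀ y < P.n + P.L, y * P.M + c < (P.n + P.L) * P.M := fun y hy =>
    calc y * P.M + c < y * P.M + P.M := Nat.add_lt_add_left hc _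
      _ = (y + 1) * P.M := by ring
      _ ≤ _ := Nat.mul_le_mul_right _ hy
  refine WP.cost (T := (P.L * (5 + 20) + 3) + ((P.k * (P.L * 250) + 10) + ((P.L * 30 + 3) +
    (2 + (P.n / P.m * (Tb + 1) + 1))))) ?_ ?_
  swap
  · have h1 : P.k * (P.L * 250) = LK * 250 := by rw [hLK]; ring
    have h2 : Tb + 1 ≤ LK * 800 := by rw [hTb, ← hLK]; omega
    have h3 : P.n / P.m * (Tb + 1) ≤ P.n / P.m * (LK * 800) := Nat.mul_le_mul_left _ h2
    rw [← hLK, add_mul, one_mul, h1]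
    omega
  have hbC : ∀ x, ‖((b x : ℝ) : ℂ)‖ ≤ Θ ^ 0 := fun x => by
    rw [Complex.norm_real, pow_zero, Real.norm_eq_abs, abs_of_nonneg (hb x).1]; exact (hb x).2
  refine WP.seq (WP.mono (load_wp H hV (k := .PT) (ix := .var .x * .var .M + .var .c) (a := b)
    (e := Θ ^ 2 / 2 ^ w) (fun x => x * P.M + c) (by decide) ?_ ?_) le_rfl ?_)
  · intro x hx σ' hf hvx
    have h1 := hcell x (by omega)
    refine ⟨Ev.addN hw (Ev.mulN hw (Ev.vN hvx) (Ev.vN ((hV.frame hf) .M (by decide))) (by omega))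
      (Ev.vN ?_) (by omega), by omega⟩
    rw [hf.var _ (by decide)]; exact hvc
  · intro x hx
    rw [hPT x hx, sub_self, abs_zero]; positivity
  intro σ1 hf1 h1
  have hV1 := hV.frame hf1
  have hR1 := hR.congr (hf1.arr _ (by decide)) (hf1.arr _ (by decide))
  refine WP.seq (WP.mono (H.fwd_wp hV1 (i := 0) (j := 2) (by norm_num) (by norm_num) hbC h1 hR1) le_rfl ?_)
  intro σ2 hf2 h2
  have hV2 := hV1.frame hf2
  refine WP.seq (saveB_wp H hV2 _ ?_)
  intro σ3 hf3 h3
  have hV3 := hV2.frame hf3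
  have hB3 : Close σ3 .br .bi (fftCur (fun x => (b x : ℂ)) 1 P.L) P.L (Θ ^ 6 / 2 ^ w) := by
    intro x hx
    have := h2 x hx
    obtain ⟨r1, r2⟩ := h3 x hx
    unfold cplx at this ⊢
    rw [r1, r2]
    exact this
  refine WP.seq (WP.asg (Ev.zero hw) ?_)
  set σ4 := σ3.setVar .s 0 with hσ4
  have hF4 : Frame columnPg σ σ4 :=
    (hf1.mono (by decide) (by decide) (by decide)).trans ((hf2.mono (by decide) (by decide) (by decide)).trans
      ((hf3.mono (by decide) (by decide) (by decide)).trans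
        ⟨fun x hx => Sto.setVar_ne _ _ (by rintro rfl; exact hx (by decide)), fun _ _ => rfl, fun _ => rfl⟩))
  have hV4 : Vals P σ4 := hV3.set 0
  have hacc4 : σ4.arr .acc = σ.arr .acc := by
    change σ3.arr .acc = _
    rw [hf3.arr _ (by decide), hf2.arr _ (by decide), hf1.arr _ (by decide)]
  have hW4 : σ4.arr .W = σ.arr .W := by
    change σ3.arr .W = _
    rw [hf3.arr _ (by decide), hf2.arr _ (by decide), hf1.arr _ (by decide)]
  have hrr4 : σ4.arr .rr = σ.arr .rr := by
    change σ3.arr .rr = _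
    rw [hf3.arr _ (by decide), hf2.arr _ (by decide), hf1.arr _ (by decide)]
  have hri4 : σ4.arr .ri = σ.arr .ri := by
    change σ3.arr .ri = _
    rw [hf3.arr _ (by decide), hf2.arr _ (by decide), hf1.arr _ (by decide)]
  set D := fun i => P.colSum t b c i with hD
  have hDb : ∀ i, |D i| ≤ Θ ^ 5 := fun i => by
    have := H.colSum_bounds ht hb c i
    rw [abs_of_nonneg this.1]; exact this.2
  have hdm := Nat.div_add_mod P.n P.m
  have hmod := Nat.mod_lt P.n hm
  have hcomm : P.m * (P.n / P.m) = P.n / P.m * P.m := mul_comm _ _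
  have hNM : ∀ σ' : Sto, Vals P σ' → σ'.var .NM = ((P.n - P.m + 1 : ℕ) : ℝ) := fun σ' h => h .NM (by decide)
  have htest : ∀ (j : ℕ) (σ' : Sto), Vals P σ' → σ'.var .s = ((j * P.m : ℕ) : ℝ) →
      (σ'.var .s < σ'.var .NM ↔ j * P.m < P.n - P.m + 1) := fun j σ' h h' => by
    rw [hNM σ' h, h', Nat.cast_lt]
  -- The chunk that starts at s = jm serves the positions s, …, s + m - 1, and n / m chunks cover
  -- all n - m + 1 windows. The last chunk may also write positions that are not starts of windows,
  -- so the invariant speaks of n + 1 cells of the accumulator.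
  refine WP.wh (P.n / P.m) Tb (fun j σ' => σ'.var .s = ((j * P.m : ℕ) : ℝ) ∧
    Acc P σ' g D e (Θ ^ 19 / 2 ^ w) (j * P.m)) ⟨by simp [hσ4], ?_⟩ ?_ ?_ ?_
  · intro i hi
    simpa [hacc4] using hacc i hi
  · rintro j hj σ5 hf5 ⟨hs5, ha5⟩ hlt
    have hV5 := hV4.frame hf5
    have hjm : j * P.m < P.n - P.m + 1 := (htest j σ5 hV5 hs5).mp hlt
    set s := j * P.m with hsdef
    have hR5 : Close σ5 .rr .ri root P.L (Θ ^ 2 / 2 ^ w) :=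
      hR.congr (by rw [hf5.arr _ (by decide), hrr4]) (by rw [hf5.arr _ (by decide), hri4])
    have hB5 : Close σ5 .br .bi (fftCur (fun x => (b x : ℂ)) 1 P.L) P.L (Θ ^ 6 / 2 ^ w) :=
      hB3.congr (hf5.arr _ (by decide)) (hf5.arr _ (by decide))
    set a : ℕ → ℝ := fun x => t ((s + x) * P.M + c) with ha
    refine WP.seq (WP.mono (load_wp H hV5 (k := .W) (ix := (.var .s + .var .x) * .var .M + .var .c) (a := a)
      (e := Θ ^ 8 / 2 ^ w) (fun x => (s + x) * P.M + c) (by decide) ?_ ?_) le_rfl ?_)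
    · intro x hx σ' hf hvx
      have h1 := hcell (s + x) (by omega)
      have h4 : s + x ≤ Z := by
        have h5 : P.n + P.L ≤ (P.n + P.L) * P.M := Nat.le_mul_of_pos_right _ hM
        omega
      have h6 : (s + x) * P.M ≤ 2 ^ w := by omega
      refine ⟨Ev.addN hw (Ev.mulN hw (Ev.addN hw (Ev.vN ?_) (Ev.vN hvx) (by omega))
        (Ev.vN ((hV5.frame hf) .M (by decide))) (by omega)) (Ev.vN ?_) (by omega), by omega⟩
      · rw [hf.var _ (by decide)]; exact hs5
      · rw [hf.var _ (by decide), hf5.var _ (by decide), hF4.var _ (by decide)]; exact hvc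
    · intro x hx
      rw [hf5.arr _ (by decide), hW4]
      exact hW _ (hcell _ (by omega))
    intro σ6 hf6 h6
    have hV6 := hV5.frame hf6
    have hB6 := hB5.congr (hf6.arr _ (by decide)) (hf6.arr _ (by decide))
    have hR6 := hR5.congr (hf6.arr _ (by decide)) (hf6.arr _ (by decide))
    obtain ⟨T1, r1, σ7, x7, hf7, r7⟩ := correlate_wp (ω := ω) H hV6 (a := a) (b := b)
      (fun x => by rw [abs_of_nonneg (ht _).1]; exact (ht _).2)
      (fun x => by rw [abs_of_nonneg (hb _).1]; exact (hb _).2) h6 hB6 hR6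
      (fun σ' => Frame (fwdPg ;; mulPg ;; invPg) σ6 σ' ∧
        ∀ x < P.L, |σ'.arr .xr x - 2 ^ P.k * corr a b P.L x| ≤ Θ ^ 18 / 2 ^ w) (fun σ' h h' => ⟨h, h'⟩)
    have hV7 := hV6.frame hf7
    have hs7 : σ7.var .s = s := by
      rw [hf7.var _ (by decide), hf6.var _ (by decide)]; exact hs5
    have hacc7 : Acc P σ7 g D e (Θ ^ 19 / 2 ^ w) s := by
      intro i hi
      rw [hf7.arr _ (by decide), hf6.arr _ (by decide)]
      exact ha5 i hi
    have hadd := addAcc_wp (ω := ω) H hV7 he hg hDb (s := s) (by omega) hs7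
      (d := fun x => corr a b P.L x) (fun x hx => by
        rw [corr_eq a b hbm (by omega)]
        refine Finset.sum_congr rfl fun j _ => ?_
        simp only [ha, add_assoc]) r7 hacc7
    obtain ⟨T2, r2, σ8, x8, r8⟩ := hadd
    have hf8 := x8.frame
    have hs8 : σ8.var .s = s := by rw [hf8.var _ (by decide)]; exact hs7
    have hev : Ev w Z σ8 (.var .s + .var .m) ((s + P.m : ℕ) : ℝ) :=
      Ev.addN hw (Ev.vN hs8) (Ev.vN ((hV7.frame hf8) .m (by decide))) (by omega)
    obtain ⟨T3, r3, σ9, x9, r9⟩ := WP.asg (ω := ω) (x := .s) hev (Q := fun σ' => σ' = _) rfl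
    obtain ⟨t1, t23, _, rfl, y1, y23⟩ := x7.seq_inv
    obtain ⟨t2, t3, _, rfl, y2, y3⟩ := y23.seq_inv
    refine ⟨t1 + (t2 + (t3 + (T2 + T3))), ?_, σ9, .seq y1 (.seq y2 (.seq y3 (.seq x8 x9))), ?_⟩
    · have : (Ex.var Var.s + Ex.var Var.m).cost + 1 = 4 := rfl
      omega
    · subst r9
      have e1 : (j + 1) * P.m = s + P.m := by rw [hsdef]; ring
      rw [e1]
      refine ⟨by simp, ?_⟩
      exact r8
  · rintro σ5 hf5 ⟨hs5, -⟩
    rw [htest _ σ5 (hV4.frame hf5) hs5]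
    omega
  · rintro j hj σ5 hf5 ⟨hs5, ha5⟩ hlt
    rw [htest _ σ5 (hV4.frame hf5) hs5] at hlt
    -- The loop cannot stop early: jm ≥ n - m + 1 gives (j + 1) m > n.
    have hjj : j = P.n / P.m := by
      refine le_antisymm hj ?_
      rw [← Nat.lt_succ_iff, Nat.div_lt_iff_lt_mul hm, Nat.succ_mul]
      omega
    subst hjj
    intro i hi
    refine (ha5 i hi).trans ?_
    gcongr
    split_ifs
    · exact le_rfl
    · positivity

end Column

/-! ### One level -/

def patPg : Pg :=
  zeroPg .PT .LM ;;
  forL .j .m (.asg .vh (.get .pat (.var .j)) ;; cellPg ;;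
    .put .PT (.var .j * .var .M + .var .ce) (.lit 1))

def halveLoop (k : Arr) (y : Var) : Pg :=
  forL .x y (.put k (.var .x) (.flr (.get k (.var .x) / .lit 2)))

def levelPg : Pg :=
  scatterPg ;; patPg ;; forL .c .M columnPg ;; halveLoop .txt .n ;; halveLoop .pat .m ;;
  .asg .G (.lit 2 * .var .G)

section Level

variable {w : ℕ} {ω : ℕ → Fin (2 ^ w)} {Z : ℕ} {σ : Sto} {P : Par} {Θ : ℝ}

/-- The indicator function of the positions of the pattern symbols in cell `c`. -/
noncomputable def Par.patInd (P : Par) (b : ℕ) (v : ℕ → ℕ) (c x : ℕ) : ℝ :=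
  if x < P.m ∧ (cell P.N P.Lam b (v x)).toNat = c then 1 else 0

theorem mul_add_inj {M x c x' c' : ℕ} (hc : c < M) (hc' : c' < M) (h : x * M + c = x' * M + c') :
    x = x' ∧ c = c' := by
  have h1 : x = x' := by
    have e1 : (x * M + c) / M = x := by
      rw [mul_comm, Nat.mul_add_div (by omega), Nat.div_eq_of_lt hc, add_zero]
    have e2 : (x' * M + c') / M = x' := by
      rw [mul_comm, Nat.mul_add_div (by omega), Nat.div_eq_of_lt hc', add_zero]
    rw [← e1, h, e2]
  subst h1
  exact ⟨rfl, by omega⟩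

theorem pat_wp (H : Good w Z P Θ) (hV : Vals P σ) {b : ℕ} {v : ℕ → ℕ} (hb : b ≤ 2 * P.Lam)
    (hbeta : σ.var .beta = (b : ℝ) / 2 ^ (P.ν + P.lam + 2)) (hpat : ∀ j < P.m, σ.arr .pat j = v j)
    (hv : ∀ j, v j < 2 ^ P.A) (Q : Sto → Prop)
    (hQ : ∀ σ', Frame patPg σ σ' →
      (∀ c < P.M, ∀ x < P.L, σ'.arr .PT (x * P.M + c) = P.patInd b v c x) → Q σ') :
    WP w ω Z patPg (P.L * P.M * 11 + P.m * 50 + 6) σ Q := by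
  have hw := H.hw
  have hM := H.M_pos
  have hSZ := H.hSZ
  have hZw := H.Zw
  have h2m := H.h2m
  have hLM : P.L * P.M ≤ Z := (Nat.mul_le_mul_right _ (Nat.le_add_left _ _)).trans hSZ
  have hLZ : P.L ≤ Z := H.ctx.hL
  suffices key : WP w ω Z patPg (P.L * P.M * 11 + P.m * 50 + 6) σ
      (fun σ' => ∀ c < P.M, ∀ x < P.L, σ'.arr .PT (x * P.M + c) = P.patInd b v c x) from
    key.mono le_rfl fun σ' hf h => hQ σ' hf h
  refine WP.cost (T := (P.L * P.M * 11 + 3) + (P.m * (45 + 5) + 3)) ?_ (by omega)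
  refine WP.seq (zero_wp hw (hV .LM (by decide)) hLM hZw (by decide) _ ?_)
  intro σ1 hf1 hz
  have hV1 := hV.frame hf1
  have hcellM : ∀ j, (cell P.N P.Lam b (v j)).toNat < P.M := fun j => by
    have c1 := cell_lt P.N P.Lam b H.N_pos H.Lam_pos (v j)
    unfold Par.M; have := H.N_pos; omega
  refine WP.for 45 (fun j σ' => ∀ c < P.M, ∀ x < P.L, σ'.arr .PT (x * P.M + c) =
    if x < j ∧ (cell P.N P.Lam b (v x)).toNat = c then 1 else 0) hw (hV1 .m (by decide)) (by omega)
    ?_ ?_ (fun σ' _ h => h)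
  · intro c hc x hx
    rw [if_neg (by omega)]
    refine hz _ ?_
    calc x * P.M + c < x * P.M + P.M := by omega
      _ = (x + 1) * P.M := by ring
      _ ≤ _ := Nat.mul_le_mul_right _ hx
  · intro j hj σ2 hf2 hvj hI
    have hV2 := hV1.frame hf2
    have hpj : Ev w Z σ2 (.get .pat (.var .j)) ((v j : ℤ) : ℝ) := by
      rw [Int.cast_natCast, ← hpat j hj]
      have := Ev.getN (w := w) (Z := Z) (k := .pat) (Ev.vN hvj) (by omega)
      rwa [hf2.arr _ (by decide), hf1.arr _ (by decide)] at this
    refine WP.cost (T := 6 + (12 + 20)) (WP.seq (WP.asg hpj ?_)) (by norm_num)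
    set σ3 := σ2.setVar .vh ((v j : ℤ) : ℝ) with hσ3
    have hV3 : Vals P σ3 := hV2.set _
    refine WP.seq (cell_wp H hV3 hb (v := (v j : ℤ)) ?_ rfl ?_ _ ?_)
    · change σ2.var .beta = _
      rw [hf2.var _ (by decide), hf1.var _ (by decide)]; exact hbeta
    · have h1 : (v j : ℝ) ≤ Θ := by
        refine le_trans ?_ H.ΘA
        exact_mod_cast (hv j).le
      rw [Int.cast_natCast, abs_of_nonneg (by positivity)]
      linarith [H.Θpos]
    intro σ4 hf4 ha4 hce hcM
    have hV4 := hV3.frame hf4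
    have hj4 : σ4.var .j = j := by rw [hf4.var _ (by decide)]; exact hvj
    have hlt : j * P.M + (cell P.N P.Lam b (v j)).toNat < P.L * P.M := by
      calc j * P.M + (cell P.N P.Lam b (v j)).toNat < j * P.M + P.M := by omega
        _ = (j + 1) * P.M := by ring
        _ ≤ _ := Nat.mul_le_mul_right _ (by omega)
    refine WP.cost (WP.put (Ev.addN hw (Ev.mulN hw (Ev.vN hj4) (Ev.vN (hV4 .M (by decide))) (by omega))
      (Ev.vN hce) (by omega)) (by omega) (Ev.one hw) ?_) (by decide)
    intro c hc x hx
    simp only [Sto.setVar_arr, Sto.setArr_arr, true_and, ha4]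
    by_cases hxx : x * P.M + c = j * P.M + (cell P.N P.Lam b (v j)).toNat
    · obtain ⟨rfl, rfl⟩ := mul_add_inj hc (hcellM j) hxx
      simp
    · rw [if_neg hxx]
      have := hI c hc x hx
      rw [show σ3.arr = σ2.arr from rfl, this]
      -- At row j the only cell that is new is the one just written, and that case has been
      -- excluded.
      have : x < j + 1 ∧ (cell P.N P.Lam b (v x)).toNat = c ↔ x < j ∧ (cell P.N P.Lam b (v x)).toNat = c := by
        constructor
        · rintro ⟨h1, h2⟩
          refine ⟨?_, h2⟩
          rcases Nat.lt_succ_iff_lt_or_eq.mp h1 with h | h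
          · exact h
          · subst h; subst h2; exact absurd rfl hxx
        · rintro ⟨h1, h2⟩
          exact ⟨by omega, h2⟩
      simp only [this]

theorem halve_wp (hw : 0 < w) (hZ : Z ≤ 2 ^ w) {k : Arr} {y : Var} {B : ℕ} {f : ℕ → ℕ} (hy : σ.var y = B)
    (hB : B ≤ Z) (hyx : y ≠ .x) (hf : ∀ i < B, σ.arr k i = f i) (hfw : ∀ i, f i ≤ 2 ^ w) (Q : Sto → Prop)
    (hQ : ∀ σ', Frame (halveLoop k y) σ σ' → (∀ i < B, σ'.arr k i = ((f i / 2 : ℕ) : ℝ)) → Q σ') :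
    WP w ω Z (halveLoop k y) (B * 18 + 3) σ Q := by
  have key : WP w ω Z (halveLoop k y) (B * (13 + 5) + 3) σ (fun σ' => ∀ i < B, σ'.arr k i = ((f i / 2 : ℕ) : ℝ)) := by
    refine WP.for 13 (fun j σ' => ∀ i < B, σ'.arr k i = (((if i < j then f i / 2 else f i) : ℕ) : ℝ)) hw hy
      (by omega) ?_ ?_ ?_ hyx (by simp [Pg.mv]) (by simp [Pg.mv])
    · intro i hi
      simpa using hf i hi
    · intro j hj σ' _ hx hI
      have h1 := hI j hj
      rw [if_neg (lt_irrefl _)] at h1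
      have h2 : Ev w Z σ' (.get k (.var .x)) (f j : ℝ) := by
        rw [← h1]; exact Ev.getN (Ev.vN hx) (by omega)
      refine WP.cost (WP.put (Ev.vN hx) (by omega) (Ev.divFlr hw (e := 1) h2 (Ev.two hw) (hfw j) hw) ?_)
        (by simp only [Ex.cost]; change 1 + (1 + 4 + 1 + 1 + 1) + 4 ≤ 13; norm_num)
      intro i hi
      simp only [Sto.setVar_arr, Sto.setArr_arr, true_and]
      by_cases hij : i = j
      · subst hij
        simp
      · rw [if_neg hij, hI i hi]
        have : i < j + 1 ↔ i < j := by omega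
        simp only [this]
    · intro σ' _ hI i hi
      rw [hI i hi, if_pos hi]
  exact key.mono le_rfl fun σ' hf h => hQ σ' hf h

/-- The contribution of level `a` to position `i`. -/
noncomputable def Par.levelSum (P : Par) (b a : ℕ) (u v : ℕ → ℕ) (i : ℕ) : ℝ :=
  ∑ c ∈ Finset.range P.M, if i < P.cov then P.colSum (P.table a b u P.n) (P.patInd b v c) c i else 0

/-- The state before level `a`. -/
structure LevelState (P : Par) (b a : ℕ) (T Pt : ℕ → ℕ) (σ : Sto) : Prop where
  vals : Vals P σ
  beta : σ.var .beta = (b : ℝ) / 2 ^ (P.ν + P.lam + 2)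
  G : σ.var .G = ((2 ^ a : ℕ) : ℝ)
  txt : ∀ i < P.n, σ.arr .txt i = ((T i / 2 ^ a : ℕ) : ℝ)
  pat : ∀ j < P.m, σ.arr .pat j = ((Pt j / 2 ^ a : ℕ) : ℝ)

/-- The cost of a level. -/
def Par.levelCost (P : Par) : ℕ := (P.n / P.m + 1) * P.L * P.k * P.M * 1200

/-- Each of the M columns adds its correlation to the accumulator with an error of at most Θ^19/2^w.
Halving text and pattern and doubling the block size then prepares the next scale. -/
theorem level_wp (H : Good w Z P Θ) {b a : ℕ} {T Pt : ℕ → ℕ} (hS : LevelState P b a T Pt σ)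
    (hb : b ≤ 2 * P.Lam) (ha : a < P.A) (hT : ∀ i, T i < 2 ^ P.A) (hP : ∀ i, Pt i < 2 ^ P.A)
    {g : ℕ → ℝ} {e : ℝ} (he : e ≤ Θ ^ 21 / 2 ^ w) (hg : ∀ i, |g i| ≤ Θ ^ 7)
    (hR : Close σ .rr .ri root P.L (Θ ^ 2 / 2 ^ w))
    (hacc : ∀ i < P.n + 1, |σ.arr .acc i - g i| ≤ e) :
    WP w ω Z levelPg P.levelCost σ (fun σ' => LevelState P b (a + 1) T Pt σ' ∧
      ∀ i < P.n + 1, |σ'.arr .acc i - (g i + P.levelSum b a (fun i => T i / 2 ^ a) (fun j => Pt j / 2 ^ a) i)|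
        ≤ e + P.M * (Θ ^ 19 / 2 ^ w)) := by
  have hw := H.hw
  have hZw := H.Zw
  have hM := H.M_pos
  have hSZ := H.hSZ
  have hm := H.hm
  have hmn := H.hmn
  have hk := H.k_pos
  have hΘ := H.Θpos
  have h2m := H.h2m
  have hnZ : P.n ≤ Z := by nlinarith
  set u := fun i => T i / 2 ^ a with hu
  set v := fun j => Pt j / 2 ^ a with hv
  have hu2 : ∀ i, u i < 2 ^ P.A := fun i => (Nat.div_le_self _ _).trans_lt (hT i)
  have hv2 : ∀ i, v i < 2 ^ P.A := fun i => (Nat.div_le_self _ _).trans_lt (hP i)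
  have hAw : 2 ^ P.A ≤ 2 ^ w := H.nat_le (j := 1) (by norm_num) (by rw [pow_one]; exact_mod_cast H.ΘA)
  have hMw : P.M ≤ 2 ^ w := H.nat_le (j := 1) (by norm_num) (by rw [pow_one]; exact H.ΘM)
  obtain ⟨CC, hCC⟩ : ∃ CC, CC = (P.n / P.m + 1) * (P.L * P.k * 800) := ⟨_, rfl⟩
  refine WP.cost (T := ((P.n + P.L) * P.M * 11 + P.n * (2 * P.N * 200) + 100) +
    ((P.L * P.M * 11 + P.m * 50 + 6) + ((P.M * (CC + 5) + 3) + ((P.n * 18 + 3) + ((P.m * 18 + 3) + 4))))) ?_ ?_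
  swap
  -- The total transform length (n/m + 1) L dominates both n and L, so every part of the cost is a
  -- multiple of this length times k times M.
  · have hX : P.n ≤ (P.n / P.m + 1) * P.L := by
      have h1 := Nat.div_add_mod P.n P.m
      have h2 := Nat.mod_lt P.n hm
      calc P.n ≤ (P.n / P.m + 1) * P.m := by rw [add_mul, one_mul, mul_comm (P.n / P.m)]; omega
        _ ≤ _ := Nat.mul_le_mul_left _ (by omega)
    have hX2 : P.L ≤ (P.n / P.m + 1) * P.L := Nat.le_mul_of_pos_left _ (Nat.succ_pos _)
    obtain ⟨X, hXd⟩ : ∃ X, X = (P.n / P.m + 1) * P.L := ⟨_, rfl⟩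
    rw [← hXd] at hX hX2
    have hXk : X * 1 ≤ X * P.k := Nat.mul_le_mul_left _ hk
    obtain ⟨Y, hY⟩ : ∃ Y, Y = X * P.k := ⟨_, rfl⟩
    have e1 : P.levelCost = Y * P.M * 1200 := by unfold Par.levelCost; rw [← hXd, hY]
    have e2 : CC = Y * 800 := by rw [hCC, hY, hXd]; ring
    have e3 : P.n * (2 * P.N * 200) = P.n * P.M * 100 := by unfold Par.M; ring
    have f1 : P.n * P.M ≤ Y * P.M := Nat.mul_le_mul_right _ (by omega)
    have f2 : P.L * P.M ≤ Y * P.M := Nat.mul_le_mul_right _ (by omega)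
    have f3 : Y * 1 ≤ Y * P.M := Nat.mul_le_mul_left _ hM
    have f4 : P.M * (CC + 5) = Y * P.M * 800 + P.M * 5 := by rw [e2]; ring
    have f5 : 1 * P.M ≤ Y * P.M := Nat.mul_le_mul_right _ (by omega)
    have f6 : (P.n + P.L) * P.M * 11 = P.n * P.M * 11 + P.L * P.M * 11 := by ring
    have f7 : 4 ≤ P.M := by unfold Par.M; have := H.N_pos; omega
    rw [e1, e3, f4, f6]
    omega
  refine WP.seq (scatter_wp H hS.vals hb hS.beta hS.G ha hS.txt hu2 _ ?_)
  intro σ1 hf1 hW1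
  have hV1 := hS.vals.frame hf1
  refine WP.seq (pat_wp H hV1 hb (by rw [hf1.var _ (by decide)]; exact hS.beta) (v := v)
    (fun j hj => by rw [hf1.arr _ (by decide)]; exact hS.pat j hj) hv2 _ ?_)
  intro σ2 hf2 hPT2
  have hV2 := hV1.frame hf2
  have hW2 : σ2.arr .W = σ1.arr .W := hf2.arr _ (by decide)
  have hR2 : Close σ2 .rr .ri root P.L (Θ ^ 2 / 2 ^ w) :=
    (hR.congr (hf1.arr _ (by decide)) (hf1.arr _ (by decide))).congr (hf2.arr _ (by decide)) (hf2.arr _ (by decide))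
  have hacc2 : ∀ i < P.n + 1, |σ2.arr .acc i - g i| ≤ e := by
    rw [hf2.arr _ (by decide), hf1.arr _ (by decide)]; exact hacc
  have ht : ∀ q, 0 ≤ P.table a b u P.n q ∧ P.table a b u P.n q ≤ Θ ^ 4 := fun q =>
    H.table_bounds b u ha q le_rfl
  have hbb : ∀ c x, 0 ≤ P.patInd b v c x ∧ P.patInd b v c x ≤ 1 := fun c x => by
    unfold Par.patInd; split_ifs <;> norm_num
  set D : ℕ → ℕ → ℝ := fun c i => if i < P.cov then P.colSum (P.table a b u P.n) (P.patInd b v c) c i else 0 with hD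
  have hDb : ∀ c i, 0 ≤ D c i ∧ D c i ≤ Θ ^ 5 := fun c i => by
    simp only [hD]
    split_ifs
    · exact H.colSum_bounds ht (hbb c) c i
    · exact ⟨le_rfl, by positivity⟩
  have hu19 : Θ ^ 19 / 2 ^ w * Θ = Θ ^ 20 / 2 ^ w := by ring
  have h21 : 20 * (Θ ^ 21 / 2 ^ w) ≤ 1 := by
    rw [← mul_div_assoc]
    exact (H.div_le (i := 22) (H.bump (by norm_num) 21) le_rfl).trans (H.div_le_one (by norm_num))
  have h20 : Θ ^ 20 / 2 ^ w ≤ Θ ^ 21 / 2 ^ w := H.div_le le_rfl (by norm_num)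
  have hδ0 : 0 ≤ Θ ^ 19 / 2 ^ w := by positivity
  refine WP.seq (WP.for CC (fun c σ' => ∀ i < P.n + 1, |σ'.arr .acc i - (g i + ∑ c' ∈ Finset.range c, D c' i)|
    ≤ e + c * (Θ ^ 19 / 2 ^ w)) hw (hV2 .M (by decide)) hMw ?_ ?_ ?_)
  · intro i hi
    simpa using hacc2 i hi
  · intro c hc σ3 hf3 hvc hI
    rw [hCC]
    have hcr : (c : ℝ) ≤ Θ := by
      refine le_trans ?_ H.ΘM
      exact_mod_cast hc.le
    have hce : c * (Θ ^ 19 / 2 ^ w) ≤ Θ ^ 20 / 2 ^ w := by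
      rw [← hu19, mul_comm]; gcongr
    refine WP.mono (column_wp H (hV2.frame hf3) (g := fun i => g i + ∑ c' ∈ Finset.range c, D c' i)
      (t := P.table a b u P.n) (b := P.patInd b v c) (e := e + c * (Θ ^ 19 / 2 ^ w)) (c := c)
      (by linarith) ?_ hc hvc ht (hbb c) ?_ ?_ ?_ ?_ hI) le_rfl ?_
    · intro i
      have h1 : |∑ c' ∈ Finset.range c, D c' i| ≤ Θ ^ 6 := by
        rw [abs_of_nonneg (Finset.sum_nonneg fun c' _ => (hDb c' i).1)]
        calc _ ≤ ∑ c' ∈ Finset.range c, Θ ^ 5 := Finset.sum_le_sum fun c' _ => (hDb c' i).2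
          _ = c * Θ ^ 5 := by rw [Finset.sum_const, Finset.card_range, nsmul_eq_mul]
          _ ≤ Θ * Θ ^ 5 := by gcongr
          _ = Θ ^ 6 := by ring
      have h2 := abs_add_le (g i) (∑ c' ∈ Finset.range c, D c' i)
      have h3 := hg i
      have h4 : Θ ^ 6 ≤ Θ ^ 7 := H.pow_mono (by norm_num)
      have h5 : 20 * Θ ^ 7 ≤ Θ ^ 8 := H.bump (by norm_num) 7
      have h6 : 0 ≤ Θ ^ 7 := by positivity
      linarith
    · intro x hx
      unfold Par.patInd
      rw [if_neg (by omega)]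
    · intro q hq
      rw [hf3.arr _ (by decide), hW2]
      exact hW1 q hq
    · intro x hx
      rw [hf3.arr _ (by decide)]
      exact hPT2 c hc x hx
    · exact hR2.congr (hf3.arr _ (by decide)) (hf3.arr _ (by decide))
    · intro σ4 hf4 h4 i hi
      have := h4 i hi
      simp only [Sto.setVar_arr]
      rw [Finset.sum_range_succ, ← add_assoc]
      refine this.trans (le_of_eq ?_)
      push_cast; ring
  intro σ5 hf5 hacc5
  have hV5 := hV2.frame hf5
  refine WP.seq (halve_wp hw hZw (f := u) (hV5 .n (by decide)) hnZ (by decide) ?_ (fun i => (hu2 i).le.trans hAw) _ ?_)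
  · intro i hi
    rw [hf5.arr _ (by decide), hf2.arr _ (by decide), hf1.arr _ (by decide)]; exact hS.txt i hi
  intro σ6 hf6 ht6
  have hV6 := hV5.frame hf6
  refine WP.seq (halve_wp hw hZw (f := v) (hV6 .m (by decide)) (by omega) (by decide) ?_ (fun i => (hv2 i).le.trans hAw) _ ?_)
  · intro i hi
    rw [hf6.arr _ (by decide), hf5.arr _ (by decide), hf2.arr _ (by decide), hf1.arr _ (by decide)]
    exact hS.pat i hi
  intro σ7 hf7 hp7
  have hV7 := hV6.frame hf7
  have hG7 : σ7.var .G = ((2 ^ a : ℕ) : ℝ) := by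
    rw [hf7.var _ (by decide), hf6.var _ (by decide), hf5.var _ (by decide), hf2.var _ (by decide),
      hf1.var _ (by decide)]
    exact hS.G
  have h2a : 2 * 2 ^ a ≤ 2 ^ w := by
    rw [← pow_succ']
    exact (Nat.pow_le_pow_right (by norm_num) ha).trans hAw
  have hdiv : ∀ x, x / 2 ^ a / 2 = x / 2 ^ (a + 1) := fun x => by
    rw [pow_succ, ← Nat.div_div_eq_div_mul]
  refine WP.cost (WP.asg (Ev.mulN hw (Ev.two hw) (Ev.vN hG7) h2a) ⟨⟨hV7.set _, ?_, ?_, ?_, ?_⟩, ?_⟩) (by decide)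
  · change σ7.var .beta = _
    rw [hf7.var _ (by decide), hf6.var _ (by decide), hf5.var _ (by decide), hf2.var _ (by decide),
      hf1.var _ (by decide)]
    exact hS.beta
  · rw [Sto.setVar_self, pow_succ']
  · intro i hi
    rw [Sto.setVar_arr, hf7.arr _ (by decide), ht6 i hi, ← hdiv]
  · intro i hi
    rw [Sto.setVar_arr, hp7 i hi, ← hdiv]
  · intro i hi
    rw [Sto.setVar_arr, hf7.arr _ (by decide), hf6.arr _ (by decide)]
    exact hacc5 i hi

end Level

/-! ### One trial -/

def copyIn (k : Arr) (y : Var) (e : Ex) : Pg := forL .x y (.put k (.var .x) (.get .io e))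

def updateBest : Pg :=
  forL .x .NM (.ite (.get .acc (.var .x)) (.get .best (.var .x))
    (.put .best (.var .x) (.get .acc (.var .x))) .skip)

/-- The random fraction is truncated to a multiple k/Λ of 1/Λ, and (1 + k/Λ)/M is the dyadic number
(Λ + k)/(4NΛ). The truncation is what keeps the products with symbols exact. -/
def hashPg : Pg :=
  .rnd .r ;; .asg .rho (.flr (.var .r * .var .LAM) / .var .LAM) ;;
  .asg .beta ((.lit 1 + .var .rho) / .var .M)

def loadPg : Pg :=
  copyIn .txt .n (.var .x) ;; copyIn .pat .m (.var .n + .var .x) ;; zeroPg .acc .NMm ;; .asg .G (.lit 1)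

def trialPg : Pg := hashPg ;; loadPg ;; forL .a .A levelPg ;; updateBest

section Trial

variable {w : ℕ} {ω : ℕ → Fin (2 ^ w)} {Z : ℕ} {σ : Sto} {P : Par} {Θ : ℝ}

theorem WP.rnd {x : Var} {Q : Sto → Prop}
    (h : Q { σ.setVar x (((ω σ.pos : ℕ) : ℝ) / 2 ^ w) with pos := σ.pos + 1 }) :
    WP w ω Z (.rnd x) 1 σ Q := ⟨_, le_rfl, _, .rnd, h⟩

/-- The multiplier drawn by means of the random word `x`. -/
def Par.mult (P : Par) (w x : ℕ) : ℕ := P.Lam + x / 2 ^ (w - P.lam)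

theorem Good.lam_le (H : Good w Z P Θ) : P.lam ≤ w := by
  have h : P.Lam ≤ 2 ^ w := H.nat_le (j := 1) (by norm_num) (by rw [pow_one]; exact H.ΘLam)
  exact (Nat.pow_le_pow_iff_right (by norm_num)).mp h

theorem Good.mult_lt (H : Good w Z P Θ) {x : ℕ} (hx : x < 2 ^ w) : P.mult w x < 2 * P.Lam := by
  have h : x / 2 ^ (w - P.lam) < P.Lam := by
    rw [Nat.div_lt_iff_lt_mul (Nat.two_pow_pos _)]
    unfold Par.Lam
    rwa [← pow_add, Nat.add_sub_cancel' H.lam_le]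
  unfold Par.mult; omega

theorem hash_wp (H : Good w Z P Θ) (hV : Vals P σ) (Q : Sto → Prop)
    (hQ : ∀ σ', Frame hashPg σ σ' → σ'.arr = σ.arr → σ'.pos = σ.pos + 1 →
      σ'.var .beta = (P.mult w (ω σ.pos) : ℝ) / 2 ^ (P.ν + P.lam + 2) → Q σ') :
    WP w ω Z hashPg 14 σ Q := by
  have hw := H.hw
  have hl := H.lam_le
  obtain ⟨x, hx⟩ : ∃ x, x = ((ω σ.pos : ℕ)) := ⟨_, rfl⟩
  have hxw : x < 2 ^ w := by rw [hx]; exact (ω σ.pos).isLt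
  have hww : w ≤ 2 ^ w := Nat.lt_two_pow_self.le
  have hmw : P.mult w x ≤ 2 ^ w := by
    refine (H.mult_lt hxw).le.trans (H.nat_le (j := 2) (by norm_num) ?_)
    push_cast
    have h1 : 20 * Θ ^ 1 ≤ Θ ^ 2 := H.bump (by norm_num) 1
    have := H.ΘLam
    have := H.Θpos
    linarith
  have hmr : ((P.mult w x : ℕ) : ℝ) = P.Lam + (x / 2 ^ (w - P.lam) : ℕ) := by
    unfold Par.mult; push_cast; rfl
  have hLr : (P.Lam : ℝ) = 2 ^ P.lam := by unfold Par.Lam; push_cast; rfl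
  have hJ : P.ν + P.lam + 2 ≤ 2 ^ w := by
    have h1 : 4 * P.N * P.Lam ≤ 2 ^ w := by
      refine H.nat_le (j := 2) (by norm_num) ?_
      push_cast
      rw [sq]; exact mul_le_mul H.ΘN H.ΘLam (by positivity) H.Θpos.le
    have h2 : 4 * P.N * P.Lam = 2 ^ (P.ν + P.lam + 2) := by unfold Par.N Par.Lam; ring
    rw [h2] at h1
    exact Nat.lt_two_pow_self.le.trans h1
  suffices key : WP w ω Z hashPg 14 σ (fun σ' => σ'.arr = σ.arr ∧ σ'.pos = σ.pos + 1 ∧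
      σ'.var .beta = (P.mult w x : ℝ) / 2 ^ (P.ν + P.lam + 2)) from
    key.mono le_rfl fun σ' hf h => hQ σ' hf h.1 h.2.1 (by rw [← hx]; exact h.2.2)
  have abs_nat : ∀ {y : ℕ}, y ≤ 2 ^ w → |((y : ℤ) : ℝ)| ≤ 2 ^ w := fun {y} hy => by
    rw [Int.cast_natCast, abs_of_nonneg (by positivity)]; exact_mod_cast hy
  refine WP.cost (WP.seq (WP.rnd ?_)) (T := 1 + (7 + 6)) (by norm_num)
  set σ1 : Sto := { σ.setVar .r (((ω σ.pos : ℕ) : ℝ) / 2 ^ w) with pos := σ.pos + 1 } with hσ1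
  have hV1 : Vals P σ1 := (hV.set (y := .r) (((ω σ.pos : ℕ) : ℝ) / 2 ^ w)).congr rfl
  have hr1 : σ1.var .r = (x : ℝ) / 2 ^ w := by rw [hx]; rfl
  have e1 : Ev w Z σ1 (.var .r * .var .LAM) (((x : ℤ) : ℝ) / 2 ^ (w - P.lam)) := by
    refine Ev.binD hw (o := .mul) x (w - P.lam) (Ev.v hr1) (Ev.v (hV1 .LAM (by decide))) trivial ?_
      (abs_nat hxw.le) (by omega)
    have h2 : P.val .LAM = 2 ^ P.lam := hLr
    have h3 : (2 : ℝ) ^ w = 2 ^ (w - P.lam) * 2 ^ P.lam := by rw [← pow_add, Nat.sub_add_cancel hl]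
    simp only [BinOp.eval]
    rw [h2, h3]; push_cast; field_simp
  obtain ⟨κ, hκ⟩ : ∃ κ, κ = x / 2 ^ (w - P.lam) := ⟨_, rfl⟩
  have hκw : κ ≤ 2 ^ w := by rw [hκ]; exact (Nat.div_le_self _ _).trans hxw.le
  have e2 : Ev w Z σ1 (.flr (.var .r * .var .LAM)) (κ : ℝ) := by
    refine Ev.flrN hw e1 ?_ hκw
    have := floor_nat_div x (2 ^ (w - P.lam))
    push_cast at this
    rw [hκ]; push_cast; exact this
  have e3 : Ev w Z σ1 (.flr (.var .r * .var .LAM) / .var .LAM) (((κ : ℤ) : ℝ) / 2 ^ P.lam) := by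
    refine Ev.binD hw (o := .div) κ P.lam e2 (Ev.v (hV1 .LAM (by decide))) ?_ ?_ (abs_nat hκw) (by omega)
    · change (P.Lam : ℝ) ≠ 0
      rw [hLr]; positivity
    · change (κ : ℝ) / (P.Lam : ℝ) = _
      rw [hLr]; simp
  refine WP.seq (T₁ := 7) (T₂ := 6) (WP.cost (WP.asg e3 ?_) (by decide))
  set σ2 := σ1.setVar .rho (((κ : ℤ) : ℝ) / 2 ^ P.lam) with hσ2
  have hV2 : Vals P σ2 := hV1.set _
  have e4 : Ev w Z σ2 (.lit 1 + .var .rho) (((P.mult w x : ℤ) : ℝ) / 2 ^ P.lam) := by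
    refine Ev.binD hw (o := .add) _ P.lam (Ev.one hw) (Ev.v rfl) trivial ?_ (abs_nat hmw) (by omega)
    simp only [BinOp.eval]
    rw [hσ2, Sto.setVar_self, Int.cast_natCast (P.mult w x), hmr, hLr, ← hκ]
    push_cast; field_simp
  have e5 : Ev w Z σ2 ((.lit 1 + .var .rho) / .var .M) (((P.mult w x : ℤ) : ℝ) / 2 ^ (P.ν + P.lam + 2)) := by
    have hM : P.val .M = 4 * 2 ^ P.ν := by
      change ((P.M : ℕ) : ℝ) = _
      unfold Par.M Par.N; push_cast; rfl
    refine Ev.binD hw (o := .div) _ _ e4 (Ev.v (hV2 .M (by decide))) ?_ ?_ (abs_nat hmw) hJ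
    · change P.val .M ≠ 0
      rw [hM]; positivity
    · simp only [BinOp.eval]
      rw [hM, pow_add, pow_add]; field_simp; norm_num
  refine WP.cost (WP.asg e5 ⟨rfl, rfl, ?_⟩) (by decide)
  rw [Sto.setVar_self, Int.cast_natCast]

theorem copyIn_wp (hw : 0 < w) (hZ : Z ≤ 2 ^ w) {k : Arr} {y : Var} {e : Ex} {B o : ℕ} {f : ℕ → ℝ}
    (hy : σ.var y = B) (hB : B ≤ Z) (hyx : y ≠ .x) (hk : k ≠ .io)
    (he : ∀ σ', Frame (copyIn k y e) σ σ' → ∀ j < B, σ'.var .x = j → Ev w Z σ' e ((o + j : ℕ) : ℝ))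
    (ho : o + B ≤ Z) (hc : e.cost ≤ 3) (hf : ∀ j < B, σ.arr .io (o + j) = f j) (Q : Sto → Prop)
    (hQ : ∀ σ', Frame (copyIn k y e) σ σ' → (∀ j < B, σ'.arr k j = f j) → Q σ') :
    WP w ω Z (copyIn k y e) (B * 17 + 3) σ Q := by
  suffices key : WP w ω Z (copyIn k y e) (B * (12 + 5) + 3) σ (fun σ' => ∀ i < B, σ'.arr k i = f i) from
    key.mono le_rfl fun σ' hf h => hQ σ' hf h
  refine WP.for 12 (fun j σ' => ∀ i < j, σ'.arr k i = f i) hw hy (by omega) (by simp) ?_ (fun σ' _ h => h)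
    hyx (by simp [Pg.mv]) (by simp [Pg.mv])
  intro j hj σ' hfr hx hI
  have h1 : Ev w Z σ' (.get .io e) (f j) := by
    have := Ev.getN (k := .io) (he σ' hfr j hj hx) (by omega)
    rwa [hfr.arr .io (by simpa [forL, Pg.ma] using hk.symm), hf j hj] at this
  refine WP.cost (WP.put (Ev.vN hx) (by omega) h1 ?_) (by simp only [Ex.cost]; omega)
  intro i hi
  simp only [Sto.setVar_arr, Sto.setArr_arr, true_and]
  split_ifs with hij
  · rw [hij]
  · exact hI i (by omega)

theorem load_input_wp (H : Good w Z P Θ) (hV : Vals P σ) {T Pt : ℕ → ℕ} {b : ℕ}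
    (hT : ∀ i < P.n, σ.arr .io i = T i) (hP : ∀ j < P.m, σ.arr .io (P.n + j) = Pt j)
    (hnm : P.n + P.m ≤ Z) (hbeta : σ.var .beta = (b : ℝ) / 2 ^ (P.ν + P.lam + 2)) (Q : Sto → Prop)
    (hQ : ∀ σ', Frame loadPg σ σ' → LevelState P b 0 T Pt σ' → (∀ i < P.n + 1, σ'.arr .acc i = 0) → Q σ') :
    WP w ω Z loadPg (P.n * 60 + 30) σ Q := by
  have hw := H.hw
  have hZw := H.Zw
  have hmn := H.hmn
  have hm := H.hm
  suffices key : WP w ω Z loadPg (P.n * 60 + 30) σ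
      (fun σ' => LevelState P b 0 T Pt σ' ∧ ∀ i < P.n + 1, σ'.arr .acc i = 0) from
    key.mono le_rfl fun σ' hf h => hQ σ' hf h.1 h.2
  refine WP.cost (T := (P.n * 17 + 3) + ((P.m * 17 + 3) + (((P.n - P.m + 1 + P.m) * 11 + 3) + 2))) ?_ (by omega)
  refine WP.seq (copyIn_wp hw hZw (o := 0) (f := fun i => (T i : ℝ)) (hV .n (by decide)) (by omega) (by decide) (by decide)
    (fun σ' _ j _ hx => by rw [zero_add]; exact Ev.vN hx) (by omega) (by decide)
    (fun j hj => by rw [zero_add]; exact hT j hj) _ ?_)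
  intro σ1 hf1 h1
  have hV1 := hV.frame hf1
  refine WP.seq (copyIn_wp hw hZw (o := P.n) (f := fun i => (Pt i : ℝ)) (hV1 .m (by decide)) (by omega) (by decide) (by decide)
    (fun σ' hf j hj hx => Ev.addN hw (Ev.vN ((hV1.frame hf) .n (by decide))) (Ev.vN hx) (by omega)) (by omega)
    (by decide) (fun j hj => by rw [hf1.arr _ (by decide)]; exact hP j hj) _ ?_)
  intro σ2 hf2 h2
  have hV2 := hV1.frame hf2
  refine WP.seq (zero_wp hw (hV2 .NMm (by decide)) (by omega) hZw (by decide) _ ?_)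
  intro σ3 hf3 h3
  have hV3 := hV2.frame hf3
  refine WP.cost (WP.asg (Ev.one hw) ⟨⟨hV3.set _, ?_, ?_, ?_, ?_⟩, ?_⟩) (by decide)
  · rw [Sto.setVar_ne _ _ (by decide), hf3.var _ (by decide), hf2.var _ (by decide), hf1.var _ (by decide)]
    exact hbeta
  · simp
  · intro i hi
    rw [Sto.setVar_arr, hf3.arr _ (by decide), hf2.arr _ (by decide), h1 i hi]; simp
  · intro i hi
    rw [Sto.setVar_arr, hf3.arr _ (by decide), h2 i hi]; simp
  · intro i hi
    rw [Sto.setVar_arr]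
    exact h3 i (by omega)

theorem updateBest_wp (H : Good w Z P Θ) (hV : Vals P σ) (Q : Sto → Prop)
    (hQ : ∀ σ', Frame updateBest σ σ' →
      (∀ i < P.n - P.m + 1, σ'.arr .best i = min (σ.arr .best i) (σ.arr .acc i)) → Q σ') :
    WP w ω Z updateBest (P.n * 40 + 3) σ Q := by
  have hw := H.hw
  have hZw := H.Zw
  have hmn := H.hmn
  have hm := H.hm
  have hnZ : P.n + 1 ≤ Z := by
    have h1 := H.hSZ
    have h2 := H.M_pos
    have h3 := H.L_pos
    nlinarith
  suffices key : WP w ω Z updateBest (P.n * 40 + 3) σ (fun σ' =>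
      ∀ i < P.n - P.m + 1, σ'.arr .best i = min (σ.arr .best i) (σ.arr .acc i)) from
    key.mono le_rfl fun σ' hf h => hQ σ' hf h
  refine WP.cost (T := (P.n - P.m + 1) * (30 + 5) + 3) ?_ (by omega)
  refine WP.for 30 (fun j σ' => ∀ i, σ'.arr .best i =
    if i < j then min (σ.arr .best i) (σ.arr .acc i) else σ.arr .best i) hw (hV .NM (by decide)) (by omega)
    (by simp) ?_ (fun σ' _ h i hi => by rw [h i, if_pos hi])
  intro j hj σ1 hf hx hI
  have ha : σ1.arr .acc = σ.arr .acc := hf.arr _ (by decide)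
  have hbj := hI j
  rw [if_neg (lt_irrefl _)] at hbj
  have e1 := Ev.getN (w := w) (Z := Z) (k := .acc) (Ev.vN hx) (by omega)
  have e2 := Ev.getN (w := w) (Z := Z) (k := .best) (Ev.vN hx) (by omega)
  rw [ha] at e1
  rw [hbj] at e2
  refine WP.cost (WP.ite (T := 15) e1 e2 (fun h => WP.cost (WP.put (Ev.vN hx) (by omega) e1 ?_) (by decide))
    (fun h => WP.cost (WP.skip ?_) (by norm_num))) (by decide)
  · intro i
    simp only [Sto.setVar_arr, Sto.setArr_arr, true_and, hI i]
    by_cases hij : i = j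
    · subst hij; rw [if_pos rfl, if_pos (by omega), min_eq_right h.le]
    · rw [if_neg hij]
      have : i < j + 1 ↔ i < j := by omega
      simp only [this]
  · intro i
    simp only [Sto.setVar_arr, hI i]
    by_cases hij : i = j
    · subst hij; rw [if_neg (lt_irrefl _), if_pos (by omega), min_eq_left (not_lt.mp h)]
    · have : i < j + 1 ↔ i < j := by omega
      simp only [this]

/-- The exact value that a trial computes for position `i`. -/
noncomputable def Par.trialSum (P : Par) (b : ℕ) (T Pt : ℕ → ℕ) (A i : ℕ) : ℝ :=
  ∑ a ∈ Finset.range A, P.levelSum b a (fun i => T i / 2 ^ a) (fun j => Pt j / 2 ^ a) i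

theorem Good.levelSum_bounds (H : Good w Z P Θ) (b : ℕ) (u v : ℕ → ℕ) {a : ℕ} (ha : a < P.A) (i : ℕ) :
    0 ≤ P.levelSum b a u v i ∧ P.levelSum b a u v i ≤ Θ ^ 6 := by
  have hΘ := H.Θpos
  have hbb : ∀ c x, 0 ≤ P.patInd b v c x ∧ P.patInd b v c x ≤ 1 := fun c x => by
    unfold Par.patInd; split_ifs <;> norm_num
  have hD : ∀ c, 0 ≤ (if i < P.cov then P.colSum (P.table a b u P.n) (P.patInd b v c) c i else 0) ∧
      (if i < P.cov then P.colSum (P.table a b u P.n) (P.patInd b v c) c i else 0) ≤ Θ ^ 5 := fun c => by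
    split_ifs
    · exact H.colSum_bounds (fun q => H.table_bounds b u ha q le_rfl) (hbb c) c i
    · exact ⟨le_rfl, by positivity⟩
  refine ⟨Finset.sum_nonneg fun c _ => (hD c).1, ?_⟩
  calc _ ≤ ∑ c ∈ Finset.range P.M, Θ ^ 5 := Finset.sum_le_sum fun c _ => (hD c).2
    _ = P.M * Θ ^ 5 := by rw [Finset.sum_const, Finset.card_range, nsmul_eq_mul]
    _ ≤ Θ * Θ ^ 5 := by gcongr; exact H.ΘM
    _ = Θ ^ 6 := by ring

theorem Good.ΘA' (H : Good w Z P Θ) : (P.A : ℝ) ≤ Θ := by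
  refine le_trans ?_ H.ΘA
  exact_mod_cast Nat.lt_two_pow_self.le

theorem Good.trialSum_bounds (H : Good w Z P Θ) (b : ℕ) (T Pt : ℕ → ℕ) {A : ℕ} (hA : A ≤ P.A) (i : ℕ) :
    0 ≤ P.trialSum b T Pt A i ∧ P.trialSum b T Pt A i ≤ Θ ^ 7 := by
  have hΘ := H.Θpos
  have h : ∀ a ∈ Finset.range A, a < P.A := fun a ha => (Finset.mem_range.mp ha).trans_le hA
  refine ⟨Finset.sum_nonneg fun a ha => (H.levelSum_bounds b _ _ (h a ha) i).1, ?_⟩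
  calc _ ≤ ∑ a ∈ Finset.range A, Θ ^ 6 :=
        Finset.sum_le_sum fun a ha => (H.levelSum_bounds b _ _ (h a ha) i).2
    _ = A * Θ ^ 6 := by rw [Finset.sum_const, Finset.card_range, nsmul_eq_mul]
    _ ≤ Θ * Θ ^ 6 := by
        gcongr
        refine le_trans ?_ H.ΘA'
        exact_mod_cast hA
    _ = Θ ^ 7 := by ring

/-- The state before a trial. -/
structure TrialState (P : Par) (T Pt : ℕ → ℕ) (η : ℝ) (σ : Sto) : Prop where
  vals : Vals P σ
  txt : ∀ i < P.n, σ.arr .io i = T i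
  pat : ∀ j < P.m, σ.arr .io (P.n + j) = Pt j
  roots : Close σ .rr .ri root P.L η

theorem TrialState.frame {T Pt : ℕ → ℕ} {η : ℝ} (h : TrialState P T Pt η σ) {c : Pg} {σ' : Sto} (hf : Frame c σ σ')
    (hc : ∀ x ∈ constVars, x ∉ c.mv := by decide) (ha : ∀ k ∈ [Arr.io, .rr, .ri], k ∉ c.ma := by decide) :
    TrialState P T Pt η σ' := by
  have h1 := hf.arr .io (ha _ (by decide))
  refine ⟨h.vals.frame hf hc, by rw [h1]; exact h.txt, by rw [h1]; exact h.pat,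
    h.roots.congr (hf.arr .rr (ha _ (by decide))) (hf.arr .ri (ha _ (by decide)))⟩

def Par.trialCost (P : Par) : ℕ := P.A * (P.levelCost + 5) + P.n * 100 + 100

/-- A trial draws exactly one word, so the t-th trial depends on the t-th word alone. The value v
that it computes appears only through the minimum, which is all that the later argument needs. -/
theorem trial_wp (H : Good w Z P Θ) {T Pt : ℕ → ℕ} (hS : TrialState P T Pt (Θ ^ 2 / 2 ^ w) σ)
    (hnm : P.n + P.m ≤ Z) (hT : ∀ i, T i < 2 ^ P.A) (hP : ∀ i, Pt i < 2 ^ P.A) :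
    WP w ω Z trialPg P.trialCost σ (fun σ' => σ'.pos = σ.pos + 1 ∧ ∀ i < P.n - P.m + 1,
      ∃ v, |v - P.trialSum (P.mult w (ω σ.pos)) T Pt P.A i| ≤ Θ ^ 21 / 2 ^ w ∧
        σ'.arr .best i = min (σ.arr .best i) v) := by
  have hw := H.hw
  have hΘ := H.Θpos
  have hmn := H.hmn
  have hm := H.hm
  obtain ⟨b, hb⟩ : ∃ b, b = P.mult w (ω σ.pos) := ⟨_, rfl⟩
  rw [← hb]
  have hb2 : b ≤ 2 * P.Lam := by rw [hb]; exact (H.mult_lt (ω σ.pos).isLt).le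
  obtain ⟨LC, hLC⟩ : ∃ LC, LC = P.levelCost := ⟨_, rfl⟩
  refine WP.cost (T := 14 + ((P.n * 60 + 30) + ((P.A * (LC + 5) + 3) + (P.n * 40 + 3)))) ?_
    (by unfold Par.trialCost; rw [← hLC]; omega)
  refine WP.seq (hash_wp H hS.vals _ ?_)
  intro σ1 hf1 ha1 hp1 hbeta1
  rw [← hb] at hbeta1
  have hS1 := hS.frame hf1
  refine WP.seq (load_input_wp H hS1.vals hS1.txt hS1.pat hnm hbeta1 _ ?_)
  intro σ2 hf2 hL2 hacc2
  have hS2 := hS1.frame hf2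
  have hAw : P.A ≤ 2 ^ w := H.nat_le (j := 1) (by norm_num) (by rw [pow_one]; exact H.ΘA')
  have hδ : (P.M : ℝ) * (Θ ^ 19 / 2 ^ w) ≤ Θ ^ 20 / 2 ^ w := by
    calc (P.M : ℝ) * (Θ ^ 19 / 2 ^ w) ≤ Θ * (Θ ^ 19 / 2 ^ w) := by gcongr; exact H.ΘM
      _ = Θ ^ 20 / 2 ^ w := by ring
  have hδa : ∀ a ≤ P.A, (a : ℝ) * (P.M * (Θ ^ 19 / 2 ^ w)) ≤ Θ ^ 21 / 2 ^ w := fun a ha => by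
    calc (a : ℝ) * (P.M * (Θ ^ 19 / 2 ^ w)) ≤ Θ * (Θ ^ 20 / 2 ^ w) := by
          gcongr
          refine le_trans ?_ H.ΘA'
          exact_mod_cast ha
      _ = Θ ^ 21 / 2 ^ w := by ring
  refine WP.seq (WP.for LC (fun a σ' => LevelState P b a T Pt σ' ∧ ∀ i < P.n + 1,
    |σ'.arr .acc i - P.trialSum b T Pt a i| ≤ a * (P.M * (Θ ^ 19 / 2 ^ w))) hw (hS2.vals .A (by decide)) hAw
    ⟨⟨hL2.vals.set _, hL2.beta, hL2.G, hL2.txt, hL2.pat⟩, ?_⟩ ?_ ?_)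
  · intro i hi
    rw [Sto.setVar_arr, hacc2 i hi]
    simp [Par.trialSum]
  · intro a ha σ3 hf3 hva hI
    rw [hLC]
    refine WP.mono (level_wp H hI.1 hb2 ha hT hP (g := P.trialSum b T Pt a)
      (e := a * (P.M * (Θ ^ 19 / 2 ^ w))) (hδa a ha.le) ?_ ?_ hI.2) le_rfl ?_
    · intro i
      have := H.trialSum_bounds b T Pt ha.le i
      rw [abs_of_nonneg this.1]; exact this.2
    · exact hS2.roots.congr (hf3.arr _ (by decide)) (hf3.arr _ (by decide))
    · rintro σ4 hf4 ⟨hL4, hacc4⟩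
      refine ⟨⟨hL4.vals.set _, hL4.beta, hL4.G, hL4.txt, hL4.pat⟩, ?_⟩
      intro i hi
      rw [Sto.setVar_arr]
      have h5 : P.trialSum b T Pt (a + 1) i = P.trialSum b T Pt a i +
          P.levelSum b a (fun i => T i / 2 ^ a) (fun j => Pt j / 2 ^ a) i := Finset.sum_range_succ _ _
      rw [h5]
      refine (hacc4 i hi).trans (le_of_eq ?_)
      push_cast; ring
  rintro σ5 hf5 ⟨hL5, hacc5⟩
  refine (updateBest_wp H hL5.vals _ ?_)
  intro σ6 hf6 hbest
  refine ⟨?_, fun i hi => ⟨σ5.arr .acc i, (hacc5 i (by omega)).trans (hδa _ le_rfl), ?_⟩⟩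
  · rw [hf6.pos (by decide), hf5.pos (by decide), hf2.pos (by decide), hp1]
  · rw [hbest i hi, hf5.arr _ (by decide), hf2.arr _ (by decide), ha1]

end Trial

/-! ### The computed sums are the sums of the estimator. -/

section Identity

variable {w : ℕ} {ω : ℕ → Fin (2 ^ w)} {Z : ℕ} {σ : Sto} {P : Par} {Θ : ℝ}

theorem Good.cell_lt (H : Good w Z P Θ) (b : ℕ) (v : ℤ) : (cell P.N P.Lam b v).toNat < P.M := by
  have := FloatRAM.cell_lt P.N P.Lam b H.N_pos H.Lam_pos v
  have := H.N_pos
  unfold Par.M; omega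

/-- An index determines its row and its cell, as cells are below M; so a row of the table receives
contributions from its own text symbol only. -/
theorem Good.table_eq (H : Good w Z P Θ) (a b : ℕ) (u : ℕ → ℕ) {x c : ℕ} (hx : x < P.n) (hc : c < P.M) :
    P.table a b u P.n (x * P.M + c) = ∑ k ∈ Finset.range (2 * P.N - 1),
      if P.nearCell b (u x) k = c then weight P.p a (u x) (P.near (u x) k) else 0 := by
  have h : ∀ i k, x * P.M + c = i * P.M + P.nearCell b (u i) k ↔ i = x ∧ P.nearCell b (u i) k = c := by
    intro i k
    constructor
    · intro hh
      obtain ⟨h1, h2⟩ := mul_add_inj hc (H.cell_lt b _) hh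
      exact ⟨h1.symm, h2.symm⟩
    · rintro ⟨rfl, h2⟩
      rw [h2]
  unfold Par.table
  rw [Finset.sum_eq_single x]
  · unfold Par.row
    refine Finset.sum_congr rfl fun k _ => ?_
    simp only [h, true_and]
  · intro i _ hi
    refine Finset.sum_eq_zero fun k _ => ?_
    rw [if_neg]
    rw [h]; exact fun hh => hi hh.1
  · intro hh
    exact absurd (Finset.mem_range.mpr hx) hh

/-- Every pattern symbol lies in exactly one cell. After exchanging the sums over cells and pattern
positions, the indicator selects that cell, and the table entry there is the contribution of the
pair to the estimate. -/
theorem Good.levelSum_eq (H : Good w Z P Θ) (a b : ℕ) (u v : ℕ → ℕ) {i : ℕ} (hi : i < P.n - P.m + 1) :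
    P.levelSum b a u v i = ∑ j ∈ Finset.range P.m, estLevel P.p P.N P.Lam b a (u (i + j)) (v j) := by
  have hmn := H.hmn
  have hm := H.hm
  -- The chunks cover all starts of windows: n < (n/m) m + m.
  have hcov : i < P.cov := by
    have h1 := Nat.div_add_mod P.n P.m
    have h2 := Nat.mod_lt P.n hm
    unfold Par.cov
    rw [mul_comm]; omega
  unfold Par.levelSum Par.colSum
  simp only [if_pos hcov]
  rw [Finset.sum_comm]
  refine Finset.sum_congr rfl fun j hj => ?_
  rw [Finset.mem_range] at hj
  rw [Finset.sum_eq_single (cell P.N P.Lam b (v j)).toNat]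
  · unfold Par.patInd
    rw [if_pos ⟨hj, rfl⟩, mul_one, H.table_eq a b u (by omega) (H.cell_lt b _)]
    unfold estLevel
    refine Finset.sum_congr rfl fun k _ => ?_
    have hL := Nat.mul_pos H.N_pos H.Lam_pos
    have h : P.nearCell b (u (i + j)) k = (cell P.N P.Lam b (v j)).toNat ↔
        cell P.N P.Lam b ((u (i + j) : ℤ) + ((k : ℤ) - (P.N - 1))) = cell P.N P.Lam b (v j) := by
      have h1 := cell_nonneg P.N P.Lam b hL (P.near (u (i + j)) k)
      have h2 := cell_nonneg P.N P.Lam b hL (v j)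
      change (cell P.N P.Lam b (P.near (u (i + j)) k)).toNat = _ ↔ cell P.N P.Lam b (P.near (u (i + j)) k) = _
      omega
    simp only [h]
    rfl
  · intro c _ hc
    unfold Par.patInd
    rw [if_neg (fun hh => hc hh.2.symm), mul_zero]
  · intro hh
    exact absurd (Finset.mem_range.mpr (H.cell_lt b _)) hh

theorem Good.trialSum_eq (H : Good w Z P Θ) (b A : ℕ) (T Pt : ℕ → ℕ) {i : ℕ} (hi : i < P.n - P.m + 1) :
    P.trialSum b T Pt A i = ∑ j ∈ Finset.range P.m, est P.p P.N P.Lam b A (T (i + j)) (Pt j) := by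
  unfold Par.trialSum est
  rw [Finset.sum_comm]
  exact Finset.sum_congr rfl fun a _ => H.levelSum_eq a b _ _ hi

end Identity

/-! ### All trials, and the output -/

/-- Since p ≤ 1, nU is an upper bound for every sum of p-th powers, so starting the minimum there
does no harm, and it caps the final value whatever the random words are. -/
def initBest : Pg := forL .x .NM (.put .best (.var .x) (.var .n * .var .U))

/-- The sum of p-th powers of integers is 0 or at least 1, so the threshold 1/2 recognizes zero
distances exactly and keeps the base of the root away from 0. -/
def outPg : Pg :=
  forL .x .NM (.ite (.get .best (.var .x)) (.lit 1 / .lit 2) (.put .io (.var .x) (.lit 0))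
    (.put .io (.var .x) (.bin .pow (.get .best (.var .x)) (.lit 1 / .var .p))))

def mainPg : Pg := rootsPg ;; initBest ;; forL .t .R trialPg ;; outPg

section Main

variable {w : ℕ} {ω : ℕ → Fin (2 ^ w)} {Z : ℕ} {σ : Sto} {P : Par} {Θ : ℝ}

/-- The output for the estimate `B` of a sum of powers. -/
noncomputable def outVal (w : ℕ) (p B : ℝ) : ℝ :=
  if B < 1 / 2 then 0 else fround w (B ^ fround w (1 / p))

theorem initBest_wp (H : Good w Z P Θ) (hV : Vals P σ) (hU : P.U ≤ 2 ^ P.A) (Q : Sto → Prop)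
    (hQ : ∀ σ', Frame initBest σ σ' → (∀ i < P.n - P.m + 1, σ'.arr .best i = P.n * P.U) → Q σ') :
    WP w ω Z initBest (P.n * 13 + 3) σ Q := by
  have hw := H.hw
  have hZw := H.Zw
  have hmn := H.hmn
  have hm := H.hm
  have hnZ : P.n + 1 ≤ Z := by
    have h1 := H.hSZ
    have h2 := H.M_pos
    have h3 := H.L_pos
    nlinarith
  have hnU : P.n * P.U ≤ 2 ^ w := by
    refine H.nat_le (j := 2) (by norm_num) ?_
    push_cast
    rw [sq]
    refine mul_le_mul H.Θn (le_trans ?_ H.ΘA) (by positivity) H.Θpos.le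
    exact_mod_cast hU
  suffices key : WP w ω Z initBest (P.n * 13 + 3) σ
      (fun σ' => ∀ i < P.n - P.m + 1, σ'.arr .best i = P.n * P.U) from
    key.mono le_rfl fun σ' hf h => hQ σ' hf h
  refine WP.cost (T := (P.n - P.m + 1) * (8 + 5) + 3) ?_ (by omega)
  refine WP.for 8 (fun j σ' => ∀ i < j, σ'.arr .best i = P.n * P.U) hw (hV .NM (by decide)) (by omega)
    (by simp) ?_ (fun σ' _ h => h)
  intro j hj σ1 hf hx hI
  have hV1 := hV.frame hf
  refine WP.cost (WP.put (Ev.vN hx) (by omega)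
    (Ev.mulN hw (Ev.vN (hV1 .n (by decide))) (Ev.vN (hV1 .U (by decide))) hnU) ?_) (by decide)
  intro i hi
  simp only [Sto.setVar_arr, Sto.setArr_arr, true_and]
  split_ifs with h
  · push_cast; rfl
  · exact hI i (by omega)

theorem fround_nonneg (w : ℕ) {x : ℝ} (hx : 0 ≤ x) : 0 ≤ fround w x := by
  unfold fround
  split_ifs
  · exact le_rfl
  · refine mul_nonneg ?_ (by positivity)
    have : (0 : ℤ) ≤ round (x / (2 : ℝ) ^ (Int.log 2 |x| - (w : ℤ) + 1)) := by
      rw [round_eq]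
      exact Int.floor_nonneg.mpr (by positivity)
    exact_mod_cast this

theorem pow_four_le_two_pow {w : ℕ} (h : 16 ≤ w) : w ^ 4 ≤ 2 ^ w := by
  induction w, h using Nat.le_induction with
  | base => norm_num
  | succ w hw ih =>
    have h1 : (w + 1) ^ 4 ≤ 2 * w ^ 4 := by
      have h2 : 4 * w ^ 3 ≤ w ^ 4 / 4 := by
        rw [Nat.le_div_iff_mul_le (by norm_num), pow_succ w 3]
        nlinarith [Nat.zero_le (w ^ 3)]
      have h3 : 6 * w ^ 2 + 4 * w + 1 ≤ w ^ 3 := by nlinarith [Nat.zero_le (w ^ 2)]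
      have h4 : (w + 1) ^ 4 = w ^ 4 + 4 * w ^ 3 + (6 * w ^ 2 + 4 * w + 1) := by ring
      omega
    rw [pow_succ 2 w]; omega

/-- Already 1000^30 exceeds 2^200. -/
theorem Good.w_ge (H : Good w Z P Θ) : 200 ≤ w := by
  by_contra hh
  have h1 : (2 : ℝ) ^ w ≤ 2 ^ 200 := pow_le_pow_right₀ (by norm_num) (by omega)
  have h2 : (1000 : ℝ) ^ 30 ≤ Θ ^ 30 := by gcongr; exact H.Θ0
  have h3 := H.Θw
  have h4 : (2 : ℝ) ^ 200 < 1000 ^ 30 := by norm_num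
  linarith

/-- Roots do not overflow. -/
theorem Good.root_inRange (H : Good w Z P Θ) {B y : ℝ} (hB : 1 / 2 ≤ B) (hB2 : B ≤ Θ ^ 3) (hy0 : 0 ≤ y)
    (hy : y ≤ Θ) : InRange w (B ^ y) := by
  have hΘ := H.Θpos
  have hB0 : 0 < B := by linarith
  have hw1 : (0 : ℝ) < w := by have := H.w_ge; positivity
  unfold InRange
  rw [abs_of_nonneg (by positivity)]
  -- Compared by fourth powers, using w^4 ≤ 2^w and Θ^4 ≤ 2^w.
  have h1 : (w : ℝ) * Θ < 2 ^ w := by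
    have h2 : ((w : ℝ) * Θ) ^ 4 < (2 ^ w) ^ 4 := by
      have h3 : (w : ℝ) ^ 4 ≤ 2 ^ w := by exact_mod_cast pow_four_le_two_pow (by have := H.w_ge; omega)
      have h4 : Θ ^ 4 ≤ 2 ^ w := H.pow_le (by norm_num)
      have h5 : (1 : ℝ) < 2 ^ w := one_lt_pow₀ (by norm_num) H.hw.ne'
      calc ((w : ℝ) * Θ) ^ 4 = (w : ℝ) ^ 4 * Θ ^ 4 := by ring
        _ ≤ 2 ^ w * 2 ^ w := by gcongr
        _ = (2 ^ w) ^ 2 := by ring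
        _ < (2 ^ w) ^ 4 := pow_lt_pow_right₀ h5 (by norm_num)
    exact lt_of_pow_lt_pow_left₀ 4 (by positivity) h2
  have hBw : B ≤ 2 ^ (w : ℝ) := by
    rw [Real.rpow_natCast]
    exact hB2.trans (H.pow_le (by norm_num))
  calc B ^ y ≤ (2 ^ (w : ℝ)) ^ y := Real.rpow_le_rpow hB0.le hBw hy0
    _ = 2 ^ ((w : ℝ) * y) := by rw [← Real.rpow_mul (by norm_num)]
    _ < 2 ^ (((2 ^ w : ℕ) : ℝ)) := by
        refine Real.rpow_lt_rpow_of_exponent_lt (by norm_num) ?_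
        push_cast
        calc (w : ℝ) * y ≤ w * Θ := by gcongr
          _ < _ := h1
    _ = 2 ^ (2 ^ w : ℕ) := Real.rpow_natCast _ _

theorem out_wp (H : Good w Z P Θ) (hV : Vals P σ) (hip : 4 / P.p ≤ Θ) {B : ℕ → ℝ}
    (hB : ∀ i < P.n - P.m + 1, σ.arr .best i = B i) (hB3 : ∀ i < P.n - P.m + 1, B i ≤ Θ ^ 3) (Q : Sto → Prop)
    (hQ : ∀ σ', Frame outPg σ σ' → (∀ i < P.n - P.m + 1, σ'.arr .io i = outVal w P.p (B i)) → Q σ') :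
    WP w ω Z outPg (P.n * 40 + 3) σ Q := by
  have hw := H.hw
  have hZw := H.Zw
  have hmn := H.hmn
  have hm := H.hm
  have hp := H.p0
  have hnZ : P.n + 1 ≤ Z := by
    have h1 := H.hSZ
    have h2 := H.M_pos
    have h3 := H.L_pos
    nlinarith
  suffices key : WP w ω Z outPg (P.n * 40 + 3) σ
      (fun σ' => ∀ i < P.n - P.m + 1, σ'.arr .io i = outVal w P.p (B i)) from
    key.mono le_rfl fun σ' hf h => hQ σ' hf h
  refine WP.cost (T := (P.n - P.m + 1) * (35 + 5) + 3) ?_ (by omega)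
  refine WP.for 35 (fun j σ' => ∀ i < j, σ'.arr .io i = outVal w P.p (B i)) hw (hV .NM (by decide)) (by omega)
    (by simp) ?_ (fun σ' _ h => h)
  intro j hj σ1 hf hx hI
  have hV1 := hV.frame hf
  have ej : Ev w Z σ1 (.get .best (.var .x)) (B j) := by
    have := Ev.getN (w := w) (Z := Z) (k := .best) (Ev.vN hx) (by omega)
    rwa [hf.arr _ (by decide), hB j hj] at this
  have eh : Ev w Z σ1 (.lit 1 / .lit 2) (1 / 2 : ℝ) := by
    refine (Ev.binD hw (o := .div) 1 1 (Ev.one hw) (Ev.two hw) (by change ((2 : ℕ) : ℝ) ≠ 0; norm_num)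
      (by simp [BinOp.eval]) ?_ Nat.one_le_two_pow).cast (by norm_num)
    simpa using one_le_pow₀ (by norm_num)
  have hfin : ∀ v, v = outVal w P.p (B j) → ∀ i < j + 1,
      ((σ1.setArr .io j v).setVar .x ((j + 1 : ℕ) : ℝ)).arr .io i = outVal w P.p (B i) := by
    intro v hv i hi
    simp only [Sto.setVar_arr, Sto.setArr_arr, true_and]
    split_ifs with h
    · rw [h]; exact hv
    · exact hI i (by omega)
  refine WP.cost (WP.ite (T := 20) ej eh (fun h => WP.cost (WP.put (Ev.vN hx) (by omega) (Ev.zero hw) ?_) (by decide))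
    (fun h => ?_)) (by decide)
  · refine hfin _ ?_
    unfold outVal
    rw [if_pos h]
  · rw [not_lt] at h
    have hB0 : 0 < B j := by linarith
    have h1p : 1 / P.p ≤ Θ / 4 := by
      have : 4 / P.p = 4 * (1 / P.p) := by ring
      linarith
    have hΘw : Θ ≤ 2 ^ w := by have := H.pow_le (j := 1) (by norm_num); rwa [pow_one] at this
    have hw1 : (1 : ℝ) ≤ 2 ^ w := one_le_pow₀ (by norm_num)
    have hp0 : 0 ≤ 1 / P.p := by positivity
    have ey : Ev w Z σ1 (.lit 1 / .var .p) (fround w (1 / P.p)) := by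
      refine (Ev.bin_ok (o := .div) (Ev.one hw) (Ev.v (hV1 .p (by decide))) (by exact hp.ne') ?_).cast ?_
      · change |((1 : ℕ) : ℝ) / P.p| ≤ _
        rw [Nat.cast_one, abs_of_nonneg hp0]
        linarith [H.Θ0]
      · change fround w (((1 : ℕ) : ℝ) / P.p) = _
        rw [Nat.cast_one]
    have hy : fround w (1 / P.p) ≤ Θ := by
      have h2 := abs_fround_sub_le w (1 / P.p)
      rw [abs_of_nonneg hp0] at h2
      have h3 : (1 / P.p + 1) / 2 ^ w ≤ 1 / P.p + 1 := div_le_self (by linarith) hw1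
      have h4 := le_abs_self (fround w (1 / P.p) - 1 / P.p)
      linarith [H.Θ0]
    refine WP.cost (WP.put (Ev.vN hx) (by omega) (v := fround w (B j ^ fround w (1 / P.p)))
      ⟨_, _, ej, ey, Or.inl hB0, H.root_inRange h (hB3 j hj) (fround_nonneg w hp0) hy, rfl⟩ ?_) (by decide)
    refine hfin _ ?_
    unfold outVal
    rw [if_neg (not_lt.mpr h)]

/-- The estimate `B` of position `i` after `t` trials. -/
def Par.Within (P : Par) (w : ℕ) (ω : ℕ → Fin (2 ^ w)) (T Pt : ℕ → ℕ) (δ : ℝ) (t i : ℕ) (B : ℝ) : Prop :=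
  B ≤ P.n * P.U ∧ (∀ x : ℝ, x ≤ P.n * P.U → (∀ t' < t, x ≤ P.trialSum (P.mult w (ω t')) T Pt P.A i) → x - δ ≤ B) ∧
    ∀ t' < t, B ≤ P.trialSum (P.mult w (ω t')) T Pt P.A i + δ

def Par.mainCost (P : Par) : ℕ := P.R * (P.trialCost + 5) + P.n * 60 + P.k * P.L * 100 + 200

/-- The statement holds for every sequence of random words: the result is capped by nU, is not below
any common lower bound of the trials, and is not above any single trial, up to the rounding error.
Halting, running time and absence of faults thus do not involve probability. -/
theorem main_wp (H : Good w Z P Θ) {T Pt : ℕ → ℕ} (hV : Vals P σ) (hpos : σ.pos = 0)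
    (hio : ∀ i < P.n, σ.arr .io i = T i) (hiop : ∀ j < P.m, σ.arr .io (P.n + j) = Pt j)
    (hnm : P.n + P.m ≤ Z) (hT : ∀ i, T i < 2 ^ P.A) (hP : ∀ i, Pt i < 2 ^ P.A) (hU : P.U ≤ 2 ^ P.A)
    (hip : 4 / P.p ≤ Θ) (hR : P.R ≤ 2 ^ w) :
    WP w ω Z mainPg P.mainCost σ (fun σ' => ∀ i < P.n - P.m + 1, ∃ B,
      P.Within w ω T Pt (Θ ^ 21 / 2 ^ w) P.R i B ∧ σ'.arr .io i = outVal w P.p B) := by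
  have hw := H.hw
  have hΘ := H.Θpos
  have hmn := H.hmn
  have hm := H.hm
  have Θ0 := H.Θ0
  have hwg := H.w_ge
  have hk : (P.k : ℝ) ≤ Θ := by
    refine le_trans ?_ H.ΘL
    unfold Par.L
    exact_mod_cast Nat.lt_two_pow_self.le
  have hk1 : 1000 * (P.k : ℝ) ≤ Θ ^ 2 := by nlinarith
  obtain ⟨TC, hTC⟩ : ∃ TC, TC = P.trialCost := ⟨_, rfl⟩
  refine WP.cost (T := (P.k * (2 ^ P.k * 100) + 100) + ((P.n * 13 + 3) + ((P.R * (TC + 5) + 3) + (P.n * 40 + 3)))) ?_ ?_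
  swap
  · unfold Par.mainCost Par.L
    rw [← hTC]
    have : P.k * (2 ^ P.k * 100) = P.k * 2 ^ P.k * 100 := by ring
    omega
  refine WP.seq (WP.mono (roots_wp H.ctx H.k_pos (by omega) (hk1.trans (H.pow_le (by norm_num)))
    (hV .KM (by decide))) le_rfl ?_)
  intro σ1 hf1 hr1
  have hS1 : TrialState P T Pt (Θ ^ 2 / 2 ^ w) σ1 := by
    have h1 : σ1.arr .io = σ.arr .io := hf1.arr _ (by decide)
    refine ⟨hV.frame hf1, by rw [h1]; exact hio, by rw [h1]; exact hiop, ?_⟩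
    refine Close.mono hr1 ?_
    gcongr
  have hpos1 : σ1.pos = 0 := by rw [hf1.pos (by decide), hpos]
  refine WP.seq (initBest_wp H hS1.vals hU _ ?_)
  intro σ2 hf2 hb2
  have hS2 := hS1.frame hf2
  have hpos2 : σ2.pos = 0 := by rw [hf2.pos (by decide), hpos1]
  have hδ0 : 0 ≤ Θ ^ 21 / 2 ^ w := by positivity
  set δ := Θ ^ 21 / 2 ^ w with hδ
  refine WP.seq (WP.for TC (fun t σ' => σ'.pos = t ∧ ∀ i < P.n - P.m + 1, P.Within w ω T Pt δ t i (σ'.arr .best i))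
    hw (hS2.vals .R (by decide)) hR ⟨by simpa using hpos2, ?_⟩ ?_ ?_)
  · intro i hi
    rw [Sto.setVar_arr, hb2 i hi]
    exact ⟨le_rfl, fun x hx _ => by linarith, by simp⟩
  · rintro t ht σ3 hf3 - ⟨hp3, hI⟩
    rw [hTC]
    refine WP.mono (trial_wp H (hS2.frame hf3) hnm hT hP) le_rfl ?_
    rintro σ4 hf4 ⟨hp4, hbest⟩
    rw [hp3] at hp4 hbest
    refine ⟨hp4, fun i hi => ?_⟩
    obtain ⟨v, hv, hmin⟩ := hbest i hi
    obtain ⟨h1, h2, h3⟩ := hI i hi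
    rw [abs_le] at hv
    rw [Sto.setVar_arr, hmin]
    refine ⟨(min_le_left _ _).trans h1, fun x hx hxt => le_min (h2 x hx fun t' ht' => hxt t' (by omega)) ?_, ?_⟩
    · have := hxt t (by omega)
      linarith
    · intro t' ht'
      rcases Nat.lt_succ_iff_lt_or_eq.mp ht' with h | h
      · exact (min_le_left _ _).trans (h3 t' h)
      · subst h
        refine (min_le_right _ _).trans ?_
        linarith
  rintro σ5 hf5 ⟨-, hI⟩
  have hV5 : Vals P σ5 := hS2.vals.frame hf5
  have hnU : (P.n * P.U : ℝ) ≤ Θ ^ 3 := by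
    have h1 : (P.n * P.U : ℝ) ≤ Θ * Θ := by
      refine mul_le_mul H.Θn (le_trans ?_ H.ΘA) (by positivity) hΘ.le
      exact_mod_cast hU
    nlinarith
  refine (out_wp H hV5 hip (B := σ5.arr .best) (fun i _ => rfl) (fun i hi => (hI i hi).1.trans hnU) _ ?_)
  intro σ6 hf6 ho i hi
  exact ⟨_, hI i hi, ho i hi⟩

end Main

/-! ### The setup of the parameters -/

def doubleLoop (x y : Var) (c : Pg) : Pg := .asg x (.lit 1) ;; .wh x y (.asg x (.lit 2 * .var x) ;; c)

def levelsPg : Pg := .asg .A (.lit 0) ;; doubleLoop .PU .U (.asg .A (.var .A + .lit 1))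

/-- The transform length is 2^(clog m + 1), hence between 2m and 4m. `KM` trails `K` by one and
counts the doublings of the table of roots. -/
def sizePg : Pg :=
  .asg .K (.lit 1) ;; .asg .KM (.lit 0) ;;
  doubleLoop .L .m (.asg .KM (.var .K) ;; .asg .K (.var .K + .lit 1)) ;;
  .asg .L (.lit 2 * .var .L)

def trialsPg (C : ℕ) : Pg := .asg .R (.lit C) ;; doubleLoop .P2 .n (.asg .R (.var .R + .lit C))

/-- N is doubled until the rounded product N p ε reaches 16384 (A + 1). The large constant is what
makes the error of the sums a small multiple of pε in spite of rounding. -/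
def windowPg : Pg :=
  .asg .TH (.lit 16384 * (.var .A + .lit 1)) ;; .asg .ip (.var .p * .var .eps) ;;
  .asg .N (.lit 2) ;; .asg .X (.var .N * .var .ip) ;;
  .wh .X .TH (.asg .N (.lit 2 * .var .N) ;; .asg .X (.var .N * .var .ip))

def derivedPg : Pg :=
  .asg .M (.lit 4 * .var .N) ;; .asg .LAM (.lit 8 * .var .PU * .var .N) ;;
  .asg .NM (.var .n - .var .m + .lit 1) ;; .asg .NMm (.var .NM + .var .m) ;;
  .asg .SZ ((.var .n + .var .L) * .var .M) ;; .asg .LM (.var .L * .var .M) ;;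
  .asg .Wd (.lit 2 * .var .N - .lit 1)

def setupPg (C : ℕ) : Pg := levelsPg ;; sizePg ;; trialsPg C ;; windowPg ;; derivedPg

section Setup

variable {w : ℕ} {ω : ℕ → Fin (2 ^ w)} {Z : ℕ} {σ : Sto}

/-- A loop that doubles `x` until it reaches `y`. -/
theorem double_wp (hw : 0 < w) {x y : Var} {c : Pg} {Y : ℕ} (Tb : ℕ) (J : ℕ → Sto → Prop) (hY : σ.var y = Y)
    (hYw : 2 * Y ≤ 2 ^ w) (h0 : J 0 (σ.setVar x 1))
    (hstep : ∀ j < Nat.clog 2 Y, ∀ σ', Frame (doubleLoop x y c) σ σ' → J j σ' →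
      WP w ω Z c Tb (σ'.setVar x ((2 ^ (j + 1) : ℕ) : ℝ)) (J (j + 1))) (Q : Sto → Prop)
    (hend : ∀ σ', Frame (doubleLoop x y c) σ σ' → J (Nat.clog 2 Y) σ' →
      σ'.var x = ((2 ^ Nat.clog 2 Y : ℕ) : ℝ) → Q σ')
    (hyx : y ≠ x := by decide) (hy : y ∉ c.mv := by decide) (hx : x ∉ c.mv := by decide) :
    WP w ω Z (doubleLoop x y c) (2 + (Nat.clog 2 Y * (4 + Tb + 1) + 1)) σ Q := by
  refine WP.seq (T₁ := 2) (WP.mono (WP.asg (Q := fun σ' => σ' = σ.setVar x ((1 : ℕ) : ℝ)) (Ev.one hw) rfl)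
    le_rfl ?_)
  rintro σ0 hf0 rfl
  have hyf : y ∉ (doubleLoop x y c).mv := by simp [doubleLoop, Pg.mv, hyx, hy]
  have hF : ∀ σ', Frame (.asg x (.lit 2 * .var x) ;; c) (σ.setVar x ((1 : ℕ) : ℝ)) σ' →
      Frame (doubleLoop x y c) σ σ' := by
    intro σ' hf
    refine (Frame.mono hf0 ?_ ?_ ?_).trans (Frame.mono hf ?_ ?_ ?_) <;>
      simp +contextual [doubleLoop, Pg.mv, Pg.ma, Pg.random]
  refine WP.wh (Nat.clog 2 Y) (4 + Tb) (fun j σ' => σ'.var x = ((2 ^ j : ℕ) : ℝ) ∧ J j σ')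
    ⟨by simp, by simpa using h0⟩ ?_ ?_ ?_
  · rintro j hj σ' hf ⟨hxj, hJ⟩ -
    have h2 : 2 * 2 ^ j ≤ 2 ^ w := by
      have := (Nat.lt_clog_iff_pow_lt (by norm_num)).mp hj
      omega
    refine WP.seq (T₁ := 4) (WP.asg (Ev.mulN hw (Ev.two hw) (Ev.vN hxj) h2) ?_)
    rw [← pow_succ']
    refine WP.mono (hstep j hj σ' (hF σ' hf) hJ) le_rfl ?_
    intro σ'' hf' hJ'
    exact ⟨by rw [hf'.var x hx]; simp, hJ'⟩
  · rintro σ' hf ⟨h1, -⟩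
    rw [h1, (hF σ' hf).var y hyf, hY, not_lt]
    exact_mod_cast Nat.le_pow_clog (by norm_num) Y
  · rintro j hj σ' hf ⟨h1, hJ⟩ hn
    rw [h1, (hF σ' hf).var y hyf, hY, not_lt] at hn
    have h2 : Y ≤ 2 ^ j := by exact_mod_cast hn
    have : j = Nat.clog 2 Y := le_antisymm hj ((Nat.clog_le_iff_le_pow (by norm_num)).mpr h2)
    subst this
    exact hend σ' (hF σ' hf) hJ h1

theorem clog_le_self (Y : ℕ) : Nat.clog 2 Y ≤ Y := by
  rw [Nat.clog_le_iff_le_pow (by norm_num)]; exact Nat.lt_two_pow_self.le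

/-- Rounding up to a power of two at most doubles; this controls every size that the setup computes.
-/
theorem pow_clog_le {Y : ℕ} (hY : 1 ≤ Y) : 2 ^ Nat.clog 2 Y ≤ 2 * Y := by
  rcases Nat.eq_zero_or_pos (Nat.clog 2 Y) with h | h
  · rw [h]; omega
  · have h1 : 2 ^ (Nat.clog 2 Y - 1) < Y := (Nat.lt_clog_iff_pow_lt (by norm_num)).mp (by omega)
    have h2 : 2 ^ Nat.clog 2 Y = 2 * 2 ^ (Nat.clog 2 Y - 1) := by
      rw [← pow_succ']; congr 1; omega
    omega

theorem levels_wp (hw : 0 < w) {U : ℕ} (hU : σ.var .U = U) (hUw : 2 * U ≤ 2 ^ w) (Q : Sto → Prop)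
    (hQ : ∀ σ', Frame levelsPg σ σ' → σ'.var .A = Nat.clog 2 U → σ'.var .PU = ((2 ^ Nat.clog 2 U : ℕ) : ℝ) → Q σ') :
    WP w ω Z levelsPg (Nat.clog 2 U * 9 + 10) σ Q := by
  suffices key : WP w ω Z levelsPg (Nat.clog 2 U * 9 + 10) σ (fun σ' => σ'.var .A = Nat.clog 2 U ∧
      σ'.var .PU = ((2 ^ Nat.clog 2 U : ℕ) : ℝ)) from key.mono le_rfl fun σ' hf h => hQ σ' hf h.1 h.2
  refine WP.cost (T := 2 + (2 + (Nat.clog 2 U * (4 + 4 + 1) + 1))) ?_ (by omega)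
  refine WP.seq (WP.cost (WP.asg (Ev.zero hw) ?_) (by decide))
  have hcU := clog_le_self U
  refine double_wp (x := .PU) (y := .U) (c := .asg .A (.var .A + .lit 1)) hw 4 (fun j σ' => σ'.var .A = j) (Y := U) ?_ hUw ?_ ?_ _ ?_
  · exact hU
  · simp [Sto.setVar_var]
  · intro j hj σ' _ hA
    have hA' : (σ'.setVar .PU ((2 ^ (j + 1) : ℕ) : ℝ)).var .A = j := hA
    refine WP.cost (WP.asg (Ev.addN hw (Ev.vN hA') (Ev.one hw) (by omega)) ?_) (by decide)
    simp
  · intro σ' _ h1 h2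
    exact ⟨h1, h2⟩

theorem size_wp (hw : 0 < w) {m : ℕ} (hm : σ.var .m = m) (hmw : 4 * m ≤ 2 ^ w) (hm1 : 1 ≤ m) (Q : Sto → Prop)
    (hQ : ∀ σ', Frame sizePg σ σ' → σ'.var .K = ((Nat.clog 2 m + 1 : ℕ) : ℝ) → σ'.var .KM = Nat.clog 2 m →
      σ'.var .L = ((2 ^ (Nat.clog 2 m + 1) : ℕ) : ℝ) → Q σ') :
    WP w ω Z sizePg (Nat.clog 2 m * 11 + 20) σ Q := by
  suffices key : WP w ω Z sizePg (Nat.clog 2 m * 11 + 20) σ (fun σ' => σ'.var .K = ((Nat.clog 2 m + 1 : ℕ) : ℝ) ∧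
      σ'.var .KM = Nat.clog 2 m ∧ σ'.var .L = ((2 ^ (Nat.clog 2 m + 1) : ℕ) : ℝ)) from
    key.mono le_rfl fun σ' hf h => hQ σ' hf h.1 h.2.1 h.2.2
  refine WP.cost (T := 2 + (2 + ((2 + (Nat.clog 2 m * (4 + 6 + 1) + 1)) + 4))) ?_ (by omega)
  have hcm := clog_le_self m
  have hpm := pow_clog_le hm1
  refine WP.seq (WP.cost (WP.asg (Ev.one hw) ?_) (by decide))
  refine WP.seq (WP.cost (WP.asg (Ev.zero hw) ?_) (by decide))
  refine WP.seq (double_wp hw 6 (fun j σ' => σ'.var .K = ((j + 1 : ℕ) : ℝ) ∧ σ'.var .KM = j) (Y := m) ?_ (by omega) ?_ ?_ _ ?_)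
  · exact hm
  · simp [Sto.setVar_var]
  · rintro j hj σ' _ ⟨hK, hKM⟩
    refine WP.cost (T := 2 + 4) (WP.seq (WP.cost (WP.asg (Ev.vN (v := j + 1) hK) ?_) (by decide))) le_rfl
    refine WP.cost (WP.asg (Ev.addN hw (i := j + 1) (Ev.vN hK) (Ev.one hw) (by omega)) ?_) (by decide)
    simp [Sto.setVar_var]
  · rintro σ' _ ⟨h1, h2⟩ h3
    refine WP.cost (WP.asg (Ev.mulN hw (Ev.two hw) (Ev.vN h3) (by omega)) ⟨h1, h2, ?_⟩) (by decide)
    rw [Sto.setVar_self, pow_succ']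

theorem trials_wp (hw : 0 < w) {n C : ℕ} (hn : σ.var .n = n) (hnw : 2 * n ≤ 2 ^ w)
    (hC : C * (n + 1) ≤ 2 ^ w) (Q : Sto → Prop)
    (hQ : ∀ σ', Frame (trialsPg C) σ σ' → σ'.var .R = ((C * (Nat.clog 2 n + 1) : ℕ) : ℝ) → Q σ') :
    WP w ω Z (trialsPg C) (Nat.clog 2 n * 9 + 10) σ Q := by
  suffices key : WP w ω Z (trialsPg C) (Nat.clog 2 n * 9 + 10) σ
      (fun σ' => σ'.var .R = ((C * (Nat.clog 2 n + 1) : ℕ) : ℝ)) from key.mono le_rfl fun σ' hf h => hQ σ' hf h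
  refine WP.cost (T := 2 + (2 + (Nat.clog 2 n * (4 + 4 + 1) + 1))) ?_ (by omega)
  have hcn := clog_le_self n
  have hC1 : C ≤ 2 ^ w := le_trans (Nat.le_mul_of_pos_right _ (Nat.succ_pos _)) hC
  refine WP.seq (WP.cost (WP.asg (Ev.litN hw C hC1) ?_) (by simp [Ex.cost]))
  refine double_wp hw 4 (fun j σ' => σ'.var .R = ((C * (j + 1) : ℕ) : ℝ)) (Y := n) ?_ hnw ?_ ?_ _ ?_ (by decide)
    (by simp [Pg.mv]) (by simp [Pg.mv])
  · exact hn
  · simp [Sto.setVar_var]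
  · intro j hj σ' _ hR
    have hR' : (σ'.setVar .P2 ((2 ^ (j + 1) : ℕ) : ℝ)).var .R = ((C * (j + 1) : ℕ) : ℝ) := hR
    have h1 : C * (j + 1) + C ≤ 2 ^ w := by
      have : C * (j + 1 + 1) ≤ C * (n + 1) := Nat.mul_le_mul_left _ (by omega)
      rw [mul_add, mul_one] at this
      omega
    refine WP.cost (WP.asg (Ev.addN hw (Ev.vN hR') (Ev.litN hw C hC1) h1) ?_) (le_of_eq rfl)
    rw [Sto.setVar_self]
    push_cast; ring
  · intro σ' _ h1 _
    exact h1

theorem fround_half_le {w : ℕ} (hw : 0 < w) {x : ℝ} (hx : ((2 : ℝ) ^ w)⁻¹ ≤ x) :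
    x / 2 ≤ fround w x ∧ fround w x ≤ 2 * x := by
  have hx0 : 0 < x := lt_of_lt_of_le (by positivity) hx
  have h := abs_fround_sub_le_of_le (w := w) (x := x) (by
    rw [abs_of_pos hx0]
    exact (inv_anti₀ (by positivity) (pow_lt_pow_pow w).le).trans hx)
  rw [abs_of_pos hx0] at h
  have h2 : x / 2 ^ w ≤ x / 2 := by
    have : (2 : ℝ) ^ 1 ≤ 2 ^ w := pow_le_pow_right₀ (by norm_num) hw
    rw [pow_one] at this
    gcongr
  rw [abs_le] at h
  constructor <;> linarith [h.1, h.2]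

/-- The window loop; `x` is the product of the exponent and the accuracy. -/
theorem window_wp (hw : 0 < w) {A B : ℕ} {p e x : ℝ} (hx : x = p * e) (hx1 : x ≤ 1) (hx0 : 0 < x)
    (hB : 131072 * ((A : ℝ) + 1) ≤ B * x) (hBw : 2 * B ≤ 2 ^ w) :
    ∃ ν, 4096 * ((A : ℝ) + 1) ≤ 2 ^ ν * x ∧ 2 ^ ν * x ≤ 131072 * (A + 1) ∧
      ∀ (ω : ℕ → Fin (2 ^ w)) (Z : ℕ) (σ : Sto), σ.var .A = A → σ.var .p = p → σ.var .eps = e →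
      ∀ Q : Sto → Prop, (∀ σ', Frame windowPg σ σ' → σ'.var .N = ((2 ^ ν : ℕ) : ℝ) → Q σ') →
        WP w ω Z windowPg (B * 9 + 20) σ Q := by
  have hA0 : (0 : ℝ) ≤ A := by positivity
  have hBx : (B : ℝ) * x ≤ B := mul_le_of_le_one_right (by positivity) hx1
  have hBr : 131072 * ((A : ℝ) + 1) ≤ B := hB.trans hBx
  have hBpos : (0 : ℝ) < B := by linarith
  have hBn : 131072 * (A + 1) ≤ B := by exact_mod_cast hBr
  have hBwr : 2 * (B : ℝ) ≤ 2 ^ w := by exact_mod_cast hBw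
  have hxw : ((2 : ℝ) ^ w)⁻¹ ≤ x / 2 := by
    rw [inv_le_iff_one_le_mul₀ (by positivity)]
    calc (1 : ℝ) ≤ 131072 * ((A : ℝ) + 1) := by linarith
      _ ≤ B * x := hB
      _ = x / 2 * (2 * B) := by ring
      _ ≤ x / 2 * 2 ^ w := by gcongr
  obtain ⟨y, hy⟩ : ∃ y, y = fround w x := ⟨_, rfl⟩
  obtain ⟨hy1, hy2⟩ := fround_half_le hw (hxw.trans (half_le_self hx0.le))
  rw [← hy] at hy1 hy2
  have hy0 : 0 < y := by linarith
  set f : ℕ → ℝ := fun j => fround w (((2 ^ (j + 1) : ℕ) : ℝ) * y) with hf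
  have hfb : ∀ j, 2 ^ j * y ≤ f j ∧ f j ≤ 4 * (2 ^ j * y) := by
    intro j
    have h1 : (1 : ℝ) ≤ 2 ^ j := one_le_pow₀ (by norm_num)
    have e1 : ((2 ^ (j + 1) : ℕ) : ℝ) * y = 2 * (2 ^ j * y) := by push_cast; ring
    have h2 : y ≤ 2 ^ j * y := le_mul_of_one_le_left hy0.le h1
    obtain ⟨h3, h4⟩ := fround_half_le hw (x := ((2 ^ (j + 1) : ℕ) : ℝ) * y) (by rw [e1]; linarith)
    simp only [hf]
    rw [e1] at h3 h4 ⊢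
    constructor <;> linarith
  obtain ⟨TH, hTH⟩ : ∃ TH : ℕ, TH = 16384 * (A + 1) := ⟨_, rfl⟩
  have hTHr : (TH : ℝ) = 16384 * (A + 1) := by rw [hTH]; push_cast; ring
  have hex : ∃ j, (TH : ℝ) ≤ f j := by
    refine ⟨B, ?_⟩
    have h1 : (B : ℝ) ≤ 2 ^ B := by exact_mod_cast Nat.lt_two_pow_self.le
    have h2 : (B : ℝ) * y ≤ 2 ^ B * y := by gcongr
    have h3 : (B : ℝ) * (x / 2) ≤ B * y := by gcongr
    have := (hfb B).1
    rw [hTHr]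
    linarith
  obtain ⟨j0, hj0, hj1⟩ : ∃ j0, (TH : ℝ) ≤ f j0 ∧ ∀ j < j0, f j < TH := by
    classical
    exact ⟨Nat.find hex, Nat.find_spec hex, fun j hj => not_le.mp (Nat.find_min hex hj)⟩
  -- The last test that failed bounds 2^j y by the threshold. Two more doublings and y ≥ x/2 give
  -- the factor 8 = 131072/16384.
  have hup : (2 : ℝ) ^ (j0 + 1) * x ≤ 131072 * (A + 1) := by
    rcases j0 with _ | j
    · norm_num; linarith
    · have h1 := hj1 j (Nat.lt_succ_self _)
      have h2 := (hfb j).1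
      have h3 : (2 : ℝ) ^ j * (x / 2) ≤ 2 ^ j * y := by gcongr
      have e1 : (2 : ℝ) ^ (j + 1 + 1) * x = 8 * (2 ^ j * (x / 2)) := by ring
      rw [e1]
      linarith
  -- The rounded value is at most four times 2^j y, and y ≤ 2x; this gives the factor 1/4 =
  -- 4096/16384.
  have hlow : 4096 * ((A : ℝ) + 1) ≤ 2 ^ (j0 + 1) * x := by
    have h2 := (hfb j0).2
    have h3 : (2 : ℝ) ^ j0 * y ≤ 2 ^ j0 * (2 * x) := by gcongr
    have e1 : (2 : ℝ) ^ (j0 + 1) * x = 2 ^ j0 * (2 * x) := by ring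
    rw [e1]
    linarith
  have hNB : 2 ^ (j0 + 1) ≤ B := by
    have : (2 : ℝ) ^ (j0 + 1) * x ≤ B * x := hup.trans hB
    have := le_of_mul_le_mul_right this hx0
    exact_mod_cast this
  have hjB : j0 + 1 ≤ B := Nat.lt_two_pow_self.le.trans hNB
  refine ⟨j0 + 1, hlow, hup, fun ω Z σ hA hp he Q hQ => ?_⟩
  suffices key : WP w ω Z windowPg (B * 9 + 20) σ (fun σ' => σ'.var .N = ((2 ^ (j0 + 1) : ℕ) : ℝ)) from
    key.mono le_rfl fun σ' hf h => hQ σ' hf h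
  refine WP.cost (T := 6 + (4 + (2 + (4 + (j0 * (8 + 1) + 1))))) ?_ (by omega)
  refine WP.seq (WP.cost (WP.asg (Ev.mulN hw (Ev.litN hw 16384 (by omega))
    (Ev.addN hw (Ev.vN hA) (Ev.one hw) (by omega)) (by omega)) ?_) (by decide))
  have ey : Ev w Z (σ.setVar .TH ((16384 * (A + 1) : ℕ) : ℝ)) (.var .p * .var .eps) y := by
    have hp' : (σ.setVar .TH ((16384 * (A + 1) : ℕ) : ℝ)).var .p = p := hp
    have he' : (σ.setVar .TH ((16384 * (A + 1) : ℕ) : ℝ)).var .eps = e := he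
    refine (Ev.bin_ok (o := .mul) (Ev.v hp') (Ev.v he') trivial ?_).cast ?_
    · change |p * e| ≤ _
      rw [← hx, abs_of_pos hx0]
      linarith
    · change fround w (p * e) = y
      rw [← hx, hy]
  refine WP.seq (WP.cost (WP.asg ey ?_) (by decide))
  refine WP.seq (WP.cost (WP.asg (Ev.two hw) ?_) (by decide))
  have eX : ∀ {σ' : Sto} {j : ℕ}, j ≤ j0 → σ'.var .N = ((2 ^ (j + 1) : ℕ) : ℝ) → σ'.var .ip = y →
      Ev w Z σ' (.var .N * .var .ip) (f j) := by
    intro σ' j hj hN hip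
    refine Ev.bin_ok (o := .mul) (Ev.vN hN) (Ev.v hip) trivial ?_
    change |((2 ^ (j + 1) : ℕ) : ℝ) * y| ≤ _
    rw [abs_of_nonneg (by positivity)]
    have h1 : 2 ^ (j + 1) ≤ B := (Nat.pow_le_pow_right (by norm_num) (by omega)).trans hNB
    have h2 : ((2 ^ (j + 1) : ℕ) : ℝ) ≤ B := by exact_mod_cast h1
    calc ((2 ^ (j + 1) : ℕ) : ℝ) * y ≤ B * 2 := by gcongr; linarith
      _ ≤ _ := by linarith
  refine WP.seq (WP.cost (WP.asg (eX (j := 0) (Nat.zero_le _) (by simp) ?_) ?_) (by decide))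
  · simp [Sto.setVar_var]
  refine WP.wh j0 8 (fun j σ' => σ'.var .N = ((2 ^ (j + 1) : ℕ) : ℝ) ∧ σ'.var .X = f j ∧ σ'.var .ip = y ∧
    σ'.var .TH = TH) ?_ ?_ ?_ ?_
  · refine ⟨by simp [Sto.setVar_var], by simp, by simp [Sto.setVar_var], ?_⟩
    simp [Sto.setVar_var, hTH]
  · rintro j hj σ' _ ⟨h1, h2, h3, h4⟩ -
    have hp1 : 2 * 2 ^ (j + 1) ≤ 2 ^ w := by
      have : 2 ^ (j + 1) ≤ B := (Nat.pow_le_pow_right (by norm_num) (by omega)).trans hNB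
      omega
    refine WP.seq (T₁ := 4) (T₂ := 4) (WP.asg (Ev.mulN hw (Ev.two hw) (Ev.vN h1) hp1) ?_)
    rw [← pow_succ']
    refine WP.cost (WP.asg (eX (j := j + 1) hj (by simp) (by simpa [Sto.setVar_var] using h3)) ?_) (by decide)
    refine ⟨by simp [Sto.setVar_var], by simp, by simpa [Sto.setVar_var] using h3, by simpa [Sto.setVar_var] using h4⟩
  · rintro σ' _ ⟨h1, h2, h3, h4⟩
    rw [h2, h4]; exact not_lt.mpr hj0
  · rintro j hj σ' _ ⟨h1, h2, h3, h4⟩ hn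
    rw [h2, h4] at hn
    have : j = j0 := by
      by_contra hne
      exact hn (hj1 j (by omega))
    subst this
    exact h1

theorem derived_wp (hw : 0 < w) {n m N L PU : ℕ} (hn : σ.var .n = n) (hm : σ.var .m = m) (hN : σ.var .N = N)
    (hL : σ.var .L = L) (hPU : σ.var .PU = PU) (hmn : m ≤ n) (hN0 : 1 ≤ N) (hnw : n + 1 ≤ 2 ^ w)
    (hL1 : 1 ≤ L) (hPU1 : 1 ≤ PU) (hSZ : (n + L) * (4 * N) ≤ 2 ^ w) (hLam : 8 * PU * N ≤ 2 ^ w) (Q : Sto → Prop)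
    (hQ : ∀ σ', Frame derivedPg σ σ' → σ'.var .M = ((4 * N : ℕ) : ℝ) → σ'.var .LAM = ((8 * PU * N : ℕ) : ℝ) →
      σ'.var .NM = ((n - m + 1 : ℕ) : ℝ) → σ'.var .NMm = ((n - m + 1 + m : ℕ) : ℝ) →
      σ'.var .SZ = (((n + L) * (4 * N) : ℕ) : ℝ) → σ'.var .LM = ((L * (4 * N) : ℕ) : ℝ) →
      σ'.var .Wd = ((2 * N - 1 : ℕ) : ℝ) → Q σ') :
    WP w ω Z derivedPg 50 σ Q := by
  suffices key : WP w ω Z derivedPg 50 σ (fun σ' => σ'.var .M = ((4 * N : ℕ) : ℝ) ∧ σ'.var .LAM = ((8 * PU * N : ℕ) : ℝ) ∧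
      σ'.var .NM = ((n - m + 1 : ℕ) : ℝ) ∧ σ'.var .NMm = ((n - m + 1 + m : ℕ) : ℝ) ∧
      σ'.var .SZ = (((n + L) * (4 * N) : ℕ) : ℝ) ∧ σ'.var .LM = ((L * (4 * N) : ℕ) : ℝ) ∧
      σ'.var .Wd = ((2 * N - 1 : ℕ) : ℝ)) from
    key.mono le_rfl fun σ' hf h => hQ σ' hf h.1 h.2.1 h.2.2.1 h.2.2.2.1 h.2.2.2.2.1 h.2.2.2.2.2.1 h.2.2.2.2.2.2
  refine WP.cost (T := 4 + (6 + (6 + (4 + (6 + (4 + 6)))))) ?_ (by norm_num)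
  have e4 : 4 * N ≤ 2 ^ w := by nlinarith
  have h8 : 8 * PU ≤ 2 ^ w := (Nat.le_mul_of_pos_right _ hN0).trans hLam
  have hnL : n + L ≤ 2 ^ w := (Nat.le_mul_of_pos_right _ (by omega)).trans hSZ
  have hLM : L * (4 * N) ≤ 2 ^ w := (Nat.mul_le_mul_right _ (Nat.le_add_left _ _)).trans hSZ
  refine WP.seq (WP.cost (WP.asg (Ev.mulN hw (Ev.litN hw 4 (by omega)) (Ev.vN hN) e4) ?_) (by decide))
  refine WP.seq (WP.cost (WP.asg (Ev.mulN hw (i := 8 * PU) (Ev.mulN hw (Ev.litN hw 8 (by omega)) (Ev.vN (v := PU) ?_) h8)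
    (Ev.vN (v := N) ?_) hLam) ?_) (by decide))
  · simpa [Sto.setVar_var] using hPU
  · simpa [Sto.setVar_var] using hN
  refine WP.seq (WP.cost (WP.asg (Ev.addN hw (i := n - m) (Ev.subN hw (Ev.vN (v := n) ?_) (Ev.vN (v := m) ?_) hmn (by omega))
    (Ev.one hw) (by omega)) ?_) (by decide))
  · simpa [Sto.setVar_var] using hn
  · simpa [Sto.setVar_var] using hm
  refine WP.seq (WP.cost (WP.asg (Ev.addN hw (i := n - m + 1) (j := m) (Ev.vN ?_) (Ev.vN ?_) (by omega)) ?_) (by decide))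
  · simp
  · simpa [Sto.setVar_var] using hm
  refine WP.seq (WP.cost (WP.asg (Ev.mulN hw (i := n + L) (j := 4 * N) (Ev.addN hw (Ev.vN (v := n) ?_) (Ev.vN (v := L) ?_) hnL)
    (Ev.vN ?_) hSZ) ?_) (by decide))
  · simpa [Sto.setVar_var] using hn
  · simpa [Sto.setVar_var] using hL
  · simp [Sto.setVar_var]
  refine WP.seq (WP.cost (WP.asg (Ev.mulN hw (i := L) (j := 4 * N) (Ev.vN ?_) (Ev.vN ?_) hLM) ?_) (by decide))
  · simpa [Sto.setVar_var] using hL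
  · simp [Sto.setVar_var]
  refine WP.cost (WP.asg (Ev.subN hw (i := 2 * N) (j := 1) (Ev.mulN hw (Ev.two hw) (Ev.vN (v := N) ?_) (by omega)) (Ev.one hw)
    (by omega) (by omega)) ?_) (by decide)
  · simpa [Sto.setVar_var] using hN
  · simp [Sto.setVar_var]

end Setup

/-- The parameters that are set up for given input. -/
def setupPar (n m U C ν : ℕ) (p : ℝ) : Par where
  n := n
  m := m
  U := U
  A := Nat.clog 2 U
  ν := ν
  lam := 3 + Nat.clog 2 U + ν
  k := Nat.clog 2 m + 1
  R := C * (Nat.clog 2 n + 1)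
  p := p

/-- Input for which words of `w` bits are long enough. -/
structure Input (w n m U C : ℕ) (p e Q : ℝ) : Prop where
  hm : 1 ≤ m
  hmn : m ≤ n
  hU : 1 ≤ U
  p0 : 0 < p
  p1 : p ≤ 1
  e0 : 0 < e
  e1 : e ≤ 1
  hQ : Q * (p * e) = 4 * n * U
  hw : Q ^ 330 ≤ 2 ^ w
  hC : C * (n + 1) ≤ 2 ^ w

section Setup

variable {w n m U C ν : ℕ} {p e Q : ℝ}

namespace Input

theorem x0 (h : Input w n m U C p e Q) : 0 < p * e := mul_pos h.p0 h.e0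

theorem x1 (h : Input w n m U C p e Q) : p * e ≤ 1 := mul_le_one₀ h.p1 h.e0.le h.e1

theorem n1 (h : Input w n m U C p e Q) : (1 : ℝ) ≤ n := by exact_mod_cast h.hm.trans h.hmn

theorem U1 (h : Input w n m U C p e Q) : (1 : ℝ) ≤ U := by exact_mod_cast h.hU

theorem Q0 (h : Input w n m U C p e Q) : 0 < Q := by
  have h1 := h.n1
  have h2 := h.U1
  have h3 : 0 < Q * (p * e) := by rw [h.hQ]; positivity
  exact pos_of_mul_pos_left h3 h.x0.le

theorem nU_le (h : Input w n m U C p e Q) : 4 * (n : ℝ) * U ≤ Q := by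
  rw [← h.hQ]; exact mul_le_of_le_one_right h.Q0.le h.x1

theorem n_le (h : Input w n m U C p e Q) : 4 * (n : ℝ) ≤ Q :=
  le_trans (le_mul_of_one_le_right (by positivity) h.U1) h.nU_le

theorem U_le (h : Input w n m U C p e Q) : 4 * (U : ℝ) ≤ Q := by
  refine le_trans ?_ h.nU_le
  have h1 := h.n1
  have h2 := h.U1
  nlinarith

theorem Q4 (h : Input w n m U C p e Q) : 4 ≤ Q := by linarith [h.n_le, h.n1]

theorem inv_le (h : Input w n m U C p e Q) : 4 ≤ Q * (p * e) := by
  rw [h.hQ]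
  have h1 := h.n1
  have h2 := h.U1
  nlinarith

/-- Constants up to 4^9 are absorbed by nine powers of Q, since Q ≥ 4. -/
theorem const_le (h : Input w n m U C p e Q) {c : ℝ} (hc : c ≤ 4 ^ 9) (j : ℕ) : c * Q ^ j ≤ Q ^ (j + 9) := by
  have h1 : (4 : ℝ) ^ 9 ≤ Q ^ 9 := by gcongr; exact h.Q4
  have h2 := h.Q0
  rw [pow_add, mul_comm (Q ^ j)]
  gcongr
  linarith

theorem pow_mono (h : Input w n m U C p e Q) {i j : ℕ} (hij : i ≤ j) : Q ^ i ≤ Q ^ j :=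
  pow_le_pow_right₀ (by linarith [h.Q4]) hij

theorem w0 (h : Input w n m U C p e Q) : 0 < w := by
  by_contra hh
  have h1 := h.hw
  have h2 : w = 0 := by omega
  rw [h2, pow_zero] at h1
  have h3 : Q ^ 1 ≤ Q ^ 330 := h.pow_mono (by norm_num)
  rw [pow_one] at h3
  linarith [h.Q4]

theorem levels_le (h : Input w n m U C p e Q) : ((Nat.clog 2 U : ℕ) : ℝ) + 1 ≤ 2 * U := by
  have h1 : ((Nat.clog 2 U : ℕ) : ℝ) ≤ U := by exact_mod_cast clog_le_self U
  linarith [h.U1]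

/-- The number of scales is at most of order U, and Q pε = 4nU, so the window size is at most a
constant times Q. -/
theorem window_le (h : Input w n m U C p e Q) {y : ℝ}
    (hν : y * (p * e) ≤ 131072 * ((Nat.clog 2 U : ℕ) + 1)) : y ≤ 65536 * Q := by
  have h1 := h.levels_le
  have h2 : y * (p * e) ≤ 65536 * Q * (p * e) := by
    have h3 : (U : ℝ) ≤ n * U := le_mul_of_one_le_left (by linarith [h.U1]) h.n1
    have h4 := h.hQ
    linarith
  exact le_of_mul_le_mul_right h2 h.x0

theorem pow_levels_le (h : Input w n m U C p e Q) : (2 : ℝ) ^ Nat.clog 2 U ≤ Q := by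
  have h1 : ((2 ^ Nat.clog 2 U : ℕ) : ℝ) ≤ 2 * U := by exact_mod_cast pow_clog_le h.hU
  push_cast at h1
  linarith [h.U_le, h.U1]

theorem size_le (h : Input w n m U C p e Q) : ((2 ^ (Nat.clog 2 m + 1) : ℕ) : ℝ) ≤ Q := by
  have h1 : ((2 ^ Nat.clog 2 m : ℕ) : ℝ) ≤ 2 * m := by exact_mod_cast pow_clog_le h.hm
  have h2 : (m : ℝ) ≤ n := by exact_mod_cast h.hmn
  rw [pow_succ]
  push_cast at h1 ⊢
  linarith [h.n_le]

theorem Lam_le (h : Input w n m U C p e Q) (hν : 2 ^ ν * (p * e) ≤ 131072 * ((Nat.clog 2 U : ℕ) + 1)) :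
    8 * 2 ^ Nat.clog 2 U * 2 ^ ν ≤ Q ^ 11 := by
  have h1 := h.window_le hν
  have h2 : (2 : ℝ) ^ Nat.clog 2 U ≤ 2 * U := by exact_mod_cast pow_clog_le h.hU
  have h3 : (2 : ℝ) ^ Nat.clog 2 U ≤ Q / 2 := by linarith [h.U_le]
  have h0 := h.Q0
  calc (8 : ℝ) * 2 ^ Nat.clog 2 U * 2 ^ ν ≤ 8 * (Q / 2) * (65536 * Q) := by gcongr
    _ = 262144 * Q ^ 2 := by ring
    _ ≤ Q ^ (2 + 9) := h.const_le (by norm_num) 2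

/-- Θ is chosen as Q^11, the bound needed for Λ = 8 · 2^A · N, so that Θ^30 ≤ 2^w is the hypothesis
on Q^330. -/
theorem good (h : Input w n m U C p e Q) (hν : 2 ^ ν * (p * e) ≤ 131072 * ((Nat.clog 2 U : ℕ) + 1)) :
    Good w ((n + 2 ^ (Nat.clog 2 m + 1)) * (4 * 2 ^ ν)) (setupPar n m U C ν p) (Q ^ 11) := by
  have h0 := h.Q0
  have hQ4 := h.Q4
  have h1 : Q ≤ Q ^ 11 := by
    have := h.pow_mono (i := 1) (j := 11) (by norm_num)
    rwa [pow_one] at this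
  have hM : ((4 * 2 ^ ν : ℕ) : ℝ) ≤ Q ^ 10 := by
    have h2 := h.window_le hν
    have h3 : 262144 * Q ^ 1 ≤ Q ^ 10 := h.const_le (by norm_num) 1
    push_cast
    rw [pow_one] at h3
    linarith
  have hM' : ((4 * 2 ^ ν : ℕ) : ℝ) ≤ Q ^ 11 := hM.trans (h.pow_mono (by norm_num))
  have hn : (n : ℝ) ≤ Q := by linarith [h.n_le, h.n1]
  refine ⟨h.w0, ?_, le_rfl, h.hm, h.hmn, ?_, h.p0, h.p1, ?_, ?_, hn.trans h1, h.pow_levels_le.trans h1, hM', ?_,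
    h.size_le.trans h1⟩
  · have h3 : ((16 * ((n + 2 ^ (Nat.clog 2 m + 1)) * (4 * 2 ^ ν)) : ℕ) : ℝ) ≤ Q ^ 330 := by
      push_cast only [Nat.cast_mul, Nat.cast_add]
      have h4 := h.size_le
      push_cast at h4 hM ⊢
      calc 16 * (((n : ℝ) + 2 ^ (Nat.clog 2 m + 1)) * (4 * 2 ^ ν)) ≤ 16 * ((Q + Q) * Q ^ 10) := by gcongr
        _ = 32 * Q ^ 11 := by ring
        _ ≤ Q ^ (11 + 9) := h.const_le (by norm_num) 11
        _ ≤ Q ^ 330 := h.pow_mono (by norm_num)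
    exact_mod_cast h3.trans h.hw
  · have := Nat.le_pow_clog (b := 2) (by norm_num) m
    change 2 * m ≤ 2 ^ (Nat.clog 2 m + 1)
    rw [pow_succ]; omega
  · calc (1000 : ℝ) ≤ 4 ^ 11 := by norm_num
      _ ≤ Q ^ 11 := by gcongr
  · rw [← pow_mul]; exact h.hw
  · have e1 : ((setupPar n m U C ν p).Lam : ℝ) = 8 * 2 ^ Nat.clog 2 U * 2 ^ ν := by
      unfold Par.Lam setupPar
      push_cast; ring
    rw [e1]; exact h.Lam_le hν

theorem nat_le (h : Input w n m U C p e Q) {x : ℕ} (hx : (x : ℝ) ≤ Q ^ 330) : x ≤ 2 ^ w := by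
  exact_mod_cast hx.trans h.hw

end Input

/-- The bound for the number of rounds of the window loop. -/
noncomputable def windowBound (U : ℕ) (x : ℝ) : ℕ := ⌈131072 * (((Nat.clog 2 U : ℕ) : ℝ) + 1) / x⌉₊

noncomputable def setupCost (n m U : ℕ) (x : ℝ) : ℕ :=
  Nat.clog 2 U * 9 + Nat.clog 2 m * 11 + Nat.clog 2 n * 9 + windowBound U x * 9 + 110

/-- The exponent ν of the window size is fixed before the random words and the store, because the
sets of bad multipliers depend on it. -/
theorem setup_wp (h : Input w n m U C p e Q) :
    ∃ ν, 4096 * (((Nat.clog 2 U : ℕ) : ℝ) + 1) ≤ 2 ^ ν * (p * e) ∧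
      2 ^ ν * (p * e) ≤ 131072 * ((Nat.clog 2 U : ℕ) + 1) ∧
      ∀ (ω : ℕ → Fin (2 ^ w)) (Z : ℕ) (σ : Sto), σ.var .n = n → σ.var .m = m → σ.var .U = U → σ.var .p = p →
        σ.var .eps = e → WP w ω Z (setupPg C) (setupCost n m U (p * e)) σ (Vals (setupPar n m U C ν p)) := by
  have hw := h.w0
  have h0 := h.Q0
  have hQ4 := h.Q4
  have hx0 := h.x0
  have h330 : Q ≤ Q ^ 330 := by
    have := h.pow_mono (i := 1) (j := 330) (by norm_num)
    rwa [pow_one] at this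
  have hnw : 4 * n ≤ 2 ^ w := h.nat_le (by push_cast; linarith [h.n_le])
  have hUw : 2 * U ≤ 2 ^ w := h.nat_le (by push_cast; linarith [h.U_le, h.U1])
  have hmn := h.hmn
  have hm1 := h.hm
  have hBw : 2 * windowBound U (p * e) ≤ 2 ^ w := by
    refine h.nat_le ?_
    have h1 : (windowBound U (p * e) : ℝ) < 131072 * (((Nat.clog 2 U : ℕ) : ℝ) + 1) / (p * e) + 1 :=
      Nat.ceil_lt_add_one (by positivity)
    have h2 : 131072 * (((Nat.clog 2 U : ℕ) : ℝ) + 1) / (p * e) ≤ 65536 * Q :=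
      h.window_le (by rw [div_mul_cancel₀ _ hx0.ne'])
    have h3 : 262144 * Q ^ 1 ≤ Q ^ (1 + 9) := h.const_le (by norm_num) 1
    have h4 : Q ^ (1 + 9) ≤ Q ^ 330 := h.pow_mono (by norm_num)
    push_cast
    rw [pow_one] at h3
    linarith
  have hB : 131072 * (((Nat.clog 2 U : ℕ) : ℝ) + 1) ≤ windowBound U (p * e) * (p * e) := by
    rw [← div_le_iff₀ hx0]; exact Nat.le_ceil _
  obtain ⟨ν, hlow, hup, hwin⟩ := window_wp hw (p := p) (e := e) rfl h.x1 hx0 hB hBw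
  refine ⟨ν, hlow, hup, fun ω Z σ hn hm hU hp he => ?_⟩
  refine WP.cost (T := (Nat.clog 2 U * 9 + 10) + ((Nat.clog 2 m * 11 + 20) + ((Nat.clog 2 n * 9 + 10) +
    ((windowBound U (p * e) * 9 + 20) + 50)))) ?_ (by unfold setupCost; omega)
  refine WP.seq (levels_wp hw hU hUw _ ?_)
  intro σ1 f1 hA1 hPU1
  refine WP.seq (size_wp hw (m := m) (by rw [f1.var _ (by decide)]; exact hm) (by omega) hm1 _ ?_)
  intro σ2 f2 hK2 hKM2 hL2
  refine WP.seq (trials_wp hw (n := n) (by rw [f2.var _ (by decide), f1.var _ (by decide)]; exact hn) (by omega) h.hC _ ?_)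
  intro σ3 f3 hR3
  -- The written variables do not depend on the literal C; with 0 in its place the membership
  -- questions become decidable closed terms.
  have f3' : ∀ x, x ∉ (trialsPg 0).mv → σ3.var x = σ2.var x := fun x hx => f3.var x hx
  refine WP.seq (hwin ω Z σ3
    (by rw [f3' _ (by decide), f2.var _ (by decide)]; exact hA1)
    (by rw [f3' _ (by decide), f2.var _ (by decide), f1.var _ (by decide)]; exact hp)
    (by rw [f3' _ (by decide), f2.var _ (by decide), f1.var _ (by decide)]; exact he) _ ?_)
  intro σ4 f4 hN4
  have G := h.good hup
  have hn4 : σ4.var .n = n := by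
    rw [f4.var _ (by decide), f3' _ (by decide), f2.var _ (by decide), f1.var _ (by decide)]; exact hn
  have hm4 : σ4.var .m = m := by
    rw [f4.var _ (by decide), f3' _ (by decide), f2.var _ (by decide), f1.var _ (by decide)]; exact hm
  refine derived_wp hw (n := n) (m := m) (N := 2 ^ ν) (L := 2 ^ (Nat.clog 2 m + 1)) (PU := 2 ^ Nat.clog 2 U) hn4 hm4 hN4
    (by rw [f4.var _ (by decide), f3' _ (by decide)]; exact hL2)
    (by rw [f4.var _ (by decide), f3' _ (by decide), f2.var _ (by decide)]; exact hPU1)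
    hmn Nat.one_le_two_pow (by omega) Nat.one_le_two_pow Nat.one_le_two_pow (by have := G.Zw; exact this) ?_ _ ?_
  · refine h.nat_le ?_
    push_cast
    exact (h.Lam_le hup).trans (h.pow_mono (by norm_num))
  intro σ5 f5 hM hLAM hNM hNMm hSZ hLM hWd x hx
  simp only [constVars, List.mem_cons, List.not_mem_nil, or_false] at hx
  rcases hx with rfl | rfl | rfl | rfl | rfl | rfl | rfl | rfl | rfl | rfl | rfl | rfl | rfl | rfl | rfl | rfl | rfl
  · rw [f5.var _ (by decide)]; exact hn4
  · rw [f5.var _ (by decide)]; exact hm4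
  · rw [f5.var _ (by decide), f4.var _ (by decide), f3' _ (by decide), f2.var _ (by decide), f1.var _ (by decide)]; exact hU
  · rw [f5.var _ (by decide), f4.var _ (by decide), f3' _ (by decide), f2.var _ (by decide), f1.var _ (by decide)]; exact hp
  · rw [f5.var _ (by decide), f4.var _ (by decide), f3' _ (by decide), f2.var _ (by decide)]; exact hA1
  · rw [f5.var _ (by decide)]; exact hN4
  · exact hM
  · rw [hLAM]
    change _ = ((2 ^ (3 + Nat.clog 2 U + ν) : ℕ) : ℝ)
    congr 1
    ring
  · rw [f5.var _ (by decide), f4.var _ (by decide), f3' _ (by decide)]; exact hK2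
  · rw [f5.var _ (by decide), f4.var _ (by decide), f3' _ (by decide)]; exact hKM2
  · rw [f5.var _ (by decide), f4.var _ (by decide), f3' _ (by decide)]; exact hL2
  · rw [f5.var _ (by decide), f4.var _ (by decide)]; exact hR3
  · exact hNM
  · exact hNMm
  · exact hSZ
  · exact hLM
  · exact hWd

end Setup

/-! ### The complete program -/

/-- The input registers 0, 1 and 3 collide with the array size and the temporaries and are moved
away; U and ε already arrive in the registers of their variables. The setup runs with array size 0,
so it cannot touch the memory. Then register 0 receives the true size, and the array `io`, whose
code is 0, coincides with the input and output cells. -/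
def program (C : ℕ) : Cmd :=
  .seq (.copy Var.n.reg 0) (.seq (.copy Var.m.reg 1) (.seq (.copy Var.p.reg 3) (.seq (.const 0 0)
    (.seq (setupPg C).comp (.seq (.copy 0 Var.SZ.reg) mainPg.comp)))))

/-- A string, continued by zeros. -/
def extend {n : ℕ} (T : Fin n → ℕ) (i : ℕ) : ℕ := if h : i < n then T ⟨i, h⟩ else 0

theorem extend_lt {n U : ℕ} (hU : 1 ≤ U) {T : Fin n → ℕ} (hT : ∀ i, T i < U) (i : ℕ) :
    extend T i < 2 ^ Nat.clog 2 U := by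
  refine lt_of_lt_of_le ?_ (Nat.le_pow_clog (by norm_num) U)
  unfold extend
  split_ifs
  · exact hT _
  · exact hU

section Program

variable {w n m U C : ℕ} {Q : ℝ}

theorem program_exec {p ε : ℝ} {T : Fin n → ℕ} {P : Fin m → ℕ} (h : Input w n m U C (fround w p) (fround w ε) Q)
    (hT : ∀ i, T i < U) (hP : ∀ j, P j < U) :
    ∃ ν, 4096 * (((Nat.clog 2 U : ℕ) : ℝ) + 1) ≤ 2 ^ ν * (fround w p * fround w ε) ∧
      2 ^ ν * (fround w p * fround w ε) ≤ 131072 * ((Nat.clog 2 U : ℕ) + 1) ∧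
      ∀ ω : ℕ → Fin (2 ^ w), ∃ t s, Exec w ω (program C) (inputState w U p ε T P) t s ∧
      t ≤ setupCost n m U (fround w p * fround w ε) + (setupPar n m U C ν (fround w p)).mainCost + 5 ∧
      ∀ i < n - m + 1, ∃ B, (setupPar n m U C ν (fround w p)).Within w ω (extend T) (extend P)
        ((Q ^ 11) ^ 21 / 2 ^ w) (C * (Nat.clog 2 n + 1)) i B ∧ s.mem i = outVal w (fround w p) B := by
  obtain ⟨ν, hlow, hup, hset⟩ := setup_wp h
  refine ⟨ν, hlow, hup, fun ω => ?_⟩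
  have hw := h.w0
  have h330 : Q ≤ Q ^ 330 := by
    have := h.pow_mono (i := 1) (j := 330) (by norm_num)
    rwa [pow_one] at this
  have hnw : n ≤ 2 ^ w := h.nat_le (by linarith [h.n_le, h.n1])
  have hmn := h.hmn
  have hm1 := h.hm
  have hUw : U ≤ 2 ^ w := h.nat_le (by linarith [h.U_le, h.U1])
  obtain ⟨s0, hs0⟩ : ∃ s0, s0 = inputState w U p ε T P := ⟨_, rfl⟩
  rw [← hs0]
  have r0 : s0.reg 0 = n := by rw [hs0]; exact fround_nat hw n hnw
  have r1 : s0.reg 1 = m := by rw [hs0]; exact fround_nat hw m (by omega)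
  have r2 : s0.reg 2 = U := by rw [hs0]; exact fround_nat hw U hUw
  have r3 : s0.reg 3 = fround w p := by rw [hs0]; rfl
  have r4 : s0.reg 4 = fround w ε := by rw [hs0]; rfl
  have hTm : ∀ i < n, s0.mem i = extend T i := by
    intro i hi
    rw [hs0]
    have := fround_nat hw (T ⟨i, hi⟩) ((hT _).le.trans hUw)
    simp only [inputState, extend, dif_pos hi, this]
  have hPm : ∀ j < m, s0.mem (n + j) = extend P j := by
    intro j hj
    rw [hs0]
    have := fround_nat hw (P ⟨j, hj⟩) ((hP _).le.trans hUw)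
    simp [inputState, extend, hj, this]
  obtain ⟨s1, hs1⟩ : ∃ s1, s1 = s0.setReg Var.n.reg (s0.reg 0) := ⟨_, rfl⟩
  obtain ⟨s2, hs2⟩ : ∃ s2, s2 = s1.setReg Var.m.reg (s1.reg 1) := ⟨_, rfl⟩
  obtain ⟨s3, hs3⟩ : ∃ s3, s3 = s2.setReg Var.p.reg (s2.reg 3) := ⟨_, rfl⟩
  obtain ⟨s4, hs4⟩ : ∃ s4, s4 = s3.setReg 0 (fround w ((0 : ℤ) : ℝ)) := ⟨_, rfl⟩
  have x1 : Exec w ω (.copy Var.n.reg 0) s0 1 s1 := hs1 ▸ .copy _ _ _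
  have x2 : Exec w ω (.copy Var.m.reg 1) s1 1 s2 := hs2 ▸ .copy _ _ _
  have x3 : Exec w ω (.copy Var.p.reg 3) s2 1 s3 := hs3 ▸ .copy _ _ _
  have x4 : Exec w ω (.const 0 0) s3 1 s4 := hs4 ▸ .const _ _ _ (inRange_of_le (by simp))
  have m4 : s4.mem = s0.mem := by rw [hs4, hs3, hs2, hs1]; rfl
  have p4 : s4.pos = 0 := by rw [hs4, hs3, hs2, hs1, hs0]; rfl
  have q0 : s4.reg 0 = 0 := by rw [hs4]; simp [State.setReg, fround_zero]
  have qn : s4.reg Var.n.reg = n := by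
    rw [← r0, hs4, hs3, hs2, hs1]; simp [State.setReg, Var.reg, Var.ctorIdx]
  have qm : s4.reg Var.m.reg = m := by
    rw [← r1, hs4, hs3, hs2, hs1]; simp [State.setReg, Var.reg, Var.ctorIdx]
  have qp : s4.reg Var.p.reg = fround w p := by
    rw [← r3, hs4, hs3, hs2, hs1]; simp [State.setReg, Var.reg, Var.ctorIdx]
  have qU : s4.reg Var.U.reg = U := by
    rw [← r2, hs4, hs3, hs2, hs1]; simp [State.setReg, Var.reg, Var.ctorIdx]
  have qe : s4.reg Var.eps.reg = fround w ε := by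
    rw [← r4, hs4, hs3, hs2, hs1]; simp [State.setReg, Var.reg, Var.ctorIdx]
  set σ0 : Sto := { var := fun x => s4.reg x.reg, arr := fun _ _ => 0, pos := 0 } with hσ0
  -- With array size 0 every memory cell belongs to the part that is preserved.
  have R0 : Rep 0 s4.mem s4 σ0 :=
    ⟨by rw [q0]; simp, fun _ => rfl, fun _ i hi => absurd hi (Nat.not_lt_zero i), fun _ _ => rfl, p4⟩
  obtain ⟨t1, ht1, σ1, hx1, hV1⟩ := hset ω 0 σ0 qn qm qU qp qe
  obtain ⟨s5, x5, R5⟩ := hx1.exec (by omega) R0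
  set PP := setupPar n m U C ν (fround w p) with hPP
  have G := h.good hup
  rw [← hPP] at G
  obtain ⟨Z, hZ⟩ : ∃ Z, Z = (n + 2 ^ (Nat.clog 2 m + 1)) * (4 * 2 ^ ν) := ⟨_, rfl⟩
  rw [← hZ] at G
  obtain ⟨s6, hs6⟩ : ∃ s6, s6 = s5.setReg 0 (s5.reg Var.SZ.reg) := ⟨_, rfl⟩
  have x6 : Exec w ω (.copy 0 Var.SZ.reg) s5 1 s6 := hs6 ▸ .copy _ _ _
  have m6 : s6.mem = s0.mem := by
    rw [hs6, ← m4]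
    funext a
    exact R5.rest a (Nat.zero_le _)
  have hpos1 : σ1.pos = 0 := by
    have : (setupPg C).random = false := by
      -- Whether words are drawn does not depend on C, and the closed term can be evaluated.
      change (setupPg 0).random = false
      decide
    rw [hx1.frame.pos this]
  -- The store is read off the same memory anew, with the true array size. Only the contents of `io`
  -- matter for `main_wp`.
  set σ2 : Sto := { var := σ1.var, arr := fun k i => s6.mem (k.code * Z + i), pos := 0 } with hσ2
  have R6 : Rep Z s6.mem s6 σ2 := by
    refine ⟨?_, fun x => ?_, fun _ _ _ => rfl, fun _ _ => rfl, ?_⟩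
    · rw [hs6]
      simp only [State.setReg, Function.update_self]
      rw [R5.var, hV1 .SZ (by decide), hZ]
      rfl
    · rw [hs6]
      simp only [State.setReg]
      rw [Function.update_of_ne, R5.var]
      unfold Var.reg; omega
    · rw [hs6]
      change s5.pos = 0
      rw [R5.pos, hpos1]
  have hnmZ : n + m ≤ Z := by
    have h2 := G.h2m
    have h3 : PP.L = 2 ^ (Nat.clog 2 m + 1) := rfl
    have h4 : 1 ≤ 4 * 2 ^ ν := by have := Nat.two_pow_pos ν; omega
    have h5 : PP.m = m := rfl
    rw [hZ, ← h3]
    rw [h5] at h2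
    nlinarith
  have hip : 4 / PP.p ≤ Q ^ 11 := by
    have h1 := h.inv_le
    have h2 : Q ^ 1 ≤ Q ^ 11 := h.pow_mono (by norm_num)
    have h3 : 4 / fround w p ≤ Q := by
      rw [div_le_iff₀ h.p0]
      refine h1.trans ?_
      have h0 := h.Q0
      have := h.p0
      gcongr
      exact mul_le_of_le_one_right h.p0.le h.e1
    rw [pow_one] at h2
    exact h3.trans h2
  have hR : PP.R ≤ 2 ^ w := by
    refine le_trans ?_ h.hC
    exact Nat.mul_le_mul_left _ (Nat.succ_le_succ (clog_le_self n))
  obtain ⟨t2, ht2, σ3, hx2, hout⟩ := main_wp (ω := ω) (σ := σ2) (T := extend T) (Pt := extend P) G hV1 rfl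
    (fun i hi => by
      change s6.mem (0 * Z + i) = _
      rw [m6, zero_mul, zero_add]; exact hTm i hi)
    (fun j hj => by
      change s6.mem (0 * Z + (n + j)) = _
      rw [m6, zero_mul, zero_add]; exact hPm j hj)
    hnmZ (extend_lt h.hU hT) (extend_lt h.hU hP) (Nat.le_pow_clog (by norm_num) U) hip hR
  obtain ⟨s7, x7, R7⟩ := hx2.exec G.hZ R6
  refine ⟨_, s7, .seq x1 (.seq x2 (.seq x3 (.seq x4 (.seq x5 (.seq x6 x7))))), by omega, ?_⟩
  intro i hi
  obtain ⟨B, hB, ho⟩ := hout i hi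
  refine ⟨B, hB, ?_⟩
  refine Eq.trans ?_ ho
  rw [← R7.arr .io i (by omega)]
  change _ = s7.mem (0 * Z + i)
  rw [zero_mul, zero_add]

end Program

/-! ### Accuracy -/

/-- Relative errors are converted to logarithms because the root with exponent 1/p just multiplies
them by 1/p there; `abs_sub_le_of_log` converts back at the end. -/
theorem abs_log_sub_le {x y ρ : ℝ} (hx : 0 < x) (h : |y - x| ≤ ρ * x) (hρ : ρ ≤ 1 / 2) :
    0 < y ∧ |Real.log y - Real.log x| ≤ 2 * ρ := by
  rw [abs_le] at h
  have hρ0 : 0 ≤ ρ := by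
    have : 0 ≤ ρ * x := by linarith [h.1, h.2]
    exact nonneg_of_mul_nonneg_left this hx
  have hy1 : (1 - ρ) * x ≤ y := by linarith [h.1]
  have hy2 : y ≤ (1 + ρ) * x := by linarith [h.2]
  have hy : 0 < y := lt_of_lt_of_le (by apply mul_pos _ hx; linarith) hy1
  refine ⟨hy, ?_⟩
  rw [← Real.log_div hy.ne' hx.ne', abs_le]
  have r1 : 1 - ρ ≤ y / x := by rwa [le_div_iff₀ hx]
  have r2 : y / x ≤ 1 + ρ := by rwa [div_le_iff₀ hx]
  have r0 : 0 < y / x := div_pos hy hx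
  constructor
  · have h1 := Real.one_sub_inv_le_log_of_pos r0
    have h2 : (y / x)⁻¹ ≤ 1 + 2 * ρ := by
      rw [inv_le_iff_one_le_mul₀ r0]
      calc 1 ≤ (1 + 2 * ρ) * (1 - ρ) := by nlinarith
        _ ≤ _ := by gcongr
    linarith
  · have := Real.log_le_sub_one_of_pos r0
    linarith

theorem abs_sub_le_of_log {x y ε : ℝ} (hx : 0 < x) (hy : 0 < y) (hε1 : ε ≤ 1)
    (h : |Real.log y - Real.log x| ≤ ε / 4) : |y - x| ≤ ε * x := by
  have e1 : y = Real.exp (Real.log y - Real.log x) * x := by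
    rw [Real.exp_sub, Real.exp_log hy, Real.exp_log hx]; field_simp
  have h1 := Real.abs_exp_sub_one_le (x := Real.log y - Real.log x) (by linarith)
  have h0 := abs_nonneg (Real.log y - Real.log x)
  have e2 : y - x = (Real.exp (Real.log y - Real.log x) - 1) * x := by
    rw [sub_mul, ← e1, one_mul]
  rw [e2, abs_mul, abs_of_pos hx]
  gcongr
  linarith

/-! ### Dependence of sums of powers on the exponent. -/

section Powers

variable {m : ℕ} {d : Fin m → ℝ} {U : ℝ}

/-- For 1 ≤ d ≤ U a change of the exponent multiplies d^p by d^(p' - p), and log d ≤ d ≤ U suffices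
as a bound. Zero terms stay zero for positive exponents. -/
theorem sum_rpow_le_exp (hd : ∀ j, d j = 0 ∨ 1 ≤ d j ∧ d j ≤ U) {p p' τ : ℝ} (hp' : 0 < p')
    (hτ : |p' - p| * U ≤ τ) : ∑ j, d j ^ p' ≤ Real.exp τ * ∑ j, d j ^ p := by
  rw [Finset.mul_sum]
  refine Finset.sum_le_sum fun j _ => ?_
  rcases hd j with h | ⟨h1, h2⟩
  · rw [h, Real.zero_rpow hp'.ne']
    positivity
  · have h0 : 0 < d j := by linarith
    have e : d j ^ p' = d j ^ (p' - p) * d j ^ p := by rw [← Real.rpow_add h0, sub_add_cancel]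
    rw [e]
    gcongr
    rw [Real.rpow_def_of_pos h0]
    refine Real.exp_le_exp.mpr (le_trans ?_ hτ)
    have l0 := Real.log_nonneg h1
    have l1 : Real.log (d j) ≤ U := (Real.log_le_self h0.le).trans h2
    calc Real.log (d j) * (p' - p) ≤ Real.log (d j) * |p' - p| := by gcongr; exact le_abs_self _
      _ ≤ U * |p' - p| := by gcongr
      _ = _ := mul_comm _ _

theorem one_le_sum_rpow (hd : ∀ j, d j = 0 ∨ 1 ≤ d j ∧ d j ≤ U) {p : ℝ} (hp : 0 < p) {j : Fin m} (hj : d j ≠ 0) :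
    1 ≤ ∑ j, d j ^ p := by
  have h0 : ∀ i, 0 ≤ d i := fun i => by rcases hd i with h | h <;> linarith
  refine le_trans ?_ (Finset.single_le_sum (fun i _ => Real.rpow_nonneg (h0 i) p) (Finset.mem_univ j))
  rcases hd j with h | h
  · exact absurd h hj
  · exact Real.one_le_rpow h.1 hp.le

theorem abs_log_sum_rpow_sub_le (hd : ∀ j, d j = 0 ∨ 1 ≤ d j ∧ d j ≤ U) {p p' : ℝ} (hp : 0 < p) (hp' : 0 < p')
    {j : Fin m} (hj : d j ≠ 0) :
    |Real.log (∑ j, d j ^ p') - Real.log (∑ j, d j ^ p)| ≤ |p' - p| * U := by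
  have s1 := one_le_sum_rpow hd hp hj
  have s2 := one_le_sum_rpow hd hp' hj
  have h1 := sum_rpow_le_exp hd hp' (p := p) le_rfl
  have h2 := sum_rpow_le_exp hd hp (p := p') le_rfl
  rw [abs_sub_comm] at h2
  have l1 := Real.log_le_log (by linarith) h1
  have l2 := Real.log_le_log (by linarith) h2
  rw [Real.log_mul (Real.exp_ne_zero _) (by linarith), Real.log_exp] at l1 l2
  rw [abs_le]
  constructor <;> linarith

end Powers

/-- The machine words for `p` and `ε`. -/
structure Rounded (w : ℕ) (p ε p' e : ℝ) : Prop where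
  p0 : 0 < p
  ε0 : 0 < ε
  ε1 : ε ≤ 1
  hp : |p' - p| ≤ p / 2 ^ w
  he : |e - ε| ≤ ε / 2 ^ w


namespace Rounded

variable {w n m U C : ℕ} {p ε p' e Q : ℝ}

theorem W256 (hI : Input w n m U C p' e Q) : (256 : ℝ) ≤ 2 ^ w := by
  calc (256 : ℝ) = 4 ^ 4 := by norm_num
    _ ≤ Q ^ 4 := by gcongr; exact hI.Q4
    _ ≤ 2 ^ w := (hI.pow_mono (by norm_num)).trans hI.hw

theorem facts (hI : Input w n m U C p' e Q) (hR : Rounded w p ε p' e) :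
    p' * e ≤ 4 * (p * ε) ∧ 1 ≤ Q * (p * ε) ∧ 2 ≤ Q * ε ∧ 4 ≤ Q * p' ∧ p ≤ 2 := by
  have hp0 := hR.p0
  have hε0 := hR.ε0
  have hQ0 := hI.Q0
  have hp'0 := hI.p0
  have he0 := hI.e0
  have hW256 := W256 hI
  have hpW : p / 2 ^ w ≤ p / 2 := by gcongr; linarith
  have hεW : ε / 2 ^ w ≤ ε / 2 := by gcongr; linarith
  have hpa := abs_le.mp hR.hp
  have hea := abs_le.mp hR.he
  have hp'p : p' ≤ 2 * p := by linarith [hpa.2]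
  have hee : e ≤ 2 * ε := by linarith [hea.2]
  have hx : 4 ≤ Q * (p' * e) := hI.inv_le
  have hpε : p' * e ≤ 4 * (p * ε) := by
    calc p' * e ≤ (2 * p) * (2 * ε) := by gcongr
      _ = _ := by ring
  refine ⟨hpε, ?_, ?_, ?_, ?_⟩
  · have : Q * (p' * e) ≤ Q * (4 * (p * ε)) := by gcongr
    linarith
  · have : Q * (p' * e) ≤ Q * (1 * (2 * ε)) := by gcongr; exact hI.p1
    linarith
  · refine hx.trans ?_
    gcongr
    exact mul_le_of_le_one_right hp'0.le hI.e1
  · linarith [hpa.1, hI.p1]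

end Rounded

/-- This collects the rounding of the result, of the exponent 1/p and of p itself; each is a low
power of Q over 2^w, while ε is at least 2/Q. -/
theorem error_sum_le {Q W ε : ℝ} (hQ4 : 4 ≤ Q) (hW : Q ^ 5 ≤ W) (hQe : 2 ≤ Q * ε) (hε0 : 0 < ε) :
    2 * (1 / W) + Q / 2 / W * Q + Q / W ≤ ε / 12 := by
  have hQ0 : 0 < Q := by linarith
  have hW0 : 0 < W := lt_of_lt_of_le (by positivity) hW
  have g1 : 2 * (1 / W) + Q / 2 / W * Q + Q / W = (2 + Q ^ 2 / 2 + Q) / W := by field_simp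
  rw [g1, div_le_iff₀ hW0]
  have g2 : 2 + Q ^ 2 / 2 + Q ≤ Q ^ 2 := by nlinarith
  have g3 : Q ^ 4 * 2 ≤ ε * Q ^ 5 := by
    calc Q ^ 4 * 2 ≤ Q ^ 4 * (Q * ε) := by gcongr
      _ = ε * Q ^ 5 := by ring
  have g4 : ε * Q ^ 5 ≤ ε * W := by gcongr
  have g5 : 12 * Q ^ 2 ≤ Q ^ 4 * 2 := by
    have : Q ^ 4 * 2 = 2 * Q ^ 2 * Q ^ 2 := by ring
    rw [this]; gcongr; linarith
  linarith

/-- In logarithms the final error is a sum of four terms: rounding of the power, the error of the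
exponent times log B, the error of B divided by p, and the change of the sum caused by rounding p,
again divided by p. The third one is ε/6; the others together are at most ε/12, and the total is
ε/4. -/
theorem root_accuracy {w n m U C : ℕ} {p ε p' e Q B S S' : ℝ} (hI : Input w n m U C p' e Q)
    (hR : Rounded w p ε p' e) (hS1 : 1 ≤ S) (hlogS : |Real.log S' - Real.log S| ≤ |p' - p| * U)
    (hlogB : |Real.log B - Real.log S'| ≤ 2 * (p * ε / 12)) (hBhalf : 1 / 2 ≤ B) (h3 : B ≤ Q) :
    |fround w (B ^ fround w (1 / p')) - S ^ (1 / p)| ≤ ε * S ^ (1 / p) := by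
  have hQ4 := hI.Q4
  have hQ0 := hI.Q0
  have hp0 := hR.p0
  have hε0 := hR.ε0
  have hε1 := hR.ε1
  have hp'0 := hI.p0
  have hp'1 := hI.p1
  obtain ⟨-, hQpε, hQe, hQp', -⟩ := Rounded.facts hI hR
  have hB0 : 0 < B := by linarith
  have hW : (Q ^ 5 : ℝ) ≤ 2 ^ w := (hI.pow_mono (by norm_num)).trans hI.hw
  have hW256 := Rounded.W256 hI
  have hRp := hR.hp
  have hWn : ((2 ^ w : ℕ) : ℝ) = 2 ^ w := by push_cast; rfl
  have hround := fun x => abs_fround_sub_le_of_le (w := w) (x := x)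
  obtain ⟨W, hWd⟩ : ∃ W : ℝ, W = 2 ^ w := ⟨_, rfl⟩
  rw [← hWd] at hW hW256 hRp hWn
  simp only [← hWd] at hround
  have hW0 : 0 < W := by linarith
  -- the exponent
  obtain ⟨y, hy⟩ : ∃ y, y = fround w (1 / p') := ⟨_, rfl⟩
  have hip1 : 1 ≤ 1 / p' := by rw [le_div_iff₀ hp'0]; linarith
  have htiny : ((2 : ℝ) ^ (2 ^ w : ℕ))⁻¹ ≤ 1 := inv_le_one_of_one_le₀ (one_le_pow₀ (by norm_num))
  have hy1 : |y - 1 / p'| ≤ 1 / p' / W := by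
    have := hround (1 / p') (by
      rw [abs_of_pos (by linarith)]; exact htiny.trans hip1)
    rwa [abs_of_pos (by linarith : 0 < 1 / p'), ← hy] at this
  have hipQ : 1 / p' ≤ Q / 4 := by
    rw [div_le_div_iff₀ hp'0 (by norm_num)]; linarith
  have hy2 : |1 / p' - 1 / p| ≤ 1 / p' / W := by
    have e1 : 1 / p' - 1 / p = (p - p') / (p * p') := by
      rw [div_sub_div _ _ hp'0.ne' hp0.ne', one_mul, mul_one, mul_comm]
    rw [e1, abs_div, abs_of_pos (by positivity : 0 < p * p'), div_le_iff₀ (by positivity), abs_sub_comm]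
    refine hRp.trans (le_of_eq ?_)
    field_simp
  have hy3 : |y - 1 / p| ≤ Q / 2 / W := by
    have := abs_add_le (y - 1 / p') (1 / p' - 1 / p)
    rw [sub_add_sub_cancel] at this
    have f : 1 / p' / W ≤ Q / 4 / W := by gcongr
    have f2 : Q / 2 / W = Q / 4 / W + Q / 4 / W := by ring
    linarith
  have hy0 : 0 ≤ y := by rw [hy]; exact fround_nonneg w (by positivity)
  have hyQ : y ≤ Q := by
    have := (abs_le.mp hy1).2
    have f : 1 / p' / W ≤ 1 / p' := div_le_self (by positivity) (by linarith)
    linarith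
  have hlB : |Real.log B| ≤ Q := by
    rw [abs_le]
    constructor
    · have := Real.one_sub_inv_le_log_of_pos hB0
      have f : B⁻¹ ≤ 2 := by
        rw [inv_le_comm₀ hB0 (by norm_num)]; linarith
      linarith
    · have := Real.log_le_sub_one_of_pos hB0
      linarith
  -- the result
  have hBy0 : 0 < B ^ y := Real.rpow_pos_of_pos hB0 y
  -- B ≥ 1/2 and an exponent of at most 2^w keep the power above the threshold below which numbers
  -- are flushed to zero.
  have hBy : ((2 : ℝ) ^ (2 ^ w : ℕ))⁻¹ ≤ |B ^ y| := by
    rw [abs_of_pos hBy0]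
    have hyw : y ≤ ((2 ^ w : ℕ) : ℝ) := by
      rw [hWn]
      have : Q ^ 1 ≤ Q ^ 5 := hI.pow_mono (by norm_num)
      rw [pow_one] at this
      exact hyQ.trans (this.trans hW)
    calc ((2 : ℝ) ^ (2 ^ w : ℕ))⁻¹ = (1 / 2 : ℝ) ^ (((2 ^ w : ℕ)) : ℝ) := by
          rw [Real.rpow_natCast, one_div, inv_pow]
      _ ≤ (1 / 2 : ℝ) ^ y := Real.rpow_le_rpow_of_exponent_ge (by norm_num) (by norm_num) hyw
      _ ≤ B ^ y := Real.rpow_le_rpow (by norm_num) hBhalf hy0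
  have hfr := hround _ hBy
  rw [abs_of_pos hBy0] at hfr
  obtain ⟨ho0, hlo⟩ := abs_log_sub_le hBy0 (y := fround w (B ^ y)) (ρ := 1 / W) (by rw [one_div_mul_eq_div]; exact hfr)
    (by rw [div_le_div_iff₀ hW0 (by norm_num)]; linarith)
  rw [Real.log_rpow hB0] at hlo
  rw [← hy]
  have hSp : 0 < S ^ (1 / p) := Real.rpow_pos_of_pos (by linarith) _
  refine abs_sub_le_of_log hSp ho0 hε1 ?_
  rw [Real.log_rpow (by linarith)]
  have e1 : Real.log (fround w (B ^ y)) - 1 / p * Real.log S = (Real.log (fround w (B ^ y)) - y * Real.log B) +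
      (y - 1 / p) * Real.log B + 1 / p * (Real.log B - Real.log S') + 1 / p * (Real.log S' - Real.log S) := by ring
  have b1 : |(y - 1 / p) * Real.log B| ≤ Q / 2 / W * Q := abs_mul_le hy3 hlB
  have b2 : |1 / p * (Real.log B - Real.log S')| ≤ ε / 6 := by
    rw [abs_mul, abs_of_pos (by positivity : 0 < 1 / p)]
    calc 1 / p * |Real.log B - Real.log S'| ≤ 1 / p * (2 * (p * ε / 12)) := by gcongr
      _ = ε / 6 := by field_simp; norm_num
  have b3 : |1 / p * (Real.log S' - Real.log S)| ≤ Q / W := by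
    rw [abs_mul, abs_of_pos (by positivity : 0 < 1 / p)]
    have hUQ : (U : ℝ) ≤ Q := by linarith [hI.U_le, hI.U1]
    calc 1 / p * |Real.log S' - Real.log S| ≤ 1 / p * (p / W * U) := by
          gcongr
          refine hlogS.trans ?_
          gcongr
      _ = U / W := by field_simp
      _ ≤ Q / W := by gcongr
  have hfin := error_sum_le hQ4 hW hQe hε0
  rw [e1]
  have t1 := abs_add_le ((Real.log (fround w (B ^ y)) - y * Real.log B) +
      (y - 1 / p) * Real.log B + 1 / p * (Real.log B - Real.log S')) (1 / p * (Real.log S' - Real.log S))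
  have t2 := abs_add_le ((Real.log (fround w (B ^ y)) - y * Real.log B) +
      (y - 1 / p) * Real.log B) (1 / p * (Real.log B - Real.log S'))
  have t3 := abs_add_le (Real.log (fround w (B ^ y)) - y * Real.log B) ((y - 1 / p) * Real.log B)
  linarith

/-- If all differences vanish, the estimate is at most δ < 1/2 and the output is exactly 0.
Otherwise the sum is at least 1, the additive error δ becomes a relative one, and the choice of N
makes the total relative error of the sum at most pε/12. -/
theorem outVal_accuracy {w n m U C N A : ℕ} {p ε p' e Q B δ : ℝ} (hI : Input w n m U C p' e Q)
    (hR : Rounded w p ε p' e) {d : Fin m → ℝ} (hd : ∀ j, d j = 0 ∨ 1 ≤ d j ∧ d j ≤ U)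
    (hN : 4096 * ((A : ℝ) + 1) ≤ N * (p' * e)) (hδ : δ ≤ 1 / (256 * Q))
    (h1 : (1 - 8 / N) * (∑ j, d j ^ p') - δ ≤ B) (h2 : B ≤ (1 + 64 * A / N) * (∑ j, d j ^ p') + δ)
    (h3 : B ≤ Q) :
    |outVal w p' B - (∑ j, d j ^ p) ^ (1 / p)| ≤ ε * (∑ j, d j ^ p) ^ (1 / p) := by
  have hQ4 := hI.Q4
  have hQ0 := hI.Q0
  have hp0 := hR.p0
  have hε0 := hR.ε0
  have hp'0 := hI.p0
  have he0 := hI.e0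
  have hε1 := hR.ε1
  obtain ⟨hpε, hQpε, hQe, hQp', hpp⟩ := Rounded.facts hI hR
  have hδ1 : δ ≤ 1 / 1024 := hδ.trans (by
    rw [div_le_div_iff₀ (by positivity) (by norm_num)]; linarith)
  by_cases hz : ∀ j, d j = 0
  · have s1 : ∑ j, d j ^ p' = 0 := Finset.sum_eq_zero fun j _ => by rw [hz j, Real.zero_rpow hp'0.ne']
    have s2 : ∑ j, d j ^ p = 0 := Finset.sum_eq_zero fun j _ => by rw [hz j, Real.zero_rpow hp0.ne']
    rw [s1, mul_zero, zero_add] at h2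
    have : outVal w p' B = 0 := by
      unfold outVal
      rw [if_pos (by linarith)]
    rw [s2, this, Real.zero_rpow (by positivity)]
    simp
  push Not at hz
  obtain ⟨j0, hj0⟩ := hz
  obtain ⟨S, hS⟩ : ∃ S, S = ∑ j, d j ^ p := ⟨_, rfl⟩
  obtain ⟨S', hS'⟩ : ∃ S', S' = ∑ j, d j ^ p' := ⟨_, rfl⟩
  have hS1 : 1 ≤ S := by rw [hS]; exact one_le_sum_rpow hd hp0 hj0
  have hS1' : 1 ≤ S' := by rw [hS']; exact one_le_sum_rpow hd hp'0 hj0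
  have hlogS : |Real.log S' - Real.log S| ≤ |p' - p| * U := by
    rw [hS, hS']; exact abs_log_sum_rpow_sub_le hd hp0 hp'0 hj0
  rw [← hS]
  rw [← hS'] at h1 h2
  clear hS hS'
  have hN0 : (0 : ℝ) < N := by
    have h5 : 0 < (N : ℝ) * (p' * e) := by
      have : (0 : ℝ) ≤ A := by positivity
      linarith
    exact pos_of_mul_pos_left h5 hI.x0.le
  have hNpε : 1024 * ((A : ℝ) + 1) ≤ N * (p * ε) := by
    have : (N : ℝ) * (p' * e) ≤ N * (4 * (p * ε)) := by gcongr
    linarith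
  have hpε0 : 0 < p * ε := by positivity
  have hA0 : (0 : ℝ) ≤ A := by positivity
  -- The 1024 left of the window constant is 64 · 16; the same bound covers 8/N because of the
  -- summand 1 in A + 1.
  have ha : 64 * A / N ≤ p * ε / 16 := by
    rw [div_le_iff₀ hN0]; linarith
  have hb : 8 / N ≤ p * ε / 16 := by
    rw [div_le_iff₀ hN0]; linarith
  have hδp : δ ≤ p * ε / 256 := by
    refine hδ.trans ?_
    rw [div_le_div_iff₀ (by positivity) (by norm_num)]
    linarith
  have hp'1 := hI.p1
  have hpε2 : p * ε ≤ 2 := by nlinarith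
  have hBS : |B - S'| ≤ p * ε / 12 * S' := by
    have f1 : 64 * A / N * S' ≤ p * ε / 16 * S' := by gcongr
    have f2 : 8 / N * S' ≤ p * ε / 16 * S' := by gcongr
    have f3 : δ ≤ p * ε / 256 * S' := hδp.trans (le_mul_of_one_le_right (by positivity) hS1')
    have f4 : 0 ≤ p * ε * S' := by positivity
    rw [abs_le]
    constructor <;> linarith
  obtain ⟨hB0, hlogB⟩ := abs_log_sub_le (by linarith) hBS (by linarith)
  have hBhalf : 1 / 2 ≤ B := by
    have := (abs_le.mp hBS).1
    have f5 : p * ε / 12 * S' ≤ 1 / 6 * S' := mul_le_mul_of_nonneg_right (by linarith) (by linarith)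
    linarith
  have hB := root_accuracy hI hR hS1 hlogS hlogB hBhalf h3
  unfold outVal
  rwa [if_neg (not_lt.mpr hBhalf)]

/-! ### Probability -/

open MeasureTheory in
instance (w : ℕ) : IsProbabilityMeasure (coinMeasure w) := by
  unfold coinMeasure; infer_instance

theorem uniform_le_half {N : ℕ} [NeZero N] (S : Finset (Fin N)) (h : 2 * S.card ≤ N) :
    (PMF.uniformOfFintype (Fin N)).toMeasure (S : Set (Fin N)) ≤ 2⁻¹ := by
  rw [PMF.toMeasure_uniformOfFintype_apply _ (Finset.measurableSet S)]
  simp only [Fintype.card_fin, Finset.coe_sort_coe, Fintype.card_coe]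
  rw [ENNReal.div_le_iff (by simpa using NeZero.ne N) (ENNReal.natCast_ne_top N), mul_comm, ← div_eq_mul_inv,
    ENNReal.le_div_iff_mul_le (by simp) (by simp), mul_comm]
  exact_mod_cast h

/-- The event is a finite box in the product space, so independence turns its measure into a
product. -/
theorem coinMeasure_forall_mem_le (w R : ℕ) (S : Finset (Fin (2 ^ w))) (h : 2 * S.card ≤ 2 ^ w) :
    coinMeasure w {ω | ∀ t < R, ω t ∈ S} ≤ 2⁻¹ ^ R := by
  have e : {ω : ℕ → Fin (2 ^ w) | ∀ t < R, ω t ∈ S} =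
      Set.pi (Finset.range R) (fun _ => (S : Set (Fin (2 ^ w)))) := by
    ext ω; simp
  unfold coinMeasure
  rw [e, MeasureTheory.Measure.infinitePi_pi _ (fun _ _ => Finset.measurableSet S)]
  calc _ ≤ ∏ _t ∈ Finset.range R, (2⁻¹ : ENNReal) := Finset.prod_le_prod' fun _ _ => uniform_le_half S h
    _ = _ := by rw [Finset.prod_const, Finset.card_range]

/-- If each of `k` events has failure probability at most `1 / 2`, then all of them succeed in some of `R`
trials, except with probability at most `k / 2 ^ R`. -/
theorem le_coinMeasure (w R k : ℕ) (S : Fin k → Finset (Fin (2 ^ w))) (h : ∀ i, 2 * (S i).card ≤ 2 ^ w)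
    (G : Set (ℕ → Fin (2 ^ w))) (hG : ∀ ω, (∀ i, ∃ t < R, ω t ∉ S i) → ω ∈ G) :
    ENNReal.ofReal (1 - k / 2 ^ R) ≤ coinMeasure w G := by
  have hE : coinMeasure w (⋃ i, {ω | ∀ t < R, ω t ∈ S i}) ≤ k * 2⁻¹ ^ R :=
    calc _ ≤ ∑ i, coinMeasure w {ω | ∀ t < R, ω t ∈ S i} := MeasureTheory.measure_iUnion_fintype_le _ _
      _ ≤ ∑ _i : Fin k, 2⁻¹ ^ R := Finset.sum_le_sum fun i _ => coinMeasure_forall_mem_le w R (S i) (h i)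
      _ = _ := by simp
  have h1 : 1 ≤ coinMeasure w G + k * 2⁻¹ ^ R :=
    calc 1 = coinMeasure w Set.univ := (MeasureTheory.measure_univ).symm
      _ ≤ coinMeasure w (G ∪ ⋃ i, {ω | ∀ t < R, ω t ∈ S i}) := by
          refine MeasureTheory.measure_mono fun ω _ => ?_
          by_cases hω : ∀ i, ∃ t < R, ω t ∉ S i
          · exact Or.inl (hG ω hω)
          · push Not at hω
            obtain ⟨i, hi⟩ := hω
            exact Or.inr (Set.mem_iUnion.mpr ⟨i, hi⟩)
      _ ≤ _ := MeasureTheory.measure_union_le _ _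
      _ ≤ _ := by gcongr
  have e : ENNReal.ofReal (k / 2 ^ R) = k * 2⁻¹ ^ R := by
    rw [ENNReal.ofReal_div_of_pos (by positivity), ENNReal.ofReal_natCast, ENNReal.ofReal_pow (by norm_num),
      div_eq_mul_inv, ENNReal.inv_pow]
    simp
  rw [ENNReal.ofReal_sub _ (by positivity), ENNReal.ofReal_one, e, tsub_le_iff_right]
  exact h1

/-- The multiplier is given by the leading bits of the random word. Every value of the leading bits
has at most 2^s continuations, so densities of multipliers carry over to words. -/
theorem card_div_mem_le (w s : ℕ) (K : Finset ℕ) :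
    (Finset.univ.filter fun x : Fin (2 ^ w) => (x : ℕ) / 2 ^ s ∈ K).card ≤ K.card * 2 ^ s := by
  have e : K.card * 2 ^ s = (K ×ˢ Finset.range (2 ^ s)).card := by rw [Finset.card_product, Finset.card_range]
  rw [e]
  refine Finset.card_le_card_of_injOn (fun x => ((x : ℕ) / 2 ^ s, (x : ℕ) % 2 ^ s)) ?_ ?_
  · intro x hx
    rw [Finset.mem_coe, Finset.mem_filter] at hx
    rw [Finset.mem_coe, Finset.mem_product]
    exact ⟨hx.2, Finset.mem_range.mpr (Nat.mod_lt _ (Nat.two_pow_pos s))⟩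
  · intro x _ y _ hxy
    simp only [Prod.mk.injEq] at hxy
    refine Fin.ext ?_
    rw [← Nat.div_add_mod (x : ℕ) (2 ^ s), hxy.1, hxy.2, Nat.div_add_mod]

/-- The trials give 2^(clog n + 1) ≥ n to the power C; one power of n is spent on the union bound,
the other c remain. -/
theorem div_two_pow_le {n C : ℕ} {c : ℝ} (hn : 1 ≤ n) (hC : c + 1 ≤ C) :
    (n : ℝ) / 2 ^ (C * (Nat.clog 2 n + 1)) ≤ 1 / (n : ℝ) ^ c := by
  have hn0 : (0 : ℝ) < n := by exact_mod_cast hn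
  have hn1 : (1 : ℝ) ≤ n := by exact_mod_cast hn
  rw [div_le_div_iff₀ (by positivity) (by positivity), one_mul]
  have h1 : (n : ℝ) ≤ 2 ^ (Nat.clog 2 n + 1) := by
    have : n ≤ 2 ^ (Nat.clog 2 n + 1) := (Nat.le_pow_clog (by norm_num) n).trans
      (Nat.pow_le_pow_right (by norm_num) (Nat.le_succ _))
    exact_mod_cast this
  calc (n : ℝ) * (n : ℝ) ^ c = (n : ℝ) ^ (c + 1) := by rw [Real.rpow_add_one hn0.ne', mul_comm]
    _ ≤ (n : ℝ) ^ (C : ℝ) := Real.rpow_le_rpow_of_exponent_le hn1 hC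
    _ = (n : ℝ) ^ C := Real.rpow_natCast _ _
    _ ≤ (2 ^ (Nat.clog 2 n + 1)) ^ C := by gcongr
    _ = 2 ^ (C * (Nat.clog 2 n + 1)) := by rw [← pow_mul, mul_comm]

/-! ### Accuracy of a run with a good trial for each position. -/

section Success

variable {w n m U C ν : ℕ} {p ε Q : ℝ}

theorem dist_zero_or_one (x y : ℕ) (hx : x < U) (hy : y < U) :
    |(x : ℝ) - y| = 0 ∨ 1 ≤ |(x : ℝ) - y| ∧ |(x : ℝ) - y| ≤ U := by
  rw [abs_sub_eq_natAbs]
  rcases Nat.eq_zero_or_pos (((x : ℤ) - y).natAbs) with h | h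
  · left; exact_mod_cast h
  · right
    constructor
    · exact_mod_cast h
    · have : ((x : ℤ) - y).natAbs ≤ U := by omega
      exact_mod_cast this

/-- The result of a run in which some trial is good for position `i`. -/
theorem within_accuracy (hI : Input w n m U C (fround w p) (fround w ε) Q)
    (hR : Rounded w p ε (fround w p) (fround w ε))
    (hlow : 4096 * (((Nat.clog 2 U : ℕ) : ℝ) + 1) ≤ 2 ^ ν * (fround w p * fround w ε))
    (hup : 2 ^ ν * (fround w p * fround w ε) ≤ 131072 * ((Nat.clog 2 U : ℕ) + 1))
    {T : Fin n → ℕ} {P : Fin m → ℕ} (hT : ∀ i, T i < U) (hP : ∀ j, P j < U) (hmn : m ≤ n)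
    {ω : ℕ → Fin (2 ^ w)} (i : Fin (n - m + 1)) {B : ℝ}
    (hB : (setupPar n m U C ν (fround w p)).Within w ω (extend T) (extend P)
        ((Q ^ 11) ^ 21 / 2 ^ w) (C * (Nat.clog 2 n + 1)) i B)
    (hgood : ∃ t < C * (Nat.clog 2 n + 1), ∑ j, est (fround w p) (2 ^ ν) (setupPar n m U C ν (fround w p)).Lam
      ((setupPar n m U C ν (fround w p)).mult w (ω t)) (Nat.clog 2 U) (window hmn T i j) (P j) ≤
        (1 + 64 * (Nat.clog 2 U : ℕ) / (2 ^ ν : ℕ)) * ∑ j, |(window hmn T i j : ℝ) - P j| ^ fround w p) :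
    (1 - ε) * lpDist p (window hmn T i) P ≤ outVal w (fround w p) B ∧
      outVal w (fround w p) B ≤ (1 + ε) * lpDist p (window hmn T i) P := by
  obtain ⟨PP, hPP⟩ : ∃ PP, PP = setupPar n m U C ν (fround w p) := ⟨_, rfl⟩
  have G := hI.good hup
  rw [← hPP] at G hB hgood
  have hA : PP.A = Nat.clog 2 U := by rw [hPP]; rfl
  have hN : PP.N = 2 ^ ν := by rw [hPP]; rfl
  have hm : PP.m = m := by rw [hPP]; rfl
  have hn : PP.n = n := by rw [hPP]; rfl
  have hU : PP.U = U := by rw [hPP]; rfl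
  have hp : PP.p = fround w p := by rw [hPP]; rfl
  set X := window hmn T i with hX
  have hXU : ∀ j, X j < U := fun j => hT _
  have hUA := Nat.le_pow_clog (b := 2) (by norm_num) U
  have hsum : ∀ b, PP.trialSum b (extend T) (extend P) PP.A i =
      ∑ j, est (fround w p) (2 ^ ν) PP.Lam b (Nat.clog 2 U) (X j) (P j) := by
    intro b
    rw [G.trialSum_eq b _ _ _ (by rw [hm, hn]; exact i.isLt), hA, hN, hm, hp, Finset.sum_range]
    refine Finset.sum_congr rfl fun j _ => ?_
    have h1 : extend T ((i : ℕ) + j) = X j := by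
      unfold extend
      rw [dif_pos (by have := i.isLt; have := j.isLt; omega)]
      rfl
    have h2 : extend P (j : ℕ) = P j := by
      unfold extend
      rw [dif_pos j.isLt]
    rw [h1, h2]
  have hd : ∀ j, |(X j : ℝ) - P j| = 0 ∨ 1 ≤ |(X j : ℝ) - P j| ∧ |(X j : ℝ) - P j| ≤ U := fun j =>
    dist_zero_or_one _ _ (hXU j) (hP j)
  obtain ⟨h1, h2, h3⟩ := hB
  simp only [hsum] at h2 h3
  rw [hn, hU] at h1 h2
  have hQ0 := hI.Q0
  have hδ : (Q ^ 11) ^ 21 / 2 ^ w ≤ 1 / (256 * Q) := by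
    rw [div_le_div_iff₀ (by positivity) (by positivity), one_mul]
    refine le_trans ?_ hI.hw
    calc (Q ^ 11) ^ 21 * (256 * Q) = 256 * Q ^ 232 := by ring
      _ ≤ Q ^ (232 + 9) := hI.const_le (by norm_num) 232
      _ ≤ Q ^ 330 := hI.pow_mono (by norm_num)
  have hNpos : (0 : ℝ) < ((2 ^ ν : ℕ) : ℝ) := by positivity
  have hN2 : 2 ≤ 2 ^ ν := by
    by_contra hh
    have e0 : 2 ^ ν ≤ 1 := by omega
    have e1 : (2 : ℝ) ^ ν ≤ 1 := by exact_mod_cast e0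
    have e2 : (2 : ℝ) ^ ν * (fround w p * fround w ε) ≤ 1 := mul_le_one₀ e1 hI.x0.le hI.x1
    have e3 : (0 : ℝ) ≤ (Nat.clog 2 U : ℕ) := by positivity
    linarith
  have hS0 : 0 ≤ ∑ j, |(X j : ℝ) - P j| ^ fround w p := Finset.sum_nonneg fun j _ => by positivity
  have hSn : ∑ j, |(X j : ℝ) - P j| ^ fround w p ≤ n * U := by
    calc _ ≤ ∑ _j : Fin m, (U : ℝ) := by
          refine Finset.sum_le_sum fun j _ => rpow_le_max (abs_nonneg _) hI.p0 hI.p1 hI.U1 ?_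
          rcases hd j with h | h
          · rw [h]; positivity
          · exact h.2
      _ = m * U := by simp
      _ ≤ n * U := by gcongr
  have h8 : (1 - 8 / ((2 ^ ν : ℕ) : ℝ)) * ∑ j, |(X j : ℝ) - P j| ^ fround w p ≤
      ∑ j, |(X j : ℝ) - P j| ^ fround w p := by
    refine mul_le_of_le_one_left hS0 ?_
    have : 0 ≤ 8 / ((2 ^ ν : ℕ) : ℝ) := by positivity
    linarith
  -- The lower bound is supplied by all trials, since `le_est` holds for every multiplier; the upper
  -- bound is supplied by the good trial alone. The cap nU on the minimum gives B ≤ Q.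
  have hacc := outVal_accuracy (N := 2 ^ ν) (A := Nat.clog 2 U) (B := B) hI hR hd
    (by push_cast; exact hlow) hδ (h2 _ (h8.trans hSn) fun t _ => by
      rw [Finset.mul_sum]
      refine Finset.sum_le_sum fun j _ => ?_
      have hb := G.mult_lt (ω t).isLt
      exact le_est hI.p0 hI.p1 hN2 G.Lam_pos (Nat.le_add_right _ _) hb
        ((hXU j).trans_le hUA) ((hP j).trans_le hUA))
    (by
      obtain ⟨t, ht, hg⟩ := hgood
      exact (h3 t ht).trans (by linarith))
    (h1.trans (by linarith [hI.nU_le, mul_nonneg (by positivity : (0 : ℝ) ≤ n) (by positivity : (0 : ℝ) ≤ U)]))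
  rw [abs_le] at hacc
  unfold lpDist
  constructor <;> linarith [hacc.1, hacc.2]

end Success

/-! ### Running time -/

theorem one_le_logb_succ {x : ℕ} (hx : 1 ≤ x) : 1 ≤ Real.logb 2 (x + 1) := by
  rw [Real.le_logb_iff_rpow_le (by norm_num) (by positivity), Real.rpow_one]
  have : (1 : ℝ) ≤ x := by exact_mod_cast hx
  linarith

/-- From 2^(clog x) ≤ 2x ≤ (x + 1)^2. The logarithms of x + 1 are at least 1, so additive constants
can be absorbed as well. -/
theorem clog_le_logb {x : ℕ} (hx : 1 ≤ x) : (Nat.clog 2 x : ℝ) ≤ 2 * Real.logb 2 (x + 1) := by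
  have hx1 : (1 : ℝ) ≤ x := by exact_mod_cast hx
  have h1 : ((2 : ℝ) ^ Nat.clog 2 x) ≤ (x + 1) ^ 2 := by
    have : ((2 ^ Nat.clog 2 x : ℕ) : ℝ) ≤ 2 * x := by exact_mod_cast pow_clog_le hx
    push_cast at this
    nlinarith
  have h2 := Real.logb_le_logb_of_le (b := 2) (by norm_num) (by positivity) h1
  rw [Real.logb_pow, Real.logb_pow, Real.logb_self_eq_one (by norm_num), mul_one] at h2
  exact_mod_cast h2

/-- The chunks have length proportional to m, so the transforms together have length O(n); only log
m, not log n, appears as the transform factor. -/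
theorem chunks_le {n m L : ℕ} (hmn : m ≤ n) (hL : L ≤ 4 * m) : (n / m + 1) * L ≤ 8 * n := by
  have h1 := Nat.div_mul_le_self n m
  calc (n / m + 1) * L ≤ (n / m + 1) * (4 * m) := Nat.mul_le_mul_left _ hL
    _ = 4 * (n / m * m) + 4 * m := by ring
    _ ≤ 8 * n := by omega

/-- Products of numbers that are at least `1`. -/
theorem time_arith {Y n Lm LU Ln C A M k X R W cm cn : ℝ} (hY : 1 ≤ Y) (hn : 1 ≤ n) (hLm : 1 ≤ Lm) (hLU : 1 ≤ LU)
    (hLn : 1 ≤ Ln) (hC : 0 ≤ C) (hA0 : 0 ≤ A) (hA : A ≤ 2 * LU) (hM0 : 0 ≤ M) (hM : M ≤ 10000000 * (Y * LU))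
    (hk0 : 0 ≤ k) (hk : k ≤ 3 * Lm) (hX0 : 0 ≤ X) (hX : X ≤ 8 * n) (hR : R ≤ C * (3 * Ln))
    (hW : W ≤ 10000000 * (Y * LU)) (hcm : cm ≤ 2 * Lm) (hcn : cn ≤ 2 * Ln) :
    (A * 9 + cm * 11 + cn * 9 + W * 9 + 110) +
      (R * (A * (X * k * M * 1200 + 5) + n * 100 + 100 + 5) + n * 60 + k * X * 100 + 200) + 5 ≤
      (10 ^ 13 * C + 10 ^ 9) * (Y * n * Lm * LU ^ 2 * Ln) := by
  have p1 : 1 ≤ Y * LU := one_le_mul_of_one_le_of_one_le hY hLU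
  have p2 : 1 ≤ n * Lm := one_le_mul_of_one_le_of_one_le hn hLm
  set V := Y * n * Lm * LU ^ 2 with hV
  have eV : V = (Y * LU) * (n * Lm) * LU := by rw [hV]; ring
  have v1 : Y * LU ≤ V := by
    rw [eV, mul_assoc]
    exact le_mul_of_one_le_right (by linarith) (one_le_mul_of_one_le_of_one_le p2 hLU)
  have v2 : n * Lm ≤ V := by
    have : V = (n * Lm) * ((Y * LU) * LU) := by rw [hV]; ring
    rw [this]
    exact le_mul_of_one_le_right (by linarith) (one_le_mul_of_one_le_of_one_le p1 hLU)
  have v3 : n ≤ n * Lm := le_mul_of_one_le_right (by linarith) hLm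
  have v4 : Lm ≤ n * Lm := le_mul_of_one_le_left (by linarith) hn
  have v5 : LU ≤ Y * LU := le_mul_of_one_le_left (by linarith) hY
  have v6 : X * k ≤ 24 * (n * Lm) := by
    calc X * k ≤ (8 * n) * (3 * Lm) := by gcongr
      _ = _ := by ring
  have v7 : A * (X * k * M * 1200) ≤ 576000000000 * V := by
    calc A * (X * k * M * 1200) ≤ (2 * LU) * ((24 * (n * Lm)) * (10000000 * (Y * LU)) * 1200) := by gcongr
      _ = 576000000000 * V := by rw [eV]; ring
  have v8 : A * (X * k * M * 1200 + 5) + n * 100 + 100 + 5 ≤ 10 ^ 12 * V := by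
    have : A * (X * k * M * 1200 + 5) = A * (X * k * M * 1200) + A * 5 := by ring
    rw [this]
    linarith
  have v9 : R * (A * (X * k * M * 1200 + 5) + n * 100 + 100 + 5) ≤ (C * (3 * Ln)) * (10 ^ 12 * V) := by
    gcongr
  have hV1 : 1 ≤ V := by linarith
  have w1 : V ≤ V * Ln := le_mul_of_one_le_right (by linarith) hLn
  have w2 : Ln ≤ V * Ln := le_mul_of_one_le_left (by linarith) hV1
  have w3 : 0 ≤ C * (V * Ln) := by positivity
  have e1 : (C * (3 * Ln)) * (10 ^ 12 * V) = 3 * 10 ^ 12 * (C * (V * Ln)) := by ring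
  have e2 : (10 ^ 13 * C + 10 ^ 9) * (V * Ln) = 10 ^ 13 * (C * (V * Ln)) + 10 ^ 9 * (V * Ln) := by ring
  have e3 : k * X = X * k := mul_comm _ _
  rw [e1] at v9
  rw [e2, e3]
  linarith

/-! ### Running time, word length and the bad random words. -/

section Final

variable {w n m U C ν : ℕ} {p ε Q : ℝ}

theorem Rounded.inv_le (hI : Input w n m U C (fround w p) (fround w ε) Q)
    (hR : Rounded w p ε (fround w p) (fround w ε)) : p * ε ≤ 4 * (fround w p * fround w ε) := by
  have hp0 := hR.p0
  have hε0 := hR.ε0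
  have hW256 := W256 hI
  have hpW : p / 2 ^ w ≤ p / 2 := by gcongr; linarith
  have hεW : ε / 2 ^ w ≤ ε / 2 := by gcongr; linarith
  have hpa := abs_le.mp hR.hp
  have hea := abs_le.mp hR.he
  have h1 : p ≤ 2 * fround w p := by linarith [hpa.1]
  have h2 : ε ≤ 2 * fround w ε := by linarith [hea.1]
  have := hI.p0
  calc p * ε ≤ (2 * fround w p) * (2 * fround w ε) := by gcongr
    _ = _ := by ring

/-- The product p'ε' of the machine words is at least pε/4, so the window size and the number of
rounds that find it are O(log U / (pε)). The remaining factors are the number of scales, the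
transforms and the trials. -/
theorem time_le (hI : Input w n m U C (fround w p) (fround w ε) Q)
    (hR : Rounded w p ε (fround w p) (fround w ε)) (hp1 : p ≤ 1)
    (hup : 2 ^ ν * (fround w p * fround w ε) ≤ 131072 * ((Nat.clog 2 U : ℕ) + 1)) {t : ℕ}
    (ht : t ≤ setupCost n m U (fround w p * fround w ε) + (setupPar n m U C ν (fround w p)).mainCost + 5) :
    (t : ℝ) ≤ (10 ^ 13 * C + 10 ^ 9) * (p⁻¹ * ε⁻¹ * n * Real.logb 2 (m + 1) * Real.logb 2 (U + 1) ^ 2 *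
      Real.logb 2 (n + 1)) := by
  have hp0 := hR.p0
  have hε0 := hR.ε0
  have hm := hI.hm
  have hmn := hI.hmn
  have hLm := one_le_logb_succ hm
  have hLn := one_le_logb_succ (hm.trans hmn)
  have hLU := one_le_logb_succ hI.hU
  have hcU := clog_le_logb hI.hU
  have hcm := clog_le_logb hm
  have hcn := clog_le_logb (hm.trans hmn)
  have hY : 1 ≤ p⁻¹ * ε⁻¹ := one_le_mul_of_one_le_of_one_le ((one_le_inv₀ hp0).mpr hp1) ((one_le_inv₀ hε0).mpr hR.ε1)
  have hx0 := hI.x0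
  have hxY : ∀ {y : ℝ}, y * (fround w p * fround w ε) ≤ 131072 * ((Nat.clog 2 U : ℕ) + 1) →
      y ≤ 1572864 * (p⁻¹ * ε⁻¹ * Real.logb 2 (U + 1)) := by
    intro y hy
    have h1 : y * (fround w p * fround w ε) ≤ 393216 * Real.logb 2 (U + 1) := by linarith
    have h2 : 1 ≤ 4 * (fround w p * fround w ε) * (p⁻¹ * ε⁻¹) := by
      have h3 := hR.inv_le hI
      have h4 : 1 = p * ε * (p⁻¹ * ε⁻¹) := by field_simp
      rw [h4]
      gcongr
    have h5 : y * (fround w p * fround w ε) ≤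
        1572864 * (p⁻¹ * ε⁻¹ * Real.logb 2 (U + 1)) * (fround w p * fround w ε) := by
      calc _ ≤ 393216 * Real.logb 2 (U + 1) * 1 := by linarith
        _ ≤ 393216 * Real.logb 2 (U + 1) * (4 * (fround w p * fround w ε) * (p⁻¹ * ε⁻¹)) := by gcongr
        _ = _ := by ring
    exact le_of_mul_le_mul_right h5 hx0
  have hM : ((4 * 2 ^ ν : ℕ) : ℝ) ≤ 10000000 * (p⁻¹ * ε⁻¹ * Real.logb 2 (U + 1)) := by
    have h1 := hxY hup
    have h2 : 0 ≤ p⁻¹ * ε⁻¹ * Real.logb 2 (U + 1) := by positivity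
    push_cast
    linarith
  have hW : (windowBound U (fround w p * fround w ε) : ℝ) ≤ 10000000 * (p⁻¹ * ε⁻¹ * Real.logb 2 (U + 1)) := by
    have h1 : (windowBound U (fround w p * fround w ε) : ℝ) <
        131072 * (((Nat.clog 2 U : ℕ) : ℝ) + 1) / (fround w p * fround w ε) + 1 :=
      Nat.ceil_lt_add_one (by positivity)
    have h2 := hxY (y := 131072 * (((Nat.clog 2 U : ℕ) : ℝ) + 1) / (fround w p * fround w ε))
      (by rw [div_mul_cancel₀ _ hx0.ne'])
    have h3 : 1 ≤ p⁻¹ * ε⁻¹ * Real.logb 2 (U + 1) := one_le_mul_of_one_le_of_one_le hY hLU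
    linarith
  have hX : (((n / m + 1) * 2 ^ (Nat.clog 2 m + 1) : ℕ) : ℝ) ≤ 8 * n := by
    have : 2 ^ (Nat.clog 2 m + 1) ≤ 4 * m := by
      have := pow_clog_le hm
      rw [pow_succ]; omega
    exact_mod_cast chunks_le hmn this
  have hLX : (2 ^ (Nat.clog 2 m + 1) : ℕ) ≤ (n / m + 1) * 2 ^ (Nat.clog 2 m + 1) :=
    Nat.le_mul_of_pos_left _ (Nat.succ_pos _)
  have hcost : t ≤ (Nat.clog 2 U * 9 + Nat.clog 2 m * 11 + Nat.clog 2 n * 9 +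
      windowBound U (fround w p * fround w ε) * 9 + 110) + (C * (Nat.clog 2 n + 1) * (Nat.clog 2 U *
        ((n / m + 1) * 2 ^ (Nat.clog 2 m + 1) * (Nat.clog 2 m + 1) * (4 * 2 ^ ν) * 1200 + 5) + n * 100 + 100 + 5) +
        n * 60 + (Nat.clog 2 m + 1) * ((n / m + 1) * 2 ^ (Nat.clog 2 m + 1)) * 100 + 200) + 5 := by
    refine ht.trans ?_
    have h1 : (Nat.clog 2 m + 1) * 2 ^ (Nat.clog 2 m + 1) ≤
        (Nat.clog 2 m + 1) * ((n / m + 1) * 2 ^ (Nat.clog 2 m + 1)) := Nat.mul_le_mul_left _ hLX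
    have h2 : (setupPar n m U C ν (fround w p)).mainCost = C * (Nat.clog 2 n + 1) * (Nat.clog 2 U *
        ((n / m + 1) * 2 ^ (Nat.clog 2 m + 1) * (Nat.clog 2 m + 1) * (4 * 2 ^ ν) * 1200 + 5) + n * 100 + 100 + 5) +
        n * 60 + (Nat.clog 2 m + 1) * 2 ^ (Nat.clog 2 m + 1) * 100 + 200 := rfl
    rw [h2]
    unfold setupCost
    omega
  refine (Nat.cast_le.mpr hcost).trans ?_
  have := time_arith (C := C) (A := Nat.clog 2 U) (M := ((4 * 2 ^ ν : ℕ) : ℝ)) (k := ((Nat.clog 2 m + 1 : ℕ) : ℝ))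
    (X := (((n / m + 1) * 2 ^ (Nat.clog 2 m + 1) : ℕ) : ℝ)) (R := ((C * (Nat.clog 2 n + 1) : ℕ) : ℝ))
    hY hI.n1 hLm hLU hLn (by positivity) (by positivity) hcU (by positivity) hM (by positivity)
    (by push_cast; linarith) (by positivity) hX (by push_cast; gcongr; linarith) hW hcm hcn
  refine le_trans (le_of_eq ?_) this
  push_cast
  ring

/-- The analysis needs exponents of at most 1, so the rounded p must not exceed 1. It does not, as 1
is a multiple of the ulp of any number below it. -/
theorem fround_le_one {w : ℕ} (hw : 0 < w) {x : ℝ} (hx0 : 0 < x) (hx1 : x ≤ 1) : fround w x ≤ 1 := by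
  unfold fround
  split_ifs
  · norm_num
  · have he : Int.log 2 |x| ≤ 0 := by
      rw [abs_of_pos hx0, ← Int.log_one_right (R := ℝ) 2]
      exact Int.log_mono_right hx0 hx1
    obtain ⟨k, hk⟩ : ∃ k : ℕ, Int.log 2 |x| - (w : ℤ) + 1 = -(k : ℤ) :=
      ⟨((w : ℤ) - 1 - Int.log 2 |x|).toNat, by omega⟩
    simp only [hk, zpow_neg, zpow_natCast, div_inv_eq_mul]
    rw [mul_inv_le_iff₀ (by positivity), one_mul, round_eq]
    have h1 : ⌊x * 2 ^ k + 1 / 2⌋ ≤ ⌊(((2 ^ k : ℕ) : ℤ) : ℝ) + 1 / 2⌋ := by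
      refine Int.floor_mono ?_
      push_cast
      have : x * 2 ^ k ≤ 1 * 2 ^ k := by gcongr
      linarith
    have h2 : ⌊(((2 ^ k : ℕ) : ℤ) : ℝ) + 1 / 2⌋ = ((2 ^ k : ℕ) : ℤ) := by
      rw [Int.floor_eq_iff]; constructor <;> linarith
    rw [h2] at h1
    exact_mod_cast h1

/-- Long enough words. -/
theorem exists_input (hmn : m ≤ n) (hm : 1 ≤ m) (hU : 1 ≤ U) (hC : 1 ≤ C) (hp0 : 0 < p) (hp1 : p < 1) (hε0 : 0 < ε)
    (hε1 : ε ≤ 1) (hw : ((2000 + C : ℕ) : ℝ) * (1 + Real.logb 2 (n * U / (p * ε))) ≤ w) :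
    ∃ Q, Input w n m U C (fround w p) (fround w ε) Q ∧ Rounded w p ε (fround w p) (fround w ε) := by
  have hn1 : (1 : ℝ) ≤ n := by exact_mod_cast hm.trans hmn
  have hU1 : (1 : ℝ) ≤ U := by exact_mod_cast hU
  have hpε : p * ε ≤ 1 := mul_le_one₀ hp1.le hε0.le hε1
  have hpε0 : 0 < p * ε := by positivity
  -- The factor 2 accounts for the summand 1 in the hypothesis: log q = 1 + log(nU/(pε)), so the
  -- hypothesis says q^(2000 + C) ≤ 2^w.
  obtain ⟨q, hq⟩ : ∃ q, q = 2 * (n * U / (p * ε)) := ⟨_, rfl⟩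
  have hqn : 2 * (n : ℝ) ≤ q := by
    rw [hq]
    have : (n : ℝ) ≤ n * U / (p * ε) := by
      rw [le_div_iff₀ hpε0]
      calc (n : ℝ) * (p * ε) ≤ n * 1 := by gcongr
        _ ≤ n * U := by gcongr
    linarith
  have hq2 : 2 ≤ q := by linarith
  have hq0 : 0 < q := by linarith
  have hqpε : 2 ≤ q * (p * ε) := by
    have e : q * (p * ε) = 2 * (n * U) := by rw [hq]; field_simp
    rw [e]
    have : (1 : ℝ) ≤ n * U := one_le_mul_of_one_le_of_one_le hn1 hU1
    linarith
  have hqw : q ^ (2000 + C) ≤ 2 ^ w := by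
    have h1 : Real.logb 2 q = 1 + Real.logb 2 (n * U / (p * ε)) := by
      rw [hq, Real.logb_mul (by norm_num) (by positivity), Real.logb_self_eq_one (by norm_num)]
    rw [← h1] at hw
    have h2 : (2 : ℝ) ^ (((2000 + C : ℕ) : ℝ) * Real.logb 2 q) ≤ 2 ^ (w : ℝ) :=
      Real.rpow_le_rpow_of_exponent_le (by norm_num) hw
    rwa [mul_comm, Real.rpow_mul (by norm_num), Real.rpow_logb (by norm_num) (by norm_num) hq0, Real.rpow_natCast,
      Real.rpow_natCast] at h2
  have hqj : ∀ {j : ℕ}, j ≤ 2000 + C → q ^ j ≤ 2 ^ w := fun hj =>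
    (pow_le_pow_right₀ (by linarith) hj).trans hqw
  have hw0 : 0 < w := by
    by_contra hh
    have h1 := hqj (j := 1) (by omega)
    have h2 : w = 0 := by omega
    rw [h2, pow_zero, pow_one] at h1
    linarith
  have hq1w : q ≤ 2 ^ w := by have := hqj (j := 1) (by omega); rwa [pow_one] at this
  have htiny : ∀ {x : ℝ}, 1 ≤ q * x → ((2 : ℝ) ^ (2 ^ w : ℕ))⁻¹ ≤ x := by
    intro x hx
    refine (inv_anti₀ (by positivity) (pow_lt_pow_pow w).le).trans ?_
    rw [inv_le_iff_one_le_mul₀ (by positivity)]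
    have hx0 : 0 < x := pos_of_mul_pos_right (by linarith) hq0.le
    calc 1 ≤ q * x := hx
      _ ≤ 2 ^ w * x := by gcongr
      _ = x * 2 ^ w := mul_comm _ _
  have hqp : 1 ≤ q * p := by
    have : q * (p * ε) ≤ q * (p * 1) := by gcongr
    rw [mul_one] at this
    linarith
  have hqε : 1 ≤ q * ε := by
    have : q * (p * ε) ≤ q * (1 * ε) := by gcongr
    rw [one_mul] at this
    linarith
  have rp := abs_fround_sub_le_of_le (w := w) (x := p) (by rw [abs_of_pos hp0]; exact htiny hqp)
  have rε := abs_fround_sub_le_of_le (w := w) (x := ε) (by rw [abs_of_pos hε0]; exact htiny hqε)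
  rw [abs_of_pos hp0] at rp
  rw [abs_of_pos hε0] at rε
  have hW2 : (2 : ℝ) ≤ 2 ^ w := by linarith
  have hpW : p / 2 ^ w ≤ p / 2 := by gcongr
  have hεW : ε / 2 ^ w ≤ ε / 2 := by gcongr
  have hp' : p / 2 ≤ fround w p := by linarith [(abs_le.mp rp).1]
  have hε' : ε / 2 ≤ fround w ε := by linarith [(abs_le.mp rε).1]
  have hp'0 : 0 < fround w p := by linarith
  have hε'0 : 0 < fround w ε := by linarith
  have hx : p * ε ≤ 4 * (fround w p * fround w ε) := by
    calc p * ε = 4 * (p / 2 * (ε / 2)) := by ring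
      _ ≤ _ := by gcongr
  refine ⟨4 * n * U / (fround w p * fround w ε), ⟨hm, hmn, hU, hp'0, fround_le_one hw0 hp0 hp1.le, hε'0,
    fround_le_one hw0 hε0 hε1, by field_simp, ?_, ?_⟩, hp0, hε0, hε1, rp, rε⟩
  -- Q is defined from the rounded p and ε. It is at most 8q ≤ q^4, and 4 · 330 = 1320 is below
  -- 2000.
  · have h1 : 4 * n * U / (fround w p * fround w ε) ≤ q ^ 4 := by
      rw [div_le_iff₀ (by positivity)]
      have e : 2 * (n * U : ℝ) = q * (p * ε) := by rw [hq]; field_simp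
      calc 4 * (n : ℝ) * U = 2 * (q * (p * ε)) := by rw [← e]; ring
        _ ≤ 2 * (q * (4 * (fround w p * fround w ε))) := by gcongr
        _ = (2 ^ 3 * q) * (fround w p * fround w ε) := by ring
        _ ≤ (q ^ 3 * q) * (fround w p * fround w ε) := by gcongr
        _ = _ := by ring
    calc _ ≤ (q ^ 4) ^ 330 := by gcongr
      _ = q ^ 1320 := by rw [← pow_mul]
      _ ≤ 2 ^ w := hqj (by omega)
  · have h1 : (C : ℝ) ≤ q ^ C := by
      have h2 : (C : ℝ) ≤ 2 ^ C := by exact_mod_cast Nat.lt_two_pow_self.le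
      refine h2.trans ?_
      gcongr
    have h3 : ((C * (n + 1) : ℕ) : ℝ) ≤ 2 ^ w := by
      push_cast
      calc (C : ℝ) * (n + 1) ≤ q ^ C * q := by gcongr; linarith
        _ = q ^ (C + 1) := (pow_succ _ _).symm
        _ ≤ 2 ^ w := hqj (by omega)
    exact_mod_cast h3

/-- The random words for which a trial is bad. -/
noncomputable def badWords (n m U C ν w : ℕ) (p' : ℝ) (X Y : Fin m → ℕ) : Finset (Fin (2 ^ w)) :=
  Finset.univ.filter fun x => (x : ℕ) / 2 ^ (w - (setupPar n m U C ν p').lam) ∈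
    (Finset.range (setupPar n m U C ν p').Lam).filter fun k =>
      (1 + 64 * (Nat.clog 2 U : ℕ) / (2 ^ ν : ℕ)) * ∑ j, |(X j : ℝ) - Y j| ^ p' <
        ∑ j, est p' (2 ^ ν) (setupPar n m U C ν p').Lam ((setupPar n m U C ν p').Lam + k) (Nat.clog 2 U) (X j) (Y j)

theorem card_badWords_le (hI : Input w n m U C (fround w p) (fround w ε) Q)
    (hlow : 4096 * (((Nat.clog 2 U : ℕ) : ℝ) + 1) ≤ 2 ^ ν * (fround w p * fround w ε))
    (hup : 2 ^ ν * (fround w p * fround w ε) ≤ 131072 * ((Nat.clog 2 U : ℕ) + 1))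
    {X Y : Fin m → ℕ} (hX : ∀ j, X j < U) (hY : ∀ j, Y j < U) :
    2 * (badWords n m U C ν w (fround w p) X Y).card ≤ 2 ^ w := by
  have G := hI.good hup
  have hl := G.lam_le
  have hUA := Nat.le_pow_clog (b := 2) (by norm_num) U
  have hN2 : 2 ≤ 2 ^ ν := by
    by_contra hh
    have e0 : 2 ^ ν ≤ 1 := by omega
    have e1 : (2 : ℝ) ^ ν ≤ 1 := by exact_mod_cast e0
    have e2 : (2 : ℝ) ^ ν * (fround w p * fround w ε) ≤ 1 := mul_le_one₀ e1 hI.x0.le hI.x1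
    have e3 : (0 : ℝ) ≤ (Nat.clog 2 U : ℕ) := by positivity
    linarith
  -- The summand 3 in the exponent of Λ provides the factor 8 that the collision bound requires.
  have hLam : 8 * 2 ^ Nat.clog 2 U * 2 ^ ν ≤ (setupPar n m U C ν (fround w p)).Lam := by
    unfold Par.Lam setupPar
    refine le_of_eq ?_
    ring
  have h1 := card_bad_le hI.p0 hI.p1 hN2 hLam X Y (fun j => (hX j).trans_le hUA) (fun j => (hY j).trans_le hUA)
  have h2 := card_div_mem_le w (w - (setupPar n m U C ν (fround w p)).lam)
    ((Finset.range (setupPar n m U C ν (fround w p)).Lam).filter fun k =>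
      (1 + 64 * (Nat.clog 2 U : ℕ) / (2 ^ ν : ℕ)) * ∑ j, |(X j : ℝ) - Y j| ^ fround w p <
        ∑ j, est (fround w p) (2 ^ ν) (setupPar n m U C ν (fround w p)).Lam
          ((setupPar n m U C ν (fround w p)).Lam + k) (Nat.clog 2 U) (X j) (Y j))
  unfold badWords
  calc _ ≤ 2 * (_ * 2 ^ (w - (setupPar n m U C ν (fround w p)).lam)) := Nat.mul_le_mul_left _ h2
    _ = 2 * _ * 2 ^ (w - (setupPar n m U C ν (fround w p)).lam) := (mul_assoc _ _ _).symm
    _ ≤ (setupPar n m U C ν (fround w p)).Lam * 2 ^ (w - (setupPar n m U C ν (fround w p)).lam) :=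
        Nat.mul_le_mul_right _ h1
    _ = 2 ^ w := by
        unfold Par.Lam
        rw [← pow_add, Nat.add_sub_cancel' hl]

theorem good_of_not_mem_badWords (hI : Input w n m U C (fround w p) (fround w ε) Q)
    (hup : 2 ^ ν * (fround w p * fround w ε) ≤ 131072 * ((Nat.clog 2 U : ℕ) + 1))
    {X Y : Fin m → ℕ} {x : Fin (2 ^ w)} (hx : x ∉ badWords n m U C ν w (fround w p) X Y) :
    ∑ j, est (fround w p) (2 ^ ν) (setupPar n m U C ν (fround w p)).Lam
      ((setupPar n m U C ν (fround w p)).mult w x) (Nat.clog 2 U) (X j) (Y j) ≤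
        (1 + 64 * (Nat.clog 2 U : ℕ) / (2 ^ ν : ℕ)) * ∑ j, |(X j : ℝ) - Y j| ^ fround w p := by
  have G := hI.good hup
  have h1 := G.mult_lt x.isLt
  unfold badWords at hx
  rw [Finset.mem_filter, Finset.mem_filter] at hx
  refine not_lt.mp fun hh => hx ⟨Finset.mem_univ _, Finset.mem_range.mpr ?_, hh⟩
  unfold Par.mult at h1
  omega

end Final

end FloatRAM

/-! ### The main theorem. -/

theorem mainTheorem2 (c : ℝ) (hc : 0 < c) :
    ∃ (prog : FloatRAM.Cmd) (K C : ℝ),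
      ∀ (p ε : ℝ) (n m U w : ℕ) (hmn : m ≤ n) (T : Fin n → ℕ) (P : Fin m → ℕ),
        0 < p → p < 1 → 0 < ε → ε ≤ 1 → 1 ≤ m →
        (∀ i, T i < U) → (∀ j, P j < U) →
        K * (1 + Real.logb 2 (n * U / (p * ε))) ≤ w →
        (∀ ω : ℕ → Fin (2 ^ w), ∃ (t : ℕ) (s : FloatRAM.State),
          FloatRAM.Exec w ω prog (inputState w U p ε T P) t s ∧
          (t : ℝ) ≤ C * (p⁻¹ * ε⁻¹ * n * Real.logb 2 (m + 1) * Real.logb 2 (U + 1) ^ 2 *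
            Real.logb 2 (n + 1))) ∧
        ENNReal.ofReal (1 - 1 / (n : ℝ) ^ c) ≤
          FloatRAM.coinMeasure w {ω | ∃ (t : ℕ) (s : FloatRAM.State),
            FloatRAM.Exec w ω prog (inputState w U p ε T P) t s ∧
            IsApproxDistances p ε hmn T P (outputArray n m s)} := by
  -- One unit of C pays for the union bound over the positions, the rest for the failure probability
  -- n^(-c).
  obtain ⟨C, hC⟩ : ∃ C : ℕ, c + 1 ≤ C := exists_nat_ge _
  have hC1 : 1 ≤ C := by
    have : (1 : ℝ) ≤ C := by linarith
    exact_mod_cast this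
  refine ⟨FloatRAM.program C, ((2000 + C : ℕ) : ℝ), 10 ^ 13 * C + 10 ^ 9, ?_⟩
  intro p ε n m U w hmn T P hp0 hp1 hε0 hε1 hm hT hP hw
  -- The pattern is nonempty and its first symbol is below U.
  have hU : 1 ≤ U := Nat.one_le_of_lt (hP ⟨0, hm⟩)
  obtain ⟨Q, hI, hR⟩ := FloatRAM.exists_input hmn hm hU hC1 hp0 hp1 hε0 hε1 hw
  obtain ⟨ν, hlow, hup, hrun⟩ := FloatRAM.program_exec hI hT hP
  constructor
  · intro ω
    obtain ⟨t, s, hx, ht, -⟩ := hrun ω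
    exact ⟨t, s, hx, FloatRAM.time_le hI hR hp1.le hup ht⟩
  -- One event per position: a word is bad for a position if its multiplier makes the estimate of
  -- that window too large. The run succeeds if every position meets a word that is not bad for it,
  -- possibly in different trials.
  · refine le_trans ?_ (FloatRAM.le_coinMeasure w (C * (Nat.clog 2 n + 1)) (n - m + 1)
      (fun i => FloatRAM.badWords n m U C ν w (FloatRAM.fround w p) (window hmn T i) P)
      (fun i => FloatRAM.card_badWords_le hI hlow hup (fun j => hT _) hP) _ ?_)
    · refine ENNReal.ofReal_le_ofReal ?_
      have h1 := FloatRAM.div_two_pow_le (hm.trans hmn) hC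
      have h2 : ((n - m + 1 : ℕ) : ℝ) / 2 ^ (C * (Nat.clog 2 n + 1)) ≤ n / 2 ^ (C * (Nat.clog 2 n + 1)) := by
        gcongr
        omega
      linarith
    · intro ω hω
      obtain ⟨t, s, hx, -, hout⟩ := hrun ω
      refine ⟨t, s, hx, fun i => ?_⟩
      obtain ⟨B, hB, ho⟩ := hout i i.isLt
      obtain ⟨t', ht', hg⟩ := hω i
      change _ ≤ s.mem i ∧ s.mem i ≤ _
      rw [ho]
      exact FloatRAM.within_accuracy hI hR hlow hup hT hP hmn i hB
        ⟨t', ht', FloatRAM.good_of_not_mem_badWords hI hup hg⟩
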